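/- **Setting.** Fix $n\in\mathbb N$ and $s\in\mathbb R$, and write $D=-i\nabla_x$, $\langle\xi\rangle=(1+|\xi|^2)^{1/2}$. Let $\phi,\varphi:\mathbb R^n\to\mathbb R$ be smooth and compactly supported with $\sum_{j\in\mathbb Z^n}\phi(x-j)=1$ and $\sum_{k\in\mathbb Z^n}\varphi(\xi-k)=1$ for all $x,\xi$; put $\phi_j(x)=\phi(x-j)$, and let $\varphi_k(D)$ be the Fourier multiplier in $x$ with symbol $\varphi(\xi-k)$ and $e^{it\Delta}$ the one with symbol $e^{-it|\xi|^2}$. For a function $v:\mathbb R\to L^2(\mathbb R^n)$ let $$\|v\|_{V^2L^2}=\sup_{t_0<\dots<t_K}\Big(\sum_{i<K}\|v(t_{i+1})-v(t_i)\|_{L^2}^2\Big)^{1/2}$$ (no continuity is required). A $U^2L^2$ atom is a step function $\sum_{i=0}^{K}h_i\,1_{[t_i,t_{i+1})}$ with $t_0<\dots<t_K<t_{K+1}=\infty$ and $\sum_i\|h_i\|_{L^2}^2\le 1$; the norm $\|F\|_{U^2L^2}$ is the infimum of $\sum_k|c_k|$ over all representations $F=\sum_k c_ka_k$ with atoms $a_k$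 and complex $c_k$. For a tempered distribution $g$ on $\mathbb R\times\mathbb R^n$ let $\|g\|_{DU^2L^2}=\|F\|_{U^2L^2}$ if $g=\partial_tF$ with $F\in U^2L^2$, and $\infty$ if there is no such $F$. $X^s$ is the space of all functions $u:[0,1]\to\mathcal S'(\mathbb R^n)$, extended by $0$ to $\mathbb R$, with $$\|u\|_{X^s}^2=\sum_{k\in\mathbb Z^n}\langle k\rangle^{2s}\sum_{j\in\mathbb Z^n}\|\phi_j\,e^{it\Delta}\varphi_k(D)u\|_{V^2L^2}^2<\infty ,$$ and $Y^s$ is the space of all tempered distributions $f$ on $\mathbb R\times\mathbb R^n$ supported in $[0,1]\times\mathbb R^n$ with $$\|f\|_{Y^s}^2=\sum_{k\in\mathbb Z^n}\langle k\rangle^{2s}\sum_{j\in\mathbb Z^n}\|\phi_j\,e^{it\Delta}\varphi_k(D)f\|_{DU^2L^2}^2<\infty .$$ **Proposition (duality).** $(Y^s)^*=X^{-s}$ with respect to the pairing $\int_0^1\!\int u\bar f\,dx\,dt$. Precisely: 1. For every $g\in\mathcal S(\mathbb R\times\mathbb R^n)$ the function $1_{[0,1]}(t)\,g$ belongs to $Y^s$.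 For all $t_0\in[0,1]$ and $h\in\mathcal S(\mathbb R^n)$ the distribution $\delta(t-t_0)h(x)$ belongs to $Y^s$, and the linear span of these distributions is dense in $Y^s$. 2. There is a linear isomorphism $\Phi$ of $X^{-s}$ onto the space of all bounded conjugate-linear functionals on $Y^s$, bounded together with its inverse, that is given by the pairing: for all $u\in X^{-s}$, $$\Phi(u)\big(\delta(t-t_0)h\big)=\langle u(t_0),\bar h\rangle\qquad(t_0\in[0,1],\ h\in\mathcal S(\mathbb R^n)),$$ and $$\Phi(u)\big(1_{[0,1]}g\big)=\int_0^1\langle u(t),\overline{g(t,\cdot)}\rangle\,dt\qquad(g\in\mathcal S(\mathbb R\times\mathbb R^n)),$$ where the integrand on the right is integrable on $[0,1]$. Here $\langle\cdot,\cdot\rangle$ is the bilinear pairing of $\mathcal S'(\mathbb R^n)$ with $\mathcal S(\mathbb R^n)$. -/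

import Mathlib

open MeasureTheory Set
open scoped ENNReal NNReal SchwartzMap FourierTransform LineDeriv ComplexConjugate

noncomputable section

namespace WavePacket

/-! ### Extended seminorms and the normed spaces they define -/

/-- `N` is a seminorm on the complex vector space `V`, possibly with the value `∞`. -/
structure IsExtSeminorm {V : Type*} [AddCommGroup V] [Module ℂ V] (N : V → ℝ≥0∞) : Prop where
  map_zero : N 0 = 0
  add_le : ∀ x y, N (x + y) ≤ N x + N y
  smul_le : ∀ (c : ℂ) x, N (c • x) ≤ ‖c‖ₑ * N x

/-- The vectors of `S` on which an extended seminorm is finite. -/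
def finiteSubmodule {V : Type*} [AddCommGroup V] [Module ℂ V] {N : V → ℝ≥0∞}
    (hN : IsExtSeminorm N) (S : Submodule ℂ V) : Submodule ℂ V where
  carrier := {x | x ∈ S ∧ N x < ⊤}
  add_mem' hx hy := ⟨S.add_mem hx.1 hy.1,
    (hN.add_le _ _).trans_lt (ENNReal.add_lt_top.2 ⟨hx.2, hy.2⟩)⟩
  zero_mem' := ⟨S.zero_mem, by simp [hN.map_zero]⟩
  smul_mem' c _ hx := ⟨S.smul_mem c hx.1,
    (hN.smul_le _ _).trans_lt (ENNReal.mul_lt_top enorm_lt_top hx.2)⟩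

/-- The space of all vectors of `S` of finite norm, with the (semi)norm `N`. -/
def FiniteSpace {V : Type*} [AddCommGroup V] [Module ℂ V] {N : V → ℝ≥0∞}
    (hN : IsExtSeminorm N) (S : Submodule ℂ V) : Type _ :=
  ↥(finiteSubmodule hN S)

section FiniteSpace

variable {V : Type*} [AddCommGroup V] [Module ℂ V] {N : V → ℝ≥0∞}
  (hN : IsExtSeminorm N) (S : Submodule ℂ V)

instance : AddCommGroup (FiniteSpace hN S) :=
  inferInstanceAs (AddCommGroup ↥(finiteSubmodule hN S))

instance : Module ℂ (FiniteSpace hN S) :=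
  inferInstanceAs (Module ℂ ↥(finiteSubmodule hN S))

/-- The vector of `V` underlying an element of the space. -/
def FiniteSpace.val {hN : IsExtSeminorm N} {S : Submodule ℂ V} (x : FiniteSpace hN S) : V :=
  Subtype.val x

/-- The norm `x ↦ N x`, a real number. -/
def FiniteSpace.addGroupSeminorm : AddGroupSeminorm (FiniteSpace hN S) where
  toFun x := (N x.val).toReal
  map_zero' := by
    change (N 0).toReal = 0
    simp [hN.map_zero]
  add_le' x y := by
    have hx : N x.val < ⊤ := x.2.2
    have hy : N y.val < ⊤ := y.2.2
    rw [← ENNReal.toReal_add hx.ne hy.ne]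
    exact ENNReal.toReal_mono (ENNReal.add_lt_top.2 ⟨hx, hy⟩).ne (hN.add_le x.val y.val)
  neg' x := by
    have key : ∀ v : V, N (-v) ≤ N v := fun v => by
      have := hN.smul_le (-1) v
      simpa using this
    have h : N (-x.val) = N x.val :=
      le_antisymm (key _) (by simpa using key (-x.val))
    change (N (-x.val)).toReal = _
    rw [h]

instance : SeminormedAddCommGroup (FiniteSpace hN S) :=
  (FiniteSpace.addGroupSeminorm hN S).toSeminormedAddCommGroup

instance : NormedSpace ℂ (FiniteSpace hN S) where
  norm_smul_le c x := by
    have hx : N x.val < ⊤ := x.2.2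
    change (N (c • x.val)).toReal ≤ ‖c‖ * (N x.val).toReal
    refine (ENNReal.toReal_mono (ENNReal.mul_lt_top enorm_lt_top hx).ne
      (hN.smul_le c x.val)).trans ?_
    simp [ENNReal.toReal_mul]

theorem FiniteSpace.norm_eq (x : FiniteSpace hN S) : ‖x‖ = (N x.val).toReal := rfl

end FiniteSpace

/-- The `ℓ²` norm of a family of elements of `[0, ∞]`. -/
def l2Sum {ι : Type*} (a : ι → ℝ≥0∞) : ℝ≥0∞ := (∑' i, a i ^ (2 : ℝ)) ^ (1 / 2 : ℝ)

theorem l2Sum_mono {ι : Type*} {a b : ι → ℝ≥0∞} (h : ∀ i, a i ≤ b i) : l2Sum a ≤ l2Sum b := by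
  unfold l2Sum
  gcongr with i
  exact h i

theorem l2Sum_add_le {ι : Type*} (a b : ι → ℝ≥0∞) :
    l2Sum (fun i => a i + b i) ≤ l2Sum a + l2Sum b := by
  let _ : MeasurableSpace ι := ⊤
  have h := ENNReal.lintegral_Lp_add_le (μ := Measure.count) (p := 2) (f := a) (g := b)
    (measurable_from_top.aemeasurable) (measurable_from_top.aemeasurable) (by norm_num)
  simpa [l2Sum, lintegral_count] using h

theorem l2Sum_mul {ι : Type*} (c : ℝ≥0∞) (a : ι → ℝ≥0∞) :
    l2Sum (fun i => c * a i) = c * l2Sum a := by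
  unfold l2Sum
  simp_rw [ENNReal.mul_rpow_of_nonneg _ _ (show (0 : ℝ) ≤ 2 by norm_num), ENNReal.tsum_mul_left]
  rw [ENNReal.mul_rpow_of_nonneg _ _ (by norm_num), ← ENNReal.rpow_mul]
  norm_num

theorem IsExtSeminorm.comp {V W : Type*} [AddCommGroup V] [Module ℂ V] [AddCommGroup W]
    [Module ℂ W] {N : V → ℝ≥0∞} (hN : IsExtSeminorm N) (L : W →ₗ[ℂ] V) :
    IsExtSeminorm (fun w => N (L w)) where
  map_zero := by simp [hN.map_zero]
  add_le x y := by simpa using hN.add_le (L x) (L y)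
  smul_le c x := by simpa using hN.smul_le c (L x)

theorem IsExtSeminorm.const_mul {V : Type*} [AddCommGroup V] [Module ℂ V] {N : V → ℝ≥0∞}
    (hN : IsExtSeminorm N) (w : ℝ≥0∞) : IsExtSeminorm (fun v => w * N v) where
  map_zero := by simp [hN.map_zero]
  add_le x y := by
    rw [← mul_add]
    gcongr
    exact hN.add_le x y
  smul_le c x := by
    rw [mul_left_comm]
    gcongr
    exact hN.smul_le c x

theorem IsExtSeminorm.l2Sum {V ι : Type*} [AddCommGroup V] [Module ℂ V] {N : ι → V → ℝ≥0∞}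
    (hN : ∀ i, IsExtSeminorm (N i)) : IsExtSeminorm (fun v => l2Sum fun i => N i v) where
  map_zero := by simp [(hN _).map_zero, WavePacket.l2Sum]
  add_le x y := (l2Sum_mono fun i => (hN i).add_le x y).trans (l2Sum_add_le _ _)
  smul_le c x := (l2Sum_mono fun i => (hN i).smul_le c x).trans (l2Sum_mul _ _).le

/-- Transport of an extended seminorm along a linear relation. -/
theorem IsExtSeminorm.iInf {V W : Type*} [AddCommGroup V] [Module ℂ V] [AddCommGroup W]
    [Module ℂ W] {N : V → ℝ≥0∞} (hN : IsExtSeminorm N) {R : V → W → Prop} (h0 : R 0 0)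
    (hadd : ∀ v v' w w', R v w → R v' w' → R (v + v') (w + w'))
    (hsmul : ∀ (c : ℂ) v w, R v w → R (c • v) (c • w)) :
    IsExtSeminorm (fun w => ⨅ (v : V) (_ : R v w), N v) where
  map_zero := le_antisymm (iInf₂_le_of_le 0 h0 hN.map_zero.le) bot_le
  add_le x y := by
    simp_rw [ENNReal.iInf_add, ENNReal.add_iInf]
    exact le_iInf₂ fun v hv => le_iInf₂ fun v' hv' =>
      iInf₂_le_of_le _ (hadd _ _ _ _ hv hv') (hN.add_le v v')
  smul_le c x := by
    by_cases hc : c = 0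
    · subst hc
      have : (⨅ (v : V) (_ : R v ((0 : ℂ) • x)), N v) ≤ 0 :=
        iInf₂_le_of_le 0 (by simpa using h0) hN.map_zero.le
      exact this.trans bot_le
    · simp_rw [ENNReal.mul_iInf_of_ne (show ‖c‖ₑ ≠ 0 by simpa using hc) enorm_ne_top]
      exact le_iInf₂ fun v hv => iInf₂_le_of_le _ (hsmul c _ _ hv) (hN.smul_le c v)

/-! ### The spaces `V²` and `U²` -/

section Variation

variable {H : Type*} [NormedAddCommGroup H]

/-- The 2-variation `sup (∑ ‖v(t_{i+1}) - v(t_i)‖²)^{1/2}` over all finite increasing sequences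
of times. -/
def v2Norm (v : ℝ → H) : ℝ≥0∞ :=
  ⨆ (t : ℕ → ℝ) (_ : StrictMono t) (K : ℕ), l2Sum fun i : Fin K => ‖v (t (i + 1)) - v (t i)‖ₑ

/-- The step function equal to `h i` on `[t i, t (i+1))` for `i < K`, to `h K` on `[t K, ∞)`, and
to `0` before `t 0`. -/
def stepFunction (K : ℕ) (t : ℕ → ℝ) (h : ℕ → H) (τ : ℝ) : H :=
  ∑ i ∈ Finset.range K, (Ico (t i) (t (i + 1))).indicator (fun _ => h i) τ
    + (Ici (t K)).indicator (fun _ => h K) τ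

/-- The atoms of `U²`: step functions with `∑ ‖h i‖² ≤ 1`. -/
def IsU2Atom (a : ℝ → H) : Prop :=
  ∃ (K : ℕ) (t : ℕ → ℝ) (h : ℕ → H), StrictMono t ∧
    ∑ i ∈ Finset.range (K + 1), ‖h i‖ ^ 2 ≤ 1 ∧ a = stepFunction K t h

theorem isU2Atom_zero : IsU2Atom (0 : ℝ → H) :=
  ⟨0, fun k => k, 0, Nat.strictMono_cast, by simp, by ext; simp [stepFunction]⟩

variable [NormedSpace ℂ H]

/-- The atomic norm of `U²`: the infimum of `∑ |c k|` over all representations `F = ∑ c k • a k`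
with atoms `a k`, and `∞` if there is none. -/
def u2Norm (F : ℝ → H) : ℝ≥0∞ :=
  ⨅ (c : ℕ → ℂ) (a : ℕ → ℝ → H)
    (_ : (∀ k, IsU2Atom (a k)) ∧ ∀ τ, HasSum (fun k => c k • a k τ) (F τ)), ∑' k, ‖c k‖ₑ

theorem isExtSeminorm_v2Norm : IsExtSeminorm (v2Norm : (ℝ → H) → ℝ≥0∞) where
  map_zero := by simp [v2Norm, l2Sum]
  add_le x y := by
    refine iSup_le fun t => iSup₂_le fun ht K => ?_
    have hle : ∀ z : ℝ → H, (l2Sum fun i : Fin K => ‖z (t (i + 1)) - z (t i)‖ₑ) ≤ v2Norm z :=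
      fun z => le_iSup_of_le t (le_iSup₂_of_le ht K le_rfl)
    refine le_trans ?_ (add_le_add (hle x) (hle y))
    refine (l2Sum_mono fun i => ?_).trans (l2Sum_add_le _ _)
    simp only [Pi.add_apply, add_sub_add_comm]
    exact enorm_add_le _ _
  smul_le c x := by
    refine iSup_le fun t => iSup₂_le fun ht K => ?_
    have hle : (l2Sum fun i : Fin K => ‖x (t (i + 1)) - x (t i)‖ₑ) ≤ v2Norm x :=
      le_iSup_of_le t (le_iSup₂_of_le ht K le_rfl)
    simp only [Pi.smul_apply, ← smul_sub, enorm_smul, l2Sum_mul]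
    gcongr

theorem isExtSeminorm_u2Norm : IsExtSeminorm (u2Norm : (ℝ → H) → ℝ≥0∞) where
  map_zero := by
    refine le_antisymm ?_ bot_le
    exact iInf₂_le_of_le 0 0 (iInf_le_of_le
      ⟨fun _ => isU2Atom_zero, fun τ => by simp⟩ (by simp))
  add_le x y := by
    unfold u2Norm
    simp_rw [ENNReal.iInf_add, ENNReal.add_iInf]
    refine le_iInf fun c => le_iInf fun a => le_iInf fun h => le_iInf fun c' => le_iInf fun a' =>
      le_iInf fun h' => ?_
    let e : ℕ ⊕ ℕ ≃ ℕ := Equiv.natSumNatEquivNat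
    refine iInf_le_of_le (fun k => Sum.elim c c' (e.symm k)) (iInf_le_of_le
      (fun k => Sum.elim a a' (e.symm k)) (iInf_le_of_le ⟨fun k => ?_, fun τ => ?_⟩ ?_))
    · change IsU2Atom (Sum.elim a a' (e.symm k))
      rcases e.symm k with i | i
      · exact h.1 i
      · exact h'.1 i
    · rw [← e.hasSum_iff]
      refine HasSum.sum ?_ ?_
      · simpa [Function.comp_def] using h.2 τ
      · simpa [Function.comp_def] using h'.2 τ
    · rw [← e.tsum_eq, ENNReal.summable.tsum_sum ENNReal.summable]
      simp
  smul_le d x := by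
    unfold u2Norm
    by_cases hd : d = 0
    · subst hd
      simp only [zero_smul, enorm_zero, zero_mul, nonpos_iff_eq_zero]
      refine le_antisymm ?_ bot_le
      exact iInf₂_le_of_le 0 0 (iInf_le_of_le
        ⟨fun _ => isU2Atom_zero, fun τ => by simp⟩ (by simp))
    · simp_rw [ENNReal.mul_iInf_of_ne (show ‖d‖ₑ ≠ 0 by simpa using hd) enorm_ne_top]
      refine le_iInf fun c => le_iInf fun a => le_iInf fun h => ?_
      refine iInf_le_of_le (fun k => d * c k) (iInf_le_of_le a (iInf_le_of_le
        ⟨h.1, fun τ => ?_⟩ ?_))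
      · simpa [mul_smul] using (h.2 τ).const_smul d
      · simp [enorm_mul, ENNReal.tsum_mul_left]

end Variation

/-! ### Phase space localization -/

/-- The physical space `ℝⁿ`. -/
abbrev Space (n : ℕ) := EuclideanSpace ℝ (Fin n)

/-- The space-time `ℝ × ℝⁿ`; its points are `WithLp.toLp 2 (t, x)`. -/
abbrev SpaceTime (n : ℕ) := WithLp 2 (ℝ × Space n)

/-- The Hilbert space `L²(ℝⁿ)`. -/
abbrev L2 (n : ℕ) := Lp ℂ 2 (volume : Measure (Space n))

variable {n : ℕ}

/-- A point of `ℤⁿ`, as a vector of `ℝⁿ`. -/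
def latticePoint (k : Fin n → ℤ) : Space n := WithLp.toLp 2 fun i => (k i : ℝ)

/-- `φ` is a smooth bump function whose translates by `ℤⁿ` are a partition of unity. -/
structure IsUnitPartition (φ : Space n → ℝ) : Prop where
  contDiff : ContDiff ℝ (⊤ : ℕ∞) φ
  hasCompactSupport : HasCompactSupport φ
  hasSum_translates : ∀ x, HasSum (fun k : Fin n → ℤ => φ (x - latticePoint k)) 1

theorem slice_hasTemperateGrowth (t : ℝ) :
    (fun x : Space n => (WithLp.toLp 2 (t, x) : SpaceTime n)).HasTemperateGrowth := by
  have h : (fun x : Space n => (WithLp.toLp 2 (t, x) : SpaceTime n)) = fun x =>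
      WithLp.toLp 2 (t, (0 : Space n)) + ((WithLp.prodContinuousLinearEquiv 2 ℝ ℝ
        (Space n)).symm.toContinuousLinearMap ∘L ContinuousLinearMap.inr ℝ ℝ (Space n)) x := by
    funext x
    simp [← WithLp.toLp_add]
  rw [h]
  fun_prop

theorem norm_le_slice (t : ℝ) : ∃ (k : ℕ) (C : ℝ), ∀ x : Space n,
    ‖x‖ ≤ C * (1 + ‖(WithLp.toLp 2 (t, x) : SpaceTime n)‖) ^ k := by
  refine ⟨1, 1, fun x => ?_⟩
  have : ‖x‖ ≤ ‖(WithLp.toLp 2 (t, x) : SpaceTime n)‖ :=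
    WithLp.norm_snd_le (p := 2) _ (WithLp.toLp 2 (t, x) : SpaceTime n)
  simp only [one_mul, pow_one]
  linarith

/-- The slice `ψ(t, ·)` of a Schwartz function of space-time. -/
def slice (t : ℝ) : 𝓢(SpaceTime n, ℂ) →L[ℂ] 𝓢(Space n, ℂ) :=
  SchwartzMap.compCLM ℂ (slice_hasTemperateGrowth t) (norm_le_slice t)

/-- The map `(τ, η) ↦ (τ + 2π|η|², η)`. -/
def shear (ζ : SpaceTime n) : SpaceTime n :=
  ζ + (2 * Real.pi * ‖ζ.snd‖ ^ 2) • WithLp.toLp 2 ((1 : ℝ), (0 : Space n))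

theorem shear_hasTemperateGrowth : (shear (n := n)).HasTemperateGrowth := by
  have h : (fun ζ : SpaceTime n => ‖ζ.snd‖ ^ 2).HasTemperateGrowth :=
    (Function.hasTemperateGrowth_norm_sq (H := Space n)).comp
      ((ContinuousLinearMap.snd ℝ ℝ (Space n)) ∘L (WithLp.prodContinuousLinearEquiv 2 ℝ ℝ
        (Space n)).toContinuousLinearMap).hasTemperateGrowth
  unfold shear
  fun_prop

theorem norm_le_shear : ∃ (k : ℕ) (C : ℝ), ∀ ζ : SpaceTime n, ‖ζ‖ ≤ C * (1 + ‖shear ζ‖) ^ k := by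
  refine ⟨2, 8, fun ζ => ?_⟩
  have h1 : (shear ζ).snd = ζ.snd := by simp [shear]
  have h2 : ‖ζ.snd‖ ≤ ‖shear ζ‖ := h1 ▸ WithLp.norm_snd_le (p := 2) _ (shear ζ)
  have h3 : ζ = shear ζ - (2 * Real.pi * ‖ζ.snd‖ ^ 2) • WithLp.toLp 2 ((1 : ℝ), (0 : Space n)) := by
    simp [shear]
  have h4 : ‖ζ‖ ≤ ‖shear ζ‖ + 2 * Real.pi * ‖ζ.snd‖ ^ 2 := by
    nth_rw 1 [h3]
    refine (norm_sub_le _ _).trans ?_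
    rw [norm_smul, WithLp.norm_toLp_fst, Real.norm_of_nonneg (by positivity)]
    simp
  have h5 : ‖ζ.snd‖ ^ 2 ≤ ‖shear ζ‖ ^ 2 := by gcongr
  nlinarith [norm_nonneg (shear ζ), Real.pi_lt_four, Real.pi_pos]

/-- The multiplication of distributions on `ℝⁿ` by `φ(x - j)`. -/
def spaceLoc (φ : Space n → ℝ) (j : Fin n → ℤ) : 𝓢'(Space n, ℂ) →L[ℂ] 𝓢'(Space n, ℂ) :=
  TemperedDistribution.smulLeftCLM ℂ fun x => (φ (x - latticePoint j) : ℂ)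

/-- The frequency localization `χ(D - k)` on `ℝⁿ`, where `D = -i∇`. (Mathlib's Fourier variable
`η` is related to the frequency by `ξ = 2πη`.) -/
def freqLoc (χ : Space n → ℝ) (k : Fin n → ℤ) : 𝓢'(Space n, ℂ) →L[ℂ] 𝓢'(Space n, ℂ) :=
  TemperedDistribution.fourierMultiplierCLM ℂ
    fun η => (χ ((2 * Real.pi) • η - latticePoint k) : ℂ)

theorem schrodingerSymbol_hasTemperateGrowth (t : ℝ) : (fun η : Space n =>
    Complex.exp (-(Complex.I * t * ((2 * Real.pi * ‖η‖) ^ 2 : ℝ)))).HasTemperateGrowth := by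
  have hexp : (fun x : ℝ => Complex.exp (Complex.I * x)).HasTemperateGrowth := by
    have hder : ∀ m : ℕ, iteratedDeriv m (fun x : ℝ => Complex.exp (Complex.I * x)) =
        fun x : ℝ => Complex.I ^ m * Complex.exp (Complex.I * x) := by
      intro m
      induction m with
      | zero => simp
      | succ m ih =>
        rw [iteratedDeriv_succ, ih]
        funext x
        have h1 : HasDerivAt (fun x : ℝ => Complex.I * (x : ℂ)) Complex.I x := by
          simpa using (Complex.ofRealCLM.hasDerivAt (x := x)).const_mul Complex.I
        rw [(h1.cexp.const_mul (Complex.I ^ m)).deriv]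
        ring
    have hc : ContDiff ℝ (⊤ : ℕ∞) (fun x : ℝ => (x : ℂ)) := Complex.ofRealCLM.contDiff
    refine ⟨(contDiff_const.mul hc).cexp, fun m => ⟨0, 1, fun x => ?_⟩⟩
    rw [norm_iteratedFDeriv_eq_norm_iteratedDeriv, hder]
    simp [mul_comm Complex.I, Complex.norm_exp_ofReal_mul_I]
  have hq : (fun η : Space n => -(t * (2 * Real.pi) ^ 2) * ‖η‖ ^ 2).HasTemperateGrowth := by
    have := Function.hasTemperateGrowth_norm_sq (H := Space n)
    fun_prop
  convert hexp.comp hq using 2 with η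
  simp only [Function.comp_apply]
  congr 1
  push_cast
  ring

/-- The operator `e^{itΔ}` on distributions on `ℝⁿ`, with symbol `e^{-it|ξ|²}`. -/
def schrodinger (t : ℝ) : 𝓢'(Space n, ℂ) →L[ℂ] 𝓢'(Space n, ℂ) :=
  TemperedDistribution.fourierMultiplierCLM ℂ
    fun η => Complex.exp (-(Complex.I * t * ((2 * Real.pi * ‖η‖) ^ 2 : ℝ)))

/-- The multiplication of distributions on `ℝ × ℝⁿ` by `φ(x - j)`. -/
def spaceLocST (φ : Space n → ℝ) (j : Fin n → ℤ) : 𝓢'(SpaceTime n, ℂ) →L[ℂ] 𝓢'(SpaceTime n, ℂ) :=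
  TemperedDistribution.smulLeftCLM ℂ fun p => (φ (p.snd - latticePoint j) : ℂ)

/-- The frequency localization `χ(D_x - k)` in the space variables, on `ℝ × ℝⁿ`. -/
def freqLocST (χ : Space n → ℝ) (k : Fin n → ℤ) : 𝓢'(SpaceTime n, ℂ) →L[ℂ] 𝓢'(SpaceTime n, ℂ) :=
  TemperedDistribution.fourierMultiplierCLM ℂ
    fun ζ => (χ ((2 * Real.pi) • ζ.snd - latticePoint k) : ℂ)

/-- The operator `ψ(t, ·) ↦ e^{itΔ} ψ(t, ·)` on Schwartz functions of space-time. On the space-time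
Fourier transform it is the change of variables `τ ↦ τ + 2π|η|²`, that is, the multiplication by
`e^{-it|ξ|²}` of the Fourier transform in the space variables. -/
def schrodingerTest : 𝓢(SpaceTime n, ℂ) →L[ℂ] 𝓢(SpaceTime n, ℂ) :=
  FourierTransform.fourierInvCLM ℂ 𝓢(SpaceTime n, ℂ) ∘L
    SchwartzMap.compCLM ℂ shear_hasTemperateGrowth norm_le_shear ∘L
      FourierTransform.fourierCLM ℂ 𝓢(SpaceTime n, ℂ)

/-- The operator `f(t, ·) ↦ e^{itΔ} f(t, ·)` on distributions on `ℝ × ℝⁿ`; the operator `e^{itΔ}`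
is its own transpose. -/
def schrodingerST : 𝓢'(SpaceTime n, ℂ) →L[ℂ] 𝓢'(SpaceTime n, ℂ) :=
  PointwiseConvergenceCLM.precomp ℂ schrodingerTest

/-! ### The spaces `X^s` and `Y^s` -/

/-- The `V²L²` norm of a distribution valued function of time: it is `∞` unless all values are
in `L²`. -/
def v2L2Norm (w : ℝ → 𝓢'(Space n, ℂ)) : ℝ≥0∞ :=
  ⨅ (v : ℝ → L2 n) (_ : ∀ t, ((v t : L2 n) : 𝓢'(Space n, ℂ)) = w t), v2Norm v

/-- The distribution `g` on `ℝ × ℝⁿ` is the time derivative of the function `F : ℝ → L²(ℝⁿ)`,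
that is, `g(ψ) = -∫ ⟨F(t), ∂_t ψ(t, ·)⟩ dt` for all test functions `ψ`. -/
def IsTimeDeriv (F : ℝ → L2 n) (g : 𝓢'(SpaceTime n, ℂ)) : Prop :=
  ∀ ψ : 𝓢(SpaceTime n, ℂ),
    Integrable (fun t => ((F t : L2 n) : 𝓢'(Space n, ℂ))
      (slice t (∂_{WithLp.toLp 2 ((1 : ℝ), (0 : Space n))} ψ))) ∧
    g ψ = -∫ t, ((F t : L2 n) : 𝓢'(Space n, ℂ))
      (slice t (∂_{WithLp.toLp 2 ((1 : ℝ), (0 : Space n))} ψ))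

/-- The `DU²L²` norm of a distribution on `ℝ × ℝⁿ`: the `U²L²` norm of `F` if it is the time
derivative of `F ∈ U²L²`, and `∞` if there is no such `F`. -/
def du2L2Norm (g : 𝓢'(SpaceTime n, ℂ)) : ℝ≥0∞ :=
  ⨅ (F : ℝ → L2 n) (_ : IsTimeDeriv F g), u2Norm F

/-- The weight `⟨k⟩^s = (1 + |k|²)^{s/2}`. -/
def weight (s : ℝ) (k : Fin n → ℤ) : ℝ≥0∞ :=
  ENNReal.ofReal ((1 + ‖latticePoint k‖ ^ 2) ^ (s / 2))

/-- The norm of `X`: the `ℓ²` sum over `j ∈ ℤⁿ` of `‖φ(x - j) e^{itΔ} u‖_{V²L²}`. -/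
def xNorm (φ : Space n → ℝ) (u : ℝ → 𝓢'(Space n, ℂ)) : ℝ≥0∞ :=
  l2Sum fun j : Fin n → ℤ => v2L2Norm fun t => spaceLoc φ j (schrodinger t (u t))

/-- The norm of `X^s`: the `ℓ²` sum over `k ∈ ℤⁿ` of `⟨k⟩^s ‖χ(D - k) u‖_X`. -/
def xsNorm (φ χ : Space n → ℝ) (s : ℝ) (u : ℝ → 𝓢'(Space n, ℂ)) : ℝ≥0∞ :=
  l2Sum fun k : Fin n → ℤ => weight s k * xNorm φ fun t => freqLoc χ k (u t)

/-- The norm of `Y`: the `ℓ²` sum over `j ∈ ℤⁿ` of `‖φ(x - j) e^{itΔ} f‖_{DU²L²}`. -/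
def yNorm (φ : Space n → ℝ) (f : 𝓢'(SpaceTime n, ℂ)) : ℝ≥0∞ :=
  l2Sum fun j : Fin n → ℤ => du2L2Norm (spaceLocST φ j (schrodingerST f))

/-- The norm of `Y^s`: the `ℓ²` sum over `k ∈ ℤⁿ` of `⟨k⟩^s ‖χ(D_x - k) f‖_Y`. -/
def ysNorm (φ χ : Space n → ℝ) (s : ℝ) (f : 𝓢'(SpaceTime n, ℂ)) : ℝ≥0∞ :=
  l2Sum fun k : Fin n → ℤ => weight s k * yNorm φ (freqLocST χ k f)

theorem isExtSeminorm_v2L2Norm :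
    IsExtSeminorm (v2L2Norm : (ℝ → 𝓢'(Space n, ℂ)) → ℝ≥0∞) := by
  refine isExtSeminorm_v2Norm.iInf (R := fun (v : ℝ → L2 n)
    (w : ℝ → 𝓢'(Space n, ℂ)) => ∀ t,
    ((v t : L2 n) : 𝓢'(Space n, ℂ)) = w t) ?_ ?_ ?_
  · exact fun t => (Lp.toTemperedDistributionCLM ℂ volume 2).map_zero
  · intro v v' w w' hv hv' t
    exact ((Lp.toTemperedDistributionCLM ℂ volume 2).map_add (v t) (v' t)).trans
      (congrArg₂ (· + ·) (hv t) (hv' t))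
  · intro c v w hv t
    exact ((Lp.toTemperedDistributionCLM ℂ volume 2).map_smul c (v t)).trans
      (congrArg (c • ·) (hv t))

theorem isExtSeminorm_du2L2Norm :
    IsExtSeminorm (du2L2Norm : 𝓢'(SpaceTime n, ℂ) → ℝ≥0∞) := by
  have hadd : ∀ v w : L2 n, ((v + w : L2 n) : 𝓢'(Space n, ℂ)) = v + w :=
    (Lp.toTemperedDistributionCLM ℂ volume 2).map_add
  have hsmul : ∀ (c : ℂ) (v : L2 n), ((c • v : L2 n) : 𝓢'(Space n, ℂ)) = c • v :=
    (Lp.toTemperedDistributionCLM ℂ volume 2).map_smul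
  have hzero : ((0 : L2 n) : 𝓢'(Space n, ℂ)) = 0 :=
    (Lp.toTemperedDistributionCLM ℂ volume 2).map_zero
  refine isExtSeminorm_u2Norm.iInf (R := IsTimeDeriv) ?_ ?_ ?_
  · intro ψ
    simp [hzero]
  · intro v v' w w' hv hv' ψ
    simp only [Pi.add_apply, hadd]
    refine ⟨(hv ψ).1.add (hv' ψ).1, ?_⟩
    refine Eq.trans ?_ (congrArg Neg.neg (integral_add (hv ψ).1 (hv' ψ).1)).symm
    rw [neg_add, ← (hv ψ).2, ← (hv' ψ).2]
    rfl
  · intro c v w hv ψ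
    simp only [Pi.smul_apply, hsmul]
    refine ⟨(hv ψ).1.smul c, ?_⟩
    refine Eq.trans ?_ (congrArg Neg.neg (integral_smul c (fun t =>
      ((v t : L2 n) : 𝓢'(Space n, ℂ))
        (slice t (∂_{WithLp.toLp 2 ((1 : ℝ), (0 : Space n))} ψ))))).symm
    rw [← smul_neg, ← (hv ψ).2]
    rfl

theorem isExtSeminorm_xsNorm (φ χ : Space n → ℝ) (s : ℝ) : IsExtSeminorm (xsNorm φ χ s) := by
  refine IsExtSeminorm.l2Sum fun k => IsExtSeminorm.const_mul (IsExtSeminorm.l2Sum fun j => ?_) _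
  exact isExtSeminorm_v2L2Norm.comp (LinearMap.pi fun t =>
    ((spaceLoc φ j ∘L schrodinger t ∘L freqLoc χ k).toLinearMap ∘ₗ LinearMap.proj t))

theorem isExtSeminorm_ysNorm (φ χ : Space n → ℝ) (s : ℝ) : IsExtSeminorm (ysNorm φ χ s) := by
  refine IsExtSeminorm.l2Sum fun k => IsExtSeminorm.const_mul (IsExtSeminorm.l2Sum fun j => ?_) _
  exact isExtSeminorm_du2L2Norm.comp
    (spaceLocST φ j ∘L schrodingerST ∘L freqLocST χ k).toLinearMap

/-- The functions on `[0,1]`, as functions on `ℝ` that vanish outside `[0,1]`. -/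
def unitTimeFunctions (n : ℕ) : Submodule ℂ (ℝ → 𝓢'(Space n, ℂ)) where
  carrier := {u | ∀ t, t ∉ Icc (0 : ℝ) 1 → u t = 0}
  add_mem' hu hv t ht := by simp [hu t ht, hv t ht]
  zero_mem' _ _ := rfl
  smul_mem' c u hu t ht := by simp [hu t ht]

/-- The distributions on `ℝ × ℝⁿ` that are supported in `[0,1] × ℝⁿ`. -/
def unitTimeDistributions (n : ℕ) : Submodule ℂ 𝓢'(SpaceTime n, ℂ) where
  carrier := {f | Distribution.IsVanishingOn f {p | p.fst ∉ Icc (0 : ℝ) 1}}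
  add_mem' {f g} hf hg ψ hψ := by
    refine Eq.trans (b := f ψ + g ψ) rfl ?_
    rw [hf ψ hψ, hg ψ hψ, add_zero]
  zero_mem' _ _ := rfl
  smul_mem' c f hf ψ hψ := by
    refine Eq.trans (b := c • f ψ) rfl ?_
    rw [hf ψ hψ, smul_zero]

/-- The space `X^s` of functions on `[0,1] × ℝⁿ`. -/
abbrev XSpace (φ χ : Space n → ℝ) (s : ℝ) : Type :=
  FiniteSpace (isExtSeminorm_xsNorm φ χ s) (unitTimeFunctions n)

/-- The space `Y^s` of distributions on `[0,1] × ℝⁿ`. -/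
abbrev YSpace (φ χ : Space n → ℝ) (s : ℝ) : Type :=
  FiniteSpace (isExtSeminorm_ysNorm φ χ s) (unitTimeDistributions n)

/-! ### The pairing on concrete elements of `Y^s` -/

/-- The complex conjugate of a Schwartz function. -/
def conjSchwartz (h : 𝓢(Space n, ℂ)) : 𝓢(Space n, ℂ) :=
  SchwartzMap.postcompCLM (𝕜 := ℝ) (Complex.conjCLE : ℂ →L[ℝ] ℂ) h

/-- The distribution `δ(t - t₀) h(x)`. -/
def instant (t₀ : ℝ) (h : 𝓢(Space n, ℂ)) : 𝓢'(SpaceTime n, ℂ) :=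
  PointwiseConvergenceCLM.precomp ℂ (slice t₀) (h : 𝓢'(Space n, ℂ))

/-- The distribution `f` is the function equal to `g` on `[0,1] × ℝⁿ` and to `0` elsewhere. -/
def IsTruncation (g : 𝓢(SpaceTime n, ℂ)) (f : 𝓢'(SpaceTime n, ℂ)) : Prop :=
  ∀ ψ : 𝓢(SpaceTime n, ℂ),
    f ψ = ∫ t in (0 : ℝ)..1, ∫ x : Space n, g (WithLp.toLp 2 (t, x)) * ψ (WithLp.toLp 2 (t, x))

end WavePacket

end

open MeasureTheory Set
open scoped ENNReal NNReal SchwartzMap FourierTransform LineDeriv ComplexConjugate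

noncomputable section

namespace WavePacket

section

/-! ### Families in `ℓ²` -/

section SquareSummable

variable {ι κ : Type*}

/-! The proof rests on two dualities, `V²` against `U²` in time and `ℓ²` against `ℓ²` over the cells
`(k, j)` of phase space, glued together by almost orthogonality. Since `e^{itΔ}` commutes with the
frequency localizations, both norms are weighted `ℓ²` sums over `(k, j)` of norms of localized
pieces of the solution pulled back by the flow (`xsNorm_eq`, `ysNorm_eq`). Localizing to one cell
after synthesizing from another is an operator on `L²` whose norm vanishes for distant frequencies
and is summable in the difference of positions (`exists_almost_orthogonality`). Young's inequality
then bounds the `Y^s` norm of anything synthesized from pieces by the `ℓ²` norm of the pieces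
(`exists_synthesis_bound`). Slightly enlarged cutoffs, equal to one on the original supports,
reproduce every distribution from its own pieces (`hasSum_localize_synthesize`).

From functions to functionals: a function with finitely many jumps `p(t)` is paired with `v` as `∑
⟨p(t), v(t)⟩`. Summation by parts and Cauchy-Schwarz on atoms bound this by the `V²` norm of `v`
times the `U²` norm of the function (`enorm_sum_inner_le`). Primitives in `U²` are unique, by right
continuity and the limit zero at `-∞`, so the second factor really is the `DU²` norm
(`IsTimeDeriv.du2L2Norm_eq`). Inserting the resolution of the identity and summing over cells gives
`exists_pairing_le` on combinations of `δ(t - t₀)h`. These are dense: finitely many cells carry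
almost all of the norm, and in each of them the primitive is approximated by finitely many jumps
with Schwartz coefficients (`exists_instants_ysNorm_sub_lt`). The pairing therefore extends to
`Y^s`.

From functionals to functions: `⟨u(t), h̄⟩` has to be `ℓ(δ(t - t₀)h)` at `t₀ = t`. To bound the
variation of all localized pieces of `u` at once, their increments are tested against Schwartz
functions. By linearity this evaluates `ℓ` on a synthesis of time derivatives of step functions,
whose norm is the `ℓ²` norm of the test vectors (`exists_norm_sum_pieceY_le`,
`exists_xsNorm_dualFun_le`).

Truncated Schwartz functions: consecutive dyadic Riemann sums differ by instants with alternating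
signs. The primitive of the difference is a step function with `2^(m+1)` values of size
`2^{-(m+1)}`, hence small in `U²`, so the sums converge in `Y^s` (`exists_riemannDist_bound`).
Applying `ℓ` gives Riemann sums of `t ↦ ⟨u(t), ḡ(t)⟩`. This function is bounded and has countably
many discontinuities, because along the flow of a fixed vector it has bounded 2-variation and the
dependence on `g` is Lipschitz (`countable_not_continuousAt_slice`). The sums converge to the
integral, which is the second pairing formula (`functional_truncation`). -/

theorem l2Sum_le_iff {a : ι → ℝ≥0∞} {B : ℝ≥0∞} :
    l2Sum a ≤ B ↔ ∑' i, a i ^ (2 : ℝ) ≤ B ^ (2 : ℝ) := by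
  rw [l2Sum, one_div, ENNReal.rpow_inv_le_iff (by norm_num)]

theorem l2Sum_rpow_two (a : ι → ℝ≥0∞) : l2Sum a ^ (2 : ℝ) = ∑' i, a i ^ (2 : ℝ) := by
  rw [l2Sum, ← ENNReal.rpow_mul]
  norm_num

theorem l2Sum_sum_le (T : Finset κ) (a : κ → ι → ℝ≥0∞) :
    l2Sum (fun i => ∑ m ∈ T, a m i) ≤ ∑ m ∈ T, l2Sum (a m) := by
  classical
  induction T using Finset.induction_on with
  | empty => simp [l2Sum]
  | insert m T hm ih =>
    simp_rw [Finset.sum_insert hm]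
    exact (l2Sum_add_le _ _).trans (by gcongr)

/-- For finitely many outer indices, both sums are limits over finite families, and there the finite
triangle inequality applies. The outer sum is the supremum of its finite parts. -/
theorem l2Sum_tsum_le (a : κ → ι → ℝ≥0∞) :
    l2Sum (fun i => ∑' m, a m i) ≤ ∑' m, l2Sum (a m) := by
  rw [l2Sum_le_iff, ENNReal.tsum_eq_iSup_sum]
  refine iSup_le fun S => ?_
  have h : Filter.Tendsto (fun T : Finset κ => ∑ i ∈ S, (∑ m ∈ T, a m i) ^ (2 : ℝ)) Filter.atTop
      (nhds (∑ i ∈ S, (∑' m, a m i) ^ (2 : ℝ))) :=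
    tendsto_finsetSum _ fun i _ =>
      (ENNReal.continuous_rpow_const.tendsto _).comp ENNReal.summable.hasSum
  refine le_of_tendsto' h fun T => ?_
  refine (ENNReal.sum_le_tsum S).trans ?_
  rw [← l2Sum_le_iff]
  exact (l2Sum_sum_le T a).trans (ENNReal.sum_le_tsum T)

theorem tsum_mul_le_l2Sum_mul (a b : ι → ℝ≥0∞) : ∑' i, a i * b i ≤ l2Sum a * l2Sum b := by
  let _ : MeasurableSpace ι := ⊤
  have h := ENNReal.lintegral_mul_le_Lp_mul_Lq (Measure.count : Measure ι)
    Real.HolderConjugate.two_two (f := a) (g := b)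
    (measurable_from_top.aemeasurable) (measurable_from_top.aemeasurable)
  simpa [l2Sum, lintegral_count] using h

theorem le_l2Sum (a : ι → ℝ≥0∞) (i : ι) : a i ≤ l2Sum a := by
  have h := ENNReal.rpow_le_rpow (ENNReal.le_tsum (f := fun i => a i ^ (2 : ℝ)) i)
    (show (0 : ℝ) ≤ 1 / 2 by norm_num)
  rwa [← ENNReal.rpow_mul, show (2 : ℝ) * (1 / 2) = 1 by norm_num, ENNReal.rpow_one] at h

theorem l2Sum_comp_equiv (e : κ ≃ ι) (a : ι → ℝ≥0∞) : l2Sum (fun k => a (e k)) = l2Sum a := by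
  rw [l2Sum, l2Sum, e.tsum_eq fun i => a i ^ (2 : ℝ)]

theorem l2Sum_prod (a : ι → κ → ℝ≥0∞) :
    l2Sum (fun i => l2Sum (a i)) = l2Sum fun p : ι × κ => a p.1 p.2 := by
  rw [l2Sum, l2Sum, ENNReal.tsum_prod']
  simp_rw [l2Sum_rpow_two]

/-- Young's inequality for the convolution with a summable sequence. -/
theorem l2Sum_convolution_le {G : Type*} [AddCommGroup G] (τ a : G → ℝ≥0∞) :
    l2Sum (fun i => ∑' j, τ (i - j) * a j) ≤ (∑' l, τ l) * l2Sum a := by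
  have h : ∀ i, ∑' j, τ (i - j) * a j = ∑' l, τ l * a (i - l) := fun i => by
    rw [← (Equiv.subLeft i).tsum_eq fun l => τ l * a (i - l)]
    simp
  -- The convolution is now a superposition of translates of `a`, all of which have the same norm.
  simp_rw [h]
  refine (l2Sum_tsum_le _).trans ?_
  rw [← ENNReal.tsum_mul_right]
  refine ENNReal.tsum_le_tsum fun l => ?_
  rw [l2Sum_mul]
  gcongr
  exact (l2Sum_comp_equiv (Equiv.subRight l) a).le

end SquareSummable

/-! ### Step functions -/

section Steps

variable {H : Type*} [NormedAddCommGroup H]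

theorem stepFunction_congr {K : ℕ} {t t' : ℕ → ℝ} {h h' : ℕ → H}
    (ht : ∀ i ≤ K, t i = t' i) (hh : ∀ i ≤ K, h i = h' i) :
    stepFunction K t h = stepFunction K t' h' := by
  funext τ
  unfold stepFunction
  congr 1
  · refine Finset.sum_congr rfl fun i hi => ?_
    have hi' := Finset.mem_range.1 hi
    rw [ht i hi'.le, ht (i + 1) hi', hh i hi'.le]
  · rw [ht K le_rfl, hh K le_rfl]

/-- This recursion allows inductions that append one value at a time; `IsStep` has the same shape.
-/
theorem stepFunction_succ {K : ℕ} {t : ℕ → ℝ} (ht : Monotone t) (h : ℕ → H) (τ : ℝ) :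
    stepFunction (K + 1) t h τ = if τ < t (K + 1) then stepFunction K t h τ else h (K + 1) := by
  unfold stepFunction
  split_ifs with hτ
  · rw [Finset.sum_range_succ, indicator_of_notMem (s := Ici (t (K + 1))) (by simpa using hτ),
      add_zero]
    congr 1
    by_cases h1 : t K ≤ τ
    · rw [indicator_of_mem (show τ ∈ Ico (t K) (t (K + 1)) from ⟨h1, hτ⟩),
        indicator_of_mem (show τ ∈ Ici (t K) from h1)]
    · rw [indicator_of_notMem (fun h2 => h1 h2.1),
        indicator_of_notMem (show τ ∉ Ici (t K) from h1)]
  · rw [indicator_of_mem (show τ ∈ Ici (t (K + 1)) by simpa using hτ), Finset.sum_eq_zero, zero_add]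
    intro i hi
    refine indicator_of_notMem (fun h2 => hτ (h2.2.trans_le (ht ?_))) _
    have := Finset.mem_range.1 hi
    omega

/-- Times are indexed by all of `ℕ`, although only finitely many matter; past the new time the
sequence continues with unit spacing. -/
theorem exists_strictMono_append {t : ℕ → ℝ} (ht : StrictMono t) {K : ℕ} {T : ℝ} (hT : t K < T) :
    ∃ t' : ℕ → ℝ, StrictMono t' ∧ (∀ i ≤ K, t' i = t i) ∧ t' (K + 1) = T := by
  refine ⟨fun i => if i ≤ K then t i else T + (i - (K + 1) : ℝ),
    strictMono_nat_of_lt_succ fun i => ?_, fun i hi => by simp [hi], by simp⟩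
  rcases lt_trichotomy i K with hi | rfl | hi
  · simp only [if_pos hi.le, if_pos (Nat.succ_le_of_lt hi)]
    exact ht i.lt_succ_self
  · simp [hT]
  · simp only [if_neg (show ¬ i ≤ K by omega), if_neg (show ¬ i + 1 ≤ K by omega)]
    push_cast
    linarith

/-- The step functions that are constant on `[T, ∞)`, built piece by piece; `q` is the sum of the
squares of the norms of the values. -/
inductive IsStep : (ℝ → H) → ℝ → ℝ → Prop
  | zero (T : ℝ) : IsStep (fun _ => 0) T 0
  | append {F : ℝ → H} {T q : ℝ} (hF : IsStep F T q) {T' : ℝ} (hT : T ≤ T') (h : H) :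
      IsStep (fun τ => if τ < T' then F τ else h) T' (q + ‖h‖ ^ 2)

theorem IsStep.nonneg {F : ℝ → H} {T q : ℝ} (hF : IsStep F T q) : 0 ≤ q := by
  induction hF with
  | zero T => exact le_rfl
  | append hF hT h ih => positivity

theorem isStep_stepFunction {K : ℕ} {t : ℕ → ℝ} (ht : Monotone t) (h : ℕ → H) :
    IsStep (stepFunction K t h) (t K) (∑ i ∈ Finset.range (K + 1), ‖h i‖ ^ 2) := by
  induction K with
  | zero =>
    have := (IsStep.zero (H := H) (t 0)).append le_rfl (h 0)
    convert this using 1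
    · funext τ
      by_cases hτ : τ < t 0
      · simp [stepFunction, hτ]
      · simp [stepFunction, hτ, not_lt.1 hτ]
    · simp
  | succ K ih =>
    have := ih.append (ht (Nat.le_succ K)) (h (K + 1))
    rw [Finset.sum_range_succ]
    convert this using 1
    exact funext fun τ => stepFunction_succ ht h τ

theorem IsStep.exists_stepFunction {F : ℝ → H} {T q : ℝ} (hF : IsStep F T q) :
    ∃ (K : ℕ) (t : ℕ → ℝ) (h : ℕ → H), StrictMono t ∧ t K = T ∧
      ∑ i ∈ Finset.range (K + 1), ‖h i‖ ^ 2 ≤ q ∧ F = stepFunction K t h := by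
  induction hF with
  | zero T =>
    refine ⟨0, fun i => T + i, 0, fun i j hij => by simpa using hij, by simp, by simp, ?_⟩
    ext
    simp [stepFunction]
  | @append F T q hF T' hT h ih =>
    obtain ⟨K, t, v, ht, htK, hv, rfl⟩ := ih
    -- `IsStep` admits empty pieces, atoms do not. If the new time equals the previous one, the last
    -- value is overwritten, which does not push the sum of squares above the bound.
    rcases hT.eq_or_lt with rfl | hT
    · refine ⟨K, t, Function.update v K h, ht, htK, ?_, ?_⟩
      · rw [Finset.sum_range_succ] at hv ⊢
        rw [Function.update_self]
        gcongr
        refine le_trans (Finset.sum_le_sum fun i hi => ?_)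
          ((le_add_of_nonneg_right (by positivity)).trans hv)
        rw [Function.update_of_ne (Finset.mem_range.1 hi).ne]
      · funext τ
        cases K with
        | zero =>
          by_cases hτ : τ < T
          · simp [stepFunction, htK, hτ]
          · simp [stepFunction, htK, hτ, not_lt.1 hτ]
        | succ K =>
          rw [stepFunction_succ ht.monotone, stepFunction_succ ht.monotone, htK,
            Function.update_self]
          split_ifs with hτ
          · refine congrFun (stepFunction_congr (fun _ _ => rfl) fun i hi => ?_) τ
            rw [Function.update_of_ne (by omega)]
          · rfl
    · obtain ⟨t', ht', htt, htT⟩ := exists_strictMono_append ht (htK.trans_lt hT)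
      refine ⟨K + 1, t', fun i => if i ≤ K then v i else h, ht', htT, ?_, ?_⟩
      · rw [Finset.sum_range_succ]
        simp only [add_le_iff_nonpos_right, nonpos_iff_eq_zero, one_ne_zero, if_false]
        gcongr
        refine (Finset.sum_le_sum fun i hi => ?_).trans hv
        rw [if_pos (Nat.lt_succ_iff.1 (Finset.mem_range.1 hi))]
      · funext τ
        rw [stepFunction_succ ht'.monotone, htT]
        split_ifs with h2 h3
        · exact congrFun (stepFunction_congr (fun i hi => (htt i hi).symm)
            fun i hi => by simp [hi]) τ
        · omega
        · rfl

theorem IsU2Atom.exists_isStep {a : ℝ → H} (ha : IsU2Atom a) :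
    ∃ T q, q ≤ 1 ∧ IsStep a T q := by
  obtain ⟨K, t, h, ht, hh, rfl⟩ := ha
  exact ⟨t K, _, hh, isStep_stepFunction ht.monotone h⟩

theorem IsStep.isU2Atom {F : ℝ → H} {T q : ℝ} (hF : IsStep F T q) (hq : q ≤ 1) : IsU2Atom F := by
  obtain ⟨K, t, h, ht, -, hh, rfl⟩ := hF.exists_stepFunction
  exact ⟨K, t, h, ht, hh.trans hq, rfl⟩

theorem IsStep.map {H' : Type*} [NormedAddCommGroup H'] {F : ℝ → H} {T q : ℝ}
    (hF : IsStep F T q) {L : H → H'} (h0 : L 0 = 0) {C : ℝ} (hL : ∀ x, ‖L x‖ ≤ C * ‖x‖) :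
    ∃ q' ≤ C ^ 2 * q, IsStep (fun τ => L (F τ)) T q' := by
  induction hF with
  | zero T => exact ⟨0, by simp, by simpa [h0] using IsStep.zero T⟩
  | @append F T q hF T' hT h ih =>
    obtain ⟨q', hq, hs⟩ := ih
    refine ⟨q' + ‖L h‖ ^ 2, ?_, ?_⟩
    · rw [mul_add, ← mul_pow]
      gcongr
      exact hL h
    · convert hs.append hT (L h) using 2 with τ
      exact apply_ite L _ _ _

/-- The operation `F ↦ 1_{t ≥ 0} F(min(t,1))` preserves step functions. -/
theorem IsStep.clamp {F : ℝ → H} {T q : ℝ} (hF : IsStep F T q) :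
    ∃ q' ≤ q, ∃ T' ≤ max 0 (min T 1),
      IsStep (fun τ => if τ < 0 then 0 else F (min τ 1)) T' q' := by
  induction hF with
  | zero T => exact ⟨0, le_rfl, 0, le_max_left _ _, by simpa using IsStep.zero _⟩
  | @append F T q hF T' hT h ih =>
    obtain ⟨q', hq, T₁, hT₁, hs⟩ := ih
    have hT₂ : T₁ ≤ max 0 (min T' 1) := hT₁.trans (by gcongr)
    -- A breakpoint up to time `1` moves to `max 0 T'`. A later one is invisible, since `F` is only
    -- evaluated at `min τ 1`.
    by_cases h1 : T' ≤ 1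
    · refine ⟨q' + ‖h‖ ^ 2, by gcongr, _, le_rfl, ?_⟩
      convert hs.append hT₂ h using 2 with τ
      rw [min_eq_left h1]
      by_cases h2 : τ < 0
      · simp [h2]
      · have h3 : (τ < max 0 T') ↔ min τ 1 < T' := by
          simp only [lt_max_iff, h2, false_or, min_lt_iff, or_iff_left (not_lt.2 h1)]
        simp [h2, h3]
    · refine ⟨q', hq.trans (le_add_of_nonneg_right (by positivity)), T₁, hT₂, ?_⟩
      simpa only [(min_le_right _ _).trans_lt (not_le.1 h1), if_true] using hs

theorem IsStep.eq_of_le {F : ℝ → H} {T q : ℝ} (hF : IsStep F T q) {τ τ' : ℝ} (hτ : T ≤ τ)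
    (hτ' : T ≤ τ') : F τ = F τ' := by
  cases hF with
  | zero T => rfl
  | append hF hT h => simp [not_lt.2 hτ, not_lt.2 hτ']

theorem IsStep.norm_sq_le {F : ℝ → H} {T q : ℝ} (hF : IsStep F T q) (τ : ℝ) : ‖F τ‖ ^ 2 ≤ q := by
  induction hF with
  | zero T => simp
  | @append F T q hF T' hT h ih =>
    dsimp only
    split_ifs
    · exact ih.trans (le_add_of_nonneg_right (by positivity))
    · exact le_add_of_nonneg_left hF.nonneg

theorem IsU2Atom.norm_le {a : ℝ → H} (ha : IsU2Atom a) (τ : ℝ) : ‖a τ‖ ≤ 1 := by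
  obtain ⟨T, q, hq, hs⟩ := ha.exists_isStep
  exact (sq_le_one_iff₀ (norm_nonneg _)).1 ((hs.norm_sq_le τ).trans hq)

/-- Pieces are closed on the left. The resulting right continuity survives in `U²` and determines
primitives at every time, not only almost everywhere. -/
theorem IsStep.eventually_eq_right {F : ℝ → H} {T q : ℝ} (hF : IsStep F T q) (τ : ℝ) :
    ∀ᶠ τ' in nhdsWithin τ (Ioi τ), F τ' = F τ := by
  induction hF with
  | zero T => simp
  | @append F T q hF T' hT h ih =>
    by_cases hτ : τ < T'
    · filter_upwards [ih, mem_nhdsWithin_of_mem_nhds (Iio_mem_nhds hτ)] with τ' h1 h2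
      rw [if_pos hτ, if_pos (mem_Iio.1 h2), h1]
    · filter_upwards [self_mem_nhdsWithin] with τ' h1
      rw [if_neg hτ, if_neg (not_lt.2 ((not_lt.1 hτ).trans h1.le))]

theorem IsStep.eventually_eq_zero {F : ℝ → H} {T q : ℝ} (hF : IsStep F T q) :
    ∀ᶠ τ in Filter.atBot, F τ = 0 := by
  induction hF with
  | zero T => simp
  | @append F T q hF T' hT h ih =>
    filter_upwards [ih, Filter.Iio_mem_atBot T'] with τ h1 h2
    rw [if_pos (mem_Iio.1 h2), h1]

theorem IsStep.stronglyMeasurable {F : ℝ → H} {T q : ℝ} (hF : IsStep F T q) :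
    StronglyMeasurable F := by
  induction hF with
  | zero T => exact stronglyMeasurable_const
  | append hF hT h ih => exact ih.ite measurableSet_Iio stronglyMeasurable_const

end Steps

/-! ### The norm of `U²` -/

section U2

variable {H : Type*} [NormedAddCommGroup H]

/-- The function that jumps from `0` to `h` at the time `t`. -/
def jump (t : ℝ) (h : H) (τ : ℝ) : H := if τ < t then 0 else h

theorem isStep_jump (t : ℝ) (h : H) : IsStep (jump t h) t (‖h‖ ^ 2) := by
  have := (IsStep.zero (H := H) t).append le_rfl h
  rwa [zero_add] at this

theorem jump_sub (t : ℝ) (h h' : H) : jump t (h - h') = jump t h - jump t h' := by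
  funext τ
  simp only [jump, Pi.sub_apply]
  split_ifs <;> simp

variable [NormedSpace ℂ H]

theorem exists_of_u2Norm_lt {F : ℝ → H} {B : ℝ≥0∞} (h : u2Norm F < B) :
    ∃ (c : ℕ → ℂ) (a : ℕ → ℝ → H), (∀ k, IsU2Atom (a k)) ∧
      (∀ τ, HasSum (fun k => c k • a k τ) (F τ)) ∧ ∑' k, ‖c k‖ₑ < B := by
  simp only [u2Norm, iInf_lt_iff] at h
  obtain ⟨c, a, ⟨ha, hF⟩, hc⟩ := h
  exact ⟨c, a, ha, hF, hc⟩

/-- An injection into `ℕ` transports the family; indices that are not hit receive the coefficient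
zero and the zero atom. -/
theorem u2Norm_le_tsum {κ : Type*} [Countable κ] {F : ℝ → H} {c : κ → ℂ} {a : κ → ℝ → H}
    (ha : ∀ k, IsU2Atom (a k)) (hF : ∀ τ, HasSum (fun k => c k • a k τ) (F τ)) :
    u2Norm F ≤ ∑' k, ‖c k‖ₑ := by
  obtain ⟨e, he⟩ := exists_injective_nat κ
  refine iInf₂_le_of_le (Function.extend e c 0) (Function.extend e a 0)
    (iInf_le_of_le ⟨fun k => ?_, fun τ => ?_⟩ ?_)
  · by_cases hk : ∃ i, e i = k
    · obtain ⟨i, rfl⟩ := hk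
      rw [he.extend_apply]
      exact ha i
    · rw [Function.extend_apply' _ _ _ hk]
      exact isU2Atom_zero
  · rw [← he.hasSum_iff]
    · simpa [Function.comp_def, he.extend_apply] using hF τ
    · intro k hk
      rw [Function.extend_apply' _ _ _ hk]
      simp
  · rw [← he.tsum_eq]
    · simp [he.extend_apply]
    · intro k hk
      by_contra h
      exact hk (by simp [Function.extend_apply' _ _ _ h])

theorem u2Norm_le_of_isStep {F : ℝ → H} {T q : ℝ} (hF : IsStep F T q) :
    u2Norm F ≤ ENNReal.ofReal (√q) := by
  refine ENNReal.le_of_forall_pos_le_add fun ε hε _ => ?_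
  have hε' : (0 : ℝ) < ε := hε
  -- The summand `ε` keeps the normalizing constant positive when `q = 0`.
  set C : ℝ := √q + ε
  have hC : 0 < C := add_pos_of_nonneg_of_pos (Real.sqrt_nonneg _) hε'
  have hqC : q ≤ C ^ 2 := by
    rw [← Real.sq_sqrt hF.nonneg]
    gcongr
    exact le_add_of_nonneg_right hε'.le
  obtain ⟨q', hq', hs⟩ := hF.map (L := fun x => (C⁻¹ : ℂ) • x) (smul_zero _) (C := C⁻¹)
    fun x => by rw [norm_smul, norm_inv, Complex.norm_real, Real.norm_of_nonneg hC.le]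
  have h1 : q' ≤ 1 := by
    refine hq'.trans ?_
    rw [inv_pow, inv_mul_le_iff₀ (by positivity), mul_one]
    exact hqC
  refine (u2Norm_le_tsum (κ := Unit) (c := fun _ => (C : ℂ)) (fun _ => hs.isU2Atom h1)
    fun τ => ?_).trans ?_
  · simp [hasSum_unique, smul_smul, hC.ne']
  · simp only [tsum_fintype, Finset.univ_unique, Finset.sum_singleton, C]
    rw [← ofReal_norm, Complex.norm_real, Real.norm_of_nonneg hC.le,
      ENNReal.ofReal_add (Real.sqrt_nonneg _) hε'.le, ENNReal.ofReal_coe_nnreal]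

theorem IsU2Atom.u2Norm_le {a : ℝ → H} (ha : IsU2Atom a) : u2Norm a ≤ 1 := by
  obtain ⟨T, q, hq, hs⟩ := ha.exists_isStep
  refine (u2Norm_le_of_isStep hs).trans (ENNReal.ofReal_le_one.2 ?_)
  exact Real.sqrt_le_one.2 hq

/-- Atoms are bounded by one. An atomic representation is thus dominated by the series of its
coefficients, uniformly in time, so that measurability, right continuity and the limit zero at `-∞`
pass from step functions to `U²`. -/
theorem enorm_le_u2Norm (F : ℝ → H) (τ : ℝ) : ‖F τ‖ₑ ≤ u2Norm F := by
  refine le_iInf₂ fun c a => le_iInf fun h => ?_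
  rw [← (h.2 τ).tsum_eq]
  refine enorm_tsum_le_tsum_enorm.trans (ENNReal.tsum_le_tsum fun k => ?_)
  rw [enorm_smul]
  refine mul_le_of_le_one_right' ?_
  rw [← ofReal_norm]
  exact ENNReal.ofReal_le_one.2 ((h.1 k).norm_le τ)

theorem summable_of_tsum_enorm_lt_top {κ E : Type*} [NormedAddCommGroup E] {c : κ → E}
    (h : ∑' k, ‖c k‖ₑ < ⊤) : Summable fun k => ‖c k‖ := by
  have := ENNReal.summable_toReal h.ne
  simpa using this

/-- The norm of `U²` is countably subadditive. -/
theorem u2Norm_le_tsum_u2Norm [CompleteSpace H] {κ : Type*} [Countable κ] {F : ℝ → H}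
    {G : κ → ℝ → H} (hF : ∀ τ, HasSum (fun k => G k τ) (F τ)) :
    u2Norm F ≤ ∑' k, u2Norm (G k) := by
  refine ENNReal.le_of_forall_pos_le_add fun ε hε hfin => ?_
  obtain ⟨δ, hδ, hδε⟩ := ENNReal.exists_pos_sum_of_countable
    (ENNReal.coe_pos.2 hε).ne' κ
  have h1 : ∀ k, ∃ (c : ℕ → ℂ) (a : ℕ → ℝ → H), (∀ m, IsU2Atom (a m)) ∧
      (∀ τ, HasSum (fun m => c m • a m τ) (G k τ)) ∧ ∑' m, ‖c m‖ₑ < u2Norm (G k) + δ k := by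
    intro k
    refine exists_of_u2Norm_lt (ENNReal.lt_add_right ?_ (by simpa using (hδ k).ne'))
    exact ((ENNReal.le_tsum k).trans_lt hfin).ne
  choose c a ha hG hc using h1
  have hlt : ∑' p : κ × ℕ, ‖c p.1 p.2‖ₑ ≤ (∑' k, u2Norm (G k)) + ε := by
    rw [ENNReal.tsum_prod' (f := fun p : κ × ℕ => ‖c p.1 p.2‖ₑ)]
    refine (ENNReal.tsum_le_tsum fun k => (hc k).le).trans ?_
    rw [ENNReal.tsum_add]
    gcongr
  refine (u2Norm_le_tsum (κ := κ × ℕ) (c := fun p => c p.1 p.2) (a := fun p => a p.1 p.2)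
    (fun p => ha p.1 p.2) fun τ => ?_).trans hlt
  -- Absolute summability of the double series permits summing it either by rows or all at once.
  have hs : Summable fun p : κ × ℕ => c p.1 p.2 • a p.1 p.2 τ := by
    refine Summable.of_norm_bounded (summable_of_tsum_enorm_lt_top (c := fun p : κ × ℕ => c p.1 p.2)
      (hlt.trans_lt (ENNReal.add_lt_top.2 ⟨hfin, ENNReal.coe_lt_top⟩))) fun p => ?_
    rw [norm_smul]
    exact mul_le_of_le_one_right (norm_nonneg _) ((ha p.1 p.2).norm_le τ)
  have h2 := hs.hasSum.prod_fiberwise fun k => hG k τ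
  rw [(hF τ).unique h2]
  exact hs.hasSum

theorem stronglyMeasurable_of_u2Norm_lt_top {F : ℝ → H} (h : u2Norm F < ⊤) :
    StronglyMeasurable F := by
  obtain ⟨c, a, ha, hF, -⟩ := exists_of_u2Norm_lt h
  refine stronglyMeasurable_of_tendsto Filter.atTop
    (f := fun N τ => ∑ k ∈ Finset.range N, c k • a k τ) (fun N => ?_)
    (tendsto_pi_nhds.2 fun τ => (hF τ).tendsto_sum_nat)
  refine Finset.stronglyMeasurable_fun_sum _ fun k _ => ?_
  obtain ⟨T, q, -, hs⟩ := (ha k).exists_isStep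
  exact hs.stronglyMeasurable.const_smul (c k)

theorem tendsto_right_of_u2Norm_lt_top [CompleteSpace H] {F : ℝ → H} (h : u2Norm F < ⊤) (τ : ℝ) :
    Filter.Tendsto F (nhdsWithin τ (Ioi τ)) (nhds (F τ)) := by
  obtain ⟨c, a, ha, hF, hc⟩ := exists_of_u2Norm_lt h
  rw [show F = fun τ => ∑' k, c k • a k τ from funext fun τ => (hF τ).tsum_eq.symm]
  refine tendsto_tsum_of_dominated_convergence (summable_of_tsum_enorm_lt_top hc) (fun k => ?_)
    (Filter.Eventually.of_forall fun τ' k => ?_)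
  · obtain ⟨T, q, -, hs⟩ := (ha k).exists_isStep
    refine tendsto_const_nhds.congr' ?_
    filter_upwards [hs.eventually_eq_right τ] with τ' h1
    rw [h1]
  · rw [norm_smul]
    exact mul_le_of_le_one_right (norm_nonneg _) ((ha k).norm_le τ')

theorem tendsto_atBot_of_u2Norm_lt_top [CompleteSpace H] {F : ℝ → H} (h : u2Norm F < ⊤) :
    Filter.Tendsto F Filter.atBot (nhds 0) := by
  obtain ⟨c, a, ha, hF, hc⟩ := exists_of_u2Norm_lt h
  rw [show F = fun τ => ∑' k, c k • a k τ from funext fun τ => (hF τ).tsum_eq.symm,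
    show (0 : H) = ∑' k : ℕ, 0 by simp]
  refine tendsto_tsum_of_dominated_convergence (summable_of_tsum_enorm_lt_top hc) (fun k => ?_)
    (Filter.Eventually.of_forall fun τ' k => ?_)
  · obtain ⟨T, q, -, hs⟩ := (ha k).exists_isStep
    refine tendsto_const_nhds.congr' ?_
    filter_upwards [hs.eventually_eq_zero] with τ' h1
    rw [h1, smul_zero]
  · rw [norm_smul]
    exact mul_le_of_le_one_right (norm_nonneg _) ((ha k).norm_le τ')

/-- An operation that is bounded on atoms is bounded on `U²`. -/
theorem u2Norm_operation_le {H' : Type*} [NormedAddCommGroup H'] [NormedSpace ℂ H']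
    [CompleteSpace H'] (L : ℝ → H →L[ℂ] H') (σ : ℝ → ℝ) {C : ℝ≥0∞} (hC : C ≠ ⊤)
    (hL : ∀ a : ℝ → H, IsU2Atom a → u2Norm (fun τ => L τ (a (σ τ))) ≤ C) {F : ℝ → H}
    (hF : u2Norm F < ⊤) : u2Norm (fun τ => L τ (F (σ τ))) ≤ C * u2Norm F := by
  have key : ∀ (c : ℕ → ℂ) (a : ℕ → ℝ → H),
      ((∀ k, IsU2Atom (a k)) ∧ ∀ τ, HasSum (fun k => c k • a k τ) (F τ)) →
      u2Norm (fun τ => L τ (F (σ τ))) ≤ C * ∑' k, ‖c k‖ₑ := by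
    intro c a h
    refine (u2Norm_le_tsum_u2Norm (G := fun k => c k • fun τ => L τ (a k (σ τ)))
      fun τ => ?_).trans ?_
    · simpa using (h.2 (σ τ)).mapL (L τ)
    · rw [← ENNReal.tsum_mul_left]
      refine ENNReal.tsum_le_tsum fun k => (isExtSeminorm_u2Norm.smul_le _ _).trans ?_
      rw [mul_comm]
      gcongr
      exact hL _ (h.1 k)
  -- Multiplication by `C` passes through the infimum only for `C ≠ 0`; for `C = 0` a single
  -- representation already suffices.
  rcases eq_or_ne C 0 with rfl | hC0
  · obtain ⟨c, a, ha, hc, -⟩ := exists_of_u2Norm_lt hF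
    simpa using key c a ⟨ha, hc⟩
  · conv_rhs => rw [u2Norm]
    simp_rw [ENNReal.mul_iInf_of_ne hC0 hC]
    exact le_iInf fun c => le_iInf fun a => le_iInf fun h => key c a h

theorem u2Norm_map_le {H' : Type*} [NormedAddCommGroup H'] [NormedSpace ℂ H']
    [CompleteSpace H'] (L : H →L[ℂ] H') {C : ℝ} (hC : ‖L‖ ≤ C) {F : ℝ → H}
    (hF : u2Norm F < ⊤) : u2Norm (fun τ => L (F τ)) ≤ ENNReal.ofReal C * u2Norm F := by
  refine u2Norm_operation_le (fun _ => L) id ENNReal.ofReal_ne_top (fun a ha => ?_) hF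
  obtain ⟨T, q, hq, hs⟩ := ha.exists_isStep
  have hC0 : 0 ≤ C := (norm_nonneg L).trans hC
  obtain ⟨q', hq', hs'⟩ := hs.map (L := L) (map_zero L) (C := C) fun x =>
    (L.le_opNorm x).trans (by gcongr)
  refine (u2Norm_le_of_isStep hs').trans (ENNReal.ofReal_le_ofReal ?_)
  rw [Real.sqrt_le_left hC0]
  exact hq'.trans (mul_le_of_le_one_right (by positivity) hq)

/-- The clamp combines the change of clock `min τ 1` with a time-dependent operator, zero at
negative times and the identity afterwards; it maps atoms to atoms. -/
theorem u2Norm_clamp_le [CompleteSpace H] {F : ℝ → H} (hF : u2Norm F < ⊤) :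
    u2Norm (fun τ => if τ < 0 then 0 else F (min τ 1)) ≤ u2Norm F := by
  have h := u2Norm_operation_le
    (fun τ => if τ < 0 then 0 else ContinuousLinearMap.id ℂ H) (fun τ => min τ 1)
    ENNReal.one_ne_top (fun a ha => ?_) hF
  · convert h using 2
    · funext τ
      split_ifs <;> rfl
    · rw [one_mul]
  · obtain ⟨T, q, hq, hs⟩ := ha.exists_isStep
    obtain ⟨q', hq', T', -, hs'⟩ := hs.clamp
    refine le_trans (le_of_eq ?_) (hs'.isU2Atom (hq'.trans hq)).u2Norm_le
    congr 1
    funext τ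
    split_ifs <;> rfl

theorem u2Norm_jump_le (t : ℝ) (h : H) : u2Norm (jump t h) ≤ ‖h‖ₑ := by
  refine (u2Norm_le_of_isStep (isStep_jump t h)).trans ?_
  rw [Real.sqrt_sq (norm_nonneg h), ofReal_norm]

/-- The functions with finitely many jumps, at times in `[0,1]`, by vectors of `D`. -/
def unitJumps (D : Set H) : Submodule ℂ (ℝ → H) :=
  Submodule.span ℂ {F | ∃ t ∈ Icc (0 : ℝ) 1, ∃ h ∈ D, F = jump t h}

theorem IsStep.clamp_mem_unitJumps {F : ℝ → H} {T q : ℝ} (hF : IsStep F T q) :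
    (fun τ => if τ < 0 then 0 else F (min τ 1)) ∈ unitJumps (univ : Set H) := by
  induction hF with
  | zero T =>
    convert (unitJumps (univ : Set H)).zero_mem using 1
    funext τ
    simp
  | @append F T q hF T' hT h ih =>
    by_cases h1 : T' ≤ 1
    -- `F` is constant on `[T, ∞)`, so appending the value `h` at `T'` adds exactly the jump `h - F
    -- T'`.
    · have h2 : jump (max 0 T') (h - F T') ∈ unitJumps (univ : Set H) :=
        Submodule.subset_span ⟨max 0 T', ⟨le_max_left _ _, max_le zero_le_one h1⟩, _, mem_univ _,
          rfl⟩
      convert (unitJumps (univ : Set H)).add_mem ih h2 using 1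
      funext τ
      simp only [Pi.add_apply, jump]
      by_cases h3 : τ < 0
      · simp [h3]
      · have h4 : (τ < max 0 T') ↔ min τ 1 < T' := by
          simp only [lt_max_iff, h3, false_or, min_lt_iff, or_iff_left (not_lt.2 h1)]
        simp only [h3, if_false, h4]
        split_ifs with h5
        · simp
        · rw [hF.eq_of_le (hT.trans (not_lt.1 h5)) hT]
          abel
    · simpa only [(min_le_right _ _).trans_lt (not_le.1 h1), if_true] using ih

/-- The functions with finitely many jumps are dense. -/
theorem exists_unitJumps_u2Norm_sub_lt [CompleteSpace H] {F : ℝ → H} (hF : u2Norm F < ⊤)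
    (h0 : ∀ τ < 0, F τ = 0) (h1 : ∀ τ, 1 ≤ τ → F τ = F 1) {D : Set H} (hD : Dense D)
    {ε : ℝ≥0∞} (hε : 0 < ε) : ∃ G ∈ unitJumps D, u2Norm (F - G) < ε := by
  -- A jump costs no more than the norm of its vector, so the vectors of a finite jump function can
  -- be moved into the dense set `D`.
  have hsub : ∀ G ∈ unitJumps (univ : Set H), ∀ δ : ℝ≥0∞, 0 < δ →
      ∃ G' ∈ unitJumps D, u2Norm (G - G') < δ := by
    intro G hG
    induction hG using Submodule.span_induction with
    | mem x hx =>
      obtain ⟨t, ht, h, -, rfl⟩ := hx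
      intro δ hδ
      obtain ⟨h', hh', hlt⟩ := EMetric.mem_closure_iff.1 (hD h) δ hδ
      refine ⟨jump t h', Submodule.subset_span ⟨t, ht, h', hh', rfl⟩, ?_⟩
      rw [← jump_sub]
      refine (u2Norm_jump_le _ _).trans_lt ?_
      rwa [← edist_eq_enorm_sub]
    | zero => exact fun δ hδ => ⟨0, zero_mem _, by simpa [isExtSeminorm_u2Norm.map_zero] using hδ⟩
    | add x y _ _ hx hy =>
      intro δ hδ
      obtain ⟨x', hx', hx⟩ := hx (δ / 2) (ENNReal.half_pos hδ.ne')
      obtain ⟨y', hy', hy⟩ := hy (δ / 2) (ENNReal.half_pos hδ.ne')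
      refine ⟨x' + y', add_mem hx' hy', ?_⟩
      rw [add_sub_add_comm]
      refine (isExtSeminorm_u2Norm.add_le _ _).trans_lt ?_
      rw [← ENNReal.add_halves δ]
      exact ENNReal.add_lt_add hx hy
    | smul c x _ hx =>
      intro δ hδ
      rcases eq_or_ne c 0 with rfl | hc
      · exact ⟨0, zero_mem _, by simpa [isExtSeminorm_u2Norm.map_zero] using hδ⟩
      · have hc' : ‖c‖ₑ ≠ 0 := by simpa using hc
        obtain ⟨x', hx', hx⟩ := hx (δ / ‖c‖ₑ) (ENNReal.div_pos hδ.ne' enorm_ne_top)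
        refine ⟨c • x', Submodule.smul_mem _ c hx', ?_⟩
        rw [← smul_sub]
        refine (isExtSeminorm_u2Norm.smul_le _ _).trans_lt ?_
        rw [mul_comm]
        exact (ENNReal.lt_div_iff_mul_lt (Or.inl hc') (Or.inl enorm_ne_top)).1 hx
  obtain ⟨c, a, ha, hFc, hc⟩ := exists_of_u2Norm_lt hF
  have hP : (fun τ => if τ < 0 then 0 else F (min τ 1)) = F := by
    funext τ
    split_ifs with h
    · exact (h0 τ h).symm
    · rcases le_total τ 1 with h2 | h2
      · rw [min_eq_left h2]
      · rw [min_eq_right h2, h1 τ h2]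
  obtain ⟨N, hN⟩ := ((ENNReal.tendsto_sum_nat_add (fun k => ‖c k‖ₑ) hc.ne).eventually_lt_const
    (ENNReal.half_pos hε.ne')).exists
  -- The clamp fixes `F`, does not increase the norm, and sends step functions to finite jump
  -- functions with times in `[0,1]`. Applied to a partial sum of atoms it yields the approximation.
  let P : (ℝ → H) →ₗ[ℂ] (ℝ → H) :=
    { toFun := fun F τ => if τ < 0 then 0 else F (min τ 1)
      map_add' := fun F G => by
        funext τ
        simp only [Pi.add_apply]
        split_ifs <;> simp
      map_smul' := fun c F => by
        funext τ
        simp only [Pi.smul_apply, RingHom.id_apply]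
        split_ifs <;> simp }
  have hG : P (∑ k ∈ Finset.range N, c k • a k) ∈ unitJumps (univ : Set H) := by
    rw [map_sum]
    refine Submodule.sum_mem _ fun k _ => ?_
    rw [map_smul]
    obtain ⟨T, q, -, hs⟩ := (ha k).exists_isStep
    exact Submodule.smul_mem _ _ hs.clamp_mem_unitJumps
  obtain ⟨G', hG', hlt⟩ := hsub _ hG _ (ENNReal.half_pos hε.ne')
  refine ⟨G', hG', ?_⟩
  have h2 : u2Norm (F - ∑ k ∈ Finset.range N, c k • a k) < ε / 2 := by
    refine (u2Norm_le_tsum (c := fun k => c (k + N)) (fun k => ha (k + N)) fun τ => ?_).trans_lt hN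
    have := (hasSum_nat_add_iff' N).2 (hFc τ)
    simpa using this
  have h3 : F - G' = P (F - ∑ k ∈ Finset.range N, c k • a k) +
      (P (∑ k ∈ Finset.range N, c k • a k) - G') := by
    rw [map_sub, show P F = F from hP]
    abel
  rw [h3, ← ENNReal.add_halves ε]
  refine (isExtSeminorm_u2Norm.add_le _ _).trans_lt (ENNReal.add_lt_add ?_ hlt)
  exact (u2Norm_clamp_le (h2.trans_le le_top)).trans_lt h2

end U2

/-! ### The pairing of `V²` and `U²` -/

section Pairing

variable {H : Type*} [NormedAddCommGroup H]

/-- Repeated times contribute nothing and can be deleted. Variations may therefore be tested on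
sequences that are only monotone. -/
theorem exists_strictMono_sum_eq (f : ℝ → ℝ → ℝ≥0∞) (hf : ∀ x, f x x = 0) {t : ℕ → ℝ}
    (ht : Monotone t) (K : ℕ) : ∃ (K' : ℕ) (t' : ℕ → ℝ), StrictMono t' ∧ t' K' = t K ∧
      ∑ i ∈ Finset.range K, f (t (i + 1)) (t i) = ∑ i ∈ Finset.range K', f (t' (i + 1)) (t' i) := by
  induction K with
  | zero => exact ⟨0, fun i => t 0 + i, fun i j hij => by simpa using hij, by simp, by simp⟩
  | succ K ih =>
    obtain ⟨K', t', ht', hK, hs⟩ := ih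
    rcases (ht K.le_succ).eq_or_lt with h | h
    · exact ⟨K', t', ht', hK.trans h, by rw [Finset.sum_range_succ, hs, ← h, hf, add_zero]⟩
    · obtain ⟨t'', ht'', h1, h2⟩ := exists_strictMono_append ht' (hK.trans_lt h)
      refine ⟨K' + 1, t'', ht'', h2, ?_⟩
      rw [Finset.sum_range_succ, Finset.sum_range_succ, hs, h2, h1 K' le_rfl, hK]
      congr 1
      refine Finset.sum_congr rfl fun i hi => ?_
      have := Finset.mem_range.1 hi
      rw [h1 i (by omega), h1 (i + 1) (by omega)]

theorem sum_le_v2Norm (v : ℝ → H) {t : ℕ → ℝ} (ht : Monotone t) (K : ℕ) :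
    ∑ i ∈ Finset.range K, ‖v (t (i + 1)) - v (t i)‖ₑ ^ (2 : ℝ) ≤ v2Norm v ^ (2 : ℝ) := by
  obtain ⟨K', t', ht', -, hs⟩ := exists_strictMono_sum_eq
    (fun x y => ‖v x - v y‖ₑ ^ (2 : ℝ)) (by simp) ht K
  rw [hs]
  have : (l2Sum fun i : Fin K' => ‖v (t' (i + 1)) - v (t' i)‖ₑ) ≤ v2Norm v :=
    le_iSup_of_le t' (le_iSup₂_of_le ht' K' le_rfl)
  rw [l2Sum_le_iff, tsum_fintype] at this
  rwa [Finset.sum_range]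

variable [InnerProductSpace ℂ H]

/-- While `F` keeps one value the increments of `v` telescope. What remains pairs the values of `F`
with increments over a coarser partition, ready for Cauchy-Schwarz. -/
theorem IsStep.exists_pairing_eq {F : ℝ → H} {T q : ℝ} (hF : IsStep F T q) (v : ℝ → H) {s : ℕ → ℝ}
    (hs : Monotone s) (M : ℕ) : ∃ (K : ℕ) (r : ℕ → ℝ) (h : ℕ → H), Monotone r ∧ r K = s M ∧
      ∑ i ∈ Finset.range K, ‖h i‖ ^ 2 ≤ q ∧
      ∑ m ∈ Finset.range M, inner ℂ (F (s m)) (v (s (m + 1)) - v (s m)) =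
        ∑ i ∈ Finset.range K, inner ℂ (h i) (v (r (i + 1)) - v (r i)) := by
  induction hF generalizing M with
  | zero T => exact ⟨0, fun _ => s M, 0, monotone_const, rfl, by simp, by simp⟩
  | @append F T q hF T' hT h ih =>
    -- `m₀` is the first sampling index at which `F` has reached its last value; the alternative `m
    -- = M` covers the case that this never happens.
    have hex : ∃ m, m = M ∨ T' ≤ s m := ⟨M, Or.inl rfl⟩
    classical
    set m₀ := Nat.find hex with hm₀
    have hm₀M : m₀ ≤ M := Nat.find_min' hex (Or.inl rfl)
    have hlt : ∀ m < m₀, s m < T' := fun m hm => by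
      have := Nat.find_min hex hm
      push Not at this
      exact this.2
    have hge : ∀ m, m₀ ≤ m → m < M → ¬ s m < T' := fun m h1 h2 => by
      rcases Nat.find_spec hex with h3 | h3
      · omega
      · exact not_lt.2 (h3.trans (hs h1))
    obtain ⟨K, r, v', hr, hrK, hv', heq⟩ := ih m₀
    refine ⟨K + 1, fun i => if i ≤ K then r i else s M, fun i => if i < K then v' i else h,
      ?_, by simp, ?_, ?_⟩
    · refine monotone_nat_of_le_succ fun i => ?_
      rcases lt_trichotomy i K with hi | rfl | hi
      · simp only [if_pos hi.le, if_pos (Nat.succ_le_of_lt hi)]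
        exact hr i.le_succ
      · simpa [hrK] using hs hm₀M
      · simp [show ¬ i ≤ K by omega, show ¬ i < K by omega]
    · rw [Finset.sum_range_succ]
      simp only [lt_irrefl, if_false]
      gcongr
      refine (Finset.sum_le_sum fun i hi => ?_).trans hv'
      rw [if_pos (Finset.mem_range.1 hi)]
    · rw [← Finset.sum_range_add_sum_Ico _ hm₀M, Finset.sum_range_succ]
      congr 1
      · refine (Finset.sum_congr rfl fun m hm => ?_).trans (heq.trans
          (Finset.sum_congr rfl fun i hi => ?_))
        · simp only [if_pos (hlt m (Finset.mem_range.1 hm))]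
        · have hi' := Finset.mem_range.1 hi
          simp [hi', hi'.le, Nat.succ_le_of_lt hi']
      · have : ∀ m ∈ Finset.Ico m₀ M,
            inner ℂ (if s m < T' then F (s m) else h) (v (s (m + 1)) - v (s m)) =
              inner ℂ h (v (s (m + 1))) - inner ℂ h (v (s m)) := fun m hm => by
          rw [if_neg (hge m (Finset.mem_Ico.1 hm).1 (Finset.mem_Ico.1 hm).2), inner_sub_right]
        rw [Finset.sum_congr rfl this, Finset.sum_Ico_sub (fun m => inner ℂ h (v (s m))) hm₀M]
        simp [hrK]

theorem IsStep.enorm_pairing_le {F : ℝ → H} {T q : ℝ} (hF : IsStep F T q) (v : ℝ → H) {s : ℕ → ℝ}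
    (hs : Monotone s) (M : ℕ) :
    ‖∑ m ∈ Finset.range M, inner ℂ (F (s m)) (v (s (m + 1)) - v (s m))‖ₑ ≤
      ENNReal.ofReal (√q) * v2Norm v := by
  obtain ⟨K, r, h, hr, -, hh, heq⟩ := hF.exists_pairing_eq v hs M
  rw [heq]
  refine (enorm_sum_le _ _).trans ?_
  have h1 : ∀ i ∈ Finset.range K, ‖inner ℂ (h i) (v (r (i + 1)) - v (r i))‖ₑ ≤
      ‖h i‖ₑ * ‖v (r (i + 1)) - v (r i)‖ₑ := fun i _ => by
    simp only [← ofReal_norm]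
    rw [← ENNReal.ofReal_mul (norm_nonneg _)]
    exact ENNReal.ofReal_le_ofReal (norm_inner_le_norm _ _)
  refine (Finset.sum_le_sum h1).trans ?_
  rw [Finset.sum_range, ← tsum_fintype (L := .unconditional _)]
  refine (tsum_mul_le_l2Sum_mul _ _).trans ?_
  gcongr
  · rw [l2Sum_le_iff, tsum_fintype, ← Finset.sum_range fun i => ‖h i‖ₑ ^ (2 : ℝ)]
    rw [ENNReal.ofReal_rpow_of_nonneg (Real.sqrt_nonneg _) (by norm_num), Real.rpow_two,
      Real.sq_sqrt hF.nonneg]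
    refine le_trans (le_of_eq ?_) (ENNReal.ofReal_le_ofReal hh)
    rw [ENNReal.ofReal_sum_of_nonneg fun _ _ => by positivity]
    refine Finset.sum_congr rfl fun i _ => ?_
    rw [← ofReal_norm, ENNReal.ofReal_rpow_of_nonneg (norm_nonneg _) (by norm_num), Real.rpow_two]
  · rw [l2Sum_le_iff, tsum_fintype,
      ← Finset.sum_range fun i => ‖v (r (i + 1)) - v (r i)‖ₑ ^ (2 : ℝ)]
    exact sum_le_v2Norm v hr K

theorem enorm_pairing_le {F : ℝ → H} (v : ℝ → H) (hv : v2Norm v < ⊤) (hF : u2Norm F < ⊤)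
    {s : ℕ → ℝ} (hs : Monotone s) (M : ℕ) :
    ‖∑ m ∈ Finset.range M, inner ℂ (F (s m)) (v (s (m + 1)) - v (s m))‖ₑ ≤
      v2Norm v * u2Norm F := by
  have key : ∀ (c : ℕ → ℂ) (a : ℕ → ℝ → H),
      ((∀ k, IsU2Atom (a k)) ∧ ∀ τ, HasSum (fun k => c k • a k τ) (F τ)) →
      ‖∑ m ∈ Finset.range M, inner ℂ (F (s m)) (v (s (m + 1)) - v (s m))‖ₑ ≤
      v2Norm v * ∑' k, ‖c k‖ₑ := by
    intro c a h
    have h1 : HasSum (fun k => conj (c k) *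
        ∑ m ∈ Finset.range M, inner ℂ (a k (s m)) (v (s (m + 1)) - v (s m)))
        (∑ m ∈ Finset.range M, inner ℂ (F (s m)) (v (s (m + 1)) - v (s m))) := by
      simp_rw [Finset.mul_sum]
      refine hasSum_sum fun m _ => ?_
      have h2 := ((innerSL ℂ (v (s (m + 1)) - v (s m))).hasSum (h.2 (s m))).star
      simpa [inner_smul_left] using h2
    rw [← h1.tsum_eq, ← ENNReal.tsum_mul_left]
    refine enorm_tsum_le_tsum_enorm.trans (ENNReal.tsum_le_tsum fun k => ?_)
    rw [enorm_mul, mul_comm]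
    have h3 : ‖conj (c k)‖ₑ = ‖c k‖ₑ := by simp [← ofReal_norm]
    rw [h3]
    gcongr
    obtain ⟨T, q, hq, hs'⟩ := (h.1 k).exists_isStep
    refine (hs'.enorm_pairing_le v hs M).trans (mul_le_of_le_one_left' ?_)
    exact ENNReal.ofReal_le_one.2 (Real.sqrt_le_one.2 hq)
  rcases eq_or_ne (v2Norm v) 0 with h0 | h0
  · obtain ⟨c, a, ha, hc, -⟩ := exists_of_u2Norm_lt hF
    simpa [h0] using key c a ⟨ha, hc⟩
  · conv_rhs => rw [u2Norm]
    simp_rw [ENNReal.mul_iInf_of_ne h0 hv.ne]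
    exact le_iInf fun c => le_iInf fun a => le_iInf fun h => key c a h

theorem exists_strictMono_enumeration (S : Finset ℝ) : ∀ a : ℝ, (∀ x ∈ S, x < a) →
    ∃ (s : ℕ → ℝ) (M : ℕ), StrictMono s ∧ s M = a ∧ S = (Finset.range M).image s := by
  classical
  induction S using Finset.induction_on_max with
  | empty => exact fun a _ => ⟨fun i => a + i, 0, fun i j hij => by simpa using hij, by simp, by simp⟩
  | insert b S hb ih =>
    intro a ha
    obtain ⟨s, M, hs, hM, hS⟩ := ih b hb
    obtain ⟨s', hs', h1, h2⟩ := exists_strictMono_append hs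
      (hM.trans_lt (ha b (Finset.mem_insert_self b S)))
    refine ⟨s', M + 1, hs', h2, ?_⟩
    rw [Finset.range_add_one, Finset.image_insert, h1 M le_rfl, hM]
    congr 1
    rw [hS]
    refine Finset.image_congr fun i hi => (h1 i ?_).symm
    exact (Finset.mem_range.1 hi).le

/-- The duality of `V²` and `U²`, for functions with finitely many jumps. -/
theorem enorm_sum_inner_le (v : ℝ → H) (hv : v2Norm v < ⊤) {a : ℝ} (hva : v a = 0) (S : Finset ℝ)
    (hS : ∀ t ∈ S, t < a) (p : ℝ → H) (hF : u2Norm (∑ t ∈ S, jump t (p t)) < ⊤) :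
    ‖∑ t ∈ S, inner ℂ (p t) (v t)‖ₑ ≤ v2Norm v * u2Norm (∑ t ∈ S, jump t (p t)) := by
  classical
  obtain ⟨s, M, hs, hM, rfl⟩ := exists_strictMono_enumeration S a hS
  refine le_trans (le_of_eq ?_) (enorm_pairing_le v hv hF hs.monotone M)
  -- Summation by parts: a jump at `s i` meets all increments of `v` from `s i` to `a`, and they
  -- telescope to `v a - v (s i) = -v (s i)`.
  rw [← enorm_neg]
  congr 1
  simp only [Finset.sum_image fun _ _ _ _ h => hs.injective h, Finset.sum_apply, sum_inner]
  rw [Finset.sum_comm, ← Finset.sum_neg_distrib]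
  refine Finset.sum_congr rfl fun i hi => ?_
  rw [← Finset.sum_range_add_sum_Ico _ (Finset.mem_range.1 hi).le, Finset.sum_eq_zero, zero_add]
  · have : ∀ m ∈ Finset.Ico i M, inner ℂ (jump (s i) (p (s i)) (s m)) (v (s (m + 1)) - v (s m)) =
        inner ℂ (p (s i)) (v (s (m + 1))) - inner ℂ (p (s i)) (v (s m)) := fun m hm => by
      rw [jump, if_neg (not_lt.2 (hs.monotone (Finset.mem_Ico.1 hm).1)), inner_sub_right]
    rw [Finset.sum_congr rfl this, Finset.sum_Ico_sub (fun m => inner ℂ (p (s i)) (v (s m)))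
      (Finset.mem_range.1 hi).le, hM, hva]
    simp
  · intro m hm
    rw [jump, if_pos (hs (Finset.mem_range.1 hm)), inner_zero_left]

end Pairing

end

section

/-! ### Slices of functions of space-time -/

section Slices

variable {n : ℕ}

theorem hasTemperateGrowth_snd : (fun p : SpaceTime n => p.snd).HasTemperateGrowth :=
  ((ContinuousLinearMap.snd ℝ ℝ (Space n)) ∘L (WithLp.prodContinuousLinearEquiv 2 ℝ ℝ
    (Space n)).toContinuousLinearMap).hasTemperateGrowth

theorem hasTemperateGrowth_comp_snd {m : Space n → ℂ} (hm : m.HasTemperateGrowth) :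
    (fun p : SpaceTime n => m p.snd).HasTemperateGrowth :=
  hm.comp hasTemperateGrowth_snd

theorem slice_apply (t : ℝ) (ψ : 𝓢(SpaceTime n, ℂ)) (x : Space n) :
    slice t ψ x = ψ (WithLp.toLp 2 (t, x)) := rfl

theorem ext_slice {ψ ψ' : 𝓢(SpaceTime n, ℂ)} (h : ∀ t, slice t ψ = slice t ψ') : ψ = ψ' := by
  ext p
  exact DFunLike.congr_fun (h p.fst) p.snd

/-- The transpose of a Fourier multiplier. -/
def multT {E : Type*} [NormedAddCommGroup E] [InnerProductSpace ℝ E] [FiniteDimensional ℝ E]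
    [MeasurableSpace E] [BorelSpace E] (g : E → ℂ) : 𝓢(E, ℂ) →L[ℂ] 𝓢(E, ℂ) :=
  FourierTransform.fourierCLM ℂ 𝓢(E, ℂ) ∘L SchwartzMap.smulLeftCLM ℂ g ∘L
    FourierTransform.fourierInvCLM ℂ 𝓢(E, ℂ)

section multT

variable {E : Type*} [NormedAddCommGroup E] [InnerProductSpace ℝ E] [FiniteDimensional ℝ E]
    [MeasurableSpace E] [BorelSpace E]

theorem multT_apply (g : E → ℂ) (ψ : 𝓢(E, ℂ)) :
    multT g ψ = 𝓕 (SchwartzMap.smulLeftCLM ℂ g (𝓕⁻ ψ)) := rfl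

theorem multT_multT {g₁ g₂ : E → ℂ} (h₁ : g₁.HasTemperateGrowth) (h₂ : g₂.HasTemperateGrowth)
    (ψ : 𝓢(E, ℂ)) : multT g₁ (multT g₂ ψ) = multT (g₁ * g₂) ψ := by
  simp [multT_apply, SchwartzMap.smulLeftCLM_smulLeftCLM_apply h₁ h₂]

theorem multT_comm {g₁ g₂ : E → ℂ} (h₁ : g₁.HasTemperateGrowth) (h₂ : g₂.HasTemperateGrowth)
    (ψ : 𝓢(E, ℂ)) : multT g₁ (multT g₂ ψ) = multT g₂ (multT g₁ ψ) := by
  rw [multT_multT h₁ h₂, multT_multT h₂ h₁, mul_comm]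

end multT

theorem norm_le_toLp_fst (t : ℝ) (x : Space n) :
    |t| ≤ ‖(WithLp.toLp 2 (t, x) : SpaceTime n)‖ :=
  WithLp.norm_fst_le (p := 2) _ (WithLp.toLp 2 (t, x) : SpaceTime n)

theorem norm_le_toLp_snd (t : ℝ) (x : Space n) :
    ‖x‖ ≤ ‖(WithLp.toLp 2 (t, x) : SpaceTime n)‖ :=
  WithLp.norm_snd_le (p := 2) _ (WithLp.toLp 2 (t, x) : SpaceTime n)

/-- Of `N + 2` powers of space-time decay, two are spent on integrability in time and `N` are kept
in space. -/
theorem exists_slice_decay (ψ : 𝓢(SpaceTime n, ℂ)) (N : ℕ) : ∃ C : ℝ, 0 ≤ C ∧ ∀ t x,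
    ‖ψ (WithLp.toLp 2 (t, x))‖ ≤ C * ((1 + |t|) ^ 2)⁻¹ * ((1 + ‖x‖) ^ N)⁻¹ := by
  refine ⟨2 ^ (N + 2) * (Finset.Iic (N + 2, 0)).sup (fun m => SchwartzMap.seminorm ℝ m.1 m.2) ψ,
    by positivity, fun t x => ?_⟩
  have h := SchwartzMap.one_add_le_sup_seminorm_apply (𝕜 := ℝ) (m := (N + 2, 0)) le_rfl le_rfl ψ
    (WithLp.toLp 2 (t, x))
  rw [norm_iteratedFDeriv_zero] at h
  rw [mul_assoc, ← mul_inv, ← div_eq_mul_inv, le_div_iff₀ (by positivity)]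
  refine le_trans ?_ h
  rw [mul_comm]
  have h1 : (1 + |t|) ^ 2 * (1 + ‖x‖) ^ N ≤
      (1 + ‖(WithLp.toLp 2 (t, x) : SpaceTime n)‖) ^ (N + 2) := by
    rw [add_comm N 2, pow_add]
    gcongr
    · exact norm_le_toLp_fst t x
    · exact norm_le_toLp_snd t x
  gcongr

theorem integrable_one_add_abs_inv : Integrable fun t : ℝ => ((1 + |t|) ^ 2)⁻¹ := by
  have h := integrable_one_add_norm (E := ℝ) (μ := volume) (r := 2) (by simp)
  refine h.congr (Filter.Eventually.of_forall fun t => ?_)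
  simp only [Real.norm_eq_abs]
  rw [Real.rpow_neg (by positivity), Real.rpow_two]

theorem measurePreserving_toLp :
    MeasurePreserving (fun p : ℝ × Space n => (WithLp.toLp 2 p : SpaceTime n)) :=
  WithLp.volume_preserving_toLp ℝ (Space n)

theorem integral_spaceTime (f : SpaceTime n → ℂ) :
    ∫ p, f p = ∫ p : ℝ × Space n, f (WithLp.toLp 2 p) :=
  (measurePreserving_toLp.integral_comp
    (MeasurableEquiv.toLp 2 (ℝ × Space n)).measurableEmbedding f).symm

theorem integrable_toLp {f : SpaceTime n → ℂ} (hf : Integrable f) :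
    Integrable fun p : ℝ × Space n => f (WithLp.toLp 2 p) :=
  measurePreserving_toLp.integrable_comp_of_integrable hf

/-- The Fourier transform in the time variable, at the time `t`. -/
def timeFourier (t : ℝ) (Ψ : SpaceTime n → ℂ) (η : Space n) : ℂ :=
  ∫ τ, Complex.exp (((-2 * Real.pi * (τ * t) : ℝ) : ℂ) * Complex.I) * Ψ (WithLp.toLp 2 (τ, η))

theorem norm_exp_real_mul_I (a : ℝ) : ‖Complex.exp ((a : ℂ) * Complex.I)‖ = 1 :=
  Complex.norm_exp_ofReal_mul_I a

theorem integrable_timeFourier (t : ℝ) (Ψ : 𝓢(SpaceTime n, ℂ)) :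
    Integrable (timeFourier t Ψ) := by
  have h : Integrable (fun p : Space n × ℝ =>
      Complex.exp (((-2 * Real.pi * (p.2 * t) : ℝ) : ℂ) * Complex.I) *
        Ψ (WithLp.toLp 2 (p.2, p.1))) (volume.prod volume) := by
    have h1 : Integrable (fun p : Space n × ℝ => Ψ (WithLp.toLp 2 (p.2, p.1)))
      (volume.prod volume) := (integrable_toLp Ψ.integrable).swap
    refine h1.mono (Continuous.aestronglyMeasurable (by fun_prop))
      (Filter.Eventually.of_forall fun p => ?_)
    rw [norm_mul, norm_exp_real_mul_I, one_mul]
  exact h.integral_prod_left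

theorem continuous_timeFourier (t : ℝ) (Ψ : 𝓢(SpaceTime n, ℂ)) :
    Continuous (timeFourier t Ψ) := by
  obtain ⟨C, hC, h⟩ := exists_slice_decay Ψ 0
  refine continuous_of_dominated (bound := fun τ => C * ((1 + |τ|) ^ 2)⁻¹) (fun η => ?_)
    (fun η => Filter.Eventually.of_forall fun τ => ?_) (integrable_one_add_abs_inv.const_mul C)
    (Filter.Eventually.of_forall fun τ => ?_)
  · have : Continuous fun τ : ℝ => Complex.exp (((-2 * Real.pi * (τ * t) : ℝ) : ℂ) * Complex.I) *
      Ψ (WithLp.toLp 2 (τ, η)) := by fun_prop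
    exact this.aestronglyMeasurable
  · rw [norm_mul, norm_exp_real_mul_I, one_mul]
    simpa using h τ η
  · fun_prop

/-- Fubini: the space-time Fourier integral may be carried out in time first. This makes operators
given on the space-time Fourier side readable slice by slice. -/
theorem fourier_timeFourier (t : ℝ) (Ψ : 𝓢(SpaceTime n, ℂ)) :
    𝓕 (timeFourier t Ψ) = slice t (𝓕 Ψ) := by
  funext x
  rw [slice_apply, SchwartzMap.fourier_coe, Real.fourier_eq', Real.fourier_eq', integral_spaceTime]
  have h : Integrable (fun p : ℝ × Space n => Complex.exp ((-2 * Real.pi *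
      inner ℝ (WithLp.toLp 2 p : SpaceTime n) (WithLp.toLp 2 (t, x)) : ℝ) * Complex.I) •
        Ψ (WithLp.toLp 2 p)) (volume.prod volume) := by
    refine (integrable_toLp Ψ.integrable).mono (Continuous.aestronglyMeasurable (by fun_prop))
      (Filter.Eventually.of_forall fun p => ?_)
    rw [norm_smul, norm_exp_real_mul_I, one_mul]
  refine Eq.trans ?_ (integral_prod_symm _ h).symm
  congr 1
  funext η
  rw [timeFourier, ← integral_smul]
  congr 1
  funext τ
  rw [smul_eq_mul, smul_eq_mul, ← mul_assoc, ← Complex.exp_add, WithLp.prod_inner_apply]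
  congr 2
  simp
  ring

theorem fourierInv_slice_fourier (t : ℝ) (Ψ : 𝓢(SpaceTime n, ℂ)) (η : Space n) :
    (𝓕⁻ (slice t (𝓕 Ψ)) : 𝓢(Space n, ℂ)) η = timeFourier t Ψ η := by
  rw [SchwartzMap.fourierInv_coe, ← fourier_timeFourier]
  refine (integrable_timeFourier t Ψ).fourierInv_fourier_eq ?_
    (continuous_timeFourier t Ψ).continuousAt
  rw [fourier_timeFourier]
  exact (slice t (𝓕 Ψ)).integrable

theorem fourierInv_slice (t : ℝ) (ψ : 𝓢(SpaceTime n, ℂ)) (η : Space n) :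
    (𝓕⁻ (slice t ψ) : 𝓢(Space n, ℂ)) η = timeFourier t (𝓕⁻ ψ : 𝓢(SpaceTime n, ℂ)) η := by
  rw [← fourierInv_slice_fourier, FourierTransform.fourier_fourierInv_eq]

theorem slice_smulLeft {m : Space n → ℂ} (hm : m.HasTemperateGrowth) (t : ℝ)
    (ψ : 𝓢(SpaceTime n, ℂ)) :
    slice t (SchwartzMap.smulLeftCLM ℂ (fun p : SpaceTime n => m p.snd) ψ) =
      SchwartzMap.smulLeftCLM ℂ m (slice t ψ) := by
  ext x
  simp [slice_apply, SchwartzMap.smulLeftCLM_apply_apply (hasTemperateGrowth_comp_snd hm),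
    SchwartzMap.smulLeftCLM_apply_apply hm]

/-- A symbol that does not involve the time frequency comes out of the Fourier integral in time. -/
theorem slice_multT {m : Space n → ℂ} (hm : m.HasTemperateGrowth) (t : ℝ)
    (ψ : 𝓢(SpaceTime n, ℂ)) :
    slice t (multT (fun p : SpaceTime n => m p.snd) ψ) = multT m (slice t ψ) := by
  have h : 𝓕⁻ (slice t (multT (fun p : SpaceTime n => m p.snd) ψ)) =
      SchwartzMap.smulLeftCLM ℂ m (𝓕⁻ (slice t ψ)) := by
    ext η
    rw [SchwartzMap.smulLeftCLM_apply_apply hm, fourierInv_slice, fourierInv_slice, multT_apply,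
      FourierTransform.fourierInv_fourier_eq, timeFourier, timeFourier, smul_eq_mul,
      ← integral_const_mul]
    congr 1
    funext τ
    rw [SchwartzMap.smulLeftCLM_apply_apply (hasTemperateGrowth_comp_snd hm)]
    change _ * (m η * _) = _
    ring
  rw [multT_apply m, ← h, FourierTransform.fourier_fourierInv_eq]

/-- The symbol of `e^{itΔ}`. -/
def schrodingerSymbol (t : ℝ) (η : Space n) : ℂ :=
  Complex.exp (-(Complex.I * t * ((2 * Real.pi * ‖η‖) ^ 2 : ℝ)))

theorem schrodingerSymbol_temperate (t : ℝ) :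
    (schrodingerSymbol t : Space n → ℂ).HasTemperateGrowth :=
  schrodingerSymbol_hasTemperateGrowth t

/-- The shear translates the time frequency by `2π|η|²`; in the Fourier integral in time this
translation becomes the phase `exp(-it|2πη|²)`. -/
theorem slice_schrodingerTest (t : ℝ) (ψ : 𝓢(SpaceTime n, ℂ)) :
    slice t (schrodingerTest ψ) = multT (schrodingerSymbol t) (slice t ψ) := by
  have h : 𝓕⁻ (slice t (schrodingerTest ψ)) =
      SchwartzMap.smulLeftCLM ℂ (schrodingerSymbol t) (𝓕⁻ (slice t ψ)) := by
    ext η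
    rw [SchwartzMap.smulLeftCLM_apply_apply (schrodingerSymbol_temperate t), fourierInv_slice,
      fourierInv_slice, timeFourier, timeFourier, smul_eq_mul, ← integral_const_mul,
      ← integral_sub_right_eq_self _ (-(2 * Real.pi * ‖η‖ ^ 2))]
    congr 1
    funext τ
    have h1 : (𝓕⁻ (schrodingerTest ψ) : 𝓢(SpaceTime n, ℂ))
        (WithLp.toLp 2 (τ - -(2 * Real.pi * ‖η‖ ^ 2), η)) =
          (𝓕⁻ ψ : 𝓢(SpaceTime n, ℂ)) (WithLp.toLp 2 (τ, η)) := by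
      have h2 : 𝓕 (schrodingerTest ψ) =
          SchwartzMap.compCLM ℂ shear_hasTemperateGrowth norm_le_shear (𝓕 ψ) :=
        FourierTransform.fourier_fourierInv_eq _
      rw [SchwartzMap.fourierInv_coe, SchwartzMap.fourierInv_coe, Real.fourierInv_eq_fourier_neg,
        Real.fourierInv_eq_fourier_neg, ← SchwartzMap.fourier_coe, ← SchwartzMap.fourier_coe, h2]
      change (𝓕 ψ : 𝓢(SpaceTime n, ℂ)) (shear _) = _
      congr 1
      simp [shear, ← WithLp.toLp_neg, ← WithLp.toLp_smul, ← WithLp.toLp_add]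
    rw [h1, ← mul_assoc (schrodingerSymbol t η), schrodingerSymbol, ← Complex.exp_add]
    congr 2
    push_cast
    ring
  rw [multT_apply, ← h, FourierTransform.fourier_fourierInv_eq]

/-! ### Slices in `L²` -/

/-- Decay of order `n + 1` is square integrable on `ℝⁿ`; pointwise bounds on slices thereby become
`L²` bounds. -/
theorem exists_norm_toLp_le (n : ℕ) : ∃ K : ℝ, 0 ≤ K ∧ ∀ (h : 𝓢(Space n, ℂ)) (C : ℝ), 0 ≤ C →
    (∀ x, ‖h x‖ ≤ C * ((1 + ‖x‖) ^ (n + 1))⁻¹) → ‖h.toLp 2‖ ≤ C * K := by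
  have hmem : MemLp (fun x : Space n => ((1 + ‖x‖) ^ (n + 1))⁻¹) 2 := by
    have hc : Continuous fun x : Space n => ((1 + ‖x‖) ^ (n + 1))⁻¹ :=
      Continuous.inv₀ (by fun_prop) fun x => by positivity
    rw [memLp_two_iff_integrable_sq hc.aestronglyMeasurable]
    have h := integrable_one_add_norm (E := Space n) (μ := volume) (r := ((2 * (n + 1) : ℕ) : ℝ))
      (by simp; linarith)
    refine h.congr (Filter.Eventually.of_forall fun x => ?_)
    simp only
    rw [Real.rpow_neg (by positivity), Real.rpow_natCast, inv_pow, ← pow_mul, mul_comm]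
  refine ⟨(eLpNorm (fun x : Space n => ((1 + ‖x‖) ^ (n + 1))⁻¹) 2 volume).toReal,
    ENNReal.toReal_nonneg, fun h C hC hx => ?_⟩
  rw [SchwartzMap.norm_toLp]
  have h1 : eLpNorm h 2 volume ≤ eLpNorm (C • fun x : Space n => ((1 + ‖x‖) ^ (n + 1))⁻¹) 2 volume :=
    eLpNorm_mono_real fun x => by simpa using hx x
  rw [eLpNorm_const_smul] at h1
  refine (ENNReal.toReal_mono (ENNReal.mul_lt_top enorm_lt_top hmem.2).ne h1).trans (le_of_eq ?_)
  rw [ENNReal.toReal_mul, toReal_enorm, Real.norm_of_nonneg hC]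

/-- The slice `ψ(t, ·)`, as an element of `L²`. -/
def sliceL2 (ψ : 𝓢(SpaceTime n, ℂ)) (t : ℝ) : L2 n := (slice t ψ).toLp 2

/-- The derivative in time. -/
abbrev timeDeriv (ψ : 𝓢(SpaceTime n, ℂ)) : 𝓢(SpaceTime n, ℂ) :=
  ∂_{WithLp.toLp 2 ((1 : ℝ), (0 : Space n))} ψ

theorem hasDerivAt_slice (ψ : 𝓢(SpaceTime n, ℂ)) (t : ℝ) (x : Space n) :
    HasDerivAt (fun τ => ψ (WithLp.toLp 2 (τ, x))) (timeDeriv ψ (WithLp.toLp 2 (t, x))) t := by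
  rw [timeDeriv, SchwartzMap.lineDerivOp_apply_eq_fderiv]
  have h1 : HasDerivAt (fun τ : ℝ => (WithLp.toLp 2 (τ, x) : SpaceTime n))
      (WithLp.toLp 2 ((1 : ℝ), (0 : Space n))) t := by
    have h2 : (fun τ : ℝ => (WithLp.toLp 2 (τ, x) : SpaceTime n)) = fun τ : ℝ =>
        τ • WithLp.toLp 2 ((1 : ℝ), (0 : Space n)) + WithLp.toLp 2 ((0 : ℝ), x) := by
      funext τ
      simp [← WithLp.toLp_smul, ← WithLp.toLp_add]
    rw [h2]
    simpa using ((hasDerivAt_id t).smul_const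
      (WithLp.toLp 2 ((1 : ℝ), (0 : Space n)) : SpaceTime n)).add_const
      (WithLp.toLp 2 ((0 : ℝ), x))
  exact (ψ.hasFDerivAt _).comp_hasDerivAt t h1

theorem exists_norm_sliceL2_le (ψ : 𝓢(SpaceTime n, ℂ)) :
    ∃ C : ℝ, 0 ≤ C ∧ ∀ t, ‖sliceL2 ψ t‖ ≤ C * ((1 + |t|) ^ 2)⁻¹ := by
  obtain ⟨K, hK, hL⟩ := exists_norm_toLp_le n
  obtain ⟨C, hC, h⟩ := exists_slice_decay ψ (n + 1)
  refine ⟨C * K, by positivity, fun t => ?_⟩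
  refine (hL _ (C * ((1 + |t|) ^ 2)⁻¹) (by positivity) fun x => h t x).trans (le_of_eq (by ring))

theorem sliceL2_sub (ψ : 𝓢(SpaceTime n, ℂ)) (s t : ℝ) :
    sliceL2 ψ s - sliceL2 ψ t = (slice s ψ - slice t ψ).toLp 2 :=
  ((SchwartzMap.toLpCLM ℂ ℂ 2 volume).map_sub (slice s ψ) (slice t ψ)).symm

theorem exists_slice_lipschitz (ψ : 𝓢(SpaceTime n, ℂ)) (N : ℕ) : ∃ C : ℝ, 0 ≤ C ∧ ∀ s t x,
    ‖ψ (WithLp.toLp 2 (s, x)) - ψ (WithLp.toLp 2 (t, x))‖ ≤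
      C * |s - t| * ((1 + ‖x‖) ^ N)⁻¹ := by
  obtain ⟨C, hC, h⟩ := exists_slice_decay (timeDeriv ψ) N
  refine ⟨C, hC, fun s t x => ?_⟩
  have h1 := convex_univ.norm_image_sub_le_of_norm_hasDerivWithin_le (C := C * ((1 + ‖x‖) ^ N)⁻¹)
    (fun τ _ => (hasDerivAt_slice ψ τ x).hasDerivWithinAt) (fun τ _ => ?_) (mem_univ t) (mem_univ s)
  · refine h1.trans (le_of_eq ?_)
    rw [Real.norm_eq_abs]
    ring
  · refine (h τ x).trans ?_
    gcongr
    refine mul_le_of_le_one_right hC (inv_le_one_of_one_le₀ ?_)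
    exact one_le_pow₀ (le_add_of_nonneg_right (abs_nonneg τ))

theorem exists_sliceL2_lipschitz (ψ : 𝓢(SpaceTime n, ℂ)) :
    ∃ C : ℝ, 0 ≤ C ∧ ∀ s t, ‖sliceL2 ψ s - sliceL2 ψ t‖ ≤ C * |s - t| := by
  obtain ⟨K, hK, hL⟩ := exists_norm_toLp_le n
  obtain ⟨C, hC, h⟩ := exists_slice_lipschitz ψ (n + 1)
  refine ⟨C * K, by positivity, fun s t => ?_⟩
  rw [sliceL2_sub]
  refine (hL _ (C * |s - t|) (by positivity) fun x => ?_).trans (le_of_eq (by ring))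
  simpa only [sub_apply, slice_apply] using h s t x

/-- The time derivative is Lipschitz in time with a constant decaying in space. The Taylor remainder
is then quadratic in `s - t` pointwise with decay, hence also in `L²`. -/
theorem hasDerivAt_sliceL2 (ψ : 𝓢(SpaceTime n, ℂ)) (t : ℝ) :
    HasDerivAt (sliceL2 ψ) (sliceL2 (timeDeriv ψ) t) t := by
  obtain ⟨K, hK, hL⟩ := exists_norm_toLp_le n
  obtain ⟨C, hC, h⟩ := exists_slice_lipschitz (timeDeriv ψ) (n + 1)
  have hbound : ∀ s, ‖sliceL2 ψ s - sliceL2 ψ t - (s - t) • sliceL2 (timeDeriv ψ) t‖ ≤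
      C * K * ‖s - t‖ ^ 2 := by
    intro s
    have h1 : sliceL2 ψ s - sliceL2 ψ t - (s - t) • sliceL2 (timeDeriv ψ) t =
        (slice s ψ - slice t ψ - (s - t) • slice t (timeDeriv ψ)).toLp 2 := by
      have h2 : SchwartzMap.toLpCLM ℝ ℂ 2 (volume : Measure (Space n))
          (slice s ψ - slice t ψ - (s - t) • slice t (timeDeriv ψ)) = _ :=
        (map_sub _ _ _).trans (congrArg₂ (· - ·) (map_sub _ _ _) (map_smul _ _ _))
      exact h2.symm
    rw [h1]
    refine (hL _ (C * ‖s - t‖ ^ 2) (by positivity) fun x => ?_).trans (le_of_eq (by ring))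
    have h3 : ∀ τ, HasDerivAt (fun τ => ψ (WithLp.toLp 2 (τ, x)) -
        (τ - t) • timeDeriv ψ (WithLp.toLp 2 (t, x)))
        (timeDeriv ψ (WithLp.toLp 2 (τ, x)) - timeDeriv ψ (WithLp.toLp 2 (t, x))) τ := fun τ => by
      have := (hasDerivAt_slice ψ τ x).sub (((hasDerivAt_id τ).sub_const t).smul_const
        (timeDeriv ψ (WithLp.toLp 2 (t, x))))
      rw [one_smul] at this
      exact this
    have h4 := (convex_uIcc t s).norm_image_sub_le_of_norm_hasDerivWithin_le
      (C := C * |s - t| * ((1 + ‖x‖) ^ (n + 1))⁻¹)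
      (fun τ _ => (h3 τ).hasDerivWithinAt) (fun τ hτ => ?_) left_mem_uIcc right_mem_uIcc
    · rw [sub_self, zero_smul, sub_zero, sub_right_comm] at h4
      simp only [sub_apply, smul_apply, slice_apply]
      refine h4.trans (le_of_eq ?_)
      rw [Real.norm_eq_abs]
      ring
    · refine (h τ t x).trans ?_
      have := abs_sub_left_of_mem_uIcc hτ
      gcongr
  rw [hasDerivAt_iff_isLittleO]
  refine Asymptotics.IsBigO.trans_isLittleO (g := fun s => ‖s - t‖ ^ 2) ?_
    (Asymptotics.isLittleO_pow_sub_sub t one_lt_two)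
  exact Asymptotics.IsBigO.of_bound (C * K) (Filter.Eventually.of_forall fun s => by
    simpa using hbound s)

end Slices

end

section

theorem hasSum_of_tsum_u2Norm_lt_top {H κ : Type*} [NormedAddCommGroup H] [NormedSpace ℂ H]
    [CompleteSpace H] {F : κ → ℝ → H} (h : ∑' m, u2Norm (F m) < ⊤) (τ : ℝ) :
    HasSum (fun m => F m τ) (∑' m, F m τ) := by
  have h1 : ∑' m, ‖F m τ‖ₑ < ⊤ := by
    refine lt_of_le_of_lt ?_ h
    exact ENNReal.tsum_le_tsum fun m => enorm_le_u2Norm (F m) τ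
  have h2 := summable_of_tsum_enorm_lt_top (c := fun m => F m τ) h1
  exact (Summable.of_norm h2).hasSum

/-! ### The bilinear pairing of `L²` -/

variable {n : ℕ}

/-- The complex conjugate of an `L²` function. -/
def conjL2 (f : L2 n) : L2 n := (Complex.conjCLE : ℂ →L[ℝ] ℂ).compLp f

theorem coeFn_conjL2 (f : L2 n) : ∀ᵐ x, conjL2 f x = conj (f x) :=
  (Complex.conjCLE : ℂ →L[ℝ] ℂ).coeFn_compLp f

theorem norm_conjL2 (f : L2 n) : ‖conjL2 f‖ = ‖f‖ := by
  refine le_antisymm (Lp.norm_le_norm_of_ae_le ?_) (Lp.norm_le_norm_of_ae_le ?_) <;>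
  · filter_upwards [coeFn_conjL2 f] with x hx
    rw [hx, RCLike.norm_conj]

theorem conjL2_conjL2 (f : L2 n) : conjL2 (conjL2 f) = f := by
  refine Lp.ext ?_
  filter_upwards [coeFn_conjL2 f, coeFn_conjL2 (conjL2 f)] with x h1 h2
  rw [h2, h1, Complex.conj_conj]

theorem conjL2_add (f g : L2 n) : conjL2 (f + g) = conjL2 f + conjL2 g :=
  ((Complex.conjCLE : ℂ →L[ℝ] ℂ).compLpL 2 volume).map_add f g

theorem conjL2_smul (c : ℂ) (f : L2 n) : conjL2 (c • f) = conj c • conjL2 f := by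
  refine Lp.ext ?_
  filter_upwards [coeFn_conjL2 f, coeFn_conjL2 (c • f), Lp.coeFn_smul c f,
    Lp.coeFn_smul (conj c) (conjL2 f)] with x h1 h2 h3 h4
  simp [h2, h3, h4, h1]

/-- The pairing `∫ f g` of `L²` functions. -/
def l2Pairing : L2 n →L[ℂ] L2 n →L[ℂ] ℂ :=
  (ContinuousLinearMap.lsmul ℂ ℂ).flip.lpPairing volume 2 2

theorem l2Pairing_eq_inner (f g : L2 n) : l2Pairing f g = inner ℂ (conjL2 f) g := by
  rw [l2Pairing, ContinuousLinearMap.lpPairing_eq_integral, L2.inner_def]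
  refine integral_congr_ae ?_
  filter_upwards [coeFn_conjL2 f] with x hx
  simp [hx]

theorem l2Pairing_comm (f g : L2 n) : l2Pairing f g = l2Pairing g f := by
  rw [l2Pairing, ContinuousLinearMap.lpPairing_eq_integral,
    ContinuousLinearMap.lpPairing_eq_integral]
  simp [mul_comm]

theorem inner_eq_l2Pairing (f g : L2 n) : inner ℂ f g = l2Pairing (conjL2 f) g := by
  rw [l2Pairing_eq_inner, conjL2_conjL2]

theorem norm_l2Pairing_le (f g : L2 n) : ‖l2Pairing f g‖ ≤ ‖f‖ * ‖g‖ := by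
  rw [l2Pairing_eq_inner, ← norm_conjL2 f]
  exact norm_inner_le_norm _ _

theorem coe_apply_eq_l2Pairing (f : L2 n) (ψ : 𝓢(Space n, ℂ)) :
    (f : 𝓢'(Space n, ℂ)) ψ = l2Pairing f (ψ.toLp 2) := by
  rw [Lp.toTemperedDistribution_apply, l2Pairing, ContinuousLinearMap.lpPairing_eq_integral]
  refine integral_congr_ae ?_
  filter_upwards [ψ.coeFn_toLp 2] with x hx
  simp [hx]

theorem toLp_conjSchwartz (h : 𝓢(Space n, ℂ)) : (conjSchwartz h).toLp 2 = conjL2 (h.toLp 2) := by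
  refine Lp.ext ?_
  filter_upwards [h.coeFn_toLp 2, (conjSchwartz h).coeFn_toLp 2, coeFn_conjL2 (h.toLp 2)]
    with x h1 h2 h3
  rw [h2, h3, h1]
  rfl

theorem coe_apply_conjSchwartz (g : L2 n) (h : 𝓢(Space n, ℂ)) :
    (g : 𝓢'(Space n, ℂ)) (conjSchwartz h) = inner ℂ (h.toLp 2) g := by
  rw [coe_apply_eq_l2Pairing, toLp_conjSchwartz, inner_eq_l2Pairing, l2Pairing_comm]

theorem conjSchwartz_conjSchwartz (h : 𝓢(Space n, ℂ)) : conjSchwartz (conjSchwartz h) = h := by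
  ext x
  exact Complex.conj_conj _

theorem coe_injective {f g : L2 n} (h : (f : 𝓢'(Space n, ℂ)) = g) : f = g :=
  LinearMap.ker_eq_bot.1 (Lp.ker_toTemperedDistributionCLM_eq_bot (F := ℂ)
    (μ := (volume : Measure (Space n))) (p := 2)) h

theorem coe_toLp (h : 𝓢(Space n, ℂ)) :
    ((h.toLp 2 : L2 n) : 𝓢'(Space n, ℂ)) = (h : 𝓢'(Space n, ℂ)) :=
  Lp.toTemperedDistribution_toLp_eq h

/-- The inclusion of Schwartz functions in `L²`, as a linear map. -/
def toL2 : 𝓢(Space n, ℂ) →ₗ[ℂ] L2 n := (SchwartzMap.toLpCLM ℂ ℂ 2 volume).toLinearMap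

theorem toL2_apply (h : 𝓢(Space n, ℂ)) : toL2 h = h.toLp 2 := rfl

theorem denseRange_toL2 : DenseRange (toL2 : 𝓢(Space n, ℂ) →ₗ[ℂ] L2 n) :=
  SchwartzMap.denseRange_toLpCLM (F := ℂ) (E := Space n) ENNReal.ofNat_ne_top

/-- A distribution that is bounded for the `L²` norm is an `L²` function. -/
theorem exists_l2_of_bound (u : 𝓢'(Space n, ℂ)) {C : ℝ} (hC : 0 ≤ C)
    (hu : ∀ ψ, ‖u ψ‖ ≤ C * ‖(ψ.toLp 2 : L2 n)‖) :
    ∃ f : L2 n, (f : 𝓢'(Space n, ℂ)) = u ∧ ‖f‖ ≤ C := by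
  let u' : 𝓢(Space n, ℂ) →ₗ[ℂ] ℂ :=
    { toFun := fun ψ => u ψ, map_add' := map_add u, map_smul' := map_smul u }
  have hb : ∀ ψ, ‖u' ψ‖ ≤ C * ‖toL2 ψ‖ := hu
  set ℓ : L2 n →L[ℂ] ℂ := u'.extendOfNorm toL2
  set f := (InnerProductSpace.toDual ℂ (L2 n)).symm ℓ
  refine ⟨conjL2 f, ?_, ?_⟩
  · ext ψ
    rw [coe_apply_eq_l2Pairing, ← inner_eq_l2Pairing, InnerProductSpace.toDual_symm_apply]
    exact LinearMap.extendOfNorm_eq denseRange_toL2 ⟨C, hb⟩ ψ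
  · rw [norm_conjL2, LinearIsometryEquiv.norm_map]
    exact LinearMap.opNorm_extendOfNorm_le denseRange_toL2 hC hb

/-- The transpose for the bilinear pairing is the Hilbert space adjoint, conjugated by complex
conjugation. -/
theorem exists_transpose (T : L2 n →L[ℂ] L2 n) {C : ℝ} (hC : ‖T‖ ≤ C) :
    ∃ S : L2 n →L[ℂ] L2 n, ‖S‖ ≤ C ∧ ∀ f g, l2Pairing (S f) g = l2Pairing f (T g) := by
  obtain ⟨A, hA, hAT⟩ : ∃ A : L2 n →L[ℂ] L2 n, ‖A‖ ≤ C ∧ ∀ f g, inner ℂ (A f) g = inner ℂ f (T g) :=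
    ⟨ContinuousLinearMap.adjoint T, by rwa [LinearIsometryEquiv.norm_map],
      fun f g => ContinuousLinearMap.adjoint_inner_left T g f⟩
  let S : L2 n →ₗ[ℂ] L2 n :=
    { toFun := fun f => conjL2 (A (conjL2 f))
      map_add' := fun f g => by rw [conjL2_add, map_add, conjL2_add]
      map_smul' := fun c f => by
        rw [conjL2_smul, map_smul, conjL2_smul, Complex.conj_conj, RingHom.id_apply] }
  have hS : ∀ f, ‖S f‖ ≤ C * ‖f‖ := fun f => by
    refine (norm_conjL2 _).le.trans ((A.le_opNorm _).trans ?_)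
    rw [norm_conjL2]
    gcongr
  refine ⟨S.mkContinuous C hS, LinearMap.mkContinuous_norm_le _ ((norm_nonneg T).trans hC) _,
    fun f g => ?_⟩
  rw [l2Pairing_eq_inner, l2Pairing_eq_inner, ← hAT]
  congr 1
  exact conjL2_conjL2 _

/-- An operator on Schwartz functions that is bounded for the `L²` norm extends to `L²`, and so does
its transpose. -/
theorem exists_l2_operator (T : 𝓢(Space n, ℂ) →L[ℂ] 𝓢(Space n, ℂ)) {C : ℝ} (hC : 0 ≤ C)
    (hT : ∀ ψ, ‖((T ψ).toLp 2 : L2 n)‖ ≤ C * ‖(ψ.toLp 2 : L2 n)‖) :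
    ∃ T' S : L2 n →L[ℂ] L2 n, ‖S‖ ≤ C ∧ (∀ ψ, T' (ψ.toLp 2) = (T ψ).toLp 2) ∧
      ∀ f g, l2Pairing (S f) g = l2Pairing f (T' g) := by
  have hb : ∀ ψ, ‖(toL2 ∘ₗ T.toLinearMap) ψ‖ ≤ C * ‖toL2 ψ‖ := hT
  obtain ⟨S, hS, hST⟩ := exists_transpose ((toL2 ∘ₗ T.toLinearMap).extendOfNorm toL2)
    (LinearMap.opNorm_extendOfNorm_le denseRange_toL2 hC hb)
  exact ⟨_, S, hS, LinearMap.extendOfNorm_eq denseRange_toL2 ⟨C, hb⟩, hST⟩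

/-! ### Distributions that are time derivatives -/

theorem isTimeDeriv_iff {F : ℝ → L2 n} {g : 𝓢'(SpaceTime n, ℂ)} : IsTimeDeriv F g ↔
    ∀ ψ, Integrable (fun t => l2Pairing (F t) (sliceL2 (timeDeriv ψ) t)) ∧
      g ψ = -∫ t, l2Pairing (F t) (sliceL2 (timeDeriv ψ) t) := by
  simp only [IsTimeDeriv, coe_apply_eq_l2Pairing]
  rfl

theorem continuous_sliceL2 (ψ : 𝓢(SpaceTime n, ℂ)) : Continuous (sliceL2 ψ) :=
  continuous_iff_continuousAt.2 fun t => (hasDerivAt_sliceL2 ψ t).continuousAt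

/-- Functions in `U²` are bounded and slices decay quadratically in time. The bound is linear in the
`U²` norm, which allows series of primitives to be differentiated termwise. -/
theorem exists_pairing_bound (ψ : 𝓢(SpaceTime n, ℂ)) : ∃ C : ℝ, 0 ≤ C ∧
    ∀ F : ℝ → L2 n, u2Norm F < ⊤ → Integrable (fun t => l2Pairing (F t) (sliceL2 ψ t)) ∧
      ∫ t, ‖l2Pairing (F t) (sliceL2 ψ t)‖ ≤ (u2Norm F).toReal * C := by
  obtain ⟨C, hC, h⟩ := exists_norm_sliceL2_le ψ
  refine ⟨∫ t : ℝ, C * ((1 + |t|) ^ 2)⁻¹, integral_nonneg fun t => by positivity, fun F hF => ?_⟩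
  have hb : ∀ t, ‖l2Pairing (F t) (sliceL2 ψ t)‖ ≤
      (u2Norm F).toReal * (C * ((1 + |t|) ^ 2)⁻¹) := fun t => by
    refine (norm_l2Pairing_le _ _).trans ?_
    gcongr
    · have := ENNReal.toReal_mono hF.ne (enorm_le_u2Norm F t)
      simpa using this
    · exact h t
  have hm : Integrable fun t : ℝ => (u2Norm F).toReal * (C * ((1 + |t|) ^ 2)⁻¹) :=
    (integrable_one_add_abs_inv.const_mul C).const_mul _
  have hi : Integrable (fun t => l2Pairing (F t) (sliceL2 ψ t)) := by
    refine hm.mono' ?_ (Filter.Eventually.of_forall hb)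
    have h1 : StronglyMeasurable fun t => (F t, sliceL2 ψ t) :=
      (stronglyMeasurable_of_u2Norm_lt_top hF).prodMk (continuous_sliceL2 ψ).stronglyMeasurable
    exact ((l2Pairing (n := n)).continuous₂.comp_stronglyMeasurable h1).aestronglyMeasurable
  refine ⟨hi, (integral_mono hi.norm hm hb).trans_eq ?_⟩
  rw [integral_const_mul]

theorem exists_isTimeDeriv_of_du2L2Norm_lt {g : 𝓢'(SpaceTime n, ℂ)} {B : ℝ≥0∞}
    (h : du2L2Norm g < B) : ∃ F, IsTimeDeriv F g ∧ u2Norm F < B := by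
  simp only [du2L2Norm, iInf_lt_iff] at h
  obtain ⟨F, hF, h⟩ := h
  exact ⟨F, hF, h⟩

theorem IsTimeDeriv.du2L2Norm_le {F : ℝ → L2 n} {g : 𝓢'(SpaceTime n, ℂ)} (h : IsTimeDeriv F g) :
    du2L2Norm g ≤ u2Norm F := iInf₂_le F h

/-- The norm of `DU²L²` is countably subadditive. -/
theorem du2L2Norm_le_tsum {κ : Type*} [Countable κ] {g : κ → 𝓢'(SpaceTime n, ℂ)}
    {f : 𝓢'(SpaceTime n, ℂ)} (h : ∀ ψ, HasSum (fun m => g m ψ) (f ψ)) :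
    du2L2Norm f ≤ ∑' m, du2L2Norm (g m) := by
  refine ENNReal.le_of_forall_pos_le_add fun ε hε hfin => ?_
  obtain ⟨δ, hδ, hδε⟩ := ENNReal.exists_pos_sum_of_countable (ENNReal.coe_pos.2 hε).ne' κ
  have hlt : ∀ m, du2L2Norm (g m) < du2L2Norm (g m) + δ m := fun m =>
    ENNReal.lt_add_right (ne_top_of_le_ne_top hfin.ne (ENNReal.le_tsum m))
      (ENNReal.coe_pos.2 (hδ m)).ne'
  choose F hF hFn using fun m => exists_isTimeDeriv_of_du2L2Norm_lt (hlt m)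
  have hsum : ∑' m, u2Norm (F m) ≤ ∑' m, du2L2Norm (g m) + ε := by
    refine (ENNReal.tsum_le_tsum fun m => (hFn m).le).trans ?_
    rw [ENNReal.tsum_add]
    gcongr
  have hsum' : ∑' m, u2Norm (F m) < ⊤ :=
    hsum.trans_lt (ENNReal.add_lt_top.2 ⟨hfin, ENNReal.coe_lt_top⟩)
  have hFfin : ∀ m, u2Norm (F m) < ⊤ := fun m => (ENNReal.le_tsum m).trans_lt hsum'
  have hhas := hasSum_of_tsum_u2Norm_lt_top hsum'
  have hle := u2Norm_le_tsum_u2Norm hhas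
  refine (IsTimeDeriv.du2L2Norm_le ?_).trans (hle.trans hsum)
  refine isTimeDeriv_iff.2 fun ψ => ?_
  obtain ⟨C, hC, hb⟩ := exists_pairing_bound (timeDeriv ψ)
  refine ⟨(hb _ (hle.trans_lt hsum')).1, ?_⟩
  have hsm : Summable fun m => (u2Norm (F m)).toReal * C :=
    (ENNReal.summable_toReal hsum'.ne).mul_right C
  have h1 := hasSum_integral_of_summable_integral_norm (fun m => (hb (F m) (hFfin m)).1)
    (Summable.of_nonneg_of_le (fun m => integral_nonneg fun t => norm_nonneg _)
      (fun m => (hb (F m) (hFfin m)).2) hsm)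
  have h2 : ∀ t, ∑' m, l2Pairing (F m t) (sliceL2 (timeDeriv ψ) t) =
      l2Pairing (∑' m, F m t) (sliceL2 (timeDeriv ψ) t) := fun t =>
    HasSum.tsum_eq (ContinuousLinearMap.hasSum
      ((l2Pairing (n := n)).flip (sliceL2 (timeDeriv ψ) t)) (hhas t))
  have h3 : (∫ t, ∑' m, l2Pairing (F m t) (sliceL2 (timeDeriv ψ) t)) =
      ∫ t, l2Pairing (∑' m, F m t) (sliceL2 (timeDeriv ψ) t) :=
    integral_congr_ae (Filter.Eventually.of_forall h2)
  rw [h3] at h1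
  refine (h ψ).unique ?_
  have h4 : (fun m => g m ψ) = fun m => -∫ t, l2Pairing (F m t) (sliceL2 (timeDeriv ψ) t) :=
    funext fun m => (isTimeDeriv_iff.1 (hF m) ψ).2
  rw [h4]
  exact h1.neg

/-- Composition with an operator acting in the space variables. -/
theorem IsTimeDeriv.comp_operator {F : ℝ → L2 n} {g : 𝓢'(SpaceTime n, ℂ)} (h : IsTimeDeriv F g)
    {T₁ : 𝓢(SpaceTime n, ℂ) →L[ℂ] 𝓢(SpaceTime n, ℂ)} {T : 𝓢(Space n, ℂ) →L[ℂ] 𝓢(Space n, ℂ)}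
    (hT₁ : ∀ t ψ, slice t (T₁ ψ) = T (slice t ψ)) {T' S : L2 n →L[ℂ] L2 n}
    (hT' : ∀ ψ, T' (ψ.toLp 2) = (T ψ).toLp 2)
    (hS : ∀ f g, l2Pairing (S f) g = l2Pairing f (T' g)) :
    IsTimeDeriv (fun t => S (F t)) (PointwiseConvergenceCLM.precomp ℂ T₁ g) := by
  refine isTimeDeriv_iff.2 fun ψ => ?_
  have h1 : ∀ ψ, sliceL2 (T₁ ψ) = fun t => T' (sliceL2 ψ t) := fun ψ => by
    funext t
    rw [sliceL2, hT₁, ← hT']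
    rfl
  -- The operator acts in space, so it commutes with the time derivative; both sides are the
  -- derivative of the same curve in `L²`.
  have h2 : ∀ t, sliceL2 (timeDeriv (T₁ ψ)) t = T' (sliceL2 (timeDeriv ψ) t) := fun t => by
    have hd := hasDerivAt_sliceL2 (T₁ ψ) t
    rw [h1] at hd
    exact hd.unique ((T'.restrictScalars ℝ).hasFDerivAt.comp_hasDerivAt t (hasDerivAt_sliceL2 ψ t))
  have h3 := isTimeDeriv_iff.1 h (T₁ ψ)
  simp_rw [h2, ← hS] at h3
  exact h3

theorem du2L2Norm_comp_operator_le {g : 𝓢'(SpaceTime n, ℂ)}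
    {T₁ : 𝓢(SpaceTime n, ℂ) →L[ℂ] 𝓢(SpaceTime n, ℂ)} {T : 𝓢(Space n, ℂ) →L[ℂ] 𝓢(Space n, ℂ)}
    (hT₁ : ∀ t ψ, slice t (T₁ ψ) = T (slice t ψ)) {C : ℝ} (hC : 0 ≤ C)
    (hT : ∀ ψ, ‖((T ψ).toLp 2 : L2 n)‖ ≤ C * ‖(ψ.toLp 2 : L2 n)‖) (hg : du2L2Norm g < ⊤) :
    du2L2Norm (PointwiseConvergenceCLM.precomp ℂ T₁ g) ≤ ENNReal.ofReal C * du2L2Norm g := by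
  obtain ⟨T', S, hSn, hT', hS⟩ := exists_l2_operator T hC hT
  have key : ∀ F, IsTimeDeriv F g → u2Norm F < ⊤ →
      du2L2Norm (PointwiseConvergenceCLM.precomp ℂ T₁ g) ≤ ENNReal.ofReal C * u2Norm F :=
    fun F hF hFn => (hF.comp_operator hT₁ hT' hS).du2L2Norm_le.trans (u2Norm_map_le S hSn hFn)
  refine le_of_forall_gt_imp_ge_of_dense fun B hB => ?_
  by_contra! hcon
  have hC0 : ENNReal.ofReal C ≠ ⊤ := ENNReal.ofReal_ne_top
  -- The infimum over primitives is approached from above, and multiplication by the finite constant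
  -- `C` is continuous; this includes `C = 0`.
  have h1 : Filter.Tendsto (fun x => ENNReal.ofReal C * x) (nhdsWithin (du2L2Norm g)
      (Ioi (du2L2Norm g))) (nhds (ENNReal.ofReal C * du2L2Norm g)) :=
    ((ENNReal.continuous_const_mul hC0).tendsto _).mono_left nhdsWithin_le_nhds
  have : (nhdsWithin (du2L2Norm g) (Ioi (du2L2Norm g))).NeBot := nhdsGT_neBot_of_exists_gt ⟨_, hg⟩
  obtain ⟨x, hx, hxg, hxt⟩ := ((h1.eventually (gt_mem_nhds hB)).and (Filter.Eventually.and
    self_mem_nhdsWithin (nhdsWithin_le_nhds (gt_mem_nhds hg)))).exists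
  obtain ⟨F, hF, hFx⟩ := exists_isTimeDeriv_of_du2L2Norm_lt (show du2L2Norm g < x from hxg)
  refine hcon.not_ge ((key F hF (hFx.trans hxt)).trans (le_trans ?_ hx.le))
  gcongr

theorem hasDerivAt_pairing_sliceL2 (h : L2 n) (ψ : 𝓢(SpaceTime n, ℂ)) (t : ℝ) :
    HasDerivAt (fun t => l2Pairing h (sliceL2 ψ t)) (l2Pairing h (sliceL2 (timeDeriv ψ) t)) t :=
  ((l2Pairing h).restrictScalars ℝ).hasFDerivAt.comp_hasDerivAt t (hasDerivAt_sliceL2 ψ t)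

theorem tendsto_sliceL2_atTop (ψ : 𝓢(SpaceTime n, ℂ)) :
    Filter.Tendsto (sliceL2 ψ) Filter.atTop (nhds 0) := by
  obtain ⟨C, hC, h⟩ := exists_norm_sliceL2_le ψ
  refine squeeze_zero_norm h ?_
  rw [show (0 : ℝ) = C * 0 by simp]
  refine Filter.Tendsto.const_mul C (Filter.Tendsto.inv_tendsto_atTop ?_)
  refine Filter.Tendsto.comp (Filter.tendsto_pow_atTop two_ne_zero) ?_
  exact Filter.tendsto_atTop_add_const_left _ _ Filter.tendsto_abs_atTop_atTop

/-- On `[t, ∞)` the integrand is a total derivative and the slices tend to zero, so only the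
boundary term at `t` remains. -/
theorem isTimeDeriv_jump (t : ℝ) (h : 𝓢(Space n, ℂ)) :
    IsTimeDeriv (jump t (h.toLp 2)) (instant t h) := by
  refine isTimeDeriv_iff.2 fun ψ => ?_
  obtain ⟨C, hC, hb⟩ := exists_pairing_bound (timeDeriv ψ)
  have hfin : u2Norm (jump t (h.toLp 2 : L2 n)) < ⊤ :=
    (u2Norm_jump_le _ _).trans_lt enorm_lt_top
  refine ⟨(hb _ hfin).1, ?_⟩
  have h1 : (fun τ => l2Pairing (jump t (h.toLp 2 : L2 n) τ) (sliceL2 (timeDeriv ψ) τ)) =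
      (Ici t).indicator fun τ => l2Pairing (h.toLp 2 : L2 n) (sliceL2 (timeDeriv ψ) τ) := by
    funext τ
    by_cases hτ : τ < t
    · simp [jump, hτ]
    · simp [jump, hτ, not_lt.1 hτ]
  have h0 := (hb _ hfin).1
  rw [h1, integrable_indicator_iff measurableSet_Ici] at h0
  rw [h1, integral_indicator measurableSet_Ici, integral_Ici_eq_integral_Ioi,
    integral_Ioi_of_hasDerivAt_of_tendsto' (m := 0)
      (fun x _ => hasDerivAt_pairing_sliceL2 (h.toLp 2) ψ x) (h0.mono_set Ioi_subset_Ici_self) ?_]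
  · rw [zero_sub, neg_neg, sliceL2, ← coe_apply_eq_l2Pairing, coe_toLp]
    rfl
  · have := ((l2Pairing (h.toLp 2 : L2 n)).continuous.tendsto 0).comp (tendsto_sliceL2_atTop ψ)
    rwa [map_zero] at this

end

section

/-! ### Uniqueness of primitives -/

variable {n : ℕ}

/-- The test function `η(t) h(x)`. -/
def tensorTest (η : ℝ → ℝ) (hη : ContDiff ℝ (⊤ : ℕ∞) η) {a b : ℝ} (hab : ∀ τ, τ ∉ Icc a b → η τ = 0)
    (h : Space n → ℝ) (hh : ContDiff ℝ (⊤ : ℕ∞) h) (hc : HasCompactSupport h) :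
    𝓢(SpaceTime n, ℂ) :=
  HasCompactSupport.toSchwartzMap (f := fun p : SpaceTime n => ((η p.fst * h p.snd : ℝ) : ℂ))
    (HasCompactSupport.of_support_subset_isCompact (K := WithLp.toLp 2 '' (Icc a b ×ˢ tsupport h))
      ((isCompact_Icc.prod hc).image (WithLp.prod_continuous_toLp 2 ℝ (Space n))) (by
        intro p hp
        refine ⟨(p.fst, p.snd), ⟨?_, subset_tsupport _ ?_⟩, rfl⟩
        · by_contra hcon
          exact hp (by simp [hab _ hcon])
        · intro h0
          exact hp (by simp [h0])))
    (by
      have h1 : ContDiff ℝ (⊤ : ℕ∞) fun p : SpaceTime n => p.fst :=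
        ((ContinuousLinearMap.fst ℝ ℝ (Space n)) ∘L (WithLp.prodContinuousLinearEquiv 2 ℝ ℝ
          (Space n)).toContinuousLinearMap).contDiff
      have h2 : ContDiff ℝ (⊤ : ℕ∞) fun p : SpaceTime n => p.snd :=
        ((ContinuousLinearMap.snd ℝ ℝ (Space n)) ∘L (WithLp.prodContinuousLinearEquiv 2 ℝ ℝ
          (Space n)).toContinuousLinearMap).contDiff
      exact Complex.ofRealCLM.contDiff.comp ((hη.comp h1).mul (hh.comp h2)))

/-- A compactly supported smooth function on `ℝⁿ`, as a Schwartz function. -/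
def bumpTest (h : Space n → ℝ) (hh : ContDiff ℝ (⊤ : ℕ∞) h) (hc : HasCompactSupport h) :
    𝓢(Space n, ℂ) :=
  HasCompactSupport.toSchwartzMap (f := fun x => (h x : ℂ))
    (hc.comp_left (g := fun x : ℝ => (x : ℂ)) Complex.ofReal_zero)
    (Complex.ofRealCLM.contDiff.comp hh)

section Tensor

variable (η : ℝ → ℝ) (hη : ContDiff ℝ (⊤ : ℕ∞) η) {a b : ℝ} (hab : ∀ τ, τ ∉ Icc a b → η τ = 0)
    (h : Space n → ℝ) (hh : ContDiff ℝ (⊤ : ℕ∞) h) (hc : HasCompactSupport h)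

theorem tensorTest_apply (τ : ℝ) (x : Space n) :
    tensorTest η hη hab h hh hc (WithLp.toLp 2 (τ, x)) = η τ * h x := by
  simp [tensorTest]

theorem slice_timeDeriv_tensorTest (τ : ℝ) :
    slice τ (timeDeriv (tensorTest η hη hab h hh hc)) = ((deriv η τ : ℝ) : ℂ) • bumpTest h hh hc := by
  ext x
  rw [slice_apply]
  refine (hasDerivAt_slice (tensorTest η hη hab h hh hc) τ x).unique ?_
  simp_rw [tensorTest_apply]
  exact ((hη.differentiable (by simp)).differentiableAt.hasDerivAt.ofReal_comp).mul_const _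

theorem sliceL2_timeDeriv_tensorTest (τ : ℝ) :
    sliceL2 (timeDeriv (tensorTest η hη hab h hh hc)) τ =
      ((deriv η τ : ℝ) : ℂ) • ((bumpTest h hh hc).toLp 2 : L2 n) := by
  rw [sliceL2, slice_timeDeriv_tensorTest]
  exact toL2.map_smul _ _

theorem slice_tensorTest_eq_zero {τ : ℝ} (hτ : τ ∉ Icc a b) :
    slice τ (tensorTest η hη hab h hh hc) = 0 := by
  ext x
  rw [slice_apply, tensorTest_apply, hab _ hτ, Complex.ofReal_zero, zero_mul]
  rfl

end Tensor

/-- A smooth function increasing from `0` at `t` to `1` at `t + ε`. -/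
def smoothStep (t ε τ : ℝ) : ℝ := Real.smoothTransition ((τ - t) / ε)

theorem contDiff_smoothStep (t ε : ℝ) : ContDiff ℝ (⊤ : ℕ∞) (smoothStep t ε) := by
  unfold smoothStep
  exact Real.smoothTransition.contDiff.comp (by fun_prop)

/-- The transition attains its minimum at such points. -/
theorem deriv_smoothTransition_of_nonpos {x : ℝ} (hx : x ≤ 0) : deriv Real.smoothTransition x = 0 := by
  have h : IsLocalMin Real.smoothTransition x := Filter.Eventually.of_forall fun y => by
    rw [Real.smoothTransition.zero_of_nonpos hx]
    exact Real.smoothTransition.nonneg y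
  exact h.deriv_eq_zero

theorem deriv_smoothTransition_of_one_le {x : ℝ} (hx : 1 ≤ x) :
    deriv Real.smoothTransition x = 0 := by
  have h : IsLocalMax Real.smoothTransition x := Filter.Eventually.of_forall fun y => by
    rw [Real.smoothTransition.one_of_one_le hx]
    exact Real.smoothTransition.le_one y
  exact h.deriv_eq_zero

theorem continuous_deriv_smoothTransition : Continuous (deriv Real.smoothTransition) :=
  (Real.smoothTransition.contDiff (n := (⊤ : ℕ∞))).continuous_deriv (by simp)

theorem deriv_smoothStep (t ε τ : ℝ) :
    deriv (smoothStep t ε) τ = deriv Real.smoothTransition ((τ - t) / ε) / ε := by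
  have h1 : HasDerivAt (fun τ : ℝ => (τ - t) / ε) (1 / ε) τ :=
    ((hasDerivAt_id τ).sub_const t).div_const ε
  have h2 := ((Real.smoothTransition.contDiff (n := (⊤ : ℕ∞))).differentiable (by simp)
    |>.differentiableAt (x := (τ - t) / ε)).hasDerivAt.comp τ h1
  have h3 : smoothStep t ε = Real.smoothTransition ∘ fun τ => (τ - t) / ε := rfl
  rw [h3, h2.deriv]
  ring

theorem hasCompactSupport_deriv_smoothTransition :
    HasCompactSupport (deriv Real.smoothTransition) := by
  refine HasCompactSupport.intro (isCompact_Icc (a := (0 : ℝ)) (b := 1)) fun x hx => ?_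
  rw [mem_Icc, not_and_or, not_le, not_le] at hx
  rcases hx with hx | hx
  · exact deriv_smoothTransition_of_nonpos hx.le
  · exact deriv_smoothTransition_of_one_le hx.le

theorem integral_deriv_smoothTransition : ∫ σ, deriv Real.smoothTransition σ = 1 := by
  have hd : ∀ x, HasDerivAt Real.smoothTransition (deriv Real.smoothTransition x) x := fun x =>
    ((Real.smoothTransition.contDiff (n := (⊤ : ℕ∞))).differentiable (by simp) x).hasDerivAt
  have h := integral_of_hasDerivAt_of_tendsto hd
    (continuous_deriv_smoothTransition.integrable_of_hasCompactSupport
      hasCompactSupport_deriv_smoothTransition) (m := 0) (n := 1) ?_ ?_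
  · simpa using h
  · refine tendsto_const_nhds.congr' ?_
    filter_upwards [Filter.eventually_le_atBot 0] with x hx
    rw [Real.smoothTransition.zero_of_nonpos hx]
  · refine tendsto_const_nhds.congr' ?_
    filter_upwards [Filter.eventually_ge_atTop 1] with x hx
    rw [Real.smoothTransition.one_of_one_le hx]

/-- After the substitution `τ = t + εσ` the weight is a fixed density of mass one, living on `σ ≥
0`. Only values of `α` to the right of `t` enter, so the right limit suffices. -/
theorem tendsto_integral_smoothStep {α : ℝ → ℂ} (hm : StronglyMeasurable α) {C : ℝ}
    (hb : ∀ τ, ‖α τ‖ ≤ C) {t : ℝ} (ht : Filter.Tendsto α (nhdsWithin t (Ioi t)) (nhds (α t))) :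
    Filter.Tendsto (fun ε => ∫ τ, ((deriv (smoothStep t ε) τ : ℝ) : ℂ) * α τ)
      (nhdsWithin 0 (Ioi 0)) (nhds (α t)) := by
  have h1 : ∀ ε ∈ Ioi (0 : ℝ), ∫ σ, ((deriv Real.smoothTransition σ : ℝ) : ℂ) * α (t + ε * σ) =
      ∫ τ, ((deriv (smoothStep t ε) τ : ℝ) : ℂ) * α τ := fun ε hε => by
    have hε' : (0 : ℝ) < ε := hε
    have h2 := Measure.integral_comp_mul_left
      (fun σ => ((deriv Real.smoothTransition (σ / ε) : ℝ) : ℂ) * α (t + σ)) ε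
    have h3 := integral_add_left_eq_self (μ := (volume : Measure ℝ))
      (fun τ => ((deriv Real.smoothTransition ((τ - t) / ε) : ℝ) : ℂ) * α τ) t
    simp only [add_sub_cancel_left] at h3
    rw [h3, abs_of_pos (inv_pos.2 hε')] at h2
    simp_rw [mul_div_cancel_left₀ _ hε'.ne'] at h2
    rw [h2, ← integral_smul]
    refine integral_congr_ae (Filter.Eventually.of_forall fun τ => ?_)
    simp only [deriv_smoothStep, Complex.real_smul]
    push_cast
    ring
  refine Filter.Tendsto.congr' (eventually_nhdsWithin_of_forall h1) ?_
  have h4 : α t = ∫ σ, ((deriv Real.smoothTransition σ : ℝ) : ℂ) * α t := by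
    rw [integral_mul_const, integral_complex_ofReal, integral_deriv_smoothTransition]
    simp
  rw [h4]
  refine tendsto_integral_filter_of_dominated_convergence
    (fun σ => ‖deriv Real.smoothTransition σ‖ * C) (Filter.Eventually.of_forall fun ε => ?_)
    (Filter.Eventually.of_forall fun ε => Filter.Eventually.of_forall fun σ => ?_)
    ((continuous_deriv_smoothTransition.integrable_of_hasCompactSupport
      hasCompactSupport_deriv_smoothTransition).norm.mul_const C)
    (Filter.Eventually.of_forall fun σ => ?_)
  · refine AEStronglyMeasurable.mul ?_ ?_
    · exact (Complex.continuous_ofReal.comp continuous_deriv_smoothTransition).aestronglyMeasurable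
    · exact (hm.comp_measurable (by fun_prop)).aestronglyMeasurable
  · rw [norm_mul, Complex.norm_real]
    gcongr
    exact hb _
  · rcases le_or_gt σ 0 with hσ | hσ
    · simp [deriv_smoothTransition_of_nonpos hσ]
    · refine Filter.Tendsto.const_mul _ (ht.comp ?_)
      refine tendsto_nhdsWithin_iff.2 ⟨?_, eventually_nhdsWithin_of_forall fun ε hε => ?_⟩
      · have : Filter.Tendsto (fun ε : ℝ => t + ε * σ) (nhds 0) (nhds (t + 0 * σ)) :=
          Continuous.tendsto (by fun_prop) 0
        rw [zero_mul, add_zero] at this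
        exact this.mono_left nhdsWithin_le_nhds
      · have : 0 < ε * σ := mul_pos hε hσ
        simp only [mem_Ioi]
        linarith

theorem l2_eq_zero_of_pairing {f : L2 n} (hf : ∀ (h : Space n → ℝ) (hh : ContDiff ℝ (⊤ : ℕ∞) h)
    (hc : HasCompactSupport h), l2Pairing f ((bumpTest h hh hc).toLp 2) = 0) : f = 0 := by
  rw [Lp.eq_zero_iff_ae_eq_zero]
  refine ae_eq_zero_of_integral_contDiff_smul_eq_zero
    ((Lp.memLp f).locallyIntegrable (by norm_num)) fun g hg hc => ?_
  have := hf g hg hc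
  rw [← coe_apply_eq_l2Pairing, Lp.toTemperedDistribution_apply] at this
  exact this

/-- A function in `U²` whose time derivative vanishes on an interval is constant there. -/
theorem IsTimeDeriv.eq_of_vanishing {F : ℝ → L2 n} {g : 𝓢'(SpaceTime n, ℂ)} (hF : IsTimeDeriv F g)
    (hfin : u2Norm F < ⊤) {S : Set ℝ} (hS : IsOpen S) (hSc : S.OrdConnected)
    (hg : ∀ a b, Icc a b ⊆ S → ∀ ψ, (∀ τ ∉ Icc a b, slice τ ψ = 0) → g ψ = 0) {t t' : ℝ} (ht : t ∈ S) (ht' : t' ∈ S) :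
    F t = F t' := by
  wlog htt : t ≤ t' generalizing t t'
  · exact (this ht' ht (le_of_not_ge htt)).symm
  rw [← sub_eq_zero]
  refine l2_eq_zero_of_pairing fun h hh hc => ?_
  rw [map_sub, sub_apply, sub_eq_zero]
  set w : L2 n := (bumpTest h hh hc).toLp 2
  set α : ℝ → ℂ := fun τ => l2Pairing (F τ) w
  have hcont : Continuous fun f : L2 n => l2Pairing f w := ((l2Pairing (n := n)).flip w).continuous
  have hm : StronglyMeasurable α :=
    hcont.comp_stronglyMeasurable (stronglyMeasurable_of_u2Norm_lt_top hfin)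
  have hb : ∀ τ, ‖α τ‖ ≤ (u2Norm F).toReal * ‖w‖ := fun τ => by
    refine (norm_l2Pairing_le _ _).trans ?_
    gcongr
    have := ENNReal.toReal_mono hfin.ne (enorm_le_u2Norm F τ)
    simpa using this
  have hr : ∀ t, Filter.Tendsto α (nhdsWithin t (Ioi t)) (nhds (α t)) := fun t =>
    (hcont.tendsto _).comp (tendsto_right_of_u2Norm_lt_top hfin t)
  refine tendsto_nhds_unique (tendsto_integral_smoothStep hm hb (hr t)) ?_
  refine (tendsto_integral_smoothStep hm hb (hr t')).congr' ?_
  obtain ⟨δ, hδ, hδS⟩ := Metric.isOpen_iff.1 hS t' ht'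
  filter_upwards [Ioo_mem_nhdsGT hδ] with ε hε
  have hsub : Icc t (t' + ε) ⊆ S := by
    refine hSc.out ht (hδS ?_)
    rw [Metric.mem_ball, Real.dist_eq, add_sub_cancel_left, abs_of_pos hε.1]
    exact hε.2
  -- The difference of the two steps is supported in `[t, t' + ε]`, where `g` vanishes. Tested
  -- against it, `F` has equal averages just after `t` and just after `t'`.
  have hη : ContDiff ℝ (⊤ : ℕ∞) (fun τ => smoothStep t ε τ - smoothStep t' ε τ) :=
    (contDiff_smoothStep t ε).sub (contDiff_smoothStep t' ε)
  have hab : ∀ τ, τ ∉ Icc t (t' + ε) → smoothStep t ε τ - smoothStep t' ε τ = 0 := by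
    intro τ hτ
    rw [mem_Icc, not_and_or, not_le, not_le] at hτ
    rcases hτ with hτ | hτ
    · rw [smoothStep, smoothStep, Real.smoothTransition.zero_of_nonpos,
        Real.smoothTransition.zero_of_nonpos, sub_zero]
      · exact div_nonpos_of_nonpos_of_nonneg (by linarith) hε.1.le
      · exact div_nonpos_of_nonpos_of_nonneg (by linarith) hε.1.le
    · rw [smoothStep, smoothStep, Real.smoothTransition.one_of_one_le,
        Real.smoothTransition.one_of_one_le, sub_self]
      · rw [one_le_div hε.1]
        linarith
      · rw [one_le_div hε.1]
        linarith
  obtain ⟨-, h2⟩ := isTimeDeriv_iff.1 hF (tensorTest _ hη hab h hh hc)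
  rw [hg _ _ hsub _ fun τ hτ => slice_tensorTest_eq_zero _ hη hab h hh hc hτ, eq_comm, neg_eq_zero] at h2
  have hint : ∀ t, Integrable fun τ => ((deriv (smoothStep t ε) τ : ℝ) : ℂ) * α τ := fun t => by
    have hc1 : Continuous (deriv (smoothStep t ε)) :=
      (contDiff_smoothStep t ε).continuous_deriv (by simp)
    have hc2 : HasCompactSupport (deriv (smoothStep t ε)) := by
      refine HasCompactSupport.intro (isCompact_Icc (a := t) (b := t + ε)) fun x hx => ?_
      rw [deriv_smoothStep]
      rw [mem_Icc, not_and_or, not_le, not_le] at hx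
      rcases hx with hx | hx
      · rw [deriv_smoothTransition_of_nonpos, zero_div]
        exact div_nonpos_of_nonpos_of_nonneg (by linarith) hε.1.le
      · rw [deriv_smoothTransition_of_one_le, zero_div]
        rw [one_le_div hε.1]
        linarith
    exact ((hc1.integrable_of_hasCompactSupport hc2).ofReal (𝕜 := ℂ)).mul_bdd
      hm.aestronglyMeasurable (Filter.Eventually.of_forall hb)
  rw [← sub_eq_zero, ← integral_sub (hint t') (hint t), ← neg_eq_zero, ← integral_neg, ← h2]
  refine integral_congr_ae (Filter.Eventually.of_forall fun τ => ?_)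
  have hd : deriv (fun τ => smoothStep t ε τ - smoothStep t' ε τ) τ =
      deriv (smoothStep t ε) τ - deriv (smoothStep t' ε) τ :=
    deriv_fun_sub ((contDiff_smoothStep t ε).differentiable (by simp) τ)
      ((contDiff_smoothStep t' ε).differentiable (by simp) τ)
  simp only [sliceL2_timeDeriv_tensorTest, hd, map_smul, smul_eq_mul]
  push_cast
  ring

/-! ### Primitives of distributions supported in the unit time interval -/

/-- The distribution vanishes at the test functions that live outside the times `[0,1]`. -/
def VanishesOffUnit (g : 𝓢'(SpaceTime n, ℂ)) : Prop :=
  ∀ a b, b < 0 ∨ 1 < a → ∀ ψ, (∀ τ ∉ Icc a b, slice τ ψ = 0) → g ψ = 0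

theorem vanishesOffUnit_of_mem {g : 𝓢'(SpaceTime n, ℂ)} (hg : g ∈ unitTimeDistributions n) :
    VanishesOffUnit g := by
  intro a b hab ψ hψ
  refine hg ψ ((closure_minimal (t := {p : SpaceTime n | p.fst ∈ Icc a b}) (fun p hp => ?_)
    ?_).trans fun p hp hp' => ?_)
  · by_contra hcon
    exact hp (DFunLike.congr_fun (hψ _ hcon) p.snd)
  · exact isClosed_Icc.preimage (WithLp.prod_continuous_ofLp 2 ℝ (Space n)).fst
  · rcases hab with h | h
    · exact absurd (hp'.1.trans hp.2) (not_le.2 h)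
    · exact absurd (hp.1.trans hp'.2) (not_le.2 h)

/-- Because the condition is stated through slices, it is inherited by operators that act on each
slice separately, however nonlocal they are in space. -/
theorem VanishesOffUnit.pull {g : 𝓢'(SpaceTime n, ℂ)} (hg : VanishesOffUnit g)
    {T₁ : 𝓢(SpaceTime n, ℂ) →L[ℂ] 𝓢(SpaceTime n, ℂ)}
    {T : ℝ → 𝓢(Space n, ℂ) →L[ℂ] 𝓢(Space n, ℂ)} (hT : ∀ t ψ, slice t (T₁ ψ) = T t (slice t ψ)) :
    VanishesOffUnit (PointwiseConvergenceCLM.precomp ℂ T₁ g) := by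
  intro a b hab ψ hψ
  refine hg a b hab (T₁ ψ) fun τ hτ => ?_
  rw [hT, hψ τ hτ, map_zero]

theorem IsTimeDeriv.eq_zero_of_neg {F : ℝ → L2 n} {g : 𝓢'(SpaceTime n, ℂ)} (hF : IsTimeDeriv F g)
    (hfin : u2Norm F < ⊤) (hg : VanishesOffUnit g) {τ : ℝ} (hτ : τ < 0) : F τ = 0 := by
  have h : ∀ᶠ τ' in Filter.atBot, F τ' = F τ := by
    filter_upwards [Filter.Iio_mem_atBot 0] with τ' hτ'
    refine hF.eq_of_vanishing hfin isOpen_Iio ordConnected_Iio (fun a b hab ψ hψ => ?_) hτ' hτ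
    rcases le_or_gt a b with h | h
    · exact hg a b (Or.inl (hab (right_mem_Icc.2 h))) ψ hψ
    -- Here `[a, b]` is empty and all slices of `ψ` vanish; the empty interval `[2, 1]` is an
    -- admissible substitute.
    · exact hg 2 1 (Or.inr one_lt_two) ψ fun τ _ => hψ τ fun h' => h.not_ge (h'.1.trans h'.2)
  exact tendsto_nhds_unique (tendsto_const_nhds.congr' (h.mono fun _ h => h.symm))
    (tendsto_atBot_of_u2Norm_lt_top hfin)

/-- `F` is constant on `(1, ∞)`, and right continuity attaches the time `1`. Together with vanishing
at negative times this makes `F` a fixed point of the clamp. -/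
theorem IsTimeDeriv.eq_of_one_le {F : ℝ → L2 n} {g : 𝓢'(SpaceTime n, ℂ)} (hF : IsTimeDeriv F g)
    (hfin : u2Norm F < ⊤) (hg : VanishesOffUnit g) {τ : ℝ} (hτ : 1 ≤ τ) : F τ = F 1 := by
  rcases hτ.eq_or_lt with rfl | hτ
  · rfl
  have h : ∀ᶠ τ' in nhdsWithin 1 (Ioi 1), F τ' = F τ := by
    filter_upwards [self_mem_nhdsWithin] with τ' hτ'
    refine hF.eq_of_vanishing hfin isOpen_Ioi ordConnected_Ioi (fun a b hab ψ hψ => ?_) hτ' hτ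
    rcases le_or_gt a b with h | h
    · exact hg a b (Or.inr (hab (left_mem_Icc.2 h))) ψ hψ
    · exact hg 2 1 (Or.inr one_lt_two) ψ fun τ _ => hψ τ fun h' => h.not_ge (h'.1.trans h'.2)
  exact tendsto_nhds_unique (tendsto_const_nhds.congr' (h.mono fun _ h => h.symm))
    (tendsto_right_of_u2Norm_lt_top hfin 1)

theorem IsTimeDeriv.sub {F F' : ℝ → L2 n} {g g' : 𝓢'(SpaceTime n, ℂ)} (h : IsTimeDeriv F g)
    (h' : IsTimeDeriv F' g') : IsTimeDeriv (F - F') (g - g') := by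
  refine isTimeDeriv_iff.2 fun ψ => ?_
  have h1 := isTimeDeriv_iff.1 h ψ
  have h2 := isTimeDeriv_iff.1 h' ψ
  simp only [Pi.sub_apply, map_sub, sub_apply]
  refine ⟨h1.1.sub h2.1, ?_⟩
  rw [integral_sub h1.1 h2.1, h1.2, h2.2]
  ring

theorem IsTimeDeriv.unique {F F' : ℝ → L2 n} {g : 𝓢'(SpaceTime n, ℂ)} (hF : IsTimeDeriv F g)
    (hF' : IsTimeDeriv F' g) (hfin : u2Norm F < ⊤) (hfin' : u2Norm F' < ⊤) : F = F' := by
  have hd := hF.sub hF'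
  rw [sub_self] at hd
  have hfd : u2Norm (F - F') < ⊤ := by
    rw [sub_eq_add_neg, ← neg_one_smul ℂ F']
    refine (isExtSeminorm_u2Norm.add_le _ _).trans_lt (ENNReal.add_lt_top.2 ⟨hfin, ?_⟩)
    exact (isExtSeminorm_u2Norm.smul_le _ _).trans_lt (ENNReal.mul_lt_top enorm_lt_top hfin')
  funext τ
  rw [← sub_eq_zero]
  have h : ∀ τ', (F - F') τ' = (F - F') τ := fun τ' =>
    hd.eq_of_vanishing hfd isOpen_univ ordConnected_univ (fun _ _ _ _ _ => rfl) trivial trivial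
  exact tendsto_nhds_unique (tendsto_const_nhds.congr fun τ' => (h τ').symm)
    (tendsto_atBot_of_u2Norm_lt_top hfd)

/-- Uniqueness of primitives leaves a single competitor of finite norm in the infimum. -/
theorem IsTimeDeriv.du2L2Norm_eq {F : ℝ → L2 n} {g : 𝓢'(SpaceTime n, ℂ)} (hF : IsTimeDeriv F g)
    (hfin : u2Norm F < ⊤) : du2L2Norm g = u2Norm F := by
  refine le_antisymm hF.du2L2Norm_le (le_iInf₂ fun F' hF' => ?_)
  rcases lt_or_ge (u2Norm F') ⊤ with h | h
  · rw [hF.unique hF' hfin h]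
  · exact le_top.trans h

end

section

/-! ### Bumps on the lattice -/

variable {n : ℕ}

/-- Smooth functions with compact support. -/
structure IsBump (φ : Space n → ℝ) : Prop where
  contDiff : ContDiff ℝ (⊤ : ℕ∞) φ
  hasCompactSupport : HasCompactSupport φ

theorem IsUnitPartition.isBump {φ : Space n → ℝ} (h : IsUnitPartition φ) : IsBump φ :=
  ⟨h.contDiff, h.hasCompactSupport⟩

theorem latticePoint_add (k l : Fin n → ℤ) :
    latticePoint (k + l) = latticePoint k + latticePoint l := by
  ext i
  simp [latticePoint]

theorem latticePoint_sub (k l : Fin n → ℤ) :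
    latticePoint (k - l) = latticePoint k - latticePoint l := by
  ext i
  simp [latticePoint]

theorem latticePoint_zero : latticePoint (0 : Fin n → ℤ) = 0 := by
  ext i
  simp [latticePoint]

theorem IsBump.comp_sub {φ : Space n → ℝ} (h : IsBump φ) (c : Space n) :
    IsBump fun x => φ (x - c) :=
  ⟨h.contDiff.comp (by fun_prop),
    h.hasCompactSupport.comp_homeomorph (Homeomorph.subRight c)⟩

theorem IsBump.comp_smul {φ : Space n → ℝ} (h : IsBump φ) {r : ℝ} (hr : r ≠ 0) :
    IsBump fun x => φ (r • x) :=
  ⟨h.contDiff.comp (by fun_prop), h.hasCompactSupport.comp_smul hr⟩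

theorem IsBump.hasTemperateGrowth {φ : Space n → ℝ} (h : IsBump φ) :
    (fun x => (φ x : ℂ)).HasTemperateGrowth :=
  HasCompactSupport.hasTemperateGrowth
    (h.hasCompactSupport.comp_left (g := fun x : ℝ => (x : ℂ)) Complex.ofReal_zero)
    (Complex.ofRealCLM.contDiff.comp h.contDiff)

/-- The translate of `φ` to the lattice point `j`, as a multiplier. -/
def latMult (φ : Space n → ℝ) (j : Fin n → ℤ) (x : Space n) : ℂ := (φ (x - latticePoint j) : ℂ)

/-- The translate of `χ` to the frequency `k`, as a symbol. -/
def latSymb (χ : Space n → ℝ) (k : Fin n → ℤ) (η : Space n) : ℂ :=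
  (χ ((2 * Real.pi) • η - latticePoint k) : ℂ)

theorem IsBump.translate {φ : Space n → ℝ} (h : IsBump φ) (j : Fin n → ℤ) :
    IsBump fun x => φ (x - latticePoint j) := h.comp_sub _

theorem IsBump.dilate {χ : Space n → ℝ} (h : IsBump χ) (k : Fin n → ℤ) :
    IsBump fun η : Space n => χ ((2 * Real.pi) • η - latticePoint k) :=
  (h.comp_sub (latticePoint k)).comp_smul (by positivity)

theorem IsBump.latMult_temperate {φ : Space n → ℝ} (h : IsBump φ) (j : Fin n → ℤ) :
    (latMult φ j).HasTemperateGrowth := (h.translate j).hasTemperateGrowth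

theorem IsBump.latSymb_temperate {χ : Space n → ℝ} (h : IsBump χ) (k : Fin n → ℤ) :
    (latSymb χ k).HasTemperateGrowth := (h.dilate k).hasTemperateGrowth

theorem IsBump.exists_bound {φ : Space n → ℝ} (h : IsBump φ) :
    ∃ R : ℝ, 0 ≤ R ∧ ∀ x, φ x ≠ 0 → ‖x‖ ≤ R := by
  obtain ⟨R, hR⟩ := h.hasCompactSupport.isCompact.isBounded.exists_norm_le
  exact ⟨max R 0, le_max_right _ _, fun x hx => (hR x (subset_tsupport _ hx)).trans (le_max_left _ _)⟩

theorem finite_latticePoint_norm_le (r : ℝ) : {l : Fin n → ℤ | ‖latticePoint l‖ ≤ r}.Finite := by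
  refine (Set.finite_Icc (fun _ : Fin n => -⌈r⌉) (fun _ => ⌈r⌉)).subset fun l hl => ?_
  have h1 : ∀ i, |(l i : ℝ)| ≤ ⌈r⌉ := fun i => by
    have := PiLp.norm_apply_le (latticePoint l) i
    exact (this.trans hl).trans (Int.le_ceil r)
  refine ⟨fun i => ?_, fun i => ?_⟩
  · exact_mod_cast (abs_le.1 (h1 i)).1
  · exact_mod_cast (abs_le.1 (h1 i)).2

/-- The exponent `n + 1` exceeds the rank `n` of the lattice. -/
theorem summable_latticePoint :
    Summable fun j : Fin n → ℤ => ((1 + ‖latticePoint j‖) ^ (n + 1))⁻¹ := by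
  set b := (EuclideanSpace.basisFun (Fin n) ℝ).toBasis
  set L : Submodule ℤ (Space n) := Submodule.span ℤ (Set.range b)
  have hmem : ∀ j : Fin n → ℤ, latticePoint j ∈ L := fun j => by
    have : latticePoint j = ∑ i, (j i) • b i := by
      ext i
      simp [latticePoint, b, Pi.single_apply]
    rw [this]
    exact Submodule.sum_mem _ fun i _ => Submodule.smul_mem _ _ (Submodule.subset_span ⟨i, rfl⟩)
  have hinj : Function.Injective fun j : Fin n → ℤ => (⟨latticePoint j, hmem j⟩ : L) := by
    intro j j' h
    have h1 : latticePoint j = latticePoint j' := congrArg Subtype.val h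
    funext i
    have h2 : (j i : ℝ) = j' i := congrArg (fun x : Space n => x i) h1
    exact_mod_cast h2
  have hrank : Module.finrank ℤ L < n + 1 := by
    rw [ZLattice.rank ℝ L]
    simp
  have hs := (ZLattice.summable_norm_pow_inv L (n + 1) hrank).comp_injective hinj
  refine Summable.of_norm_bounded_eventually hs ?_
  have hfin : {j : Fin n → ℤ | ‖latticePoint j‖ ≤ 0}.Finite := finite_latticePoint_norm_le 0
  filter_upwards [hfin.compl_mem_cofinite] with j hj
  have hj' : 0 < ‖latticePoint j‖ := not_le.1 hj
  rw [Real.norm_of_nonneg (by positivity)]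
  change ((1 + ‖latticePoint j‖) ^ (n + 1))⁻¹ ≤ ‖latticePoint j‖⁻¹ ^ (n + 1)
  rw [inv_pow]
  gcongr
  linarith

/-! ### Almost orthogonality of the localizations -/

/-- By Fubini a multiplier is a convolution. Its kernel is `𝓕 M`, not the inverse transform, because
`multT` is the transposed multiplier. -/
theorem multT_apply_eq_integral {M : Space n → ℂ} (hM : M.HasTemperateGrowth) (hMi : Integrable M)
    (u : 𝓢(Space n, ℂ)) (x : Space n) : multT M u x = ∫ y, 𝓕 M (x - y) * u y := by
  rw [multT_apply, SchwartzMap.fourier_coe, Real.fourier_eq']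
  have h1 : ∀ η : Space n, (SchwartzMap.smulLeftCLM ℂ M (𝓕⁻ u)) η =
      ∫ y, M η * (Complex.exp (((2 * Real.pi * inner ℝ y η : ℝ) : ℂ) * Complex.I) * u y) := by
    intro η
    rw [SchwartzMap.smulLeftCLM_apply_apply hM, SchwartzMap.fourierInv_coe, Real.fourierInv_eq',
      smul_eq_mul, ← integral_const_mul]
    rfl
  have h2 : ∀ y : Space n, 𝓕 M (x - y) * u y = ∫ η, Complex.exp (((-2 * Real.pi * inner ℝ η x : ℝ) : ℂ) *
      Complex.I) * (M η * (Complex.exp (((2 * Real.pi * inner ℝ y η : ℝ) : ℂ) * Complex.I) * u y)) := by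
    intro y
    rw [Real.fourier_eq', ← integral_mul_const]
    refine integral_congr_ae (Filter.Eventually.of_forall fun η => ?_)
    have : Complex.exp (((-2 * Real.pi * inner ℝ η (x - y) : ℝ) : ℂ) * Complex.I) =
        Complex.exp (((-2 * Real.pi * inner ℝ η x : ℝ) : ℂ) * Complex.I) *
          Complex.exp (((2 * Real.pi * inner ℝ y η : ℝ) : ℂ) * Complex.I) := by
      rw [← Complex.exp_add, inner_sub_right, real_inner_comm y η]
      congr 1
      push_cast
      ring
    simp only [this, smul_eq_mul]
    ring
  simp_rw [h1, h2, smul_eq_mul, ← integral_const_mul]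
  refine integral_integral_swap ?_
  have h3 : Integrable (fun p : Space n × Space n => M p.1 * u p.2) (volume.prod volume) :=
    hMi.mul_prod u.integrable
  refine h3.mono ?_ (Filter.Eventually.of_forall fun p => ?_)
  · have h4 : Continuous fun p : Space n × Space n =>
        Complex.exp (((-2 * Real.pi * inner ℝ p.1 x : ℝ) : ℂ) * Complex.I) *
          Complex.exp (((2 * Real.pi * inner ℝ p.2 p.1 : ℝ) : ℂ) * Complex.I) := by fun_prop
    refine (h4.aestronglyMeasurable.mul h3.aestronglyMeasurable).congr
      (Filter.Eventually.of_forall fun p => ?_)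
    simp only [Pi.mul_apply, Function.uncurry]
    ring
  · simp only [Function.uncurry, norm_mul, norm_exp_real_mul_I, one_mul]
    exact le_rfl

theorem norm_toLp_le_of_le {G : Space n → ℂ} (hG : MemLp G 2) (a : 𝓢(Space n, ℂ)) {c : ℝ}
    (h : ∀ x, ‖G x‖ ≤ c * ‖a x‖) : ‖(hG.toLp G : L2 n)‖ ≤ c * ‖(a.toLp 2 : L2 n)‖ := by
  refine Lp.norm_le_mul_norm_of_ae_le_mul ?_
  filter_upwards [hG.coeFn_toLp, a.coeFn_toLp 2] with x h1 h2
  rw [h1, h2]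
  exact h x

theorem norm_schwartz_toLp_le_of_le (g a : 𝓢(Space n, ℂ)) {c : ℝ} (h : ∀ x, ‖g x‖ ≤ c * ‖a x‖) :
    ‖(g.toLp 2 : L2 n)‖ ≤ c * ‖(a.toLp 2 : L2 n)‖ :=
  norm_toLp_le_of_le (g.memLp 2) a h

theorem norm_localized_integral_le {K : Space n → ℂ} (hK : Continuous K) (b : 𝓢(Space n, ℂ)) {κ : ℝ}
    (h : ∀ y, b y ≠ 0 → ‖K y‖ ≤ κ) (ψ : 𝓢(Space n, ℂ)) :
    ‖∫ y, K y * (b y * ψ y)‖ ≤ κ * ‖(b.toLp 2 : L2 n)‖ * ‖(ψ.toLp 2 : L2 n)‖ := by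
  have hle : ∀ y, ‖K y * b y‖ ≤ κ * ‖b y‖ := fun y => by
    rw [norm_mul]
    by_cases hy : b y = 0
    · simp [hy]
    · exact mul_le_mul_of_nonneg_right (h y hy) (norm_nonneg _)
  have hmem : MemLp (fun y => K y * b y) 2 :=
    MemLp.of_le_mul (b.memLp 2) (hK.mul b.continuous).aestronglyMeasurable
      (Filter.Eventually.of_forall hle)
  have h1 : ∫ y, K y * (b y * ψ y) = l2Pairing (hmem.toLp _) (ψ.toLp 2) := by
    rw [l2Pairing, ContinuousLinearMap.lpPairing_eq_integral]
    refine integral_congr_ae ?_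
    filter_upwards [hmem.coeFn_toLp, ψ.coeFn_toLp 2] with y h2 h3
    simp only [ContinuousLinearMap.flip_apply, ContinuousLinearMap.lsmul_apply, smul_eq_mul, h2, h3]
    ring
  rw [h1]
  refine (norm_l2Pairing_le _ _).trans ?_
  exact mul_le_mul_of_nonneg_right (norm_toLp_le_of_le hmem b hle) (norm_nonneg _)

theorem continuous_fourier {M : Space n → ℂ} (hM : Integrable M) : Continuous (𝓕 M) :=
  VectorFourier.fourierIntegral_continuous Real.continuous_fourierChar (by exact continuous_inner) hM

/-- The kernel `a(x) 𝓕M(x - y) b(y)` is at most `κ |a(x)| |b(y)|`: Cauchy-Schwarz in `y`, then the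
`L²` norm in `x`, as for Hilbert-Schmidt operators. -/
theorem norm_localized_multT_le {M : Space n → ℂ} (hM : M.HasTemperateGrowth) (hMi : Integrable M)
    (a b : 𝓢(Space n, ℂ)) {κ : ℝ}
    (h : ∀ x y, a x ≠ 0 → b y ≠ 0 → ‖𝓕 M (x - y)‖ ≤ κ) (ψ : 𝓢(Space n, ℂ)) :
    ‖((SchwartzMap.smulLeftCLM ℂ a (multT M (SchwartzMap.smulLeftCLM ℂ b ψ))).toLp 2 : L2 n)‖ ≤
      κ * ‖(a.toLp 2 : L2 n)‖ * ‖(b.toLp 2 : L2 n)‖ * ‖(ψ.toLp 2 : L2 n)‖ := by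
  refine (norm_schwartz_toLp_le_of_le _ a
    (c := κ * ‖(b.toLp 2 : L2 n)‖ * ‖(ψ.toLp 2 : L2 n)‖) fun x => ?_).trans_eq (by ring)
  rw [SchwartzMap.smulLeftCLM_apply_apply a.hasTemperateGrowth, smul_eq_mul, norm_mul, mul_comm]
  by_cases hx : a x = 0
  · simp [hx]
  refine mul_le_mul_of_nonneg_right ?_ (norm_nonneg _)
  rw [multT_apply_eq_integral hM hMi]
  simp_rw [SchwartzMap.smulLeftCLM_apply_apply b.hasTemperateGrowth, smul_eq_mul]
  exact norm_localized_integral_le ((continuous_fourier hMi).comp (by fun_prop)) b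
    (fun y hy => h x y hx hy) ψ

theorem norm_bumpTest_comp_sub {φ : Space n → ℝ} (h : IsBump φ) (c : Space n) :
    ‖((bumpTest (fun x => φ (x - c)) (h.comp_sub c).contDiff
      (h.comp_sub c).hasCompactSupport).toLp 2 : L2 n)‖ =
      ‖((bumpTest φ h.contDiff h.hasCompactSupport).toLp 2 : L2 n)‖ := by
  rw [SchwartzMap.norm_toLp, SchwartzMap.norm_toLp]
  have h1 : ⇑(bumpTest (fun x => φ (x - c)) (h.comp_sub c).contDiff
      (h.comp_sub c).hasCompactSupport) =
      ⇑(bumpTest φ h.contDiff h.hasCompactSupport) ∘ fun x => x - c := rfl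
  rw [h1, eLpNorm_comp_measurePreserving
    (bumpTest φ h.contDiff h.hasCompactSupport).continuous.aestronglyMeasurable
    (measurePreserving_sub_right volume c)]

/-- Translating a symbol only modulates its Fourier transform. Kernel bounds are therefore uniform
in the frequency cell. -/
theorem norm_fourier_comp_sub (M : Space n → ℂ) (c z : Space n) :
    ‖𝓕 (fun η => M (η - c)) z‖ = ‖𝓕 M z‖ := by
  have h := congrFun (VectorFourier.fourierIntegral_comp_add_right Real.fourierChar volume
    (innerₗ (Space n)) M (-c)) z
  have h2 : 𝓕 (fun η => M (η - c)) z = Real.fourierChar (inner ℝ (-c) z) • 𝓕 M z := by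
    simpa [sub_eq_add_neg] using! h
  rw [h2, Circle.norm_smul]

/-- The transpose of the localization to the frequency `k` and then to the point `j`. -/
def locT (φ χ : Space n → ℝ) (k j : Fin n → ℤ) : 𝓢(Space n, ℂ) →L[ℂ] 𝓢(Space n, ℂ) :=
  multT (latSymb χ k) ∘L SchwartzMap.smulLeftCLM ℂ (latMult φ j)

/-- The transpose of the localization to the point `j` and then to the frequency `k`. -/
def synT (φ χ : Space n → ℝ) (k j : Fin n → ℤ) : 𝓢(Space n, ℂ) →L[ℂ] 𝓢(Space n, ℂ) :=
  SchwartzMap.smulLeftCLM ℂ (latMult φ j) ∘L multT (latSymb χ k)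

theorem IsBump.mul {φ ψ : Space n → ℝ} (hφ : IsBump φ) (hψ : IsBump ψ) :
    IsBump fun x => φ x * ψ x :=
  ⟨hφ.contDiff.mul hψ.contDiff, hφ.hasCompactSupport.mul_right⟩

theorem exists_decay_fourier {M : Space n → ℝ} (hM : IsBump M) : ∃ C : ℝ, 0 ≤ C ∧
    ∀ z, ‖𝓕 (fun η => (M η : ℂ)) z‖ ≤ C * ((1 + ‖z‖) ^ (n + 1))⁻¹ := by
  set MS := bumpTest M hM.contDiff hM.hasCompactSupport
  refine ⟨2 ^ (n + 1) * (Finset.Iic (n + 1, 0)).sup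
    (fun m => SchwartzMap.seminorm ℝ m.1 m.2) (𝓕 MS), by positivity, fun z => ?_⟩
  have h := SchwartzMap.one_add_le_sup_seminorm_apply (𝕜 := ℝ) (m := (n + 1, 0)) le_rfl le_rfl
    (𝓕 MS) z
  rw [norm_iteratedFDeriv_zero, SchwartzMap.fourier_coe] at h
  rw [← div_eq_mul_inv, le_div_iff₀ (by positivity), mul_comm]
  exact h

/-- The composite cuts off at `j'`, applies the product of the two symbols and cuts off at `j`. The
product vanishes unless `k' - k` lies in a finite set; otherwise it is a translate of a bump
depending only on `k' - k`, with a rapidly decaying kernel. The spatial cutoffs turn decay in `x -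
y` into decay in `j' - j`. -/
theorem exists_almost_orthogonality {φ₁ χ₁ φ₂ χ₂ : Space n → ℝ} (hφ₁ : IsBump φ₁) (hχ₁ : IsBump χ₁)
    (hφ₂ : IsBump φ₂) (hχ₂ : IsBump χ₂) :
    ∃ (K₀ : Finset (Fin n → ℤ)) (τ : (Fin n → ℤ) → (Fin n → ℤ) → ℝ), (∀ l m, 0 ≤ τ l m) ∧
      (∀ l ∉ K₀, ∀ m, τ l m = 0) ∧ (∀ l, Summable (τ l)) ∧ ∀ k j k' j' ψ,
        ‖((synT φ₂ χ₂ k j (locT φ₁ χ₁ k' j' ψ)).toLp 2 : L2 n)‖ ≤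
          τ (k' - k) (j' - j) * ‖(ψ.toLp 2 : L2 n)‖ := by
  obtain ⟨R₁, hR₁, hb₁⟩ := hφ₁.exists_bound
  obtain ⟨R₂, hR₂, hb₂⟩ := hφ₂.exists_bound
  obtain ⟨r₁, hr₁, hc₁⟩ := hχ₁.exists_bound
  obtain ⟨r₂, hr₂, hc₂⟩ := hχ₂.exists_bound
  set N : (Fin n → ℤ) → Space n → ℝ := fun l η =>
    χ₂ ((2 * Real.pi) • η - latticePoint 0) * χ₁ ((2 * Real.pi) • η - latticePoint l)
  have hN : ∀ l, IsBump (N l) := fun l => (hχ₂.dilate 0).mul (hχ₁.dilate l)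
  have hfin := finite_latticePoint_norm_le (n := n) (r₁ + r₂)
  have hN0 : ∀ l ∉ hfin.toFinset, N l = 0 := by
    intro l hl
    rw [Set.Finite.mem_toFinset, mem_ofPred_eq, not_le] at hl
    funext η
    by_contra hne
    have h1 := hc₂ _ (left_ne_zero_of_mul hne)
    have h2 := hc₁ _ (right_ne_zero_of_mul hne)
    have h3 : latticePoint l = ((2 * Real.pi) • η - latticePoint 0) -
        ((2 * Real.pi) • η - latticePoint l) := by rw [latticePoint_zero]; abel
    rw [h3] at hl
    linarith [norm_sub_le ((2 * Real.pi) • η - latticePoint 0)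
      ((2 * Real.pi) • η - latticePoint l)]
  have hdec : ∀ l, ∃ C : ℝ, 0 ≤ C ∧ (l ∉ hfin.toFinset → C = 0) ∧
      ∀ z, ‖𝓕 (fun η => (N l η : ℂ)) z‖ ≤ C * ((1 + ‖z‖) ^ (n + 1))⁻¹ := by
    intro l
    by_cases hl : l ∈ hfin.toFinset
    · obtain ⟨C, hC, h⟩ := exists_decay_fourier (hN l)
      exact ⟨C, hC, fun h => absurd hl h, h⟩
    · refine ⟨0, le_rfl, fun _ => rfl, fun z => ?_⟩
      rw [hN0 l hl, Real.fourier_eq']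
      simp
  choose C hC hC0 hCd using hdec
  set A₁ := ‖((bumpTest φ₁ hφ₁.contDiff hφ₁.hasCompactSupport).toLp 2 : L2 n)‖
  set A₂ := ‖((bumpTest φ₂ hφ₂.contDiff hφ₂.hasCompactSupport).toLp 2 : L2 n)‖
  -- On the supports, `1 + |j' - j| ≤ (1 + R₁ + R₂)(1 + |x - y|)`; this accounts for the power of `1
  -- + R₁ + R₂`.
  refine ⟨hfin.toFinset, fun l m => C l * (1 + (R₁ + R₂)) ^ (n + 1) *
    ((1 + ‖latticePoint m‖) ^ (n + 1))⁻¹ * A₂ * A₁, fun l m => ?_, fun l hl m => ?_, fun l => ?_,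
    fun k j k' j' ψ => ?_⟩
  · have := hC l
    positivity
  · simp [hC0 l hl]
  · exact ((summable_latticePoint.mul_left _).mul_right _).mul_right _
  · have hM := (hχ₂.latSymb_temperate k).mul (hχ₁.latSymb_temperate k')
    have hMi : Integrable (latSymb χ₂ k * latSymb χ₁ k') := by
      have := (bumpTest _ ((hχ₂.dilate k).mul (hχ₁.dilate k')).contDiff
        ((hχ₂.dilate k).mul (hχ₁.dilate k')).hasCompactSupport).integrable (μ := volume)
      refine this.congr (Filter.Eventually.of_forall fun η => ?_)
      exact Complex.ofReal_mul _ _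
    have hshift : (latSymb χ₂ k * latSymb χ₁ k') = fun η =>
        (fun η => (N (k' - k) η : ℂ)) (η - (2 * Real.pi)⁻¹ • latticePoint k) := by
      funext η
      have hpi : (2 * Real.pi) ≠ 0 := by positivity
      have hsub : (2 * Real.pi) • η - latticePoint k - (latticePoint k' - latticePoint k) =
          (2 * Real.pi) • η - latticePoint k' := by abel
      simp only [Pi.mul_apply, latSymb, N, smul_sub, smul_inv_smul₀ hpi, latticePoint_sub,
        latticePoint_zero, sub_zero, Complex.ofReal_mul, hsub]
    have heq : synT φ₂ χ₂ k j (locT φ₁ χ₁ k' j' ψ) =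
        SchwartzMap.smulLeftCLM ℂ (latMult φ₂ j) (multT (latSymb χ₂ k * latSymb χ₁ k')
          (SchwartzMap.smulLeftCLM ℂ (latMult φ₁ j') ψ)) := by
      rw [← multT_multT (hχ₂.latSymb_temperate k) (hχ₁.latSymb_temperate k')]
      rfl
    have hmain := norm_localized_multT_le hM hMi
      (bumpTest _ (hφ₂.translate j).contDiff (hφ₂.translate j).hasCompactSupport)
      (bumpTest _ (hφ₁.translate j').contDiff (hφ₁.translate j').hasCompactSupport)
      (κ := C (k' - k) * (1 + (R₁ + R₂)) ^ (n + 1) *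
        ((1 + ‖latticePoint (j' - j)‖) ^ (n + 1))⁻¹)
      (fun x y hx hy => ?_) ψ
    · rw [heq]
      rw [norm_bumpTest_comp_sub hφ₂, norm_bumpTest_comp_sub hφ₁] at hmain
      exact hmain
    · have hnorm := norm_fourier_comp_sub (fun η => (N (k' - k) η : ℂ))
        ((2 * Real.pi)⁻¹ • latticePoint k) (x - y)
      rw [hshift]
      refine hnorm.trans_le ((hCd (k' - k) (x - y)).trans ?_)
      rw [mul_assoc]
      refine mul_le_mul_of_nonneg_left ?_ (hC _)
      rw [← div_eq_mul_inv, le_div_iff₀ (by positivity), inv_mul_le_iff₀ (by positivity), ← mul_pow]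
      refine pow_le_pow_left₀ (by positivity) ?_ _
      have h1 := hb₂ _ (Complex.ofReal_ne_zero.1 hx)
      have h2 := hb₁ _ (Complex.ofReal_ne_zero.1 hy)
      have h3 : latticePoint (j' - j) = (x - latticePoint j) - (y - latticePoint j') - (x - y) := by
        rw [latticePoint_sub]
        abel
      have h4 : ‖latticePoint (j' - j)‖ ≤ R₂ + R₁ + ‖x - y‖ := by
        rw [h3]
        exact (norm_sub_le _ _).trans (add_le_add ((norm_sub_le _ _).trans (add_le_add h1 h2)) le_rfl)
      nlinarith [norm_nonneg (x - y)]

end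

section

/-! ### Weights -/

variable {n : ℕ}

theorem one_add_norm_sq_le (x y : Space n) :
    1 + ‖x‖ ^ 2 ≤ 2 * (1 + ‖x - y‖ ^ 2) * (1 + ‖y‖ ^ 2) := by
  have h : ‖x‖ ≤ ‖x - y‖ + ‖y‖ := by simpa using norm_add_le (x - y) y
  have h2 : ‖x‖ ^ 2 ≤ (‖x - y‖ + ‖y‖) ^ 2 := by gcongr
  nlinarith [sq_nonneg (‖x - y‖ - ‖y‖), mul_nonneg (sq_nonneg ‖x - y‖) (sq_nonneg ‖y‖)]

/-- Peetre's inequality; for negative `s` the roles of `x` and `y` are exchanged. -/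
theorem rpow_weight_le (s : ℝ) (x y : Space n) : (1 + ‖x‖ ^ 2) ^ (s / 2) ≤
    (2 * (1 + ‖x - y‖ ^ 2)) ^ (|s| / 2) * (1 + ‖y‖ ^ 2) ^ (s / 2) := by
  rcases le_total 0 s with hs | hs
  · rw [abs_of_nonneg hs, ← Real.mul_rpow (by positivity) (by positivity)]
    exact Real.rpow_le_rpow (by positivity) (one_add_norm_sq_le x y) (by positivity)
  · have h := one_add_norm_sq_le y x
    rw [norm_sub_rev] at h
    rw [abs_of_nonpos hs, neg_div, Real.rpow_neg (by positivity), ← Real.inv_rpow (by positivity),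
      ← Real.mul_rpow (by positivity) (by positivity)]
    refine Real.rpow_le_rpow_of_nonpos (by positivity) ?_ (by linarith)
    rw [inv_mul_le_iff₀ (by positivity)]
    exact h

theorem weight_le (s : ℝ) (k k' : Fin n → ℤ) : weight s k' ≤
    ENNReal.ofReal ((2 * (1 + ‖latticePoint (k' - k)‖ ^ 2)) ^ (|s| / 2)) * weight s k := by
  rw [weight, weight, ← ENNReal.ofReal_mul (by positivity), latticePoint_sub]
  exact ENNReal.ofReal_le_ofReal (rpow_weight_le s _ _)

theorem weight_ne_zero (s : ℝ) (k : Fin n → ℤ) : weight s k ≠ 0 := by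
  rw [weight, ← pos_iff_ne_zero, ENNReal.ofReal_pos]
  positivity

theorem weight_ne_top (s : ℝ) (k : Fin n → ℤ) : weight s k ≠ ⊤ := ENNReal.ofReal_ne_top

theorem weight_mul_weight_neg (s : ℝ) (k : Fin n → ℤ) : weight s k * weight (-s) k = 1 := by
  rw [weight, weight, ← ENNReal.ofReal_mul (by positivity), ← Real.rpow_add (by positivity)]
  simp [neg_div]

/-! ### Partitions of unity in the Schwartz space -/

section PartitionOfUnity

variable {E : Type*} [NormedAddCommGroup E] [NormedSpace ℝ E]

theorem IsBump.comp_sub_clm_temperate {φ : Space n → ℝ} (hφ : IsBump φ) (L : E →L[ℝ] Space n)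
    (j : Fin n → ℤ) : (fun x => latMult φ j (L x)).HasTemperateGrowth :=
  (hφ.latMult_temperate j).comp L.hasTemperateGrowth

theorem IsBump.exists_norm_iteratedFDeriv_le {φ : Space n → ℝ} (hφ : IsBump φ) (L : E →L[ℝ] Space n)
    (i : ℕ) : ∃ B : ℝ, 0 ≤ B ∧
      ∀ j x, ‖iteratedFDeriv ℝ i (fun x => latMult φ j (L x)) x‖ ≤ B := by
  set φS := bumpTest φ hφ.contDiff hφ.hasCompactSupport
  obtain ⟨B, -, hB⟩ := φS.decay 0 i
  have hB' : ∀ x, ‖iteratedFDeriv ℝ i φS x‖ ≤ B := fun x => by simpa using hB x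
  have hB0 : 0 ≤ B := (norm_nonneg _).trans (hB' 0)
  refine ⟨B * ‖L‖ ^ i, by positivity, fun j x => ?_⟩
  have h1 : (fun x => latMult φ j (L x)) = (fun y => φS (y - latticePoint j)) ∘ L := rfl
  have h2 : ContDiff ℝ (⊤ : ℕ∞) fun y => φS (y - latticePoint j) :=
    φS.smooth'.comp (by fun_prop)
  rw [h1, L.iteratedFDeriv_comp_right h2 x (by exact_mod_cast le_top)]
  refine (ContinuousMultilinearMap.norm_compContinuousLinearMap_le _ _).trans ?_
  rw [Finset.prod_const, Finset.card_univ, Fintype.card_fin, iteratedFDeriv_comp_sub]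
  gcongr
  exact hB' _

/-- Where the `j`-th translate lives, `1 + |j|` is at most a multiple of `1 + |x|`. Giving up `n +
1` powers of the decay of `ψ` buys a factor that is summable over the lattice. -/
theorem IsBump.summable_seminorm {φ : Space n → ℝ} (hφ : IsBump φ) (L : E →L[ℝ] Space n)
    (k m : ℕ) (ψ : 𝓢(E, ℂ)) : Summable fun j : Fin n → ℤ =>
      SchwartzMap.seminorm ℝ k m (SchwartzMap.smulLeftCLM ℂ (fun x => latMult φ j (L x)) ψ) := by
  obtain ⟨R, hR, hb⟩ := hφ.exists_bound
  choose B hB0 hB using fun i => hφ.exists_norm_iteratedFDeriv_le L i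
  set p : ℝ := 2 ^ (k + (n + 1)) * (Finset.Iic (k + (n + 1), m)).sup
    (fun m => SchwartzMap.seminorm ℝ m.1 m.2) ψ
  have hp : ∀ i ≤ m, ∀ x, (1 + ‖x‖) ^ (k + (n + 1)) * ‖iteratedFDeriv ℝ i ψ x‖ ≤ p := fun i hi x =>
    SchwartzMap.one_add_le_sup_seminorm_apply (𝕜 := ℝ) (m := (k + (n + 1), m)) le_rfl hi ψ x
  set Q : ℝ := ∑ i ∈ Finset.range (m + 1), (m.choose i : ℝ) * B i * p
  set c : ℝ := ((1 + R) * (1 + ‖L‖)) ^ (n + 1)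
  refine Summable.of_nonneg_of_le (fun j => apply_nonneg _ _) (fun j => ?_)
    (summable_latticePoint.mul_left (c * Q))
  have hp0 : 0 ≤ p := by positivity
  have hQ : 0 ≤ Q := Finset.sum_nonneg fun i _ => by have := hB0 i; positivity
  refine SchwartzMap.seminorm_le_bound ℝ k m _ (by positivity) fun x => ?_
  have hcoe : ⇑(SchwartzMap.smulLeftCLM ℂ (fun x => latMult φ j (L x)) ψ) =
      fun x => latMult φ j (L x) * ψ x := by
    funext y
    rw [SchwartzMap.smulLeftCLM_apply_apply (hφ.comp_sub_clm_temperate L j), smul_eq_mul]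
  by_cases hx : ‖L x - latticePoint j‖ ≤ R
  · have h1 : 1 + ‖latticePoint j‖ ≤ (1 + R) * (1 + ‖L‖) * (1 + ‖x‖) := by
      have h2 : ‖latticePoint j‖ ≤ ‖L‖ * ‖x‖ + R := by
        have := norm_sub_le (L x) (L x - latticePoint j)
        rw [sub_sub_cancel] at this
        linarith [L.le_opNorm x]
      nlinarith [mul_nonneg (norm_nonneg L) (norm_nonneg x), norm_nonneg L, norm_nonneg x,
        mul_nonneg hR (mul_nonneg (norm_nonneg L) (norm_nonneg x)),
        mul_nonneg hR (norm_nonneg L), mul_nonneg hR (norm_nonneg x)]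
    have h2 : (1 + ‖latticePoint j‖) ^ (n + 1) ≤ c * (1 + ‖x‖) ^ (n + 1) := by
      rw [← mul_pow]
      gcongr
    have h3 : (1 + ‖x‖) ^ (k + (n + 1)) *
        ‖iteratedFDeriv ℝ m (fun x => latMult φ j (L x) * ψ x) x‖ ≤ Q := by
      refine (mul_le_mul_of_nonneg_left (norm_iteratedFDeriv_mul_le
        (hφ.comp_sub_clm_temperate L j).1 (ψ.smooth ⊤) x (n := m) (by exact_mod_cast le_top))
        (by positivity)).trans ?_
      rw [Finset.mul_sum]
      refine Finset.sum_le_sum fun i hi => ?_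
      have h4 := hp (m - i) (Nat.sub_le _ _) x
      have h5 := hB i j x
      calc _ = (m.choose i : ℝ) * ‖iteratedFDeriv ℝ i (fun x => latMult φ j (L x)) x‖ *
            ((1 + ‖x‖) ^ (k + (n + 1)) * ‖iteratedFDeriv ℝ (m - i) ψ x‖) := by ring
        _ ≤ _ := by
          have := hB0 i
          gcongr
    rw [hcoe, ← div_eq_mul_inv, le_div_iff₀ (by positivity)]
    set D := ‖iteratedFDeriv ℝ m (fun x => latMult φ j (L x) * ψ x) x‖
    calc ‖x‖ ^ k * D * (1 + ‖latticePoint j‖) ^ (n + 1)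
        ≤ (1 + ‖x‖) ^ k * D * (c * (1 + ‖x‖) ^ (n + 1)) := by
          gcongr
          linarith
      _ = c * ((1 + ‖x‖) ^ (k + (n + 1)) * D) := by ring
      _ ≤ c * Q := by gcongr
  · have h0 : iteratedFDeriv ℝ m (SchwartzMap.smulLeftCLM ℂ (fun x => latMult φ j (L x)) ψ) x = 0 := by
      by_contra hne
      have h1 := support_iteratedFDeriv_subset (𝕜 := ℝ) m hne
      have h2 : tsupport (SchwartzMap.smulLeftCLM ℂ (fun x => latMult φ j (L x)) ψ) ⊆
          {x | ‖L x - latticePoint j‖ ≤ R} := by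
        refine closure_minimal (fun y hy => hb _ fun hy0 => hy ?_) ?_
        · rw [hcoe]
          simp [latMult, hy0]
        · exact isClosed_le (by fun_prop) continuous_const
      exact hx (h2 h1)
    rw [h0, norm_zero, mul_zero]
    positivity

/-- The decomposition of a Schwartz function by a partition of unity. -/
theorem IsUnitPartition.hasSum_smulLeft {φ : Space n → ℝ} (hφ : IsUnitPartition φ)
    (L : E →L[ℝ] Space n) (ψ : 𝓢(E, ℂ)) :
    HasSum (fun j => SchwartzMap.smulLeftCLM ℂ (fun x => latMult φ j (L x)) ψ) ψ := by
  classical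
  obtain ⟨R, hR, hb⟩ := hφ.isBump.exists_bound
  rw [HasSum, (schwartz_withSeminorms ℝ E ℂ).tendsto_nhds]
  rintro ⟨k, m⟩ ε hε
  obtain ⟨S₀, hS₀⟩ := summable_iff_vanishing_norm.1
    (hφ.isBump.summable_seminorm L k m ψ) (ε / 2) (half_pos hε)
  simp only [SummationFilter.unconditional_filter]
  filter_upwards [Filter.eventually_ge_atTop S₀] with S hS
  refine lt_of_le_of_lt (SchwartzMap.seminorm_le_bound ℝ k m _ (half_pos hε).le fun x => ?_)
    (half_lt_self hε)
  -- Near `x` all nonzero translates have their index in `T`, so the error of the partial sum over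
  -- `S` is locally minus the sum over `T \ S`, which is disjoint from `S₀`.
  set T := (finite_latticePoint_norm_le (n := n) (‖L x‖ + 1 + R)).toFinset ∪ S
  have hT : ∀ᶠ y in nhds x, ∑ j ∈ T, latMult φ j (L y) = 1 := by
    have h1 : ∀ᶠ y in nhds x, ‖L y‖ < ‖L x‖ + 1 :=
      ((L.continuous.norm).tendsto x).eventually (gt_mem_nhds (by linarith))
    filter_upwards [h1] with y hy
    have h2 : HasSum (fun j => φ (L y - latticePoint j)) (∑ j ∈ T, φ (L y - latticePoint j)) := by
      refine hasSum_sum_of_ne_finset_zero fun j hj => ?_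
      by_contra hne
      refine hj (Finset.mem_union_left _ ?_)
      rw [Set.Finite.mem_toFinset, mem_ofPred_eq]
      have h3 := hb _ hne
      have h4 := norm_sub_le (L y) (L y - latticePoint j)
      rw [sub_sub_cancel] at h4
      linarith
    have h3 := h2.unique (hφ.hasSum_translates (L y))
    simp only [latMult]
    exact_mod_cast h3
  have happ : ∀ (A : Finset (Fin n → ℤ)) (y : E),
      (∑ j ∈ A, SchwartzMap.smulLeftCLM ℂ (fun x => latMult φ j (L x)) ψ) y =
        (∑ j ∈ A, latMult φ j (L y)) * ψ y := fun A y => by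
    rw [sum_apply, Finset.sum_mul]
    refine Finset.sum_congr rfl fun j _ => ?_
    rw [SchwartzMap.smulLeftCLM_apply_apply (hφ.isBump.comp_sub_clm_temperate L j), smul_eq_mul]
  have hsub : (∑ j ∈ S, SchwartzMap.smulLeftCLM ℂ (fun x => latMult φ j (L x)) ψ - ψ : 𝓢(E, ℂ))
      =ᶠ[nhds x]
      (-∑ j ∈ T \ S, SchwartzMap.smulLeftCLM ℂ (fun x => latMult φ j (L x)) ψ : 𝓢(E, ℂ)) := by
    filter_upwards [hT] with y hy
    rw [← Finset.sum_sdiff (Finset.subset_union_right : S ⊆ T)] at hy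
    rw [sub_apply, neg_apply, happ, happ, eq_sub_of_add_eq hy]
    ring
  rw [(Filter.EventuallyEq.iteratedFDeriv ℝ hsub m).eq_of_nhds]
  refine (SchwartzMap.le_seminorm ℝ k m _ x).trans ?_
  rw [map_neg_eq_map]
  refine (Finset.le_sum_of_subadditive _ (map_zero _).le (fun a b => map_add_le_add _ a b) _ _).trans ?_
  have h := hS₀ (T \ S) (Finset.disjoint_of_subset_right hS Finset.sdiff_disjoint)
  exact (le_abs_self _).trans h.le

end PartitionOfUnity

end

section

/-! ### Resolutions of the identity -/

variable {n : ℕ}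

section Resolution

variable {E : Type*} [NormedAddCommGroup E] [InnerProductSpace ℝ E] [FiniteDimensional ℝ E]
    [MeasurableSpace E] [BorelSpace E]

theorem IsUnitPartition.hasSum_multT {χ : Space n → ℝ} (hχ : IsUnitPartition χ)
    (P : E →L[ℝ] Space n) (ψ : 𝓢(E, ℂ)) :
    HasSum (fun k => multT (fun η => latSymb χ k (P η)) ψ) ψ := by
  have h := hχ.hasSum_smulLeft ((2 * Real.pi) • P) (𝓕⁻ ψ)
  have h2 := (FourierTransform.fourierCLM ℂ 𝓢(E, ℂ)).hasSum h
  rw [FourierTransform.fourierCLM_apply, FourierTransform.fourier_fourierInv_eq] at h2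
  exact h2

theorem IsBump.latSymb_comp_temperate {E : Type*} [NormedAddCommGroup E] [NormedSpace ℝ E]
    {χ : Space n → ℝ} (hχ : IsBump χ) (P : E →L[ℝ] Space n)
    (k : Fin n → ℤ) : (fun x => latSymb χ k (P x)).HasTemperateGrowth :=
  (hχ.latSymb_temperate k).comp P.hasTemperateGrowth

/-- The primed cutoffs equal one where the unprimed ones live and are absorbed by them; the sum over
`j` is then the partition of unity in space. -/
theorem hasSum_localize_synthesize {φ φ' χ χ' : Space n → ℝ} (hφ : IsUnitPartition φ)
    (hχ : IsBump χ) (hφ' : IsBump φ') (hχ' : IsBump χ') (h : ∀ x, φ x * φ' x = φ x)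
    (h' : ∀ x, χ x * χ' x = χ x) (P : E →L[ℝ] Space n) (k : Fin n → ℤ) (ψ : 𝓢(E, ℂ)) :
    HasSum (fun j => multT (fun η => latSymb χ k (P η))
      (SchwartzMap.smulLeftCLM ℂ (fun x => latMult φ j (P x))
        (SchwartzMap.smulLeftCLM ℂ (fun x => latMult φ' j (P x))
          (multT (fun η => latSymb χ' k (P η)) ψ))))
      (multT (fun η => latSymb χ k (P η)) ψ) := by
  have h1 : ∀ (j : Fin n → ℤ) (u : 𝓢(E, ℂ)),
      SchwartzMap.smulLeftCLM ℂ (fun x => latMult φ j (P x))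
        (SchwartzMap.smulLeftCLM ℂ (fun x => latMult φ' j (P x)) u) =
      SchwartzMap.smulLeftCLM ℂ (fun x => latMult φ j (P x)) u := fun j u => by
    rw [SchwartzMap.smulLeftCLM_smulLeftCLM_apply (hφ.isBump.comp_sub_clm_temperate P j)
      (hφ'.comp_sub_clm_temperate P j)]
    congr 2
    funext x
    simp only [Pi.mul_apply, latMult]
    exact_mod_cast h _
  simp_rw [h1]
  have h2 : multT (fun η => latSymb χ k (P η)) (multT (fun η => latSymb χ' k (P η)) ψ) =
      multT (fun η => latSymb χ k (P η)) ψ := by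
    rw [multT_multT (hχ.latSymb_comp_temperate P k) (hχ'.latSymb_comp_temperate P k)]
    congr 2
    funext x
    simp only [Pi.mul_apply, latSymb]
    exact_mod_cast h' _
  rw [← h2]
  exact (multT (fun η => latSymb χ k (P η))).hasSum (hφ.hasSum_smulLeft P _)

end Resolution

/-- The sum of the translates of `φ` to the points of `K`. -/
def thicken (K : Finset (Fin n → ℤ)) (φ : Space n → ℝ) (x : Space n) : ℝ :=
  ∑ l ∈ K, φ (x - latticePoint l)

theorem IsBump.thicken {φ : Space n → ℝ} (hφ : IsBump φ) (K : Finset (Fin n → ℤ)) :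
    IsBump (WavePacket.thicken K φ) := by
  classical
  refine ⟨ContDiff.sum fun l _ => (hφ.translate l).contDiff, ?_⟩
  induction K using Finset.induction_on with
  | empty => exact HasCompactSupport.intro isCompact_empty fun x _ => by simp [WavePacket.thicken]
  | insert l K hl ih =>
    have : WavePacket.thicken (insert l K) φ =
        fun x => φ (x - latticePoint l) + WavePacket.thicken K φ x := by
      funext x
      simp [WavePacket.thicken, Finset.sum_insert hl]
    rw [this]
    exact (hφ.translate l).hasCompactSupport.add ih

/-- On the support of `φ`, contained in a ball of radius `R`, only translates by lattice vectors of
length at most `2R` are nonzero, and these already add up to one. -/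
theorem IsUnitPartition.exists_thicken {φ : Space n → ℝ} (hφ : IsUnitPartition φ) :
    ∃ K, ∀ x, φ x * thicken K φ x = φ x := by
  obtain ⟨R, hR, hb⟩ := hφ.isBump.exists_bound
  refine ⟨(finite_latticePoint_norm_le (n := n) (R + R)).toFinset, fun x => ?_⟩
  by_cases hx : φ x = 0
  · simp [hx]
  have h : HasSum (fun l => φ (x - latticePoint l))
      (thicken (finite_latticePoint_norm_le (n := n) (R + R)).toFinset φ x) := by
    refine hasSum_sum_of_ne_finset_zero fun l hl => ?_
    by_contra hne
    refine hl ?_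
    rw [Set.Finite.mem_toFinset, mem_ofPred_eq]
    have h1 := norm_sub_le x (x - latticePoint l)
    rw [sub_sub_cancel] at h1
    linarith [hb _ hx, hb _ hne]
  rw [h.unique (hφ.hasSum_translates x), mul_one]

/-! ### Localization of distributions on space-time -/

/-- The projection of space-time to space. -/
def sndL : SpaceTime n →L[ℝ] Space n :=
  (ContinuousLinearMap.snd ℝ ℝ (Space n)) ∘L (WithLp.prodContinuousLinearEquiv 2 ℝ ℝ
    (Space n)).toContinuousLinearMap

/-- The operator `locT` on the slices of functions of space-time. -/
def locTS (φ χ : Space n → ℝ) (k j : Fin n → ℤ) : 𝓢(SpaceTime n, ℂ) →L[ℂ] 𝓢(SpaceTime n, ℂ) :=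
  multT (fun p => latSymb χ k p.snd) ∘L SchwartzMap.smulLeftCLM ℂ fun p => latMult φ j p.snd

/-- The operator `synT` on the slices of functions of space-time. -/
def synTS (φ χ : Space n → ℝ) (k j : Fin n → ℤ) : 𝓢(SpaceTime n, ℂ) →L[ℂ] 𝓢(SpaceTime n, ℂ) :=
  (SchwartzMap.smulLeftCLM ℂ fun p => latMult φ j p.snd) ∘L multT (fun p => latSymb χ k p.snd)

theorem slice_locTS {φ χ : Space n → ℝ} (hφ : IsBump φ) (hχ : IsBump χ) (k j : Fin n → ℤ) (t : ℝ) (ψ : 𝓢(SpaceTime n, ℂ)) :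
    slice t (locTS φ χ k j ψ) = locT φ χ k j (slice t ψ) := by
  rw [locTS, locT, ContinuousLinearMap.comp_apply, ContinuousLinearMap.comp_apply,
    slice_multT (hχ.latSymb_temperate k), slice_smulLeft (hφ.latMult_temperate j)]

theorem slice_synTS {φ χ : Space n → ℝ} (hφ : IsBump φ) (hχ : IsBump χ) (k j : Fin n → ℤ) (t : ℝ) (ψ : 𝓢(SpaceTime n, ℂ)) :
    slice t (synTS φ χ k j ψ) = synT φ χ k j (slice t ψ) := by
  rw [synTS, synT, ContinuousLinearMap.comp_apply, ContinuousLinearMap.comp_apply,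
    slice_smulLeft (hφ.latMult_temperate j), slice_multT (hχ.latSymb_temperate k)]

/-- Composition of a distribution with an operator on test functions. -/
abbrev pull {E : Type*} [NormedAddCommGroup E] [NormedSpace ℝ E] (T : 𝓢(E, ℂ) →L[ℂ] 𝓢(E, ℂ)) :
    𝓢'(E, ℂ) →L[ℂ] 𝓢'(E, ℂ) :=
  PointwiseConvergenceCLM.precomp ℂ T

theorem schrodingerTest_multT {m : Space n → ℂ} (hm : m.HasTemperateGrowth)
    (ψ : 𝓢(SpaceTime n, ℂ)) : schrodingerTest (multT (fun p => m p.snd) ψ) =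
      multT (fun p => m p.snd) (schrodingerTest ψ) := by
  refine ext_slice fun t => ?_
  rw [slice_schrodingerTest, slice_multT hm, slice_multT hm, slice_schrodingerTest,
    multT_comm hm (schrodingerSymbol_temperate t)]

theorem spaceLocST_schrodingerST_freqLocST (φ : Space n → ℝ) {χ : Space n → ℝ} (hχ : IsBump χ)
    (k j : Fin n → ℤ) (f : 𝓢'(SpaceTime n, ℂ)) :
    spaceLocST φ j (schrodingerST (freqLocST χ k f)) = pull (locTS φ χ k j) (schrodingerST f) := by
  ext ψ
  have h := schrodingerTest_multT (hχ.latSymb_temperate k)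
    (SchwartzMap.smulLeftCLM ℂ (fun p => latMult φ j p.snd) ψ)
  exact (congrArg f h).symm

theorem spaceLoc_schrodinger_freqLoc (φ : Space n → ℝ) {χ : Space n → ℝ} (hχ : IsBump χ)
    (k j : Fin n → ℤ) (t : ℝ) (u : 𝓢'(Space n, ℂ)) :
    spaceLoc φ j (schrodinger t (freqLoc χ k u)) = pull (locT φ χ k j) (schrodinger t u) := by
  ext ψ
  have h := multT_comm (hχ.latSymb_temperate k) (schrodingerSymbol_temperate t)
    (SchwartzMap.smulLeftCLM ℂ (latMult φ j) ψ)
  exact congrArg u h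

/-- The flow commutes with the frequency localization and can be applied first. The norm becomes one
`ℓ²` sum over phase space cells, the form in which it is estimated. -/
theorem ysNorm_eq (φ : Space n → ℝ) {χ : Space n → ℝ} (hχ : IsBump χ) (s : ℝ)
    (f : 𝓢'(SpaceTime n, ℂ)) : ysNorm φ χ s f = l2Sum fun i : (Fin n → ℤ) × (Fin n → ℤ) =>
      weight s i.1 * du2L2Norm (pull (locTS φ χ i.1 i.2) (schrodingerST f)) := by
  rw [ysNorm, ← l2Sum_prod fun k j => weight s k *
    du2L2Norm (pull (locTS φ χ k j) (schrodingerST f))]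
  simp_rw [l2Sum_mul, yNorm, spaceLocST_schrodingerST_freqLocST φ hχ]

theorem xsNorm_eq (φ : Space n → ℝ) {χ : Space n → ℝ} (hχ : IsBump χ) (s : ℝ)
    (u : ℝ → 𝓢'(Space n, ℂ)) : xsNorm φ χ s u = l2Sum fun i : (Fin n → ℤ) × (Fin n → ℤ) =>
      weight s i.1 * v2L2Norm fun t => pull (locT φ χ i.1 i.2) (schrodinger t (u t)) := by
  rw [xsNorm, ← l2Sum_prod fun k j => weight s k *
    v2L2Norm fun t => pull (locT φ χ k j) (schrodinger t (u t))]
  simp_rw [l2Sum_mul, xNorm, spaceLoc_schrodinger_freqLoc φ hχ]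

/-- A distribution that is synthesized from localized pieces is bounded by these pieces. -/
theorem exists_synthesis_bound (s : ℝ) {φ χ φ₂ χ₂ : Space n → ℝ} (hφ : IsBump φ) (hχ : IsBump χ)
    (hφ₂ : IsBump φ₂) (hχ₂ : IsBump χ₂) : ∃ C : ℝ≥0∞, C ≠ ⊤ ∧
      ∀ (f : 𝓢'(SpaceTime n, ℂ)) (g : (Fin n → ℤ) × (Fin n → ℤ) → 𝓢'(SpaceTime n, ℂ))
        (G : (Fin n → ℤ) → 𝓢'(SpaceTime n, ℂ)), (∀ i, du2L2Norm (g i) < ⊤) →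
        (∀ k ψ, HasSum (fun j => g (k, j) (synTS φ₂ χ₂ k j ψ)) (G k ψ)) →
        (∀ ψ, HasSum (fun k => G k ψ) (schrodingerST f ψ)) →
        ysNorm φ χ s f ≤ C * l2Sum fun i => weight s i.1 * du2L2Norm (g i) := by
  obtain ⟨K₀, τ, hτ, hK, hsum, hb⟩ := exists_almost_orthogonality hφ hχ hφ₂ hχ₂
  set c : (Fin n → ℤ) → ℝ := fun l => (2 * (1 + ‖latticePoint l‖ ^ 2)) ^ (|s| / 2)
  -- The kernel for Young's inequality: the almost orthogonality coefficient times the cost of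
  -- moving the weight from `k` to `k'`. Its sum is finite because `τ` lives on finitely many
  -- frequency differences.
  set T : (Fin n → ℤ) × (Fin n → ℤ) → ℝ≥0∞ := fun i =>
    ENNReal.ofReal (c i.1) * ENNReal.ofReal (τ i.1 i.2)
  refine ⟨∑' i, T i, ?_, fun f g G hg hG hf => ?_⟩
  · have h1 : ∀ l, ∑' m, T (l, m) = ENNReal.ofReal (c l) * ENNReal.ofReal (∑' m, τ l m) := by
      intro l
      rw [ENNReal.ofReal_tsum_of_nonneg (hτ l) (hsum l)]
      simp only [T, ENNReal.tsum_mul_left]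
    rw [ENNReal.tsum_prod']
    simp_rw [h1]
    rw [tsum_eq_sum (s := K₀)]
    · exact ENNReal.sum_ne_top.2 fun l _ => ENNReal.mul_ne_top ENNReal.ofReal_ne_top
        ENNReal.ofReal_ne_top
    · intro l hl
      simp [hK l hl]
  rw [ysNorm_eq φ hχ]
  refine le_trans (l2Sum_mono fun i' => ?_) (l2Sum_convolution_le T _)
  have h1 : ∀ k j, du2L2Norm (pull (synTS φ₂ χ₂ k j ∘L locTS φ χ i'.1 i'.2) (g (k, j))) ≤
      ENNReal.ofReal (τ (i'.1 - k) (i'.2 - j)) * du2L2Norm (g (k, j)) := fun k j => by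
    refine du2L2Norm_comp_operator_le (T := synT φ₂ χ₂ k j ∘L locT φ χ i'.1 i'.2)
      (fun t ψ => ?_) (hτ _ _) (hb k j i'.1 i'.2) (hg _)
    rw [ContinuousLinearMap.comp_apply, ContinuousLinearMap.comp_apply, slice_synTS hφ₂ hχ₂,
      slice_locTS hφ hχ]
  have h2 : ∀ k, du2L2Norm (pull (locTS φ χ i'.1 i'.2) (G k)) ≤
      ∑' j, ENNReal.ofReal (τ (i'.1 - k) (i'.2 - j)) * du2L2Norm (g (k, j)) := fun k =>
    (du2L2Norm_le_tsum fun ψ => hG k (locTS φ χ i'.1 i'.2 ψ)).trans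
      (ENNReal.tsum_le_tsum fun j => h1 k j)
  have h3 : du2L2Norm (pull (locTS φ χ i'.1 i'.2) (schrodingerST f)) ≤
      ∑' k, ∑' j, ENNReal.ofReal (τ (i'.1 - k) (i'.2 - j)) * du2L2Norm (g (k, j)) :=
    (du2L2Norm_le_tsum (g := fun k => pull (locTS φ χ i'.1 i'.2) (G k))
      (f := pull (locTS φ χ i'.1 i'.2) (schrodingerST f))
      fun ψ => hf (locTS φ χ i'.1 i'.2 ψ)).trans (ENNReal.tsum_le_tsum h2)
  refine (mul_le_mul_right h3 (weight s i'.1)).trans ?_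
  rw [ENNReal.tsum_prod', ← ENNReal.tsum_mul_left]
  refine ENNReal.tsum_le_tsum fun k => ?_
  rw [← ENNReal.tsum_mul_left]
  refine ENNReal.tsum_le_tsum fun j => ?_
  calc weight s i'.1 * (ENNReal.ofReal (τ (i'.1 - k) (i'.2 - j)) * du2L2Norm (g (k, j)))
      ≤ (ENNReal.ofReal (c (i'.1 - k)) * weight s k) *
        (ENNReal.ofReal (τ (i'.1 - k) (i'.2 - j)) * du2L2Norm (g (k, j))) := by
        gcongr
        exact weight_le s k i'.1
    _ = T (i' - (k, j)) * (weight s k * du2L2Norm (g (k, j))) := by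
        simp only [T, Prod.fst_sub, Prod.snd_sub]
        ring

end

section

/-! ### Fourier multipliers on Schwartz functions -/

variable {n : ℕ}

/-- The Fourier multiplier with symbol `m`. -/
abbrev multF (m : Space n → ℂ) : 𝓢(Space n, ℂ) →L[ℂ] 𝓢(Space n, ℂ) :=
  SchwartzMap.fourierMultiplierCLM ℂ m

theorem coe_multF {m : Space n → ℂ} (hm : m.HasTemperateGrowth) (h ψ : 𝓢(Space n, ℂ)) :
    ((multF m h : 𝓢(Space n, ℂ)) : 𝓢'(Space n, ℂ)) ψ = (h : 𝓢'(Space n, ℂ)) (multT m ψ) := by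
  have h1 := TemperedDistribution.fourierMultiplierCLM_toTemperedDistributionCLM_eq hm h
  exact (DFunLike.congr_fun h1 ψ).symm

theorem coe_smulLeft {m : Space n → ℂ} (hm : m.HasTemperateGrowth) (h ψ : 𝓢(Space n, ℂ)) :
    ((SchwartzMap.smulLeftCLM ℂ m h : 𝓢(Space n, ℂ)) : 𝓢'(Space n, ℂ)) ψ =
      (h : 𝓢'(Space n, ℂ)) (SchwartzMap.smulLeftCLM ℂ m ψ) := by
  rw [SchwartzMap.coe_apply, SchwartzMap.coe_apply]
  simp only [SchwartzMap.smulLeftCLM_apply_apply hm, smul_eq_mul]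
  congr 1 with x
  ring

/-- A multiplier and its transpose differ by a reflection of the symbol. The symbols of `e^{itΔ}`
and `⟨D⟩^s` are even. -/
theorem multF_eq_multT {m : Space n → ℂ} (hm : m.HasTemperateGrowth) (he : ∀ η, m (-η) = m η)
    (h : 𝓢(Space n, ℂ)) : multF m h = multT m h := by
  ext x
  rw [SchwartzMap.fourierMultiplierCLM_apply, multT_apply, SchwartzMap.fourierInv_coe,
    SchwartzMap.fourier_coe, Real.fourierInv_eq_fourier_comp_neg]
  refine congrArg (fun f : Space n → ℂ => 𝓕 f x) (funext fun y => ?_)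
  rw [SchwartzMap.smulLeftCLM_apply_apply hm, SchwartzMap.smulLeftCLM_apply_apply hm, he,
    SchwartzMap.fourier_coe, SchwartzMap.fourierInv_coe, Real.fourierInv_eq_fourier_neg]

theorem norm_toLp_multF (m : Space n → ℂ) (h : 𝓢(Space n, ℂ)) :
    ‖((multF m h).toLp 2 : L2 n)‖ = ‖((SchwartzMap.smulLeftCLM ℂ m (𝓕 h)).toLp 2 : L2 n)‖ := by
  rw [SchwartzMap.fourierMultiplierCLM_apply, ← SchwartzMap.norm_fourier_toL2_eq,
    FourierTransform.fourier_fourierInv_eq]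

/-- The operator `e^{itΔ}` on Schwartz functions. -/
def expT (t : ℝ) : 𝓢(Space n, ℂ) →L[ℂ] 𝓢(Space n, ℂ) := multT (schrodingerSymbol t)

theorem expT_neg_expT (t : ℝ) (h : 𝓢(Space n, ℂ)) : expT t (expT (-t) h) = h := by
  rw [expT, expT, multT_multT (schrodingerSymbol_temperate _) (schrodingerSymbol_temperate _)]
  have : (schrodingerSymbol t * schrodingerSymbol (-t) : Space n → ℂ) = fun _ => 1 := by
    funext η
    simp only [Pi.mul_apply, schrodingerSymbol, ← Complex.exp_add]
    simp
  rw [this, multT_apply, SchwartzMap.smulLeftCLM_const, one_smul,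
    ContinuousLinearMap.id_apply, FourierTransform.fourier_fourierInv_eq]

theorem coe_expT (t : ℝ) (h ψ : 𝓢(Space n, ℂ)) :
    ((expT t h : 𝓢(Space n, ℂ)) : 𝓢'(Space n, ℂ)) ψ = (h : 𝓢'(Space n, ℂ)) (expT t ψ) := by
  rw [expT, ← coe_multF (schrodingerSymbol_temperate t),
    multF_eq_multT (schrodingerSymbol_temperate t) fun η => by simp [schrodingerSymbol]]

/-- The localization to the frequency `k` and then to the point `j`. -/
def locF (φ χ : Space n → ℝ) (k j : Fin n → ℤ) : 𝓢(Space n, ℂ) →L[ℂ] 𝓢(Space n, ℂ) :=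
  SchwartzMap.smulLeftCLM ℂ (latMult φ j) ∘L multF (latSymb χ k)

/-- The localization to the point `j` and then to the frequency `k`. -/
def synF (φ χ : Space n → ℝ) (k j : Fin n → ℤ) : 𝓢(Space n, ℂ) →L[ℂ] 𝓢(Space n, ℂ) :=
  multF (latSymb χ k) ∘L SchwartzMap.smulLeftCLM ℂ (latMult φ j)

theorem coe_locF {φ χ : Space n → ℝ} (hφ : IsBump φ) (hχ : IsBump χ) (k j : Fin n → ℤ)
    (h ψ : 𝓢(Space n, ℂ)) : ((locF φ χ k j h : 𝓢(Space n, ℂ)) : 𝓢'(Space n, ℂ)) ψ =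
      (h : 𝓢'(Space n, ℂ)) (locT φ χ k j ψ) := by
  rw [locF, ContinuousLinearMap.comp_apply, coe_smulLeft (hφ.latMult_temperate j),
    coe_multF (hχ.latSymb_temperate k)]
  rfl

theorem coe_synF {φ χ : Space n → ℝ} (hφ : IsBump φ) (hχ : IsBump χ) (k j : Fin n → ℤ)
    (h ψ : 𝓢(Space n, ℂ)) : ((synF φ χ k j h : 𝓢(Space n, ℂ)) : 𝓢'(Space n, ℂ)) ψ =
      (h : 𝓢'(Space n, ℂ)) (synT φ χ k j ψ) := by
  rw [synF, ContinuousLinearMap.comp_apply, coe_multF (hχ.latSymb_temperate k),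
    coe_smulLeft (hφ.latMult_temperate j)]
  rfl

/-! ### The distributions `δ(t - t₀) h(x)` -/

/-- The distribution `δ(t - t₀) h(x)` is linear in `h`. -/
def instantL (t : ℝ) : 𝓢(Space n, ℂ) →ₗ[ℂ] 𝓢'(SpaceTime n, ℂ) :=
  (PointwiseConvergenceCLM.precomp ℂ (slice t)).toLinearMap ∘ₗ
    (SchwartzMap.toTemperedDistributionCLM (Space n) ℂ volume).toLinearMap

theorem instant_apply (t : ℝ) (h : 𝓢(Space n, ℂ)) (ψ : 𝓢(SpaceTime n, ℂ)) :
    instant t h ψ = (h : 𝓢'(Space n, ℂ)) (slice t ψ) := rfl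

theorem schrodingerST_instant (t : ℝ) (h : 𝓢(Space n, ℂ)) :
    schrodingerST (instant t h) = instant t (expT t h) := by
  ext ψ
  rw [instant_apply, coe_expT, expT, ← slice_schrodingerTest]
  rfl

theorem pull_locTS_instant {φ χ : Space n → ℝ} (hφ : IsBump φ) (hχ : IsBump χ) (k j : Fin n → ℤ)
    (t : ℝ) (h : 𝓢(Space n, ℂ)) :
    pull (locTS φ χ k j) (instant t h) = instant t (locF φ χ k j h) := by
  ext ψ
  rw [instant_apply, coe_locF hφ hχ, ← slice_locTS hφ hχ]
  rfl

theorem pull_synTS_instant {φ χ : Space n → ℝ} (hφ : IsBump φ) (hχ : IsBump χ) (k j : Fin n → ℤ)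
    (t : ℝ) (h : 𝓢(Space n, ℂ)) :
    pull (synTS φ χ k j) (instant t h) = instant t (synF φ χ k j h) := by
  ext ψ
  rw [instant_apply, coe_synF hφ hχ, ← slice_synTS hφ hχ]
  rfl

theorem instant_mem_unitTimeDistributions {t : ℝ} (ht : t ∈ Icc (0 : ℝ) 1) (h : 𝓢(Space n, ℂ)) :
    instant t h ∈ unitTimeDistributions n := by
  intro ψ hψ
  have : slice t ψ = 0 := by
    ext x
    by_contra hne
    exact hψ (subset_tsupport _ hne) ht
  rw [instant_apply, this, map_zero]

/-! ### Sobolev bounds -/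

theorem enorm_toLp_rpow_two (h : 𝓢(Space n, ℂ)) :
    ‖(h.toLp 2 : L2 n)‖ₑ ^ (2 : ℝ) = ∫⁻ x, ‖h x‖ₑ ^ (2 : ℝ) := by
  have h1 := eLpNorm_nnreal_pow_eq_lintegral (f := ⇑h) (μ := (volume : Measure (Space n)))
    (p := 2) (by norm_num)
  rw [Lp.enorm_def, eLpNorm_congr_ae (h.coeFn_toLp 2 volume)]
  exact h1

/-- Tonelli: a pointwise bound for the square function integrates to a bound in `L²`. -/
theorem l2Sum_enorm_toLp_le {κ : Type*} [Countable κ] (w : κ → ℝ≥0∞) (a : κ → 𝓢(Space n, ℂ))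
    (v : 𝓢(Space n, ℂ)) {B : ℝ≥0∞}
    (h : ∀ x, ∑' j, (w j * ‖a j x‖ₑ) ^ (2 : ℝ) ≤ (B * ‖v x‖ₑ) ^ (2 : ℝ)) :
    l2Sum (fun j => w j * ‖((a j).toLp 2 : L2 n)‖ₑ) ≤ B * ‖(v.toLp 2 : L2 n)‖ₑ := by
  have h2 : (0 : ℝ) ≤ 2 := by norm_num
  rw [l2Sum_le_iff]
  simp only [ENNReal.mul_rpow_of_nonneg _ _ h2, enorm_toLp_rpow_two] at h ⊢
  have hm : ∀ g : 𝓢(Space n, ℂ), Measurable fun x => ‖g x‖ₑ ^ (2 : ℝ) := fun g =>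
    (g.continuous.measurable.enorm).pow_const _
  simp_rw [← lintegral_const_mul _ (hm _)]
  rw [← lintegral_tsum fun j => ((hm _).const_mul _).aemeasurable]
  exact lintegral_mono h

theorem IsBump.exists_tsum_le {φ : Space n → ℝ} (hφ : IsBump φ) : ∃ B : ℝ≥0∞, B ≠ ⊤ ∧
    ∀ x, ∑' j : Fin n → ℤ, ‖latMult φ j x‖ₑ ^ (2 : ℝ) ≤ B ^ (2 : ℝ) := by
  obtain ⟨R, hR, hb⟩ := hφ.exists_bound
  obtain ⟨M, hM⟩ := hφ.hasCompactSupport.exists_bound_of_continuous hφ.contDiff.continuous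
  set K := (finite_latticePoint_norm_le (n := n) (R + R)).toFinset
  set Q : ℝ≥0∞ := (K.card : ℝ≥0∞) * ENNReal.ofReal M ^ (2 : ℝ)
  refine ⟨Q ^ (1 / 2 : ℝ), ?_, fun x => ?_⟩
  · exact ENNReal.rpow_ne_top_of_nonneg (by norm_num) (ENNReal.mul_ne_top (by simp)
      (ENNReal.rpow_ne_top_of_nonneg (by norm_num) ENNReal.ofReal_ne_top))
  rw [← ENNReal.rpow_mul, show (1 / 2 : ℝ) * 2 = 1 by norm_num, ENNReal.rpow_one]
  by_cases hx : ∀ j : Fin n → ℤ, φ (x - latticePoint j) = 0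
  · simp [latMult, hx]
  push Not at hx
  obtain ⟨j₁, hj₁⟩ := hx
  -- The sum is recentred at one translate `j₁` that is active at `x`; every other active one
  -- differs from it by a lattice vector of length at most `2R`.
  rw [← (Equiv.addLeft j₁).tsum_eq, tsum_eq_sum (s := K)]
  · refine (Finset.sum_le_card_nsmul K _ (ENNReal.ofReal M ^ (2 : ℝ)) fun l _ => ?_).trans_eq
      (nsmul_eq_mul _ _)
    gcongr
    rw [latMult, ← ofReal_norm]
    refine ENNReal.ofReal_le_ofReal ?_
    rw [Complex.norm_real]
    exact hM _
  · intro l hl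
    have h0 : φ (x - latticePoint (j₁ + l)) = 0 := by
      by_contra hne
      refine hl ?_
      rw [Set.Finite.mem_toFinset, mem_ofPred_eq]
      have h1 := norm_sub_le (x - latticePoint j₁) (x - latticePoint (j₁ + l))
      rw [latticePoint_add, sub_sub_sub_cancel_left, add_sub_cancel_left] at h1
      rw [latticePoint_add] at hne
      linarith [hb _ hj₁, hb _ hne]
    simp [latMult, h0]

/-- The symbol `⟨ξ⟩^s`. -/
def sobolevSymbol (s : ℝ) (η : Space n) : ℂ := (((1 + ‖(2 * Real.pi) • η‖ ^ 2) ^ (s / 2) : ℝ) : ℂ)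

theorem sobolevSymbol_temperate (s : ℝ) : (sobolevSymbol s : Space n → ℂ).HasTemperateGrowth := by
  have h1 := (Function.hasTemperateGrowth_one_add_norm_sq_rpow (Space n) (s / 2)).comp
    ((2 * Real.pi) • ContinuousLinearMap.id ℝ (Space n)).hasTemperateGrowth
  exact Complex.ofRealCLM.hasTemperateGrowth.comp h1

/-- The operator `⟨D⟩^s`. -/
def sobolevT (s : ℝ) : 𝓢(Space n, ℂ) →L[ℂ] 𝓢(Space n, ℂ) := multT (sobolevSymbol s)

/-- On the support of the `k`-th symbol the weight `⟨k⟩^s` is at most a multiple of `⟨ξ⟩^s`, and the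
supports overlap boundedly. -/
theorem exists_weight_symbol_bound (s : ℝ) {χ : Space n → ℝ} (hχ : IsBump χ) : ∃ B : ℝ≥0∞, B ≠ ⊤ ∧
    ∀ η, ∑' k : Fin n → ℤ, (weight s k * ‖latSymb χ k η‖ₑ) ^ (2 : ℝ) ≤
      (B * ‖sobolevSymbol s η‖ₑ) ^ (2 : ℝ) := by
  obtain ⟨B, hB, hsum⟩ := hχ.exists_tsum_le
  obtain ⟨R, hR, hb⟩ := hχ.exists_bound
  set c : ℝ≥0∞ := ENNReal.ofReal ((2 * (1 + R ^ 2)) ^ (|s| / 2))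
  have h2 : (0 : ℝ) ≤ 2 := by norm_num
  refine ⟨c * B, ENNReal.mul_ne_top ENNReal.ofReal_ne_top hB, fun η => ?_⟩
  have hle : ∀ k : Fin n → ℤ, weight s k * ‖latSymb χ k η‖ₑ ≤
      c * ‖sobolevSymbol s η‖ₑ * ‖latSymb χ k η‖ₑ := fun k => by
    by_cases h0 : χ ((2 * Real.pi) • η - latticePoint k) = 0
    · simp [latSymb, h0]
    refine mul_le_mul_left ?_ _
    have h1 := hb _ h0
    rw [norm_sub_rev] at h1
    rw [sobolevSymbol, ← ofReal_norm, Complex.norm_real, Real.norm_of_nonneg (by positivity),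
      weight, ← ENNReal.ofReal_mul (by positivity)]
    refine ENNReal.ofReal_le_ofReal ((rpow_weight_le s (latticePoint k) ((2 * Real.pi) • η)).trans ?_)
    gcongr
  refine (ENNReal.tsum_le_tsum fun k => ENNReal.rpow_le_rpow (hle k) h2).trans ?_
  simp_rw [ENNReal.mul_rpow_of_nonneg _ _ h2, ENNReal.tsum_mul_left]
  have := hsum ((2 * Real.pi) • η)
  calc _ ≤ c ^ (2 : ℝ) * ‖sobolevSymbol s η‖ₑ ^ (2 : ℝ) * B ^ (2 : ℝ) := by
        gcongr
        exact this
    _ = _ := by ring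

theorem l2Sum_locF_le {φ : Space n → ℝ} (hφ : IsBump φ) (χ : Space n → ℝ) {B : ℝ≥0∞}
    (hB : ∀ x, ∑' j : Fin n → ℤ, ‖latMult φ j x‖ₑ ^ (2 : ℝ) ≤ B ^ (2 : ℝ)) (k : Fin n → ℤ)
    (h : 𝓢(Space n, ℂ)) : l2Sum (fun j => ‖((locF φ χ k j h).toLp 2 : L2 n)‖ₑ) ≤
      B * ‖((multF (latSymb χ k) h).toLp 2 : L2 n)‖ₑ := by
  have h2 : (0 : ℝ) ≤ 2 := by norm_num
  have := l2Sum_enorm_toLp_le (fun _ => 1) (fun j => locF φ χ k j h) (multF (latSymb χ k) h)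
    (B := B) fun x => ?_
  · simpa only [one_mul] using this
  · have h3 : ∀ j, ‖locF φ χ k j h x‖ₑ = ‖latMult φ j x‖ₑ * ‖multF (latSymb χ k) h x‖ₑ := by
      intro j
      rw [locF, ContinuousLinearMap.comp_apply,
        SchwartzMap.smulLeftCLM_apply_apply (hφ.latMult_temperate j), smul_eq_mul, enorm_mul]
    simp_rw [one_mul, h3, ENNReal.mul_rpow_of_nonneg _ _ h2, ENNReal.tsum_mul_right]
    gcongr
    exact hB x

theorem enorm_toLp_multF (m : Space n → ℂ) (h : 𝓢(Space n, ℂ)) :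
    ‖((multF m h).toLp 2 : L2 n)‖ₑ =
      ‖((SchwartzMap.smulLeftCLM ℂ m (𝓕 h)).toLp 2 : L2 n)‖ₑ := by
  rw [← ofReal_norm, ← ofReal_norm, norm_toLp_multF]

theorem l2Sum_weight_multF_le (s : ℝ) {χ : Space n → ℝ} (hχ : IsBump χ) {B : ℝ≥0∞}
    (hB : ∀ η, ∑' k : Fin n → ℤ, (weight s k * ‖latSymb χ k η‖ₑ) ^ (2 : ℝ) ≤
      (B * ‖sobolevSymbol s η‖ₑ) ^ (2 : ℝ)) (h : 𝓢(Space n, ℂ)) :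
    l2Sum (fun k => weight s k * ‖((multF (latSymb χ k) h).toLp 2 : L2 n)‖ₑ) ≤
      B * ‖((sobolevT s h).toLp 2 : L2 n)‖ₑ := by
  have h2 : (0 : ℝ) ≤ 2 := by norm_num
  rw [sobolevT, ← multF_eq_multT (sobolevSymbol_temperate s) fun η => by simp [sobolevSymbol]]
  simp_rw [enorm_toLp_multF]
  refine l2Sum_enorm_toLp_le _ _ _ fun η => ?_
  simp only [SchwartzMap.smulLeftCLM_apply_apply (hχ.latSymb_temperate _),
    SchwartzMap.smulLeftCLM_apply_apply (sobolevSymbol_temperate s), smul_eq_mul, enorm_mul,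
    ← mul_assoc]
  simp_rw [ENNReal.mul_rpow_of_nonneg _ ‖(𝓕 h) η‖ₑ h2, ENNReal.tsum_mul_right]
  gcongr
  exact hB η

/-- The localized pieces of a Schwartz function are controlled by a Sobolev norm. -/
theorem exists_sobolev_bound (s : ℝ) {φ χ : Space n → ℝ} (hφ : IsBump φ) (hχ : IsBump χ) :
    ∃ C : ℝ≥0∞, C ≠ ⊤ ∧ ∀ h : 𝓢(Space n, ℂ),
      l2Sum (fun i : (Fin n → ℤ) × (Fin n → ℤ) =>
        weight s i.1 * ‖((locF φ χ i.1 i.2 h).toLp 2 : L2 n)‖ₑ) ≤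
          C * ‖((sobolevT s h).toLp 2 : L2 n)‖ₑ := by
  obtain ⟨B, hB, hsum⟩ := hφ.exists_tsum_le
  obtain ⟨B', hB', hsum'⟩ := exists_weight_symbol_bound s hχ
  refine ⟨B * B', ENNReal.mul_ne_top hB hB', fun h => ?_⟩
  have h0 := l2Sum_prod fun k j => weight s k * ‖((locF φ χ k j h).toLp 2 : L2 n)‖ₑ
  refine h0.ge.trans ?_
  simp_rw [l2Sum_mul]
  have h1 := fun k => mul_le_mul_right (l2Sum_locF_le hφ χ hsum k h) (weight s k)
  refine (l2Sum_mono h1).trans ?_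
  simp_rw [mul_left_comm _ B, l2Sum_mul]
  rw [mul_assoc]
  exact mul_le_mul_right (l2Sum_weight_multF_le s hχ hsum' h) B

end

section

/-! ### Step distributions -/

variable {n : ℕ}

theorem isTimeDeriv_zero : IsTimeDeriv (0 : ℝ → L2 n) 0 := by
  refine isTimeDeriv_iff.2 fun ψ => ?_
  simp

theorem IsTimeDeriv.add {F F' : ℝ → L2 n} {g g' : 𝓢'(SpaceTime n, ℂ)} (h : IsTimeDeriv F g)
    (h' : IsTimeDeriv F' g') : IsTimeDeriv (F + F') (g + g') := by
  have h1 := h.sub (isTimeDeriv_zero.sub h')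
  simpa using h1

theorem IsTimeDeriv.sum {κ : Type*} (S : Finset κ) {F : κ → ℝ → L2 n}
    {g : κ → 𝓢'(SpaceTime n, ℂ)} (h : ∀ m ∈ S, IsTimeDeriv (F m) (g m)) :
    IsTimeDeriv (∑ m ∈ S, F m) (∑ m ∈ S, g m) := by
  classical
  induction S using Finset.induction_on with
  | empty => simpa using isTimeDeriv_zero
  | insert m S hm ih =>
    rw [Finset.sum_insert hm, Finset.sum_insert hm]
    exact (h m (Finset.mem_insert_self _ _)).add (ih fun l hl => h l (Finset.mem_insert_of_mem hl))

theorem stepFunction_of_le {H : Type*} [NormedAddCommGroup H] {K : ℕ} {t : ℕ → ℝ} (ht : Monotone t)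
    (h : ℕ → H) {τ : ℝ} (hτ : t K ≤ τ) : stepFunction K t h τ = h K := by
  cases K with
  | zero => simp [stepFunction, hτ]
  | succ K => rw [stepFunction_succ ht, if_neg hτ.not_gt]

theorem stepFunction_succ_eq_add {H : Type*} [NormedAddCommGroup H] (K : ℕ) {t : ℕ → ℝ}
    (ht : Monotone t) (h : ℕ → H) :
    stepFunction (K + 1) t h = stepFunction K t h + jump (t (K + 1)) (h (K + 1) - h K) := by
  funext τ
  rw [stepFunction_succ ht, Pi.add_apply, jump]
  split_ifs with hτ
  · rw [add_zero]
  · rw [stepFunction_of_le ht _ ((ht K.le_succ).trans (not_lt.1 hτ)), add_sub_cancel]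

/-- The time derivative of the step function with the values `H m`. -/
def stepDist (t : ℕ → ℝ) (H : ℕ → 𝓢(Space n, ℂ)) : ℕ → 𝓢'(SpaceTime n, ℂ)
  | 0 => instant (t 0) (H 0)
  | K + 1 => stepDist t H K + instant (t (K + 1)) (H (K + 1) - H K)

theorem isTimeDeriv_stepDist {t : ℕ → ℝ} (ht : Monotone t) (H : ℕ → 𝓢(Space n, ℂ)) (K : ℕ) :
    IsTimeDeriv (stepFunction K t fun m => ((H m).toLp 2 : L2 n)) (stepDist t H K) := by
  induction K with
  | zero =>
    have : (stepFunction 0 t fun m => ((H m).toLp 2 : L2 n)) = jump (t 0) ((H 0).toLp 2) := by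
      funext τ
      by_cases hτ : τ < t 0
      · simp [stepFunction, jump, hτ]
      · simp [stepFunction, jump, hτ, not_lt.1 hτ]
    rw [this]
    exact isTimeDeriv_jump _ _
  | succ K ih =>
    rw [stepFunction_succ_eq_add K ht]
    have h := isTimeDeriv_jump (t (K + 1)) (H (K + 1) - H K)
    rw [← toL2_apply, map_sub] at h
    exact ih.add h

theorem stepDist_sum (t : ℕ → ℝ) (a : ℕ → 𝓢(Space n, ℂ)) (K : ℕ) :
    stepDist t (fun m => ∑ l ∈ Finset.range (m + 1), a l) K =
      ∑ l ∈ Finset.range (K + 1), instant (t l) (a l) := by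
  induction K with
  | zero => simp [stepDist]
  | succ K ih =>
    rw [stepDist, ih, Finset.sum_range_succ a (K + 1), add_sub_cancel_left,
      Finset.sum_range_succ _ (K + 1)]

theorem pull_locTS_stepDist {φ χ : Space n → ℝ} (hφ : IsBump φ) (hχ : IsBump χ) (k j : Fin n → ℤ)
    (t : ℕ → ℝ) (H : ℕ → 𝓢(Space n, ℂ)) (K : ℕ) :
    pull (locTS φ χ k j) (stepDist t H K) = stepDist t (fun m => locF φ χ k j (H m)) K := by
  induction K with
  | zero => exact pull_locTS_instant hφ hχ k j _ _
  | succ K ih => rw [stepDist, map_add, ih, pull_locTS_instant hφ hχ, map_sub, stepDist]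

theorem ofReal_sqrt_sum {H : Type*} [NormedAddCommGroup H] (h : ℕ → H) (M : ℕ) :
    ENNReal.ofReal (√(∑ m ∈ Finset.range M, ‖h m‖ ^ 2)) = l2Sum fun m : Fin M => ‖h m‖ₑ := by
  rw [l2Sum, tsum_fintype, Fin.sum_univ_eq_sum_range fun m => ‖h m‖ₑ ^ (2 : ℝ), Real.sqrt_eq_rpow,
    ← ENNReal.ofReal_rpow_of_nonneg (Finset.sum_nonneg fun _ _ => by positivity) (by norm_num),
    ENNReal.ofReal_sum_of_nonneg fun _ _ => by positivity]
  congr 1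
  refine Finset.sum_congr rfl fun m _ => ?_
  rw [← ofReal_norm, ENNReal.ofReal_rpow_of_nonneg (norm_nonneg _) (by norm_num), Real.rpow_two]

theorem u2Norm_stepFunction_le {H : Type*} [NormedAddCommGroup H] [NormedSpace ℂ H] {t : ℕ → ℝ}
    (ht : Monotone t) (h : ℕ → H) (K : ℕ) :
    u2Norm (stepFunction K t h) ≤ l2Sum fun m : Fin (K + 1) => ‖h m‖ₑ :=
  (u2Norm_le_of_isStep (isStep_stepFunction ht h)).trans_eq (ofReal_sqrt_sum h (K + 1))

theorem l2Sum_lt_top {ι : Type*} [Fintype ι] {a : ι → ℝ≥0∞} (ha : ∀ i, a i < ⊤) : l2Sum a < ⊤ := by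
  rw [l2Sum, tsum_fintype]
  exact ENNReal.rpow_lt_top_of_nonneg (by norm_num) (ENNReal.sum_lt_top.2 fun i _ =>
    ENNReal.rpow_lt_top_of_nonneg (by norm_num) (ha i).ne).ne

theorem du2L2Norm_stepDist_le {t : ℕ → ℝ} (ht : Monotone t) (H : ℕ → 𝓢(Space n, ℂ)) (K : ℕ) :
    du2L2Norm (stepDist t H K) ≤ l2Sum fun m : Fin (K + 1) => ‖((H m).toLp 2 : L2 n)‖ₑ := by
  exact (isTimeDeriv_stepDist ht H K).du2L2Norm_le.trans (u2Norm_stepFunction_le ht _ K)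

theorem l2Sum_comm {ι κ : Type*} (a : ι → κ → ℝ≥0∞) :
    l2Sum (fun i => l2Sum (a i)) = l2Sum fun j => l2Sum fun i => a i j := by
  rw [l2Sum_prod, l2Sum_prod fun j i => a i j, ← l2Sum_comp_equiv (Equiv.prodComm κ ι)]
  rfl

/-- The norm in `Y^s` of a distribution that becomes a step distribution under `e^{itΔ}`. -/
theorem exists_stepDist_bound (s : ℝ) {φ χ : Space n → ℝ} (hφ : IsBump φ) (hχ : IsBump χ) :
    ∃ C : ℝ≥0∞, C ≠ ⊤ ∧ ∀ (t : ℕ → ℝ) (H : ℕ → 𝓢(Space n, ℂ)) (K : ℕ) (f : 𝓢'(SpaceTime n, ℂ)),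
      Monotone t → schrodingerST f = stepDist t H K →
        ysNorm φ χ s f ≤ C * l2Sum fun m : Fin (K + 1) => ‖((sobolevT s (H m)).toLp 2 : L2 n)‖ₑ := by
  obtain ⟨C, hC, hb⟩ := exists_sobolev_bound s hφ hχ
  refine ⟨C, hC, fun t H K f ht hf => ?_⟩
  rw [ysNorm_eq φ hχ, hf, ← l2Sum_mul]
  have h1 : ∀ i : (Fin n → ℤ) × (Fin n → ℤ),
      weight s i.1 * du2L2Norm (pull (locTS φ χ i.1 i.2) (stepDist t H K)) ≤
        l2Sum fun m : Fin (K + 1) => weight s i.1 *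
          ‖((locF φ χ i.1 i.2 (H m)).toLp 2 : L2 n)‖ₑ := fun i => by
    rw [l2Sum_mul, pull_locTS_stepDist hφ hχ]
    exact mul_le_mul_right (du2L2Norm_stepDist_le ht _ K) _
  refine (l2Sum_mono h1).trans ?_
  -- Exchanging the sums over cells and over steps allows the Sobolev bound to be used for each
  -- value of the step function.
  rw [l2Sum_comm]
  exact l2Sum_mono fun m => hb (H m)

/-- The distributions `δ(t - t₀) h(x)` belong to `Y^s`. -/
theorem ysNorm_instant_lt_top (s : ℝ) {φ χ : Space n → ℝ} (hφ : IsBump φ) (hχ : IsBump χ) (t : ℝ)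
    (h : 𝓢(Space n, ℂ)) : ysNorm φ χ s (instant t h) < ⊤ := by
  obtain ⟨C, hC, hb⟩ := exists_stepDist_bound s hφ hχ
  refine (hb (fun _ => t) (fun _ => expT t h) 0 (instant t h) monotone_const
    (schrodingerST_instant t h)).trans_lt (ENNReal.mul_lt_top hC.lt_top ?_)
  exact l2Sum_lt_top fun _ => enorm_lt_top

/-- The norm of `Y^s` is countably subadditive. -/
theorem ysNorm_le_tsum {κ : Type*} [Countable κ] (s : ℝ) (φ : Space n → ℝ) {χ : Space n → ℝ}
    (hχ : IsBump χ) {g : κ → 𝓢'(SpaceTime n, ℂ)} {f : 𝓢'(SpaceTime n, ℂ)}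
    (h : ∀ ψ, HasSum (fun m => g m ψ) (f ψ)) : ysNorm φ χ s f ≤ ∑' m, ysNorm φ χ s (g m) := by
  simp_rw [ysNorm_eq φ hχ]
  refine le_trans (l2Sum_mono fun i => ?_) (l2Sum_tsum_le _)
  rw [ENNReal.tsum_mul_left]
  refine mul_le_mul_right (du2L2Norm_le_tsum fun ψ => ?_) _
  exact h (schrodingerTest (locTS φ χ i.1 i.2 ψ))

end

section

/-! ### Dyadic Riemann sums -/

section Riemann

open Filter Topology

theorem tendsto_floor_dyadic (t : ℝ) :
    Tendsto (fun m : ℕ => (⌊2 ^ m * t⌋ : ℝ) / 2 ^ m) atTop (𝓝 t) := by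
  have h0 : Tendsto (fun m : ℕ => t - (1 / 2 : ℝ) ^ m) atTop (𝓝 t) := by
    simpa using (tendsto_pow_atTop_nhds_zero_of_lt_one (r := (1 / 2 : ℝ)) (by norm_num)
      (by norm_num)).const_sub t
  refine tendsto_of_tendsto_of_tendsto_of_le_of_le h0 tendsto_const_nhds (fun m => ?_) fun m => ?_
  · have h1 := (Int.lt_floor_add_one ((2 : ℝ) ^ m * t)).le
    have h2 : (0 : ℝ) < 2 ^ m := by positivity
    change t - (1 / 2) ^ m ≤ _
    rw [le_div_iff₀ h2, sub_mul, ← mul_pow]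
    norm_num
    linarith
  · have h2 : (0 : ℝ) < 2 ^ m := by positivity
    change _ / _ ≤ t
    rw [div_le_iff₀ h2, mul_comm t]
    exact Int.floor_le _

theorem measurable_comp_floor_dyadic (θ : ℝ → ℂ) (m : ℕ) :
    Measurable fun t : ℝ => θ ((⌊2 ^ m * t⌋ : ℝ) / 2 ^ m) := by
  have h1 : Measurable fun k : ℤ => θ ((k : ℝ) / 2 ^ m) := measurable_from_top
  exact h1.comp (Int.measurable_floor.comp (measurable_const_mul _))

theorem intervalIntegrable_of_bound {f : ℝ → ℂ} {a b B : ℝ} (hf : AEStronglyMeasurable f volume)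
    (hB : ∀ t, ‖f t‖ ≤ B) : IntervalIntegrable f volume a b := by
  rw [intervalIntegrable_iff, uIoc]
  exact Integrable.of_bound hf.restrict B (ae_of_all _ hB)

theorem integral_comp_floor_dyadic {θ : ℝ → ℂ} {B : ℝ} (hB : ∀ t, ‖θ t‖ ≤ B) (m : ℕ) :
    ∫ t in (0 : ℝ)..1, θ ((⌊2 ^ m * t⌋ : ℝ) / 2 ^ m) =
      ∑ i ∈ Finset.range (2 ^ m), ((2 : ℂ) ^ m)⁻¹ * θ ((i : ℝ) / 2 ^ m) := by
  have h2 : (0 : ℝ) < 2 ^ m := by positivity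
  have h := intervalIntegral.sum_integral_adjacent_intervals (μ := volume) (n := 2 ^ m)
    (f := fun t : ℝ => θ ((⌊2 ^ m * t⌋ : ℝ) / 2 ^ m)) (a := fun i : ℕ => (i : ℝ) / 2 ^ m)
    fun i _ => intervalIntegrable_of_bound (B := B)
      (measurable_comp_floor_dyadic θ m).aestronglyMeasurable fun t => hB _
  simp only [Nat.cast_zero, zero_div, Nat.cast_pow, Nat.cast_ofNat, div_self h2.ne'] at h
  rw [← h]
  refine Finset.sum_congr rfl fun i _ => ?_
  have hle : (i : ℝ) / 2 ^ m ≤ ((i + 1 : ℕ) : ℝ) / 2 ^ m := by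
    gcongr
    exact i.le_succ
  have h3 : EqOn (fun t : ℝ => θ ((⌊2 ^ m * t⌋ : ℝ) / 2 ^ m)) (fun _ => θ ((i : ℝ) / 2 ^ m))
      (Ioo ((i : ℝ) / 2 ^ m) (((i + 1 : ℕ) : ℝ) / 2 ^ m)) := by
    intro t ht
    have h4 : ⌊2 ^ m * t⌋ = (i : ℤ) := by
      rw [Int.floor_eq_iff]
      have h5 := (div_lt_iff₀ h2).1 ht.1
      have h6 := (lt_div_iff₀ h2).1 ht.2
      push_cast at h6 ⊢
      constructor <;> linarith
    simp only [h4, Int.cast_natCast]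
  rw [intervalIntegral.integral_congr_Ioo_of_le hle h3, intervalIntegral.integral_const,
    Complex.real_smul]
  congr 1
  rw [← sub_div]
  push_cast
  rw [add_sub_cancel_left, one_div]

/-- The dyadic Riemann sums of a bounded function with countably many discontinuities converge. -/
theorem tendsto_dyadic_sum {θ : ℝ → ℂ} {B : ℝ} (hB : ∀ t, ‖θ t‖ ≤ B)
    (hc : {t | ¬ContinuousAt θ t}.Countable) :
    IntervalIntegrable θ volume 0 1 ∧
      Tendsto (fun m : ℕ => ∑ i ∈ Finset.range (2 ^ m), ((2 : ℂ) ^ m)⁻¹ * θ ((i : ℝ) / 2 ^ m)) atTop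
        (𝓝 (∫ t in (0 : ℝ)..1, θ t)) := by
  have hlim : ∀ᵐ t ∂volume, Tendsto (fun m : ℕ => θ ((⌊2 ^ m * t⌋ : ℝ) / 2 ^ m)) atTop
      (𝓝 (θ t)) := by
    filter_upwards [hc.ae_notMem volume] with t ht
    exact (not_not.1 ht).tendsto.comp (tendsto_floor_dyadic t)
  -- Measurability of `θ` is not assumed: `θ` is almost everywhere a limit of dyadic step functions.
  have hm : AEStronglyMeasurable θ volume := aestronglyMeasurable_of_tendsto_ae _
    (fun m => (measurable_comp_floor_dyadic θ m).aestronglyMeasurable) hlim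
  refine ⟨intervalIntegrable_of_bound hm hB, ?_⟩
  simp_rw [← integral_comp_floor_dyadic hB]
  refine intervalIntegral.tendsto_integral_filter_of_dominated_convergence (fun _ => B)
    (Eventually.of_forall fun m =>
      (measurable_comp_floor_dyadic θ m).aestronglyMeasurable) (Eventually.of_forall fun m =>
      ae_of_all _ fun t _ => hB _) (by simp) ?_
  filter_upwards [hlim] with t ht _
  exact ht

theorem sum_range_two_mul {M : Type*} [AddCommMonoid M] (F : ℕ → M) (N : ℕ) :
    ∑ l ∈ Finset.range (2 * N), F l = ∑ i ∈ Finset.range N, (F (2 * i) + F (2 * i + 1)) := by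
  induction N with
  | zero => simp
  | succ N ih =>
    rw [show 2 * (N + 1) = 2 * N + 1 + 1 by ring, Finset.sum_range_succ, Finset.sum_range_succ, ih,
      Finset.sum_range_succ, add_assoc]

/-- Consecutive terms combine to increments, each at most `L`, with at most one term left unpaired.
-/
theorem norm_alternating_sum_le {E : Type*} [NormedAddCommGroup E] [NormedSpace ℂ E] {x : ℕ → E}
    {B L : ℝ} (hB : ∀ l, ‖x l‖ ≤ B) (hL : ∀ l, ‖x (l + 1) - x l‖ ≤ L) (M : ℕ) :
    ‖∑ l ∈ Finset.range M, ((-1 : ℂ) ^ (l + 1)) • x l‖ ≤ M * L + B := by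
  have hL0 : 0 ≤ L := (norm_nonneg _).trans (hL 0)
  have hB0 : 0 ≤ B := (norm_nonneg _).trans (hB 0)
  have key : ∀ r : ℕ, ‖∑ l ∈ Finset.range (2 * r), ((-1 : ℂ) ^ (l + 1)) • x l‖ ≤ r * L := fun r => by
    rw [sum_range_two_mul]
    have : ∀ i : ℕ, ((-1 : ℂ) ^ (2 * i + 1)) • x (2 * i) + ((-1 : ℂ) ^ (2 * i + 1 + 1)) • x (2 * i + 1)
        = x (2 * i + 1) - x (2 * i) := fun i => by
      rw [pow_succ ((-1 : ℂ)) (2 * i + 1), pow_succ ((-1 : ℂ)) (2 * i), pow_mul]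
      norm_num
      abel
    simp_rw [this]
    refine (norm_sum_le_of_le _ fun i _ => hL (2 * i)).trans_eq ?_
    simp
  obtain ⟨r, rfl | rfl⟩ := M.even_or_odd'
  · refine (key r).trans ?_
    push_cast
    nlinarith [mul_nonneg (Nat.cast_nonneg (α := ℝ) r) hL0]
  · rw [Finset.sum_range_succ]
    refine (norm_add_le_of_le (key r) (r₂ := B) ?_).trans ?_
    · rw [norm_smul]
      simpa using hB (2 * r)
    · push_cast
      nlinarith [mul_nonneg (Nat.cast_nonneg (α := ℝ) r) hL0]

end Riemann

/-! ### Truncations of Schwartz functions -/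

section Truncation

open Filter Topology

variable {n : ℕ}

/-- The integrand of the pairing of `g` and `ψ`. -/
def slicePairing (g ψ : 𝓢(SpaceTime n, ℂ)) (t : ℝ) : ℂ := l2Pairing (sliceL2 g t) (sliceL2 ψ t)

theorem instant_slice_apply (t : ℝ) (g ψ : 𝓢(SpaceTime n, ℂ)) :
    instant t (slice t g) ψ = slicePairing g ψ t := by
  rw [instant_apply, ← coe_toLp, coe_apply_eq_l2Pairing]
  rfl

theorem exists_norm_sliceL2_bound (ψ : 𝓢(SpaceTime n, ℂ)) :
    ∃ C : ℝ, 0 ≤ C ∧ ∀ t, ‖sliceL2 ψ t‖ ≤ C := by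
  obtain ⟨C, hC, h⟩ := exists_norm_sliceL2_le ψ
  refine ⟨C, hC, fun t => (h t).trans (mul_le_of_le_one_right hC (inv_le_one_of_one_le₀ ?_))⟩
  exact one_le_pow₀ (by linarith [abs_nonneg t])

theorem exists_slicePairing_bound (g ψ : 𝓢(SpaceTime n, ℂ)) :
    ∃ B : ℝ, ∀ t, ‖slicePairing g ψ t‖ ≤ B := by
  obtain ⟨C, hC, h⟩ := exists_norm_sliceL2_bound g
  obtain ⟨C', hC', h'⟩ := exists_norm_sliceL2_bound ψ
  exact ⟨C * C', fun t => (norm_l2Pairing_le _ _).trans (mul_le_mul (h t) (h' t) (norm_nonneg _) hC)⟩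

theorem exists_slicePairing_lipschitz (g ψ : 𝓢(SpaceTime n, ℂ)) :
    ∃ L : ℝ, 0 ≤ L ∧ ∀ s t, ‖slicePairing g ψ s - slicePairing g ψ t‖ ≤ L * |s - t| := by
  obtain ⟨C, hC, h⟩ := exists_norm_sliceL2_bound g
  obtain ⟨C', hC', h'⟩ := exists_norm_sliceL2_bound ψ
  obtain ⟨L, hL, hl⟩ := exists_sliceL2_lipschitz g
  obtain ⟨L', hL', hl'⟩ := exists_sliceL2_lipschitz ψ
  refine ⟨C * L' + L * C', by positivity, fun s t => ?_⟩
  have h1 : slicePairing g ψ s - slicePairing g ψ t =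
      l2Pairing (sliceL2 g s) (sliceL2 ψ s - sliceL2 ψ t) +
        l2Pairing (sliceL2 g s - sliceL2 g t) (sliceL2 ψ t) := by
    simp only [slicePairing, map_sub, sub_apply]
    ring
  rw [h1]
  refine (norm_add_le_of_le ((norm_l2Pairing_le _ _).trans (mul_le_mul (h s) (hl' s t)
    (norm_nonneg _) hC)) ((norm_l2Pairing_le _ _).trans (mul_le_mul (hl s t) (h' t)
    (norm_nonneg _) (by positivity)))).trans_eq (by ring)

theorem continuous_slicePairing (g ψ : 𝓢(SpaceTime n, ℂ)) : Continuous (slicePairing g ψ) := by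
  unfold slicePairing
  have h1 := continuous_sliceL2 g
  have h2 := continuous_sliceL2 ψ
  fun_prop

theorem slicePairing_eq (g ψ : 𝓢(SpaceTime n, ℂ)) (t : ℝ) : slicePairing g ψ t =
    ∫ x : Space n, g (WithLp.toLp 2 (t, x)) * ψ (WithLp.toLp 2 (t, x)) := by
  rw [← instant_slice_apply, instant_apply, SchwartzMap.coe_apply]
  simp only [slice_apply, smul_eq_mul, mul_comm]

theorem isTruncation_iff {g : 𝓢(SpaceTime n, ℂ)} {f : 𝓢'(SpaceTime n, ℂ)} :
    IsTruncation g f ↔ ∀ ψ, f ψ = ∫ t in (0 : ℝ)..1, slicePairing g ψ t := by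
  simp only [IsTruncation, slicePairing_eq]

/-- The dyadic Riemann sums of the truncation of `g` to `[0,1]`. -/
def riemannDist (g : 𝓢(SpaceTime n, ℂ)) (m : ℕ) : 𝓢'(SpaceTime n, ℂ) :=
  ∑ i ∈ Finset.range (2 ^ m), ((2 : ℂ) ^ m)⁻¹ • instant ((i : ℝ) / 2 ^ m) (slice ((i : ℝ) / 2 ^ m) g)

theorem distribution_sum_apply {κ : Type*} (S : Finset κ) (f : κ → 𝓢'(SpaceTime n, ℂ))
    (ψ : 𝓢(SpaceTime n, ℂ)) : (∑ m ∈ S, f m) ψ = ∑ m ∈ S, f m ψ := by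
  classical
  induction S using Finset.induction_on with
  | empty => simp
  | insert m S hm ih =>
    rw [Finset.sum_insert hm, Finset.sum_insert hm, ← ih]
    rfl

theorem riemannDist_apply (g ψ : 𝓢(SpaceTime n, ℂ)) (m : ℕ) : riemannDist g m ψ =
    ∑ i ∈ Finset.range (2 ^ m), ((2 : ℂ) ^ m)⁻¹ * slicePairing g ψ ((i : ℝ) / 2 ^ m) := by
  rw [riemannDist, distribution_sum_apply]
  refine Finset.sum_congr rfl fun i _ => ?_
  rw [← instant_slice_apply]
  rfl

theorem instant_smul (t : ℝ) (c : ℂ) (h : 𝓢(Space n, ℂ)) : instant t (c • h) = c • instant t h :=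
  (instantL t).map_smul c h

theorem dyadic_even (m i : ℕ) : ((2 * i : ℕ) : ℝ) / 2 ^ (m + 1) = (i : ℝ) / 2 ^ m := by
  push_cast
  rw [pow_succ']
  field_simp

/-- The old nodes are the even new ones, with twice the new weight. The difference therefore carries
the weight `-2^{-(m+1)}` at even nodes and `2^{-(m+1)}` at odd ones. -/
theorem riemannDist_succ_sub (g : 𝓢(SpaceTime n, ℂ)) (m : ℕ) :
    riemannDist g (m + 1) - riemannDist g m = ∑ l ∈ Finset.range (2 ^ (m + 1)),
      instant ((l : ℝ) / 2 ^ (m + 1))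
        (((2 : ℂ) ^ (m + 1))⁻¹ • ((-1 : ℂ) ^ (l + 1)) • slice ((l : ℝ) / 2 ^ (m + 1)) g) := by
  simp only [riemannDist, instant_smul]
  rw [pow_succ' 2 m, sum_range_two_mul, sum_range_two_mul, ← Finset.sum_sub_distrib]
  refine Finset.sum_congr rfl fun i _ => ?_
  have h1 : ((2 : ℂ) ^ m)⁻¹ = 2 * ((2 : ℂ) ^ (m + 1))⁻¹ := by
    rw [pow_succ]
    field_simp
  have h2 : (-1 : ℂ) ^ (2 * i + 1) = -1 := by rw [pow_succ, pow_mul]; norm_num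
  have h3 : (-1 : ℂ) ^ (2 * i + 1 + 1) = 1 := by rw [pow_succ, h2]; norm_num
  rw [dyadic_even, h1, h2, h3]
  module

end Truncation

end

section

/-! ### The truncations belong to `Y^s` -/

section TruncationBound

open Filter Topology

variable {n : ℕ}

theorem l2Sum_const (M : ℕ) {b : ℝ} (hb : 0 ≤ b) :
    l2Sum (fun _ : Fin M => ENNReal.ofReal b) = ENNReal.ofReal (√M * b) := by
  have h := ofReal_sqrt_sum (fun _ => b) M
  simp only [Finset.sum_const, Finset.card_range, nsmul_eq_mul, Real.enorm_eq_ofReal hb,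
    Real.norm_eq_abs, sq_abs] at h
  rw [← h, Real.sqrt_mul (Nat.cast_nonneg M), Real.sqrt_sq hb]

theorem schrodingerST_riemannDist_succ_sub (g : 𝓢(SpaceTime n, ℂ)) {m K : ℕ}
    (hK : K + 1 = 2 ^ (m + 1)) :
    schrodingerST (riemannDist g (m + 1) - riemannDist g m) =
      stepDist (fun l : ℕ => (l : ℝ) / 2 ^ (m + 1)) (fun r => ∑ l ∈ Finset.range (r + 1),
        ((2 : ℂ) ^ (m + 1))⁻¹ • ((-1 : ℂ) ^ (l + 1)) •
          slice ((l : ℝ) / 2 ^ (m + 1)) (schrodingerTest g)) K := by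
  rw [riemannDist_succ_sub, stepDist_sum, hK, map_sum]
  refine Finset.sum_congr rfl fun l _ => ?_
  rw [schrodingerST_instant, map_smul, map_smul, slice_schrodingerTest, expT]

/-- After the flow the difference is the derivative of a step function with `2^(m+1)` values. The
alternating signs make each value `O(2^{-(m+1)})` in the Sobolev norm, and the square root of the
number of values leaves `O(2^{-(m+1)/2})`, summable in `m`. -/
theorem exists_riemannDist_bound (s : ℝ) {φ χ : Space n → ℝ} (hφ : IsBump φ) (hχ : IsBump χ)
    (g : 𝓢(SpaceTime n, ℂ)) : ∃ D : ℕ → ℝ≥0∞, ∑' m, D m ≠ ⊤ ∧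
      ∀ m, ysNorm φ χ s (riemannDist g (m + 1) - riemannDist g m) ≤ D m := by
  obtain ⟨C, hC, hb⟩ := exists_stepDist_bound s hφ hχ
  set P : 𝓢(SpaceTime n, ℂ) :=
    multT (fun p : SpaceTime n => sobolevSymbol s p.snd) (schrodingerTest g)
  obtain ⟨B, hB, hPB⟩ := exists_norm_sliceL2_bound P
  obtain ⟨L, hL, hPL⟩ := exists_sliceL2_lipschitz P
  refine ⟨fun m => C * ENNReal.ofReal (((√2) ^ (m + 1))⁻¹ * (L + B)), ?_, fun m => ?_⟩
  · rw [ENNReal.tsum_mul_left]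
    refine ENNReal.mul_ne_top hC (Summable.tsum_ofReal_ne_top ?_)
    refine Summable.mul_right _ ?_
    simp_rw [← inv_pow]
    refine (summable_nat_add_iff 1).2 (summable_geometric_of_lt_one (by positivity)
      (inv_lt_one_of_one_lt₀ ?_))
    exact Real.lt_sqrt_of_sq_lt (by norm_num)
  -- A step distribution with last index `K` has `K + 1` values.
  obtain ⟨K, hK⟩ : ∃ K, K + 1 = 2 ^ (m + 1) := ⟨2 ^ (m + 1) - 1, Nat.sub_add_cancel Nat.one_le_two_pow⟩
  have hd : (0 : ℝ) < 2 ^ (m + 1) := by positivity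
  refine (hb _ _ K _ ?_ (schrodingerST_riemannDist_succ_sub g hK)).trans (mul_le_mul_right ?_ C)
  · intro a b hab
    have : (a : ℝ) ≤ b := Nat.cast_le.2 hab
    dsimp only
    gcongr
  have key : ∀ r < 2 ^ (m + 1), ‖((sobolevT s (∑ l ∈ Finset.range (r + 1),
      ((2 : ℂ) ^ (m + 1))⁻¹ • ((-1 : ℂ) ^ (l + 1)) •
        slice ((l : ℝ) / 2 ^ (m + 1)) (schrodingerTest g))).toLp 2 : L2 n)‖ ≤
          (2 ^ (m + 1))⁻¹ * (L + B) := fun r hr => by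
    have h1 : ((sobolevT s (∑ l ∈ Finset.range (r + 1), ((2 : ℂ) ^ (m + 1))⁻¹ •
        ((-1 : ℂ) ^ (l + 1)) • slice ((l : ℝ) / 2 ^ (m + 1)) (schrodingerTest g))).toLp 2 : L2 n) =
        ((2 : ℂ) ^ (m + 1))⁻¹ • ∑ l ∈ Finset.range (r + 1),
          ((-1 : ℂ) ^ (l + 1)) • sliceL2 P ((l : ℝ) / 2 ^ (m + 1)) := by
      have h2 : ∀ t, sliceL2 P t = toL2 (sobolevT s (slice t (schrodingerTest g))) := fun t => by
        rw [toL2_apply, sliceL2, slice_multT (sobolevSymbol_temperate s), sobolevT]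
      simp only [h2]
      rw [← toL2_apply, ← Finset.smul_sum, map_smul, map_smul, map_sum, map_sum]
      simp only [map_smul]
    rw [h1, norm_smul, norm_inv, norm_pow, Complex.norm_ofNat]
    refine mul_le_mul_of_nonneg_left ?_ (by positivity)
    refine (norm_alternating_sum_le (L := L * (2 ^ (m + 1))⁻¹) (fun l => hPB _) (fun l => ?_)
      (r + 1)).trans ?_
    · refine (hPL _ _).trans_eq ?_
      rw [← sub_div]
      push_cast
      rw [add_sub_cancel_left, one_div, abs_of_pos (by positivity)]
    · have h3 : ((r + 1 : ℕ) : ℝ) ≤ 2 ^ (m + 1) := by exact_mod_cast hr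
      have h4 : ((r + 1 : ℕ) : ℝ) * (L * (2 ^ (m + 1))⁻¹) ≤ 2 ^ (m + 1) * (L * (2 ^ (m + 1))⁻¹) := by
        gcongr
      have h5 : (2 : ℝ) ^ (m + 1) * (L * (2 ^ (m + 1))⁻¹) = L := by field_simp
      linarith
  have h6 : ENNReal.ofReal (((√2) ^ (m + 1))⁻¹ * (L + B)) =
      l2Sum fun _ : Fin (K + 1) => ENNReal.ofReal ((2 ^ (m + 1))⁻¹ * (L + B)) := by
    rw [l2Sum_const _ (by positivity), hK]
    congr 1
    have h7 : (2 : ℝ) ^ (m + 1) = √2 ^ (m + 1) * √2 ^ (m + 1) := by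
      rw [← mul_pow, Real.mul_self_sqrt (by norm_num)]
    have h8 : √((2 ^ (m + 1) : ℕ) : ℝ) = √2 ^ (m + 1) := by
      push_cast
      rw [h7, Real.sqrt_mul_self (by positivity)]
    rw [h8, h7]
    field_simp
  rw [h6]
  refine l2Sum_mono fun r => ?_
  rw [← ofReal_norm]
  exact ENNReal.ofReal_le_ofReal (key r (hK ▸ r.2))

/-- Telescoping identifies the limit, but unconditional summability is required as well. It comes
from the Lipschitz bound on the slice pairing, which makes the differences geometrically small. -/
theorem hasSum_riemannDist {g : 𝓢(SpaceTime n, ℂ)} {f : 𝓢'(SpaceTime n, ℂ)} (hf : IsTruncation g f)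
    (m₀ : ℕ) (ψ : 𝓢(SpaceTime n, ℂ)) :
    HasSum (fun m => (riemannDist g (m₀ + m + 1) - riemannDist g (m₀ + m)) ψ)
      ((f - riemannDist g m₀) ψ) := by
  obtain ⟨L, hL, hl⟩ := exists_slicePairing_lipschitz g ψ
  obtain ⟨B, hB⟩ := exists_slicePairing_bound g ψ
  have hlim : Tendsto (fun m => riemannDist g m ψ) atTop (𝓝 (f ψ)) := by
    simp_rw [riemannDist_apply]
    rw [isTruncation_iff.1 hf ψ]
    refine (tendsto_dyadic_sum hB ?_).2
    convert countable_empty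
    ext t
    simpa using (continuous_slicePairing g ψ).continuousAt
  have hbound : ∀ m, ‖(riemannDist g (m + 1) - riemannDist g m) ψ‖ ≤ L * (1 / 2) ^ m := fun m => by
    have h0 : (riemannDist g (m + 1) - riemannDist g m) ψ =
      riemannDist g (m + 1) ψ - riemannDist g m ψ := rfl
    rw [h0, riemannDist_apply, riemannDist_apply, pow_succ' 2 m, sum_range_two_mul,
      ← Finset.sum_sub_distrib]
    have h1 : ∀ i ∈ Finset.range (2 ^ m),
        ‖((2 : ℂ) ^ (m + 1))⁻¹ * slicePairing g ψ (((2 * i : ℕ) : ℝ) / 2 ^ (m + 1)) +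
          ((2 : ℂ) ^ (m + 1))⁻¹ * slicePairing g ψ (((2 * i + 1 : ℕ) : ℝ) / 2 ^ (m + 1)) -
            ((2 : ℂ) ^ m)⁻¹ * slicePairing g ψ ((i : ℝ) / 2 ^ m)‖ ≤
          (2 ^ m)⁻¹ * (L * (1 / 2) ^ m) := fun i _ => by
      have h2 : ((2 : ℂ) ^ (m + 1))⁻¹ * slicePairing g ψ (((2 * i : ℕ) : ℝ) / 2 ^ (m + 1)) +
          ((2 : ℂ) ^ (m + 1))⁻¹ * slicePairing g ψ (((2 * i + 1 : ℕ) : ℝ) / 2 ^ (m + 1)) -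
            ((2 : ℂ) ^ m)⁻¹ * slicePairing g ψ ((i : ℝ) / 2 ^ m) =
          ((2 : ℂ) ^ (m + 1))⁻¹ * (slicePairing g ψ (((2 * i + 1 : ℕ) : ℝ) / 2 ^ (m + 1)) -
            slicePairing g ψ (((2 * i : ℕ) : ℝ) / 2 ^ (m + 1))) := by
        have h1 : ((2 : ℂ) ^ m)⁻¹ = 2 * ((2 : ℂ) ^ (m + 1))⁻¹ := by
          rw [pow_succ]
          field_simp
        rw [dyadic_even, h1]
        ring
      rw [h2, norm_mul, norm_inv, norm_pow, Complex.norm_ofNat]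
      have h3 := hl (((2 * i + 1 : ℕ) : ℝ) / 2 ^ (m + 1)) (((2 * i : ℕ) : ℝ) / 2 ^ (m + 1))
      have he : |((2 * i + 1 : ℕ) : ℝ) / 2 ^ (m + 1) - ((2 * i : ℕ) : ℝ) / 2 ^ (m + 1)| =
          1 / 2 ^ (m + 1) := by
        rw [← sub_div, Nat.cast_succ, add_sub_cancel_left, abs_of_pos (by positivity)]
      rw [he] at h3
      have h4 : (1 : ℝ) / 2 ^ (m + 1) ≤ (1 / 2) ^ m := by
        rw [← one_div_pow]
        exact pow_le_pow_of_le_one (by norm_num) (by norm_num) m.le_succ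
      have h5 : ((2 : ℝ) ^ (m + 1))⁻¹ ≤ (2 ^ m)⁻¹ :=
        inv_anti₀ (by positivity) (pow_le_pow_right₀ (by norm_num) m.le_succ)
      exact mul_le_mul h5 (h3.trans (mul_le_mul_of_nonneg_left h4 hL)) (norm_nonneg _)
        (by positivity)
    refine (norm_sum_le_of_le _ h1).trans_eq ?_
    rw [Finset.sum_const, Finset.card_range, nsmul_eq_mul, ← mul_assoc]
    push_cast
    rw [mul_inv_cancel₀ (by positivity), one_mul]
  have hs : Summable fun m => (riemannDist g (m₀ + m + 1) - riemannDist g (m₀ + m)) ψ := by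
    refine Summable.of_norm_bounded (g := fun m => L * (1 / 2) ^ (m₀ + m)) ?_ fun m => hbound _
    simp_rw [pow_add, ← mul_assoc]
    exact Summable.mul_left _ (summable_geometric_of_lt_one (by norm_num) (by norm_num))
  refine (hs.hasSum_iff_tendsto_nat).2 ?_
  have htel : ∀ N, ∑ m ∈ Finset.range N, (riemannDist g (m₀ + m + 1) - riemannDist g (m₀ + m)) ψ =
      riemannDist g (m₀ + N) ψ - riemannDist g m₀ ψ := fun N =>
    Finset.sum_range_sub (fun m => riemannDist g (m₀ + m) ψ) N
  simp_rw [htel]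
  refine Tendsto.sub_const ?_ _
  simp_rw [add_comm m₀]
  exact hlim.comp (tendsto_add_atTop_nat m₀)

theorem riemannDist_zero (g : 𝓢(SpaceTime n, ℂ)) : riemannDist g 0 = instant 0 (slice 0 g) := by
  simp [riemannDist]

/-- The Riemann sums converge in `Y^s` to the truncation. -/
theorem IsTruncation.tendsto_riemannDist (s : ℝ) {φ χ : Space n → ℝ} (hφ : IsBump φ)
    (hχ : IsBump χ) {g : 𝓢(SpaceTime n, ℂ)} {f : 𝓢'(SpaceTime n, ℂ)} (hf : IsTruncation g f) :
    Tendsto (fun m => ysNorm φ χ s (f - riemannDist g m)) atTop (𝓝 0) := by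
  obtain ⟨D, hD, hb⟩ := exists_riemannDist_bound s hφ hχ g
  have hD' := ENNReal.tendsto_sum_nat_add D hD
  refine tendsto_of_tendsto_of_tendsto_of_le_of_le tendsto_const_nhds hD' (fun m => zero_le)
    fun m => ?_
  refine (ysNorm_le_tsum s φ hχ (hasSum_riemannDist hf m)).trans (ENNReal.tsum_le_tsum fun k => ?_)
  rw [add_comm k]
  exact hb (m + k)

theorem IsTruncation.ysNorm_lt_top (s : ℝ) {φ χ : Space n → ℝ} (hφ : IsBump φ)
    (hχ : IsBump χ) {g : 𝓢(SpaceTime n, ℂ)} {f : 𝓢'(SpaceTime n, ℂ)} (hf : IsTruncation g f) :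
    ysNorm φ χ s f < ⊤ := by
  obtain ⟨D, hD, hb⟩ := exists_riemannDist_bound s hφ hχ g
  have h1 : ysNorm φ χ s (f - riemannDist g 0) < ⊤ := by
    refine lt_of_le_of_lt ((ysNorm_le_tsum s φ hχ (hasSum_riemannDist hf 0)).trans
      (ENNReal.tsum_le_tsum fun k => ?_)) hD.lt_top
    rw [zero_add]
    exact hb k
  have h2 := (isExtSeminorm_ysNorm φ χ s).add_le (f - riemannDist g 0) (riemannDist g 0)
  rw [sub_add_cancel, riemannDist_zero] at h2
  exact h2.trans_lt (ENNReal.add_lt_top.2 ⟨riemannDist_zero g ▸ h1, ysNorm_instant_lt_top s hφ hχ _ _⟩)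

theorem IsTruncation.mem_unitTimeDistributions {g : 𝓢(SpaceTime n, ℂ)} {f : 𝓢'(SpaceTime n, ℂ)}
    (hf : IsTruncation g f) : f ∈ unitTimeDistributions n := by
  intro ψ hψ
  rw [isTruncation_iff.1 hf, intervalIntegral.integral_congr (g := fun _ => 0)]
  · simp
  intro t ht
  rw [uIcc_of_le zero_le_one] at ht
  dsimp only
  rw [← instant_slice_apply]
  exact instant_mem_unitTimeDistributions ht _ ψ hψ

theorem exists_isTruncation (g : 𝓢(SpaceTime n, ℂ)) : ∃ f, IsTruncation g f := by
  -- The half-open interval agrees with the convention for interval integrals; the time `0` is a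
  -- null set.
  have hS : MeasurableSet {p : SpaceTime n | p.fst ∈ Ioc (0 : ℝ) 1} :=
    measurableSet_Ioc.preimage (WithLp.prod_continuous_ofLp 2 ℝ (Space n)).fst.measurable
  have hm : MemLp ({p : SpaceTime n | p.fst ∈ Ioc (0 : ℝ) 1}.indicator g) 2 volume :=
    (g.memLp 2 volume).indicator hS
  refine ⟨((hm.toLp _ : Lp ℂ 2 (volume : Measure (SpaceTime n))) : 𝓢'(SpaceTime n, ℂ)), fun ψ => ?_⟩
  rw [Lp.toTemperedDistribution_apply]
  have h1 : ∫ p : SpaceTime n, ψ p • (hm.toLp _ : Lp ℂ 2 (volume : Measure (SpaceTime n))) p =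
      ∫ p : SpaceTime n, {p : SpaceTime n | p.fst ∈ Ioc (0 : ℝ) 1}.indicator (fun p => g p * ψ p) p := by
    refine integral_congr_ae ?_
    filter_upwards [hm.coeFn_toLp] with p hp
    rw [hp, smul_eq_mul, mul_comm, Set.indicator_mul_left]
  have hgψ : Integrable (fun p : SpaceTime n => g p * ψ p) :=
    (g.memLp 2 volume).integrable_mul (ψ.memLp 2 volume)
  rw [h1, integral_spaceTime, Measure.volume_eq_prod, integral_prod _ (integrable_toLp (hgψ.indicator hS)),
    intervalIntegral.integral_of_le zero_le_one, ← integral_indicator measurableSet_Ioc]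
  congr 1 with t
  by_cases ht : t ∈ Ioc (0 : ℝ) 1
  · rw [indicator_of_mem ht]
    congr 1 with x
    exact indicator_of_mem (s := {p : SpaceTime n | p.fst ∈ Ioc (0 : ℝ) 1}) ht _
  · rw [indicator_of_notMem ht]
    refine (integral_congr_ae (g := fun _ => 0) (ae_of_all _ fun x => ?_)).trans (integral_zero _ _)
    exact indicator_of_notMem (s := {p : SpaceTime n | p.fst ∈ Ioc (0 : ℝ) 1}) ht _

end TruncationBound

end

section

/-! ### The distributions `δ(t - t₀) h(x)` are dense in `Y^s` -/

variable {n : ℕ}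

theorem IsTimeDeriv.smul {F : ℝ → L2 n} {g : 𝓢'(SpaceTime n, ℂ)} (c : ℂ) (h : IsTimeDeriv F g) :
    IsTimeDeriv (c • F) (c • g) := by
  refine isTimeDeriv_iff.2 fun ψ => ?_
  have h1 := isTimeDeriv_iff.1 h ψ
  have h2 : (fun t => l2Pairing ((c • F) t) (sliceL2 (timeDeriv ψ) t)) =
      fun t => c • l2Pairing (F t) (sliceL2 (timeDeriv ψ) t) := by
    funext t
    rw [Pi.smul_apply, map_smul]
    rfl
  rw [h2, integral_smul, ← smul_neg, ← h1.2]
  exact ⟨h1.1.smul c, rfl⟩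

variable (n) in
/-- The span of the distributions `δ(t - t₀) h(x)` with `t₀ ∈ [0,1]`. -/
def instants : Submodule ℂ 𝓢'(SpaceTime n, ℂ) :=
  Submodule.span ℂ {f | ∃ t ∈ Icc (0 : ℝ) 1, ∃ h : 𝓢(Space n, ℂ), f = instant t h}

theorem exists_instants_of_unitJumps {G : ℝ → L2 n}
    (hG : G ∈ unitJumps (range (toL2 : 𝓢(Space n, ℂ) → L2 n))) :
    ∃ a ∈ instants n, IsTimeDeriv G a := by
  induction hG using Submodule.span_induction with
  | mem x hx =>
    obtain ⟨t, ht, _, ⟨h, rfl⟩, rfl⟩ := hx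
    exact ⟨instant t h, Submodule.subset_span ⟨t, ht, h, rfl⟩, isTimeDeriv_jump t h⟩
  | zero => exact ⟨0, Submodule.zero_mem _, isTimeDeriv_zero⟩
  | add x y _ _ hx hy =>
    obtain ⟨a, ha, h⟩ := hx
    obtain ⟨b, hb, h'⟩ := hy
    exact ⟨a + b, Submodule.add_mem _ ha hb, h.add h'⟩
  | smul c x _ hx =>
    obtain ⟨a, ha, h⟩ := hx
    exact ⟨c • a, Submodule.smul_mem _ c ha, h.smul c⟩

/-- The primitive vanishes before time `0` and is constant from time `1` on, so finite jumps within
`[0,1]` by Schwartz functions approximate it in `U²`. -/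
theorem VanishesOffUnit.exists_instants {g : 𝓢'(SpaceTime n, ℂ)} (hg : VanishesOffUnit g)
    (hfin : du2L2Norm g < ⊤) {η : ℝ≥0∞} (hη : 0 < η) : ∃ a ∈ instants n, du2L2Norm (g - a) < η := by
  obtain ⟨F, hF, hlt⟩ := exists_isTimeDeriv_of_du2L2Norm_lt hfin
  obtain ⟨G, hG, hFG⟩ := exists_unitJumps_u2Norm_sub_lt hlt
    (fun τ hτ => hF.eq_zero_of_neg hlt hg hτ) (fun τ hτ => hF.eq_of_one_le hlt hg hτ)
    denseRange_toL2 hη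
  obtain ⟨a, ha, hGa⟩ := exists_instants_of_unitJumps hG
  exact ⟨a, ha, (hF.sub hGa).du2L2Norm_le.trans_lt hFG⟩

/-- At a single time the flow is undone by `e^{-itΔ}` on Schwartz functions, so the synthesis of
instants is again the flow of a combination of instants. -/
theorem exists_instants_schrodingerST {φ χ : Space n → ℝ} (hφ : IsBump φ) (hχ : IsBump χ)
    (k j : Fin n → ℤ) {a : 𝓢'(SpaceTime n, ℂ)} (ha : a ∈ instants n) :
    ∃ f ∈ instants n, schrodingerST f = pull (synTS φ χ k j) a := by
  induction ha using Submodule.span_induction with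
  | mem x hx =>
    obtain ⟨t, ht, h, rfl⟩ := hx
    refine ⟨instant t (expT (-t) (synF φ χ k j h)), Submodule.subset_span ⟨t, ht, _, rfl⟩, ?_⟩
    rw [schrodingerST_instant, expT_neg_expT, pull_synTS_instant hφ hχ]
  | zero => exact ⟨0, Submodule.zero_mem _, by rw [map_zero, map_zero]⟩
  | add x y _ _ hx hy =>
    obtain ⟨f, hf, h⟩ := hx
    obtain ⟨f', hf', h'⟩ := hy
    exact ⟨f + f', Submodule.add_mem _ hf hf', by rw [map_add, map_add, h, h']⟩
  | smul c x _ hx =>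
    obtain ⟨f, hf, h⟩ := hx
    exact ⟨c • f, Submodule.smul_mem _ c hf, by rw [map_smul, map_smul, h]⟩

theorem hasSum_locTS_synTS {φ φ' χ χ' : Space n → ℝ} (hφ : IsUnitPartition φ)
    (hχ : IsBump χ) (hφ' : IsBump φ') (hχ' : IsBump χ') (h : ∀ x, φ x * φ' x = φ x)
    (h' : ∀ x, χ x * χ' x = χ x) (k : Fin n → ℤ) (ψ : 𝓢(SpaceTime n, ℂ)) :
    HasSum (fun j => locTS φ χ k j (synTS φ' χ' k j ψ)) (multT (fun p => latSymb χ k p.snd) ψ) :=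
  hasSum_localize_synthesize hφ hχ hφ' hχ' h h' sndL k ψ

theorem IsUnitPartition.hasSum_multT_snd {χ : Space n → ℝ} (hχ : IsUnitPartition χ)
    (ψ : 𝓢(SpaceTime n, ℂ)) :
    HasSum (fun k => multT (fun p : SpaceTime n => latSymb χ k p.snd) ψ) ψ :=
  hχ.hasSum_multT sndL ψ

theorem distribution_sub_apply (f g : 𝓢'(SpaceTime n, ℂ)) (ψ : 𝓢(SpaceTime n, ℂ)) :
    (f - g) ψ = f ψ - g ψ := rfl

/-- The norm of `Y^s` of a distribution that differs from a finite synthesis by small pieces. -/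
theorem exists_analysis_bound (s : ℝ) {φ χ φ' χ' : Space n → ℝ} (hφ : IsUnitPartition φ)
    (hχ : IsUnitPartition χ) (hφ' : IsBump φ') (hχ' : IsBump χ') (h : ∀ x, φ x * φ' x = φ x)
    (h' : ∀ x, χ x * χ' x = χ x) : ∃ C : ℝ≥0∞, C ≠ ⊤ ∧
      ∀ (f f₀ : 𝓢'(SpaceTime n, ℂ)) (S : Finset ((Fin n → ℤ) × (Fin n → ℤ)))
        (a : (Fin n → ℤ) × (Fin n → ℤ) → 𝓢'(SpaceTime n, ℂ)),
        (∀ i, du2L2Norm (pull (locTS φ χ i.1 i.2) (schrodingerST f) -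
          if i ∈ S then a i else 0) < ⊤) →
        schrodingerST f₀ = ∑ i ∈ S, pull (synTS φ' χ' i.1 i.2) (a i) →
        ysNorm φ χ s (f - f₀) ≤ C * l2Sum fun i => weight s i.1 *
          du2L2Norm (pull (locTS φ χ i.1 i.2) (schrodingerST f) - if i ∈ S then a i else 0) := by
  obtain ⟨C, hC, hb⟩ := exists_synthesis_bound s hφ.isBump hχ.isBump hφ' hχ'
  refine ⟨C, hC, fun f f₀ S a hfin hf₀ => ?_⟩
  -- With the enlarged cutoffs, `f` is synthesized from its own pieces and `f₀` from the `a i` with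
  -- `i ∈ S`; the bound is applied to the differences of pieces.
  refine hb (f - f₀) (fun i => pull (locTS φ χ i.1 i.2) (schrodingerST f) - if i ∈ S then a i else 0)
    (fun k => pull (multT fun p : SpaceTime n => latSymb χ k p.snd)
    (schrodingerST f) - ∑ i ∈ S, if i.1 = k then pull (synTS φ' χ' i.1 i.2) (a i) else 0)
    hfin (fun k ψ => ?_) fun ψ => ?_
  · have h1 := (schrodingerST f).hasSum (hasSum_locTS_synTS hφ hχ.isBump hφ' hχ' h h' k ψ)
    have h2 : HasSum (fun j => ∑ i ∈ S, if i = (k, j) then a i (synTS φ' χ' i.1 i.2 ψ) else 0)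
        (∑ i ∈ S, if i.1 = k then a i (synTS φ' χ' i.1 i.2 ψ) else 0) := by
      refine hasSum_sum fun i _ => ?_
      by_cases hi : i.1 = k
      · have h3 : ∀ j, (i = (k, j)) ↔ (j = i.2) := fun j => by
          rw [Prod.ext_iff]
          exact ⟨fun h => h.2.symm, fun h => ⟨hi, h.symm⟩⟩
        simp only [h3, if_pos hi]
        exact hasSum_ite_eq i.2 _
      · have h3 : ∀ j, ¬ (i = (k, j)) := fun j hij => hi (by rw [hij])
        simp only [h3, if_neg hi, if_false]
        exact hasSum_zero
    convert! h1.sub h2 using 1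
    · funext j
      refine (distribution_sub_apply _ _ _).trans (congrArg₂ (fun z w : ℂ => z - w) rfl ?_)
      rw [Finset.sum_ite_eq']
      split_ifs <;> rfl
    · refine (distribution_sub_apply _ _ _).trans (congrArg₂ (fun z w : ℂ => z - w) rfl ?_)
      rw [distribution_sum_apply]
      refine Finset.sum_congr rfl fun i _ => ?_
      split_ifs <;> rfl
  · have h1 := (schrodingerST f).hasSum (hχ.hasSum_multT_snd ψ)
    have h2 : HasSum (fun k => ∑ i ∈ S, if k = i.1 then a i (synTS φ' χ' i.1 i.2 ψ) else 0)
        (∑ i ∈ S, a i (synTS φ' χ' i.1 i.2 ψ)) :=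
      hasSum_sum fun i _ => hasSum_ite_eq i.1 _
    convert! h1.sub h2 using 1
    · funext k
      refine (distribution_sub_apply _ _ _).trans (congrArg₂ (fun z w : ℂ => z - w) rfl ?_)
      rw [distribution_sum_apply]
      refine Finset.sum_congr rfl fun i _ => ?_
      simp only [eq_comm (a := k)]
      split_ifs <;> rfl
    · rw [map_sub, hf₀]
      refine (distribution_sub_apply _ _ _).trans (congrArg₂ (fun z w : ℂ => z - w) rfl ?_)
      rw [distribution_sum_apply]
      rfl

theorem du2L2Norm_lt_top_of_ysNorm (s : ℝ) {φ χ : Space n → ℝ} (hχ : IsBump χ)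
    {f : 𝓢'(SpaceTime n, ℂ)} (hf : ysNorm φ χ s f < ⊤) (i : (Fin n → ℤ) × (Fin n → ℤ)) :
    du2L2Norm (pull (locTS φ χ i.1 i.2) (schrodingerST f)) < ⊤ := by
  rw [ysNorm_eq φ hχ] at hf
  have h1 := (le_l2Sum (fun i : (Fin n → ℤ) × (Fin n → ℤ) =>
    weight s i.1 * du2L2Norm (pull (locTS φ χ i.1 i.2) (schrodingerST f))) i).trans_lt hf
  exact lt_top_iff_ne_top.2 fun h => by
    rw [h, ENNReal.mul_top (weight_ne_zero s i.1)] at h1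
    exact h1.ne rfl

theorem vanishesOffUnit_pull_locTS {φ χ : Space n → ℝ} (hφ : IsBump φ) (hχ : IsBump χ)
    {f : 𝓢'(SpaceTime n, ℂ)} (hf : f ∈ unitTimeDistributions n) (k j : Fin n → ℤ) :
    VanishesOffUnit (pull (locTS φ χ k j) (schrodingerST f)) :=
  ((vanishesOffUnit_of_mem hf).pull (T := expT) slice_schrodingerTest).pull
    (T := fun _ => locT φ χ k j) (slice_locTS hφ hχ k j)

-- All but finitely many cells carry little of the norm and are dropped. In the others the pieces
-- are approximated by instants, and the approximations are synthesized into one combination of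
-- instants.
open Filter Topology in
theorem exists_instants_ysNorm_sub_lt (s : ℝ) {φ χ : Space n → ℝ} (hφ : IsUnitPartition φ)
    (hχ : IsUnitPartition χ) {f : 𝓢'(SpaceTime n, ℂ)} (hf : f ∈ unitTimeDistributions n)
    (hfin : ysNorm φ χ s f < ⊤) {ε : ℝ≥0∞} (hε : 0 < ε) :
    ∃ f₀ ∈ instants n, ysNorm φ χ s (f - f₀) < ε := by
  classical
  obtain ⟨K, hK⟩ := hφ.exists_thicken
  obtain ⟨K', hK'⟩ := hχ.exists_thicken
  have hφ' := hφ.isBump.thicken K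
  have hχ' := hχ.isBump.thicken K'
  obtain ⟨C, hC, hb⟩ := exists_analysis_bound s hφ hχ hφ' hχ' hK hK'
  -- One `x` pays for the squares of the discarded pieces, the other for the squares of the
  -- approximation errors.
  obtain ⟨x, hx, hx0⟩ : ∃ x : ℝ≥0∞, C * (x + x) ^ (1 / 2 : ℝ) < ε ∧ 0 < x := by
    have h1 : Tendsto (fun x : ℝ≥0∞ => C * (x + x) ^ (1 / 2 : ℝ)) (𝓝 0) (𝓝 0) := by
      have h2 : Tendsto (fun x : ℝ≥0∞ => (x + x) ^ (1 / 2 : ℝ)) (𝓝 0) (𝓝 0) := by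
        have := (ENNReal.continuous_rpow_const (y := (1 / 2 : ℝ))).comp
          (continuous_id.add continuous_id : Continuous fun x : ℝ≥0∞ => x + x)
        simpa [Function.comp_def] using this.tendsto 0
      simpa using ENNReal.Tendsto.const_mul h2 (Or.inr hC)
    have h3 := ((h1.eventually (gt_mem_nhds hε)).filter_mono nhdsWithin_le_nhds).and
      (self_mem_nhdsWithin : Ioi (0 : ℝ≥0∞) ∈ 𝓝[>] 0)
    exact h3.exists
  set g : (Fin n → ℤ) × (Fin n → ℤ) → 𝓢'(SpaceTime n, ℂ) := fun i =>
    pull (locTS φ χ i.1 i.2) (schrodingerST f) with hg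
  have hgfin : ∀ i, du2L2Norm (g i) < ⊤ := du2L2Norm_lt_top_of_ysNorm s hχ.isBump hfin
  have hsum : ∑' i, (weight s i.1 * du2L2Norm (g i)) ^ (2 : ℝ) ≠ ⊤ := by
    rw [ysNorm_eq φ hχ.isBump] at hfin
    rw [← l2Sum_rpow_two]
    exact ENNReal.rpow_ne_top_of_nonneg (by norm_num) hfin.ne
  obtain ⟨S, hS⟩ := (((ENNReal.tendsto_tsum_compl_atTop_zero hsum).eventually
    (gt_mem_nhds hx0)).exists)
  -- The error allowed in the cell `i` will be the square root of `δ i` divided by the weight, so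
  -- that the weighted squares add up to less than `x`.
  obtain ⟨δ, hδ, hδx⟩ := ENNReal.exists_pos_sum_of_countable hx0.ne'
    ((Fin n → ℤ) × (Fin n → ℤ))
  have hap : ∀ i, ∃ a ∈ instants n, du2L2Norm (g i - a) <
      (δ i : ℝ≥0∞) ^ (1 / 2 : ℝ) / weight s i.1 := fun i =>
    (vanishesOffUnit_pull_locTS hφ.isBump hχ.isBump hf i.1 i.2).exists_instants (hgfin i)
      (ENNReal.div_pos (ENNReal.rpow_pos (ENNReal.coe_pos.2 (hδ i)) ENNReal.coe_ne_top).ne'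
        (weight_ne_top s i.1))
  choose a ha hga using hap
  choose e he hea using fun i : (Fin n → ℤ) × (Fin n → ℤ) =>
    exists_instants_schrodingerST hφ' hχ' i.1 i.2 (ha i)
  refine ⟨∑ i ∈ S, e i, Submodule.sum_mem _ fun i _ => he i, ?_⟩
  have hle : ∀ i, (weight s i.1 * du2L2Norm (g i - if i ∈ S then a i else 0)) ^ (2 : ℝ) ≤
      δ i + ({i | i ∉ S} : Set _).indicator
        (fun i => (weight s i.1 * du2L2Norm (g i)) ^ (2 : ℝ)) i := fun i => by
    by_cases hi : i ∈ S
    · rw [if_pos hi]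
      refine le_add_right ?_
      have h1 := (hga i).le
      rw [ENNReal.le_div_iff_mul_le (Or.inl (weight_ne_zero s i.1))
        (Or.inl (weight_ne_top s i.1)), mul_comm] at h1
      refine (ENNReal.rpow_le_rpow h1 (by norm_num)).trans_eq ?_
      rw [← ENNReal.rpow_mul]
      norm_num
    · rw [if_neg hi, sub_zero, indicator_of_mem (by exact hi)]
      exact le_add_left le_rfl
  have hlt : ∀ i, du2L2Norm (g i - if i ∈ S then a i else 0) < ⊤ := fun i => by
    by_cases hi : i ∈ S
    · rw [if_pos hi]
      exact lt_top_of_lt (hga i)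
    · rw [if_neg hi, sub_zero]
      exact hgfin i
  refine (hb f _ S a hlt ?_).trans_lt (lt_of_le_of_lt (mul_le_mul_right ?_ C) hx)
  · rw [map_sum]
    exact Finset.sum_congr rfl fun i _ => hea i
  · refine ENNReal.rpow_le_rpow ((ENNReal.tsum_le_tsum hle).trans ?_) (by norm_num)
    rw [ENNReal.tsum_add]
    refine add_le_add hδx.le ?_
    rw [← tsum_subtype ({i | i ∉ S} : Set _)]
    exact hS.le

/-- The span of the elements `δ(t - t₀) h(x)` of `Y^s`. -/
abbrev instantSpan (φ χ : Space n → ℝ) (s : ℝ) : Submodule ℂ (YSpace φ χ s) :=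
  Submodule.span ℂ {f : YSpace φ χ s | ∃ t₀ ∈ Icc (0 : ℝ) 1,
    ∃ h : 𝓢(Space n, ℂ), f.val = instant t₀ h}

theorem exists_instantSpan (s : ℝ) {φ χ : Space n → ℝ} (hφ : IsBump φ) (hχ : IsBump χ)
    {f : 𝓢'(SpaceTime n, ℂ)} (hf : f ∈ instants n) : ∃ y ∈ instantSpan φ χ s, y.val = f := by
  induction hf using Submodule.span_induction with
  | mem x hx =>
    obtain ⟨t, ht, h, rfl⟩ := hx
    exact ⟨⟨instant t h, instant_mem_unitTimeDistributions ht h,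
      ysNorm_instant_lt_top s hφ hχ t h⟩, Submodule.subset_span ⟨t, ht, h, rfl⟩, rfl⟩
  | zero => exact ⟨0, Submodule.zero_mem _, rfl⟩
  | add x y _ _ hx hy =>
    obtain ⟨f, hf, rfl⟩ := hx
    obtain ⟨f', hf', rfl⟩ := hy
    exact ⟨f + f', Submodule.add_mem _ hf hf', rfl⟩
  | smul c x _ hx =>
    obtain ⟨f, hf, rfl⟩ := hx
    exact ⟨c • f, Submodule.smul_mem _ c hf, rfl⟩

theorem dense_instantSpan (s : ℝ) {φ χ : Space n → ℝ} (hφ : IsUnitPartition φ)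
    (hχ : IsUnitPartition χ) : Dense (instantSpan φ χ s : Set (YSpace φ χ s)) := by
  intro f
  rw [SeminormedAddCommGroup.mem_closure_iff]
  intro ε hε
  have hf : f.val ∈ unitTimeDistributions n := f.2.1
  have hfin : ysNorm φ χ s f.val < ⊤ := f.2.2
  obtain ⟨f₀, hf₀, hlt⟩ := exists_instants_ysNorm_sub_lt s hφ hχ hf hfin (ENNReal.ofReal_pos.2 hε)
  obtain ⟨y, hy, rfl⟩ := exists_instantSpan s hφ.isBump hχ.isBump hf₀
  refine ⟨y, hy, ?_⟩
  rw [FiniteSpace.norm_eq]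
  exact ENNReal.toReal_lt_of_lt_ofReal hlt

end

section

/-! ### The pairing of `X^{-s}` and `Y^s` -/

variable {n : ℕ}

theorem conjSchwartz_apply (h : 𝓢(Space n, ℂ)) (x : Space n) : conjSchwartz h x = conj (h x) := rfl

theorem conj_two : conj (2 : ℂ) = 2 := by
  rw [← Complex.ofReal_ofNat]
  exact Complex.conj_ofReal _

theorem conjSchwartz_smulLeft {m m' : Space n → ℂ} (hm : m.HasTemperateGrowth)
    (hm' : m'.HasTemperateGrowth) (h : ∀ x, conj (m x) = m' x) (g : 𝓢(Space n, ℂ)) :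
    conjSchwartz (SchwartzMap.smulLeftCLM ℂ m g) =
      SchwartzMap.smulLeftCLM ℂ m' (conjSchwartz g) := by
  ext x
  rw [conjSchwartz_apply, SchwartzMap.smulLeftCLM_apply_apply hm,
    SchwartzMap.smulLeftCLM_apply_apply hm', smul_eq_mul, map_mul, h, smul_eq_mul,
    conjSchwartz_apply]

theorem conjSchwartz_fourierInv (g : 𝓢(Space n, ℂ)) :
    conjSchwartz (𝓕⁻ g) = 𝓕 (conjSchwartz g) := by
  ext x
  rw [conjSchwartz_apply, SchwartzMap.fourierInv_coe, SchwartzMap.fourier_coe,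
    Real.fourierInv_eq', Real.fourier_eq', ← integral_conj]
  congr 1 with v
  rw [smul_eq_mul, map_mul, ← Complex.exp_conj, smul_eq_mul, conjSchwartz_apply]
  simp [conj_two]

theorem conjSchwartz_fourier (g : 𝓢(Space n, ℂ)) :
    conjSchwartz (𝓕 g) = 𝓕⁻ (conjSchwartz g) := by
  have h := conjSchwartz_fourierInv (𝓕 g)
  rw [FourierTransform.fourierInv_fourier_eq] at h
  rw [h, FourierTransform.fourierInv_fourier_eq]

/-- Conjugation exchanges the Fourier transform and its inverse. It thus turns an operator on data
into the transposed operator on test functions, which is how conjugate-linear functionals meet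
localized distributions. -/
theorem conjSchwartz_multF {m m' : Space n → ℂ} (hm : m.HasTemperateGrowth)
    (hm' : m'.HasTemperateGrowth) (h : ∀ x, conj (m x) = m' x) (g : 𝓢(Space n, ℂ)) :
    conjSchwartz (multF m g) = multT m' (conjSchwartz g) := by
  rw [SchwartzMap.fourierMultiplierCLM_apply, conjSchwartz_fourierInv,
    conjSchwartz_smulLeft hm hm' h, conjSchwartz_fourier, multT_apply]

theorem conjSchwartz_expT (t : ℝ) (h : 𝓢(Space n, ℂ)) :
    conjSchwartz (expT t h) = expT (-t) (conjSchwartz h) := by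
  rw [expT, ← multF_eq_multT (schrodingerSymbol_temperate t) fun η => by simp [schrodingerSymbol],
    conjSchwartz_multF (schrodingerSymbol_temperate t) (schrodingerSymbol_temperate (-t)), expT]
  intro η
  rw [schrodingerSymbol, schrodingerSymbol, ← Complex.exp_conj]
  simp [conj_two]

theorem conjSchwartz_locF {φ χ : Space n → ℝ} (hφ : IsBump φ) (hχ : IsBump χ) (k j : Fin n → ℤ)
    (h : 𝓢(Space n, ℂ)) : conjSchwartz (locF φ χ k j h) = synT φ χ k j (conjSchwartz h) := by
  rw [locF, synT, ContinuousLinearMap.comp_apply, ContinuousLinearMap.comp_apply,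
    conjSchwartz_smulLeft (hφ.latMult_temperate j) (hφ.latMult_temperate j)
      fun x => Complex.conj_ofReal _,
    conjSchwartz_multF (hχ.latSymb_temperate k) (hχ.latSymb_temperate k)
      fun x => Complex.conj_ofReal _]

theorem conjSchwartz_synF {φ χ : Space n → ℝ} (hφ : IsBump φ) (hχ : IsBump χ) (k j : Fin n → ℤ)
    (h : 𝓢(Space n, ℂ)) : conjSchwartz (synF φ χ k j h) = locT φ χ k j (conjSchwartz h) := by
  rw [synF, locT, ContinuousLinearMap.comp_apply, ContinuousLinearMap.comp_apply,
    conjSchwartz_multF (hχ.latSymb_temperate k) (hχ.latSymb_temperate k)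
      fun x => Complex.conj_ofReal _,
    conjSchwartz_smulLeft (hφ.latMult_temperate j) (hφ.latMult_temperate j)
      fun x => Complex.conj_ofReal _]

/-- Unitarity of the flow: applied to both sides, it leaves the sesquilinear pairing unchanged. -/
theorem schrodinger_apply_conj_expT (t : ℝ) (u : 𝓢'(Space n, ℂ)) (h : 𝓢(Space n, ℂ)) :
    schrodinger t u (conjSchwartz (expT t h)) = u (conjSchwartz h) := by
  rw [conjSchwartz_expT]
  exact congrArg u (expT_neg_expT t _)

theorem hasSum_locT_synT {φ φ' χ χ' : Space n → ℝ} (hφ : IsUnitPartition φ)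
    (hχ : IsBump χ) (hφ' : IsBump φ') (hχ' : IsBump χ') (h : ∀ x, φ x * φ' x = φ x)
    (h' : ∀ x, χ x * χ' x = χ x) (k : Fin n → ℤ) (ψ : 𝓢(Space n, ℂ)) :
    HasSum (fun j => locT φ χ k j (synT φ' χ' k j ψ)) (multT (latSymb χ k) ψ) :=
  hasSum_localize_synthesize hφ hχ hφ' hχ' h h' (ContinuousLinearMap.id ℝ (Space n)) k ψ

/-- The norms of `Y^s` with different localizations are comparable. -/
theorem exists_ysNorm_le (s : ℝ) {φ χ φ' χ' : Space n → ℝ} (hφ : IsUnitPartition φ)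
    (hχ : IsUnitPartition χ) (hφ' : IsBump φ') (hχ' : IsBump χ') (h : ∀ x, φ x * φ' x = φ x)
    (h' : ∀ x, χ x * χ' x = χ x) : ∃ C : ℝ≥0∞, C ≠ ⊤ ∧ ∀ f : 𝓢'(SpaceTime n, ℂ),
      ysNorm φ χ s f < ⊤ → ysNorm φ' χ' s f ≤ C * ysNorm φ χ s f := by
  obtain ⟨C, hC, hb⟩ := exists_synthesis_bound s hφ' hχ' hφ' hχ'
  refine ⟨C, hC, fun f hf => ?_⟩
  rw [ysNorm_eq φ hχ.isBump s f]
  exact hb f (fun i => pull (locTS φ χ i.1 i.2) (schrodingerST f))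
    (fun k => pull (multT fun p : SpaceTime n => latSymb χ k p.snd) (schrodingerST f))
    (du2L2Norm_lt_top_of_ysNorm s hχ.isBump hf)
    (fun k ψ => (schrodingerST f).hasSum (hasSum_locTS_synTS hφ hχ.isBump hφ' hχ' h h' k ψ))
    fun ψ => (schrodingerST f).hasSum (hχ.hasSum_multT_snd ψ)

theorem u2Norm_sum_jump_lt_top {H : Type*} [NormedAddCommGroup H] [NormedSpace ℂ H] {κ : Type*}
    (S : Finset κ) (t : κ → ℝ) (p : κ → H) : u2Norm (∑ c ∈ S, jump (t c) (p c)) < ⊤ := by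
  classical
  induction S using Finset.induction_on with
  | empty => simp [isExtSeminorm_u2Norm.map_zero]
  | insert c S hc ih =>
    rw [Finset.sum_insert hc]
    exact (isExtSeminorm_u2Norm.add_le _ _).trans_lt
      (ENNReal.add_lt_top.2 ⟨(u2Norm_jump_le _ _).trans_lt enorm_lt_top, ih⟩)

theorem enorm_sum_inner_jump_le {H : Type*} [NormedAddCommGroup H] [InnerProductSpace ℂ H]
    (v : ℝ → H) (hv : v2Norm v < ⊤) {a : ℝ} (hva : v a = 0) (S : Finset ℝ) (hS : ∀ t ∈ S, t < a)
    (p : ℝ → H) :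
    ‖∑ t ∈ S, inner ℂ (p t) (v t)‖ₑ ≤ v2Norm v * u2Norm (∑ t ∈ S, jump t (p t)) :=
  enorm_sum_inner_le v hv hva S hS p (u2Norm_sum_jump_lt_top S _ _)

/-- The `DU²` norm stands on the large side of the pairing estimate, so an equality is needed and
not merely the bound by one primitive. -/
theorem du2L2Norm_sum_instant {κ : Type*} (S : Finset κ) (t : κ → ℝ) (h : κ → 𝓢(Space n, ℂ)) :
    du2L2Norm (∑ c ∈ S, instant (t c) (h c)) =
      u2Norm (∑ c ∈ S, jump (t c) ((h c).toLp 2 : L2 n)) :=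
  (IsTimeDeriv.sum S fun c _ => isTimeDeriv_jump (t c) (h c)).du2L2Norm_eq
    (u2Norm_sum_jump_lt_top S _ _)

theorem exists_of_v2L2Norm_lt_top {w : ℝ → 𝓢'(Space n, ℂ)} (h : v2L2Norm w < ⊤) :
    ∃ v : ℝ → L2 n, (∀ t, ((v t : L2 n) : 𝓢'(Space n, ℂ)) = w t) ∧ v2Norm v = v2L2Norm w := by
  have h' := h
  simp only [v2L2Norm, iInf_lt_iff] at h'
  obtain ⟨v, hv, -⟩ := h'
  refine ⟨v, hv, le_antisymm (le_iInf₂ fun v' hv' => ?_) (iInf₂_le v hv)⟩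
  have : v = v' := funext fun t => coe_injective ((hv t).trans (hv' t).symm)
  rw [this]

theorem v2L2Norm_lt_top_of_xsNorm (s : ℝ) {φ χ : Space n → ℝ} (hχ : IsBump χ)
    {u : ℝ → 𝓢'(Space n, ℂ)} (hu : xsNorm φ χ s u < ⊤) (i : (Fin n → ℤ) × (Fin n → ℤ)) :
    v2L2Norm (fun t => pull (locT φ χ i.1 i.2) (schrodinger t (u t))) < ⊤ := by
  rw [xsNorm_eq φ hχ] at hu
  have h1 := (le_l2Sum (fun i : (Fin n → ℤ) × (Fin n → ℤ) =>
    weight s i.1 * v2L2Norm fun t => pull (locT φ χ i.1 i.2) (schrodinger t (u t))) i).trans_lt hu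
  exact lt_top_iff_ne_top.2 fun h => by
    rw [h, ENNReal.mul_top (weight_ne_zero s i.1)] at h1
    exact h1.ne rfl

/-- The pairing of a function of bounded 2-variation with jumps in `U²`. -/
theorem enorm_sum_apply_conj_le {w : ℝ → 𝓢'(Space n, ℂ)} (hw : v2L2Norm w < ⊤) {a : ℝ}
    (ha : w a = 0) (S : Finset ℝ) (hS : ∀ t ∈ S, t < a) (h : ℝ → 𝓢(Space n, ℂ)) :
    ‖∑ t ∈ S, w t (conjSchwartz (h t))‖ₑ ≤
      v2L2Norm w * du2L2Norm (∑ t ∈ S, instant t (h t)) := by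
  obtain ⟨v, hv, hn⟩ := exists_of_v2L2Norm_lt_top hw
  rw [du2L2Norm_sum_instant S (fun t => t) h, ← hn]
  have hva : v a = 0 := coe_injective (by
    rw [hv, ha]
    exact ((Lp.toTemperedDistributionCLM ℂ volume 2).map_zero).symm)
  have h1 := enorm_sum_inner_jump_le v (hn ▸ hw) hva S hS fun t => ((h t).toLp 2 : L2 n)
  refine le_trans (le_of_eq ?_) h1
  congr 1
  refine Finset.sum_congr rfl fun t _ => ?_
  rw [← hv, coe_apply_conjSchwartz]

theorem pull_locTS_sum_instant {φ χ : Space n → ℝ} (hφ : IsBump φ) (hχ : IsBump χ)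
    (k j : Fin n → ℤ) (S : Finset ℝ) (h : ℝ → 𝓢(Space n, ℂ)) :
    pull (locTS φ χ k j) (schrodingerST (∑ t ∈ S, instant t (h t))) =
      ∑ t ∈ S, instant t (locF φ χ k j (expT t (h t))) := by
  rw [map_sum, map_sum]
  refine Finset.sum_congr rfl fun t _ => ?_
  rw [schrodingerST_instant, pull_locTS_instant hφ hχ]

theorem enorm_le_tsum_of_hasSum {κ : Type*} {z : κ → ℂ} {a : ℂ} (h : HasSum z a) :
    ‖a‖ₑ ≤ ∑' m, ‖z m‖ₑ := by
  rw [← h.tsum_eq]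
  exact enorm_tsum_le_tsum_enorm

/-- The duality estimate for the pairing of `X^{-s}` and `Y^s`. -/
theorem exists_pairing_le (s : ℝ) {φ χ : Space n → ℝ} (hφ : IsUnitPartition φ)
    (hχ : IsUnitPartition χ) : ∃ C : ℝ≥0∞, C ≠ ⊤ ∧ ∀ u ∈ unitTimeFunctions n,
      xsNorm φ χ (-s) u < ⊤ → ∀ (S : Finset ℝ) (h : ℝ → 𝓢(Space n, ℂ)),
        (∀ t ∈ S, t ∈ Icc (0 : ℝ) 1) → ‖∑ t ∈ S, u t (conjSchwartz (h t))‖ₑ ≤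
          C * xsNorm φ χ (-s) u * ysNorm φ χ s (∑ t ∈ S, instant t (h t)) := by
  obtain ⟨K, hK⟩ := hφ.exists_thicken
  obtain ⟨K', hK'⟩ := hχ.exists_thicken
  have hφ' := hφ.isBump.thicken K
  have hχ' := hχ.isBump.thicken K'
  obtain ⟨C, hC, hb⟩ := exists_ysNorm_le s hφ hχ hφ' hχ' hK hK'
  refine ⟨C, hC, fun u hu hfin S h hS => ?_⟩
  have hf : ysNorm φ χ s (∑ t ∈ S, instant t (h t)) < ⊤ := by
    refine (finiteSubmodule (isExtSeminorm_ysNorm φ χ s) ⊤).sum_mem (t := S)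
      (f := fun t => instant t (h t)) (fun t _ => ?_) |>.2
    exact ⟨Submodule.mem_top, ysNorm_instant_lt_top s hφ.isBump hχ.isBump t (h t)⟩
  set w : ℝ → 𝓢'(Space n, ℂ) := fun t => schrodinger t (u t) with hw
  -- The contribution of one cell, after inserting the resolution of the identity into the pairing:
  -- `u` is localized by the given cutoffs, the data by the enlarged ones.
  set z : (Fin n → ℤ) → (Fin n → ℤ) → ℂ := fun k j => ∑ t ∈ S,
    w t (locT φ χ k j (synT (thicken K φ) (thicken K' χ) k j (conjSchwartz (expT t (h t))))) with hz
  have hz1 : ∀ k, HasSum (z k) (∑ t ∈ S, w t (multT (latSymb χ k) (conjSchwartz (expT t (h t))))) :=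
    fun k => hasSum_sum fun t _ =>
      (w t).hasSum (hasSum_locT_synT hφ hχ.isBump hφ' hχ' hK hK' k (conjSchwartz (expT t (h t))))
  have hz2 : HasSum (fun k => ∑ t ∈ S, w t (multT (latSymb χ k) (conjSchwartz (expT t (h t)))))
      (∑ t ∈ S, u t (conjSchwartz (h t))) := by
    refine hasSum_sum fun t _ => ?_
    rw [← schrodinger_apply_conj_expT]
    exact (w t).hasSum (hχ.hasSum_multT (ContinuousLinearMap.id ℝ (Space n)) _)
  set V : (Fin n → ℤ) × (Fin n → ℤ) → ℝ≥0∞ := fun i =>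
    v2L2Norm fun t => pull (locT φ χ i.1 i.2) (w t) with hV
  set U : (Fin n → ℤ) × (Fin n → ℤ) → ℝ≥0∞ := fun i =>
    du2L2Norm (pull (locTS (thicken K φ) (thicken K' χ) i.1 i.2)
      (schrodingerST (∑ t ∈ S, instant t (h t)))) with hU
  have hzVU : ∀ k j, ‖z k j‖ₑ ≤ V (k, j) * U (k, j) := fun k j => by
    -- The time `2` lies after all jumps and `u` vanishes there, so summation by parts has no
    -- boundary term.
    have h1 := enorm_sum_apply_conj_le (v2L2Norm_lt_top_of_xsNorm (-s) hχ.isBump hfin (k, j))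
      (a := 2) (by
        have h2 : u 2 = 0 := hu 2 (by norm_num)
        rw [h2, map_zero, map_zero]) S (fun t ht => (hS t ht).2.trans_lt (by norm_num))
      (fun t => locF (thicken K φ) (thicken K' χ) k j (expT t (h t)))
    rw [← pull_locTS_sum_instant hφ' hχ'] at h1
    simp_rw [conjSchwartz_locF hφ' hχ'] at h1
    exact h1
  calc ‖∑ t ∈ S, u t (conjSchwartz (h t))‖ₑ
      ≤ ∑' k, ∑' j, V (k, j) * U (k, j) := (enorm_le_tsum_of_hasSum hz2).trans (ENNReal.tsum_le_tsum fun k =>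
        (enorm_le_tsum_of_hasSum (hz1 k)).trans (ENNReal.tsum_le_tsum fun j => hzVU k j))
    _ = ∑' i, (weight (-s) i.1 * V i) * (weight s i.1 * U i) := by
        rw [ENNReal.tsum_prod']
        refine tsum_congr fun k => tsum_congr fun j => ?_
        rw [mul_mul_mul_comm, mul_comm (weight (-s) _), weight_mul_weight_neg, one_mul]
    _ ≤ l2Sum (fun i => weight (-s) i.1 * V i) * l2Sum (fun i => weight s i.1 * U i) :=
        tsum_mul_le_l2Sum_mul _ _
    _ = xsNorm φ χ (-s) u *
        ysNorm (thicken K φ) (thicken K' χ) s (∑ t ∈ S, instant t (h t)) := by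
        rw [xsNorm_eq φ hχ.isBump, ysNorm_eq _ hχ']
    _ ≤ xsNorm φ χ (-s) u * (C * ysNorm φ χ s (∑ t ∈ S, instant t (h t))) :=
        mul_le_mul_right (hb _ hf) _
    _ = _ := by ring

end

section

/-! ### Restriction of jumps to `[0,1]` -/

section Restriction

variable {H : Type*} [NormedAddCommGroup H]

/-- `G` is obtained from `F` by keeping only the jumps at times in `[0,1]`. -/
def IsRestriction (F G : ℝ → H) : Prop :=
  ∃ τ₀ < 0, ∀ τ ∈ Ico τ₀ (0 : ℝ),
    G = (fun r => if r < 0 then 0 else F (min r 1)) - jump 0 (F τ)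

theorem isRestriction_zero : IsRestriction (0 : ℝ → H) 0 :=
  ⟨-1, by norm_num, fun τ _ => by funext r; simp [jump]⟩

/-- Clamping drops jumps after time `1` and moves those before `0` to time `0`, where subtracting
the value just before `0` cancels them. The threshold is chosen so that the jump function is
constant between it and `0`. -/
theorem isRestriction_jump (t : ℝ) (h : H) :
    IsRestriction (jump t h) (if t ∈ Icc (0 : ℝ) 1 then jump t h else 0) := by
  refine ⟨if t < 0 then t else -1, by split_ifs <;> linarith, fun τ hτ => ?_⟩
  funext r
  by_cases h0 : t < 0
  · rw [if_pos h0] at hτ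
    have h1 : t ∉ Icc (0 : ℝ) 1 := fun h => h0.not_ge h.1
    rw [if_neg h1]
    simp only [Pi.zero_apply, Pi.sub_apply, jump, hτ.1.not_gt, if_false]
    by_cases hr : r < 0
    · simp [hr]
    · have : t ≤ min r 1 := le_min (h0.le.trans (not_lt.1 hr)) (by linarith)
      simp [hr, this.not_gt]
  · have hτt : τ < t := hτ.2.trans_le (not_lt.1 h0)
    simp only [Pi.sub_apply, jump, hτt, if_true, ite_self, sub_zero]
    by_cases h1 : t ≤ 1
    · rw [if_pos ⟨not_lt.1 h0, h1⟩]
      by_cases hr : r < 0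
      · simp [hr, jump, hr.trans_le (not_lt.1 h0)]
      · simp [hr, jump, h1.not_gt]
    · rw [if_neg fun h => h1 h.2]
      simp [not_le.1 h1]

theorem IsRestriction.sub {F F' G G' : ℝ → H} (h : IsRestriction F G) (h' : IsRestriction F' G') :
    IsRestriction (F - F') (G - G') := by
  obtain ⟨a, ha, hF⟩ := h
  obtain ⟨b, hb, hF'⟩ := h'
  refine ⟨max a b, max_lt ha hb, fun τ hτ => ?_⟩
  rw [hF τ ⟨(le_max_left _ _).trans hτ.1, hτ.2⟩, hF' τ ⟨(le_max_right _ _).trans hτ.1, hτ.2⟩]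
  funext r
  simp only [Pi.sub_apply, jump]
  split_ifs <;> abel

theorem IsRestriction.sum {κ : Type*} (S : Finset κ) {F G : κ → ℝ → H}
    (h : ∀ m ∈ S, IsRestriction (F m) (G m)) :
    IsRestriction (∑ m ∈ S, F m) (∑ m ∈ S, G m) := by
  classical
  induction S using Finset.induction_on with
  | empty => simpa using isRestriction_zero
  | insert m S hm ih =>
    rw [Finset.sum_insert hm, Finset.sum_insert hm]
    have h1 := h m (Finset.mem_insert_self _ _)
    have h2 := isRestriction_zero.sub (ih fun l hl => h l (Finset.mem_insert_of_mem hl))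
    simpa using h1.sub h2

variable [NormedSpace ℂ H]

theorem u2Norm_sub_le (F G : ℝ → H) : u2Norm (F - G) ≤ u2Norm F + u2Norm G := by
  rw [sub_eq_add_neg, ← neg_one_smul ℂ G]
  refine (isExtSeminorm_u2Norm.add_le _ _).trans (add_le_add_right ?_ _)
  simpa using isExtSeminorm_u2Norm.smul_le (-1) G

/-- One unit of the constant is for the clamp, the other for the subtracted value, which is bounded
by the `U²` norm. -/
theorem IsRestriction.u2Norm_le [CompleteSpace H] {F G : ℝ → H} (h : IsRestriction F G)
    (hF : u2Norm F < ⊤) : u2Norm G ≤ 2 * u2Norm F := by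
  obtain ⟨a, ha, h⟩ := h
  rw [h a ⟨le_rfl, ha⟩, two_mul]
  exact (u2Norm_sub_le _ _).trans (add_le_add (u2Norm_clamp_le hF)
    ((u2Norm_jump_le _ _).trans (enorm_le_u2Norm F a)))

/-- A jump at `t (m + 1)` minus the same jump at `t m` is the value `-h m` between these times. The
sum is a step function that ends with the value zero. -/
theorem u2Norm_sum_jump_sub_le {t : ℕ → ℝ} (ht : Monotone t) (h : ℕ → H) (K : ℕ) :
    u2Norm (∑ m ∈ Finset.range K, (jump (t (m + 1)) (h m) - jump (t m) (h m))) ≤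
      ENNReal.ofReal (√(∑ m ∈ Finset.range K, ‖h m‖ ^ 2)) := by
  set h' : ℕ → H := fun m => if m < K then -h m else 0 with hh'
  have h1 : ∑ m ∈ Finset.range K, (jump (t (m + 1)) (h m) - jump (t m) (h m)) =
      stepFunction K t h' := by
    funext τ
    have h0 : h' K = 0 := by simp [hh']
    rw [stepFunction, h0, Finset.sum_apply, indicator_zero, add_zero]
    refine Finset.sum_congr rfl fun m hm => ?_
    have h3 : h' m = -h m := by simp [hh', Finset.mem_range.1 hm]
    rw [h3, Pi.sub_apply, jump, jump, indicator_apply]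
    have h4 := ht m.le_succ
    by_cases h5 : τ < t m
    · rw [if_pos (h5.trans_le h4), if_pos h5, if_neg fun h => h.1.not_gt h5, sub_zero]
    · by_cases h6 : τ < t (m + 1)
      · rw [if_pos h6, if_neg h5, if_pos ⟨not_lt.1 h5, h6⟩, zero_sub]
      · rw [if_neg h6, if_neg h5, if_neg fun h => h6 h.2, sub_self]
  rw [h1]
  refine (u2Norm_le_of_isStep (isStep_stepFunction ht h')).trans_eq ?_
  rw [Finset.sum_range_succ]
  congr 2
  have h0 : ‖h' K‖ ^ 2 = 0 := by simp [hh']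
  rw [h0, add_zero]
  refine Finset.sum_congr rfl fun m hm => ?_
  simp [hh', Finset.mem_range.1 hm]

end Restriction

/-! ### Suprema over partitions -/

/-- Each index has a parameter of its own, so the suprema can be taken one after the other. -/
theorem sum_iSup_le {ι P : Type*} [Nonempty P] (I : Finset ι) (f : ι → P → ℝ≥0∞) {B : ℝ≥0∞}
    (h : ∀ p : ι → P, ∑ i ∈ I, f i (p i) ≤ B) : ∑ i ∈ I, ⨆ p, f i p ≤ B := by
  classical
  induction I using Finset.induction_on generalizing B with
  | empty => simp
  | insert i I hi ih =>
    rw [Finset.sum_insert hi, ENNReal.iSup_add]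
    refine iSup_le fun p => ?_
    rcases eq_or_ne (f i p) ⊤ with hp | hp
    · have := h fun _ => p
      rw [Finset.sum_insert hi, hp, top_add, top_le_iff] at this
      rw [this]
      exact le_top
    have h1 : ∀ q : ι → P, f i p + ∑ l ∈ I, f l (q l) ≤ B := fun q => by
      have h2 := h (Function.update q i p)
      rw [Finset.sum_insert hi, Function.update_self] at h2
      refine le_trans (le_of_eq ?_) h2
      congr 1
      refine Finset.sum_congr rfl fun l hl => ?_
      rw [Function.update_of_ne (ne_of_mem_of_not_mem hl hi)]
    have h3 : ∑ l ∈ I, ⨆ p, f l p ≤ B - f i p :=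
      ih fun q => ENNReal.le_sub_of_add_le_left hp (h1 q)
    have h4 : f i p ≤ B := le_self_add.trans (h1 fun _ => p)
    calc f i p + ∑ l ∈ I, ⨆ p, f l p ≤ f i p + (B - f i p) := by gcongr
      _ = B := add_tsub_cancel_of_le h4

theorem v2Norm_eq_iSup {H : Type*} [NormedAddCommGroup H] (v : ℝ → H) :
    v2Norm v = ⨆ p : {t : ℕ → ℝ // StrictMono t} × ℕ,
      l2Sum fun m : Fin p.2 => ‖v (p.1.1 (m + 1)) - v (p.1.1 m)‖ₑ := by
  rw [iSup_prod, iSup_subtype]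
  rfl

/-- Every cell may use its own partition of time, so it suffices to bound finitely many cells with
arbitrary partitions simultaneously. -/
theorem l2Sum_mul_v2Norm_le {ι H : Type*} [NormedAddCommGroup H] (v : ι → ℝ → H) (c : ι → ℝ≥0∞)
    {B : ℝ≥0∞} (h : ∀ (I : Finset ι) (t : ι → ℕ → ℝ) (K : ι → ℕ), (∀ i, StrictMono (t i)) →
      ∑ i ∈ I, (c i * l2Sum fun m : Fin (K i) => ‖v i (t i (m + 1)) - v i (t i m)‖ₑ) ^ (2 : ℝ) ≤
        B ^ (2 : ℝ)) : l2Sum (fun i => c i * v2Norm (v i)) ≤ B := by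
  have : Nonempty ({t : ℕ → ℝ // StrictMono t} × ℕ) := ⟨⟨⟨fun k => k, Nat.strictMono_cast⟩, 0⟩⟩
  rw [l2Sum_le_iff, ENNReal.tsum_eq_iSup_sum]
  refine iSup_le fun I => ?_
  have h1 : ∀ i, (c i * v2Norm (v i)) ^ (2 : ℝ) = ⨆ p : {t : ℕ → ℝ // StrictMono t} × ℕ,
      (c i * l2Sum fun m : Fin p.2 => ‖v i (p.1.1 (m + 1)) - v i (p.1.1 m)‖ₑ) ^ (2 : ℝ) := fun i => by
    rw [v2Norm_eq_iSup, ENNReal.mul_iSup]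
    exact (ENNReal.orderIsoRpow 2 (by norm_num)).map_iSup _
  simp_rw [h1]
  exact sum_iSup_le I _ fun p => h I (fun i => (p i).1.1) (fun i => (p i).2) fun i => (p i).1.2

/-- A bound for all pairings with a dense set of vectors bounds the norm. -/
theorem sum_le_sq_of_pairing {ι P H : Type*} [NormedAddCommGroup H] [InnerProductSpace ℂ H]
    {D : P → H} (hD : DenseRange D) (I : Finset ι) (K : ι → ℕ) {w : ι → ℝ} (hw : ∀ i, 0 < w i)
    (x : ι → ℕ → H) {B : ℝ} (hB : 0 ≤ B)
    (hb : ∀ h : ι → ℕ → P, ‖∑ i ∈ I, ∑ m ∈ Finset.range (K i), inner ℂ (D (h i m)) (x i m)‖ ≤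
      B * √(∑ i ∈ I, w i ^ 2 * ∑ m ∈ Finset.range (K i), ‖D (h i m)‖ ^ 2)) :
    ∑ i ∈ I, ((w i)⁻¹) ^ 2 * ∑ m ∈ Finset.range (K i), ‖x i m‖ ^ 2 ≤ B ^ 2 := by
  have hdense : DenseRange (Pi.map fun _ : ι => Pi.map fun _ : ℕ => D) :=
    DenseRange.piMap fun _ => DenseRange.piMap fun _ => hD
  have key : ∀ y : ι → ℕ → H, ‖∑ i ∈ I, ∑ m ∈ Finset.range (K i), inner ℂ (y i m) (x i m)‖ ≤
      B * √(∑ i ∈ I, w i ^ 2 * ∑ m ∈ Finset.range (K i), ‖y i m‖ ^ 2) := fun y =>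
    hdense.induction_on y (isClosed_le (by fun_prop) (by fun_prop)) hb
  set Q := ∑ i ∈ I, ((w i)⁻¹) ^ 2 * ∑ m ∈ Finset.range (K i), ‖x i m‖ ^ 2 with hQ
  have hQ0 : 0 ≤ Q := Finset.sum_nonneg fun i _ => by positivity
  -- With the extremal test vector, the pairing and the sum under the square root both equal `Q`,
  -- which leaves `Q ≤ B √Q`.
  have h1 := key fun i m => ((((w i)⁻¹) ^ 2 : ℝ) : ℂ) • x i m
  have h2 : ∑ i ∈ I, ∑ m ∈ Finset.range (K i),
      inner ℂ (((((w i)⁻¹) ^ 2 : ℝ) : ℂ) • x i m) (x i m) = (Q : ℂ) := by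
    rw [hQ]
    rw [Complex.ofReal_sum]
    refine Finset.sum_congr rfl fun i _ => ?_
    rw [Finset.mul_sum, Complex.ofReal_sum]
    refine Finset.sum_congr rfl fun m _ => ?_
    rw [inner_smul_left, Complex.conj_ofReal, inner_self_eq_norm_sq_to_K, Complex.ofReal_mul,
      Complex.ofReal_pow ‖x i m‖]
    rfl
  have h3 : ∑ i ∈ I, w i ^ 2 * ∑ m ∈ Finset.range (K i),
      ‖((((w i)⁻¹) ^ 2 : ℝ) : ℂ) • x i m‖ ^ 2 = Q := by
    refine Finset.sum_congr rfl fun i _ => ?_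
    have h0 := (hw i).ne'
    simp_rw [norm_smul, mul_pow, ← Finset.mul_sum]
    rw [Complex.norm_real, Real.norm_of_nonneg (by positivity)]
    field_simp
  rw [h2, h3, Complex.norm_real, Real.norm_of_nonneg hQ0] at h1
  have h4 := Real.mul_self_sqrt hQ0
  rcases (Real.sqrt_nonneg Q).eq_or_lt with h5 | h5
  · rw [← h5] at h4
    nlinarith [sq_nonneg B]
  · have h6 : √Q ≤ B := by
      exact le_of_mul_le_mul_right (h4.le.trans h1) h5
    nlinarith

end

section

/-! ### Bounded functionals on `Y^s` -/

variable {n : ℕ}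

/-- The norm of `Y^s` of a finite synthesis. -/
theorem exists_finite_synthesis_bound (s : ℝ) {φ χ : Space n → ℝ} (hφ : IsBump φ) (hχ : IsBump χ) :
    ∃ C : ℝ≥0∞, C ≠ ⊤ ∧ ∀ (S : Finset ((Fin n → ℤ) × (Fin n → ℤ)))
      (g : (Fin n → ℤ) × (Fin n → ℤ) → 𝓢'(SpaceTime n, ℂ)) (f : 𝓢'(SpaceTime n, ℂ)),
      (∀ i ∉ S, g i = 0) → (∀ i, du2L2Norm (g i) < ⊤) →
      schrodingerST f = ∑ i ∈ S, pull (synTS φ χ i.1 i.2) (g i) →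
      ysNorm φ χ s f ≤ C * l2Sum fun i => weight s i.1 * du2L2Norm (g i) := by
  classical
  obtain ⟨C, hC, hb⟩ := exists_synthesis_bound s hφ hχ hφ hχ
  refine ⟨C, hC, fun S g f hg0 hfin hf => hb f g
    (fun k => ∑ i ∈ S, if k = i.1 then pull (synTS φ χ i.1 i.2) (g i) else 0) hfin
    (fun k ψ => ?_) fun ψ => ?_⟩
  · have h2 : HasSum (fun j => ∑ i ∈ S, if i = (k, j) then g i (synTS φ χ i.1 i.2 ψ) else 0)
        (∑ i ∈ S, if k = i.1 then g i (synTS φ χ i.1 i.2 ψ) else 0) := by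
      refine hasSum_sum fun i _ => ?_
      by_cases hi : k = i.1
      · have h3 : ∀ j, (i = (k, j)) ↔ (j = i.2) := fun j => by
          rw [Prod.ext_iff]
          exact ⟨fun h => h.2.symm, fun h => ⟨hi.symm, h.symm⟩⟩
        simp only [h3, if_pos hi]
        exact hasSum_ite_eq i.2 _
      · have h3 : ∀ j, ¬ (i = (k, j)) := fun j hij => hi (by rw [hij])
        simp only [h3, if_neg hi, if_false]
        exact hasSum_zero
    convert! h2 using 1
    · funext j
      rw [Finset.sum_ite_eq']
      split_ifs with hj
      · rfl
      · rw [hg0 _ hj]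
        rfl
    · rw [distribution_sum_apply]
      refine Finset.sum_congr rfl fun i _ => ?_
      split_ifs <;> rfl
  · have h2 : HasSum (fun k => ∑ i ∈ S, if k = i.1 then g i (synTS φ χ i.1 i.2 ψ) else 0)
        (∑ i ∈ S, g i (synTS φ χ i.1 i.2 ψ)) :=
      hasSum_sum fun i _ => hasSum_ite_eq i.1 _
    convert! h2 using 1
    · funext k
      rw [distribution_sum_apply]
      refine Finset.sum_congr rfl fun i _ => ?_
      split_ifs <;> rfl
    · rw [hf, distribution_sum_apply]
      rfl

theorem l2Sum_ite {ι : Type*} [DecidableEq ι] (I : Finset ι) {b : ι → ℝ} (hb : ∀ i, 0 ≤ b i) :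
    l2Sum (fun i => if i ∈ I then ENNReal.ofReal (b i) else 0) =
      ENNReal.ofReal (√(∑ i ∈ I, b i ^ 2)) := by
  rw [l2Sum, tsum_eq_sum (s := I) fun i hi => by simp [hi], Real.sqrt_eq_rpow,
    ← ENNReal.ofReal_rpow_of_nonneg (Finset.sum_nonneg fun _ _ => by positivity) (by norm_num),
    ENNReal.ofReal_sum_of_nonneg fun _ _ => by positivity]
  congr 1
  refine Finset.sum_congr rfl fun i hi => ?_
  rw [if_pos hi, ENNReal.ofReal_rpow_of_nonneg (hb i) (by norm_num), Real.rpow_two]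

/-- The distribution `δ(t - t₀) h(x)` as an element of `Y^s`. -/
def unitInstY {φ χ : Space n → ℝ} (hφ : IsBump φ) (hχ : IsBump χ) (s : ℝ) {t : ℝ}
    (ht : t ∈ Icc (0 : ℝ) 1) : 𝓢(Space n, ℂ) →ₗ[ℂ] YSpace φ χ s where
  toFun h := ⟨instant t h, instant_mem_unitTimeDistributions ht h,
    ysNorm_instant_lt_top s hφ hχ t h⟩
  map_add' h h' := Subtype.ext ((instantL t).map_add h h')
  map_smul' c h := Subtype.ext ((instantL t).map_smul c h)

/-- The distribution `δ(t - t₀) h(x)` as an element of `Y^s`, or `0` if `t₀ ∉ [0,1]`. -/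
def instY {φ χ : Space n → ℝ} (hφ : IsBump φ) (hχ : IsBump χ) (s t : ℝ) :
    𝓢(Space n, ℂ) →ₗ[ℂ] YSpace φ χ s :=
  if ht : t ∈ Icc (0 : ℝ) 1 then unitInstY hφ hχ s ht else 0

section Functional

variable {φ χ : Space n → ℝ} (hφ : IsBump φ) (hχ : IsBump χ) (s : ℝ)

theorem instY_of_notMem {t : ℝ} (ht : t ∉ Icc (0 : ℝ) 1) (h : 𝓢(Space n, ℂ)) :
    instY hφ hχ s t h = 0 := by
  rw [instY, dif_neg ht, LinearMap.zero_apply]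

theorem val_instY (t : ℝ) (h : 𝓢(Space n, ℂ)) :
    (instY hφ hχ s t h).val = if t ∈ Icc (0 : ℝ) 1 then instant t h else 0 := by
  by_cases ht : t ∈ Icc (0 : ℝ) 1
  · rw [if_pos ht, instY, dif_pos ht]
    rfl
  · rw [if_neg ht, instY_of_notMem hφ hχ s ht]
    rfl

/-- The embedding of `Y^s` in the space of distributions. -/
def valY (φ χ : Space n → ℝ) (s : ℝ) : YSpace φ χ s →ₗ[ℂ] 𝓢'(SpaceTime n, ℂ) where
  toFun y := y.val
  map_add' _ _ := rfl
  map_smul' _ _ := rfl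

theorem valY_apply (y : YSpace φ χ s) : valY φ χ s y = y.val := rfl

theorem valY_injective : Function.Injective (valY φ χ s) := fun _ _ h => Subtype.ext h

theorem exists_norm_instY_le : ∃ C : ℝ, 0 ≤ C ∧ ∀ t h,
    ‖instY hφ hχ s t h‖ ≤ C * ‖((sobolevT s (expT t h)).toLp 2 : L2 n)‖ := by
  obtain ⟨C, hC, hb⟩ := exists_stepDist_bound s hφ hχ
  refine ⟨C.toReal, ENNReal.toReal_nonneg, fun t h => ?_⟩
  by_cases ht : t ∈ Icc (0 : ℝ) 1
  · have h1 := hb (fun _ => t) (fun _ => expT t h) 0 (instant t h) monotone_const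
      (schrodingerST_instant t h)
    have h2 : (l2Sum fun _ : Fin (0 + 1) => ‖((sobolevT s (expT t h)).toLp 2 : L2 n)‖ₑ) =
        ‖((sobolevT s (expT t h)).toLp 2 : L2 n)‖ₑ := by
      rw [l2Sum, tsum_fintype, Fin.sum_univ_one, ← ENNReal.rpow_mul]
      norm_num
    rw [h2] at h1
    rw [FiniteSpace.norm_eq, val_instY, if_pos ht]
    refine (ENNReal.toReal_mono (ENNReal.mul_ne_top hC enorm_ne_top) h1).trans_eq ?_
    rw [ENNReal.toReal_mul, toReal_enorm]
  · rw [instY_of_notMem hφ hχ s ht, norm_zero]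
    positivity

/-- The element of `Y^s` that becomes `δ(t - t₀) χ(D - k) (φ(x - j) h)` under `e^{itΔ}`. -/
def pieceY (i : (Fin n → ℤ) × (Fin n → ℤ)) (t : ℝ) : 𝓢(Space n, ℂ) →ₗ[ℂ] YSpace φ χ s :=
  instY hφ hχ s t ∘ₗ (expT (-t)).toLinearMap ∘ₗ (synF φ χ i.1 i.2).toLinearMap

theorem pieceY_apply (i : (Fin n → ℤ) × (Fin n → ℤ)) (t : ℝ) (h : 𝓢(Space n, ℂ)) :
    pieceY hφ hχ s i t h = instY hφ hχ s t (expT (-t) (synF φ χ i.1 i.2 h)) := rfl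

theorem pieceY_of_notMem (i : (Fin n → ℤ) × (Fin n → ℤ)) {t : ℝ} (ht : t ∉ Icc (0 : ℝ) 1)
    (h : 𝓢(Space n, ℂ)) : pieceY hφ hχ s i t h = 0 := instY_of_notMem hφ hχ s ht _

theorem schrodingerST_pieceY (i : (Fin n → ℤ) × (Fin n → ℤ)) (t : ℝ) (h : 𝓢(Space n, ℂ)) :
    schrodingerST (valY φ χ s (pieceY hφ hχ s i t h)) =
      pull (synTS φ χ i.1 i.2) (if t ∈ Icc (0 : ℝ) 1 then instant t h else 0) := by
  rw [valY_apply, pieceY_apply, val_instY]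
  split_ifs with ht
  · rw [schrodingerST_instant, expT_neg_expT, pull_synTS_instant hφ hχ]
  · rw [map_zero, map_zero]

/-- The sum of differences `(δ(t - t_{m+1}) - δ(t - t_m)) h_m`, restricted to times in `[0,1]`. -/
def diffDist (t : ℕ → ℝ) (h : ℕ → 𝓢(Space n, ℂ)) (K : ℕ) : 𝓢'(SpaceTime n, ℂ) :=
  ∑ m ∈ Finset.range K, ((if t (m + 1) ∈ Icc (0 : ℝ) 1 then instant (t (m + 1)) (h m) else 0) -
    if t m ∈ Icc (0 : ℝ) 1 then instant (t m) (h m) else 0)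

theorem isTimeDeriv_ite (t : ℝ) (h : 𝓢(Space n, ℂ)) :
    IsTimeDeriv (if t ∈ Icc (0 : ℝ) 1 then jump t (h.toLp 2 : L2 n) else 0)
      (if t ∈ Icc (0 : ℝ) 1 then instant t h else 0) := by
  split_ifs
  · exact isTimeDeriv_jump t h
  · exact isTimeDeriv_zero

theorem u2Norm_restricted_jumps_le {H : Type*} [NormedAddCommGroup H] [NormedSpace ℂ H]
    [CompleteSpace H] {t : ℕ → ℝ} (ht : Monotone t) (h : ℕ → H) (K : ℕ) :
    u2Norm (∑ m ∈ Finset.range K,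
      ((if t (m + 1) ∈ Icc (0 : ℝ) 1 then jump (t (m + 1)) (h m) else 0) -
        if t m ∈ Icc (0 : ℝ) 1 then jump (t m) (h m) else 0)) ≤
      ENNReal.ofReal (2 * √(∑ m ∈ Finset.range K, ‖h m‖ ^ 2)) := by
  have h1 := u2Norm_sum_jump_sub_le ht h K
  rw [ENNReal.ofReal_mul (by norm_num), ENNReal.ofReal_ofNat]
  refine le_trans ?_ (mul_le_mul_right h1 2)
  exact (IsRestriction.sum _ fun m _ => (isRestriction_jump _ _).sub
    (isRestriction_jump _ _)).u2Norm_le (h1.trans_lt ENNReal.ofReal_lt_top)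

theorem du2L2Norm_diffDist_le {t : ℕ → ℝ} (ht : Monotone t) (h : ℕ → 𝓢(Space n, ℂ)) (K : ℕ) :
    du2L2Norm (diffDist t h K) ≤ ENNReal.ofReal (2 * √(∑ m ∈ Finset.range K,
      ‖((h m).toLp 2 : L2 n)‖ ^ 2)) := by
  have h1 := u2Norm_restricted_jumps_le ht (fun m => ((h m).toLp 2 : L2 n)) K
  have h2 := IsTimeDeriv.sum (Finset.range K) fun m _ =>
    (isTimeDeriv_ite (t (m + 1)) (h m)).sub (isTimeDeriv_ite (t m) (h m))
  exact h2.du2L2Norm_le.trans h1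

/-- The weight `⟨k⟩^s`, as a real number. -/
def realWeight (s : ℝ) (k : Fin n → ℤ) : ℝ := (1 + ‖latticePoint k‖ ^ 2) ^ (s / 2)

theorem realWeight_pos (s : ℝ) (k : Fin n → ℤ) : 0 < realWeight s k := by
  unfold realWeight
  positivity

theorem weight_eq (s : ℝ) (k : Fin n → ℤ) : weight s k = ENNReal.ofReal (realWeight s k) := rfl

theorem weight_neg_eq (s : ℝ) (k : Fin n → ℤ) :
    weight (-s) k = ENNReal.ofReal (realWeight s k)⁻¹ := by
  rw [weight_eq, realWeight, realWeight, neg_div, Real.rpow_neg (by positivity)]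

/-- In each cell the differences form the time derivative of a step function, restricted to jumps in
`[0,1]` at the price of a factor `2`. The synthesis bound adds the cells in `ℓ²`. -/
theorem exists_norm_sum_pieceY_le : ∃ C : ℝ, 0 ≤ C ∧
    ∀ (I : Finset ((Fin n → ℤ) × (Fin n → ℤ))) (t : (Fin n → ℤ) × (Fin n → ℤ) → ℕ → ℝ)
      (K : (Fin n → ℤ) × (Fin n → ℤ) → ℕ) (h : (Fin n → ℤ) × (Fin n → ℤ) → ℕ → 𝓢(Space n, ℂ)),
      (∀ i, Monotone (t i)) → ‖∑ i ∈ I, ∑ m ∈ Finset.range (K i),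
        (pieceY hφ hχ s i (t i (m + 1)) (h i m) - pieceY hφ hχ s i (t i m) (h i m))‖ ≤
          C * √(∑ i ∈ I, realWeight s i.1 ^ 2 * ∑ m ∈ Finset.range (K i),
            ‖((h i m).toLp 2 : L2 n)‖ ^ 2) := by
  classical
  obtain ⟨C, hC, hb⟩ := exists_finite_synthesis_bound s hφ hχ
  refine ⟨C.toReal * 2, by positivity, fun I t K h ht => ?_⟩
  set g : (Fin n → ℤ) × (Fin n → ℤ) → 𝓢'(SpaceTime n, ℂ) := fun i =>
    if i ∈ I then diffDist (t i) (h i) (K i) else 0 with hg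
  set q : (Fin n → ℤ) × (Fin n → ℤ) → ℝ := fun i =>
    ∑ m ∈ Finset.range (K i), ‖((h i m).toLp 2 : L2 n)‖ ^ 2 with hq
  have hq0 : ∀ i, 0 ≤ q i := fun i => Finset.sum_nonneg fun m _ => by positivity
  have hgle : ∀ i, du2L2Norm (g i) ≤ if i ∈ I then ENNReal.ofReal (2 * √(q i)) else 0 := fun i => by
    by_cases hi : i ∈ I
    · simp only [hg, if_pos hi]
      exact du2L2Norm_diffDist_le (ht i) (h i) (K i)
    · simp only [hg, if_neg hi, isExtSeminorm_du2L2Norm.map_zero, le_refl]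
  have h1 := hb I g (∑ i ∈ I, ∑ m ∈ Finset.range (K i), (pieceY hφ hχ s i (t i (m + 1)) (h i m) -
    pieceY hφ hχ s i (t i m) (h i m))).val (fun i hi => by simp only [hg, if_neg hi]) (fun i => by
      refine (hgle i).trans_lt ?_
      split_ifs
      · exact ENNReal.ofReal_lt_top
      · exact ENNReal.zero_lt_top) (by
      rw [← valY_apply, map_sum, map_sum]
      refine Finset.sum_congr rfl fun i hi => ?_
      simp only [hg, if_pos hi, diffDist]
      rw [map_sum, map_sum, map_sum]
      refine Finset.sum_congr rfl fun m _ => ?_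
      rw [map_sub, map_sub, schrodingerST_pieceY, schrodingerST_pieceY, map_sub])
  have h2 : (l2Sum fun i => weight s i.1 * du2L2Norm (g i)) ≤
      ENNReal.ofReal (2 * √(∑ i ∈ I, realWeight s i.1 ^ 2 * q i)) := by
    have h3 : ∀ i, weight s i.1 * du2L2Norm (g i) ≤
        if i ∈ I then ENNReal.ofReal (realWeight s i.1 * (2 * √(q i))) else 0 := fun i => by
      refine (mul_le_mul_right (hgle i) _).trans_eq ?_
      split_ifs
      · rw [weight_eq, ← ENNReal.ofReal_mul (realWeight_pos s i.1).le]
      · rw [mul_zero]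
    refine (l2Sum_mono h3).trans_eq ?_
    rw [l2Sum_ite I fun i => mul_nonneg (realWeight_pos s i.1).le (by positivity)]
    congr 1
    have h4 : ∑ i ∈ I, (realWeight s i.1 * (2 * √(q i))) ^ 2 =
        2 ^ 2 * ∑ i ∈ I, realWeight s i.1 ^ 2 * q i := by
      rw [Finset.mul_sum]
      refine Finset.sum_congr rfl fun i _ => ?_
      rw [mul_pow, mul_pow, Real.sq_sqrt (hq0 i)]
      ring
    rw [h4, Real.sqrt_mul (by norm_num), Real.sqrt_sq (by norm_num)]
  rw [FiniteSpace.norm_eq]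
  refine (ENNReal.toReal_mono (ENNReal.mul_ne_top hC ENNReal.ofReal_ne_top)
    (h1.trans (mul_le_mul_right h2 C))).trans_eq ?_
  rw [ENNReal.toReal_mul, ENNReal.toReal_ofReal (by positivity), mul_assoc]

end Functional

end

section

/-! ### From functionals on `Y^s` to functions of time -/

theorem sum_weight_mul_l2Sum_le {ι H : Type*} [NormedAddCommGroup H] (I : Finset ι) (K : ι → ℕ)
    {w : ι → ℝ} (hw : ∀ i, 0 < w i) (x : ι → ℕ → H) {B : ℝ} (hB : 0 ≤ B)
    (h : ∑ i ∈ I, ((w i)⁻¹) ^ 2 * ∑ m ∈ Finset.range (K i), ‖x i m‖ ^ 2 ≤ B ^ 2) :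
    ∑ i ∈ I, (ENNReal.ofReal (w i)⁻¹ * l2Sum fun m : Fin (K i) => ‖x i m‖ₑ) ^ (2 : ℝ) ≤
      ENNReal.ofReal B ^ (2 : ℝ) := by
  have h1 : ∀ i, (ENNReal.ofReal (w i)⁻¹ * l2Sum fun m : Fin (K i) => ‖x i m‖ₑ) ^ (2 : ℝ) =
      ENNReal.ofReal (((w i)⁻¹) ^ 2 * ∑ m ∈ Finset.range (K i), ‖x i m‖ ^ 2) := fun i => by
    have hp := (inv_pos.2 (hw i)).le
    rw [← ofReal_sqrt_sum, ← ENNReal.ofReal_mul hp,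
      ENNReal.ofReal_rpow_of_nonneg (mul_nonneg hp (Real.sqrt_nonneg _)) (by norm_num),
      Real.rpow_two, mul_pow, Real.sq_sqrt (Finset.sum_nonneg fun _ _ => by positivity)]
  rw [Finset.sum_congr rfl fun i _ => h1 i, ← ENNReal.ofReal_sum_of_nonneg
    fun i _ => mul_nonneg (by positivity) (Finset.sum_nonneg fun _ _ => by positivity),
    ENNReal.ofReal_rpow_of_nonneg hB (by norm_num), Real.rpow_two]
  exact ENNReal.ofReal_le_ofReal h

theorem l2Sum_mul_v2Norm_le_of_pairing {ι P H : Type*} [NormedAddCommGroup H]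
    [InnerProductSpace ℂ H] {D : P → H} (hD : DenseRange D) {w : ι → ℝ} (hw : ∀ i, 0 < w i)
    (v : ι → ℝ → H) {B : ℝ} (hB : 0 ≤ B)
    (hb : ∀ (I : Finset ι) (t : ι → ℕ → ℝ) (K : ι → ℕ) (h : ι → ℕ → P), (∀ i, StrictMono (t i)) →
      ‖∑ i ∈ I, ∑ m ∈ Finset.range (K i),
        inner ℂ (D (h i m)) (v i (t i (m + 1)) - v i (t i m))‖ ≤
        B * √(∑ i ∈ I, w i ^ 2 * ∑ m ∈ Finset.range (K i), ‖D (h i m)‖ ^ 2)) :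
    l2Sum (fun i => ENNReal.ofReal (w i)⁻¹ * v2Norm (v i)) ≤ ENNReal.ofReal B :=
  l2Sum_mul_v2Norm_le v _ fun I t K ht =>
    sum_weight_mul_l2Sum_le I K hw (fun i m => v i (t i (m + 1)) - v i (t i m)) hB
      (sum_le_sq_of_pairing hD I K hw _ hB fun h => hb I t K h ht)

theorem continuous_conjSchwartz :
    Continuous (conjSchwartz : 𝓢(Space n, ℂ) → 𝓢(Space n, ℂ)) :=
  (SchwartzMap.postcompCLM (𝕜 := ℝ) (Complex.conjCLE : ℂ →L[ℝ] ℂ)).continuous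

theorem conjSchwartz_add (g h : 𝓢(Space n, ℂ)) :
    conjSchwartz (g + h) = conjSchwartz g + conjSchwartz h :=
  map_add (SchwartzMap.postcompCLM (𝕜 := ℝ) (Complex.conjCLE : ℂ →L[ℝ] ℂ)) g h

theorem conjSchwartz_zero : conjSchwartz (0 : 𝓢(Space n, ℂ)) = 0 :=
  map_zero (SchwartzMap.postcompCLM (𝕜 := ℝ) (Complex.conjCLE : ℂ →L[ℝ] ℂ))

theorem conjSchwartz_smul (c : ℂ) (h : 𝓢(Space n, ℂ)) :
    conjSchwartz (c • h) = conj c • conjSchwartz h := by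
  ext x
  simp [conjSchwartz_apply]

section Functional

variable {φ χ : Space n → ℝ} (hφ : IsBump φ) (hχ : IsBump χ) (s : ℝ)

/-- The linear form `ψ ↦ ℓ(δ(t - t₀) ψ̄)`. -/
def dualLinear (ℓ : YSpace φ χ s →L⋆[ℂ] ℂ) (t : ℝ) : 𝓢(Space n, ℂ) →ₗ[ℂ] ℂ where
  toFun ψ := ℓ (instY hφ hχ s t (conjSchwartz ψ))
  map_add' ψ ψ' := by rw [conjSchwartz_add, map_add, map_add]
  map_smul' c ψ := by
    rw [conjSchwartz_smul, map_smul, ContinuousLinearMap.map_smulₛₗ, Complex.conj_conj,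
      RingHom.id_apply]

/-- The `Y^s` norm of an instant is controlled by a Sobolev norm of its profile, which is continuous
on the Schwartz space. -/
theorem continuous_dualLinear (ℓ : YSpace φ χ s →L⋆[ℂ] ℂ) (t : ℝ) :
    Continuous (dualLinear hφ hχ s ℓ t) := by
  obtain ⟨C, hC, hb⟩ := exists_norm_instY_le hφ hχ s
  refine continuous_of_continuousAt_zero (dualLinear hφ hχ s ℓ t) ?_
  have h1 : Continuous fun ψ : 𝓢(Space n, ℂ) =>
      ‖ℓ‖ * (C * ‖SchwartzMap.toLpCLM ℂ ℂ 2 volume (sobolevT s (expT t (conjSchwartz ψ)))‖) :=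
    continuous_const.mul (continuous_const.mul ((SchwartzMap.toLpCLM ℂ ℂ 2 volume).continuous.comp
      ((sobolevT s).continuous.comp ((expT t).continuous.comp continuous_conjSchwartz))).norm)
  have h2 := h1.tendsto 0
  rw [conjSchwartz_zero, map_zero, map_zero, map_zero, norm_zero, mul_zero, mul_zero] at h2
  rw [ContinuousAt, map_zero]
  exact squeeze_zero_norm (fun ψ => (ℓ.le_opNorm _).trans
    (mul_le_mul_of_nonneg_left (hb t _) (norm_nonneg ℓ))) h2

/-- The function `u` of time that represents a functional `ℓ` on `Y^s`: `⟨u(t₀), h̄⟩` is the value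
of `ℓ` at `δ(t - t₀) h`. -/
def dualFun (ℓ : YSpace φ χ s →L⋆[ℂ] ℂ) (t : ℝ) : 𝓢'(Space n, ℂ) :=
  ContinuousLinearMap.toPointwiseConvergenceCLM _ _ _ _
    ⟨dualLinear hφ hχ s ℓ t, continuous_dualLinear hφ hχ s ℓ t⟩

theorem dualFun_apply (ℓ : YSpace φ χ s →L⋆[ℂ] ℂ) (t : ℝ) (ψ : 𝓢(Space n, ℂ)) :
    dualFun hφ hχ s ℓ t ψ = ℓ (instY hφ hχ s t (conjSchwartz ψ)) := rfl

theorem dualFun_mem (ℓ : YSpace φ χ s →L⋆[ℂ] ℂ) : dualFun hφ hχ s ℓ ∈ unitTimeFunctions n :=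
  fun t ht => by
    ext ψ
    rw [dualFun_apply, instY_of_notMem hφ hχ s ht, map_zero]
    rfl

/-- Testing a localized piece of the representing function means evaluating `ℓ` on an instant
synthesized in the same cell. -/
theorem pull_schrodinger_dualFun (ℓ : YSpace φ χ s →L⋆[ℂ] ℂ) (t : ℝ)
    (i : (Fin n → ℤ) × (Fin n → ℤ)) (h : 𝓢(Space n, ℂ)) :
    pull (locT φ χ i.1 i.2) (schrodinger t (dualFun hφ hχ s ℓ t)) (conjSchwartz h) =
      ℓ (pieceY hφ hχ s i t h) := by
  have h1 : pull (locT φ χ i.1 i.2) (schrodinger t (dualFun hφ hχ s ℓ t)) (conjSchwartz h) =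
      dualFun hφ hχ s ℓ t (expT t (locT φ χ i.1 i.2 (conjSchwartz h))) := rfl
  rw [h1, dualFun_apply, conjSchwartz_expT, ← conjSchwartz_synF hφ hχ, conjSchwartz_conjSchwartz,
    pieceY_apply]

theorem exists_norm_pieceY_le (i : (Fin n → ℤ) × (Fin n → ℤ)) : ∃ C : ℝ, 0 ≤ C ∧ ∀ t h,
    ‖pieceY hφ hχ s i t h‖ ≤ C * ‖(h.toLp 2 : L2 n)‖ := by
  obtain ⟨C, hC, hb⟩ := exists_norm_sum_pieceY_le hφ hχ s
  have hw := (realWeight_pos s i.1).le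
  refine ⟨C * realWeight s i.1, by positivity, fun t h => ?_⟩
  by_cases ht : t ∈ Icc (0 : ℝ) 1
  -- A single piece is a difference whose earlier time `-1` lies outside `[0,1]`, where pieces are
  -- zero.
  · have h1 := hb {i} (fun _ m => if m = 0 then -1 else t) (fun _ => 1) (fun _ _ => h) fun _ => by
      refine monotone_nat_of_le_succ fun m => ?_
      rw [if_neg m.succ_ne_zero]
      split_ifs
      · linarith [ht.1]
      · exact le_rfl
    rw [Finset.sum_singleton, Finset.sum_singleton, Finset.sum_range_one, Finset.sum_range_one,
      if_neg (Nat.succ_ne_zero 0), if_pos rfl, pieceY_of_notMem hφ hχ s i (t := -1) (by norm_num), sub_zero,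
      ← mul_pow, Real.sqrt_sq (by positivity), ← mul_assoc] at h1
    exact h1
  · rw [pieceY_of_notMem hφ hχ s i ht, norm_zero]
    positivity

theorem exists_l2_dualFun (ℓ : YSpace φ χ s →L⋆[ℂ] ℂ) (i : (Fin n → ℤ) × (Fin n → ℤ)) (t : ℝ) :
    ∃ v : L2 n, (v : 𝓢'(Space n, ℂ)) =
      pull (locT φ χ i.1 i.2) (schrodinger t (dualFun hφ hχ s ℓ t)) := by
  obtain ⟨C, hC, hb⟩ := exists_norm_pieceY_le hφ hχ s i
  obtain ⟨v, hv, -⟩ := exists_l2_of_bound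
    (pull (locT φ χ i.1 i.2) (schrodinger t (dualFun hφ hχ s ℓ t))) (C := ‖ℓ‖ * C) (by positivity)
    fun ψ => by
      have h1 := pull_schrodinger_dualFun hφ hχ s ℓ t i (conjSchwartz ψ)
      rw [conjSchwartz_conjSchwartz] at h1
      rw [h1, mul_assoc]
      refine (ℓ.le_opNorm _).trans (mul_le_mul_of_nonneg_left ?_ (norm_nonneg ℓ))
      refine (hb t _).trans_eq ?_
      rw [toLp_conjSchwartz, norm_conjL2]
  exact ⟨v, hv⟩

/-- Pairing the increments of all localized pieces with Schwartz functions gives, by linearity, the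
value of `ℓ` at one sum of differences of pieces. The bound for that sum dualizes to the `ℓ²` sum of
variations. -/
theorem exists_xsNorm_dualFun_le : ∃ C : ℝ, 0 ≤ C ∧ ∀ ℓ : YSpace φ χ s →L⋆[ℂ] ℂ,
    xsNorm φ χ (-s) (dualFun hφ hχ s ℓ) ≤ ENNReal.ofReal (C * ‖ℓ‖) := by
  obtain ⟨C, hC, hb⟩ := exists_norm_sum_pieceY_le hφ hχ s
  refine ⟨C, hC, fun ℓ => ?_⟩
  choose v hv using exists_l2_dualFun hφ hχ s ℓ
  have hin : ∀ i t h, inner ℂ (toL2 h) (v i t) = ℓ (pieceY hφ hχ s i t h) := fun i t h => by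
    rw [toL2_apply, ← coe_apply_conjSchwartz, hv, pull_schrodinger_dualFun]
  have h1 := l2Sum_mul_v2Norm_le_of_pairing (denseRange_toL2 (n := n))
    (fun i : (Fin n → ℤ) × (Fin n → ℤ) => realWeight_pos s i.1) v (B := C * ‖ℓ‖) (by positivity)
    fun I t K h ht => by
      have h2 : ∑ i ∈ I, ∑ m ∈ Finset.range (K i),
          inner ℂ (toL2 (h i m)) (v i (t i (m + 1)) - v i (t i m)) =
          ℓ (∑ i ∈ I, ∑ m ∈ Finset.range (K i), (pieceY hφ hχ s i (t i (m + 1)) (h i m) -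
            pieceY hφ hχ s i (t i m) (h i m))) := by
        simp only [inner_sub_right, hin, map_sum, map_sub]
      rw [h2, mul_comm C, mul_assoc]
      exact (ℓ.le_opNorm _).trans (mul_le_mul_of_nonneg_left
        (hb I t K h fun i => (ht i).monotone) (norm_nonneg ℓ))
  rw [xsNorm_eq φ hχ]
  refine (l2Sum_mono fun i => ?_).trans h1
  rw [weight_neg_eq]
  exact mul_le_mul_right (iInf₂_le (v i) (hv i)) _

end Functional

end

section

/-! ### From functions of time to functionals on `Y^s` -/

/-- The sum `∑ ⟨u(t), h̄_t⟩` for a finite family `h` of Schwartz functions. -/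
def timePairing (u : ℝ → 𝓢'(Space n, ℂ)) : (ℝ →₀ 𝓢(Space n, ℂ)) →ₛₗ[starRingEnd ℂ] ℂ where
  toFun p := p.sum fun t h => u t (conjSchwartz h)
  map_add' p q := by
    refine Finsupp.sum_add_index' (fun t => ?_) fun t h h' => ?_
    · rw [conjSchwartz_zero, map_zero]
    · rw [conjSchwartz_add, map_add]
  map_smul' c p := by
    rw [Finsupp.sum_smul_index' fun t => by rw [conjSchwartz_zero, map_zero], Finsupp.smul_sum]
    refine Finsupp.sum_congr fun t _ => ?_
    rw [conjSchwartz_smul, map_smul]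

theorem timePairing_single (u : ℝ → 𝓢'(Space n, ℂ)) (t : ℝ) (h : 𝓢(Space n, ℂ)) :
    timePairing u (Finsupp.single t h) = u t (conjSchwartz h) := by
  have h0 : u t (conjSchwartz (0 : 𝓢(Space n, ℂ))) = 0 := by
    rw [conjSchwartz_zero, map_zero]
  exact Finsupp.sum_single_index (h := fun t h => u t (conjSchwartz h)) h0

section Functional

variable {φ χ : Space n → ℝ} (s : ℝ)

/-- The element `∑ δ(t - t₀) h_{t₀}` of `Y^s`, for a finite family `h` of Schwartz functions. -/
def sumInstY (hφ : IsBump φ) (hχ : IsBump χ) (s : ℝ) :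
    (ℝ →₀ 𝓢(Space n, ℂ)) →ₗ[ℂ] YSpace φ χ s :=
  Finsupp.lsum ℂ fun t => instY hφ hχ s t

theorem sumInstY_single (hφ : IsBump φ) (hχ : IsBump χ) (t : ℝ) (h : 𝓢(Space n, ℂ)) :
    sumInstY hφ hχ s (Finsupp.single t h) = instY hφ hχ s t h :=
  Finsupp.sum_single_index (map_zero (instY hφ hχ s t))

theorem instantSpan_le_range (hφ : IsBump φ) (hχ : IsBump χ) :
    instantSpan φ χ s ≤ LinearMap.range (sumInstY hφ hχ s) := by
  refine Submodule.span_le.2 ?_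
  rintro f ⟨t, ht, h, hf⟩
  refine ⟨Finsupp.single t h, ?_⟩
  rw [sumInstY_single]
  refine valY_injective s ?_
  rw [valY_apply, valY_apply, val_instY, if_pos ht, hf]

theorem denseRange_sumInstY (hφ : IsUnitPartition φ) (hχ : IsUnitPartition χ) :
    DenseRange (sumInstY hφ.isBump hχ.isBump s) :=
  (dense_instantSpan s hφ hχ).mono (instantSpan_le_range s hφ.isBump hχ.isBump)

theorem exists_norm_timePairing_le (hφ : IsUnitPartition φ) (hχ : IsUnitPartition χ) :
    ∃ C : ℝ, 0 ≤ C ∧ ∀ (u : XSpace φ χ (-s)) p,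
      ‖timePairing u.val p‖ ≤ C * ‖u‖ * ‖sumInstY hφ.isBump hχ.isBump s p‖ := by
  classical
  obtain ⟨C, hC, hb⟩ := exists_pairing_le s hφ hχ
  refine ⟨C.toReal, ENNReal.toReal_nonneg, fun u p => ?_⟩
  have hu : u.val ∈ unitTimeFunctions n := u.2.1
  have hfin : xsNorm φ χ (-s) u.val < ⊤ := u.2.2
  have hy : ysNorm φ χ s (sumInstY hφ.isBump hχ.isBump s p).val < ⊤ :=
    (sumInstY hφ.isBump hχ.isBump s p).2.2
  have h1 := hb u.val hu hfin (p.support.filter (· ∈ Icc (0 : ℝ) 1)) p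
    fun t ht => (Finset.mem_filter.1 ht).2
  -- Times outside `[0,1]` may be discarded on both sides: `u` vanishes there, and so does `instY`.
  have h2 : ∑ t ∈ p.support.filter (· ∈ Icc (0 : ℝ) 1), u.val t (conjSchwartz (p t)) =
      timePairing u.val p := by
    refine (Finset.sum_filter_of_ne fun t _ hne => ?_).trans rfl
    by_contra ht
    rw [hu t ht] at hne
    exact hne rfl
  have h3 : ∑ t ∈ p.support.filter (· ∈ Icc (0 : ℝ) 1), instant t (p t) =
      (sumInstY hφ.isBump hχ.isBump s p).val := by
    have h4 : (sumInstY hφ.isBump hχ.isBump s p).val =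
        valY φ χ s (∑ t ∈ p.support, instY hφ.isBump hχ.isBump s t (p t)) := rfl
    rw [h4, map_sum, Finset.sum_filter]
    exact Finset.sum_congr rfl fun t _ => by rw [valY_apply, val_instY]
  rw [h2, h3] at h1
  rw [FiniteSpace.norm_eq, FiniteSpace.norm_eq, ← ENNReal.toReal_mul, ← ENNReal.toReal_mul,
    ← toReal_enorm]
  exact ENNReal.toReal_mono (ENNReal.mul_ne_top (ENNReal.mul_ne_top hC hfin.ne) hy.ne) h1

theorem exists_functional (hφ : IsUnitPartition φ) (hχ : IsUnitPartition χ) :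
    ∃ C : ℝ, 0 ≤ C ∧ ∀ u : XSpace φ χ (-s), ∃ ℓ : YSpace φ χ s →L⋆[ℂ] ℂ, ‖ℓ‖ ≤ C * ‖u‖ ∧
      ∀ t h, ℓ (instY hφ.isBump hχ.isBump s t h) = u.val t (conjSchwartz h) := by
  obtain ⟨C, hC, hb⟩ := exists_norm_timePairing_le s hφ hχ
  have hd := denseRange_sumInstY s hφ hχ
  refine ⟨C, hC, fun u => ⟨(timePairing u.val).extendOfNorm (sumInstY hφ.isBump hχ.isBump s),
    LinearMap.opNorm_extendOfNorm_le hd (by positivity) (hb u), fun t h => ?_⟩⟩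
  rw [← sumInstY_single, LinearMap.extendOfNorm_eq hd ⟨_, hb u⟩, timePairing_single]

theorem functional_ext (hφ : IsUnitPartition φ) (hχ : IsUnitPartition χ)
    {ℓ ℓ' : YSpace φ χ s →L⋆[ℂ] ℂ} (h : ∀ t h, ℓ (instY hφ.isBump hχ.isBump s t h) =
      ℓ' (instY hφ.isBump hχ.isBump s t h)) : ℓ = ℓ' := by
  refine ContinuousLinearMap.ext fun y => congrFun
    ((denseRange_sumInstY s hφ hχ).equalizer ℓ.continuous ℓ'.continuous (funext fun p => ?_)) y
  have h4 : sumInstY hφ.isBump hχ.isBump s p =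
      ∑ t ∈ p.support, instY hφ.isBump hχ.isBump s t (p t) := rfl
  simp only [Function.comp_apply, h4, map_sum, h]

/-- The map from functionals on `Y^s` to `X^{-s}`. -/
def toXSpace (hφ : IsBump φ) (hχ : IsBump χ) (s : ℝ) :
    (YSpace φ χ s →L⋆[ℂ] ℂ) →ₗ[ℂ] XSpace φ χ (-s) where
  toFun ℓ := ⟨dualFun hφ hχ s ℓ, dualFun_mem hφ hχ s ℓ,
    ((exists_xsNorm_dualFun_le hφ hχ s).choose_spec.2 ℓ).trans_lt ENNReal.ofReal_lt_top⟩
  map_add' _ _ := Subtype.ext (funext fun _ => by ext; rfl)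
  map_smul' _ _ := Subtype.ext (funext fun _ => by ext; rfl)

theorem val_toXSpace_apply (hφ : IsBump φ) (hχ : IsBump χ) (ℓ : YSpace φ χ s →L⋆[ℂ] ℂ) (t : ℝ)
    (h : 𝓢(Space n, ℂ)) :
    (toXSpace hφ hχ s ℓ).val t (conjSchwartz h) = ℓ (instY hφ hχ s t h) := by
  have h1 : (toXSpace hφ hχ s ℓ).val t (conjSchwartz h) =
    ℓ (instY hφ hχ s t (conjSchwartz (conjSchwartz h))) := rfl
  rw [h1, conjSchwartz_conjSchwartz]

theorem toXSpace_eq (hφ : IsBump φ) (hχ : IsBump χ) {ℓ : YSpace φ χ s →L⋆[ℂ] ℂ}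
    {u : XSpace φ χ (-s)} (h : ∀ t h, ℓ (instY hφ hχ s t h) = u.val t (conjSchwartz h)) :
    toXSpace hφ hχ s ℓ = u := by
  refine Subtype.ext (funext fun t => ?_)
  ext ψ
  have h1 := val_toXSpace_apply s hφ hχ ℓ t (conjSchwartz ψ)
  rw [h, conjSchwartz_conjSchwartz] at h1
  exact h1

/-- Injectivity is the density of instants. Surjectivity is the extension of the pairing with a
given `u` to a bounded functional. -/
theorem bijective_toXSpace (hφ : IsUnitPartition φ) (hχ : IsUnitPartition χ) :
    Function.Bijective (toXSpace hφ.isBump hχ.isBump s) := by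
  refine ⟨fun ℓ ℓ' h => functional_ext s hφ hχ fun t ψ => ?_, fun u => ?_⟩
  · rw [← val_toXSpace_apply, h, val_toXSpace_apply]
  · obtain ⟨C, -, hb⟩ := exists_functional s hφ hχ
    obtain ⟨ℓ, -, hℓ⟩ := hb u
    exact ⟨ℓ, toXSpace_eq s hφ.isBump hχ.isBump hℓ⟩

/-- The isomorphism of `X^{-s}` with the space of functionals on `Y^s`. -/
theorem exists_duality (hφ : IsUnitPartition φ) (hχ : IsUnitPartition χ) :
    ∃ Φ : XSpace φ χ (-s) ≃L[ℂ] (YSpace φ χ s →L⋆[ℂ] ℂ), ∀ u t h,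
      Φ u (instY hφ.isBump hχ.isBump s t h) = u.val t (conjSchwartz h) := by
  obtain ⟨C, hC, hb⟩ := exists_functional s hφ hχ
  obtain ⟨C', hC', hb'⟩ := exists_xsNorm_dualFun_le hφ.isBump hχ.isBump s
  set e := (LinearEquiv.ofBijective _ (bijective_toXSpace s hφ hχ)).symm with he
  have hsymm : ∀ ℓ, e.symm ℓ = toXSpace hφ.isBump hχ.isBump s ℓ := fun ℓ => rfl
  have happ : ∀ u t h, e u (instY hφ.isBump hχ.isBump s t h) = u.val t (conjSchwartz h) :=
    fun u t h => by rw [← val_toXSpace_apply, ← hsymm, LinearEquiv.symm_apply_apply]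
  refine ⟨e.toContinuousLinearEquivOfBounds C C' (fun u => ?_) fun ℓ => ?_, happ⟩
  · obtain ⟨ℓ, hℓ, h⟩ := hb u
    have : e u = ℓ := functional_ext s hφ hχ fun t ψ => by rw [happ, h]
    rwa [this]
  · rw [hsymm, FiniteSpace.norm_eq]
    exact ENNReal.toReal_le_of_le_ofReal (by positivity) (hb' ℓ)

end Functional

end

section

/-! ### Functions of bounded variation have countably many discontinuities -/

section Countable

variable {E : Type*} [NormedAddCommGroup E]

/-- The square of the 2-variation of `v` on `(-∞, T]`. -/
def variationTo (v : ℝ → E) (T : ℝ) : ℝ≥0∞ :=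
  ⨆ p : {t : ℕ → ℝ // Monotone t} × ℕ,
    ∑ i ∈ Finset.range p.2, ‖v (min (p.1.1 (i + 1)) T) - v (min (p.1.1 i) T)‖ₑ ^ (2 : ℝ)

theorem sum_le_variationTo (v : ℝ → E) {T : ℝ} {t : ℕ → ℝ} (ht : Monotone t) (hT : ∀ i, t i ≤ T)
    (K : ℕ) : ∑ i ∈ Finset.range K, ‖v (t (i + 1)) - v (t i)‖ₑ ^ (2 : ℝ) ≤ variationTo v T := by
  refine le_iSup_of_le (⟨⟨t, ht⟩, K⟩ : {t : ℕ → ℝ // Monotone t} × ℕ) (le_of_eq ?_)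
  exact Finset.sum_congr rfl fun i _ => by
    change _ = ‖v (min (t (i + 1)) T) - v (min (t i) T)‖ₑ ^ (2 : ℝ)
    rw [min_eq_left (hT _), min_eq_left (hT _)]

theorem variationTo_le (v : ℝ → E) (T : ℝ) : variationTo v T ≤ v2Norm v ^ (2 : ℝ) :=
  iSup_le fun p => sum_le_v2Norm v (fun _ _ h => min_le_min_right T (p.1.2 h)) p.2

/-- A partition truncated at `T` is prolonged by the times `T` and `T'`. -/
theorem variationTo_add_le (v : ℝ → E) {T T' : ℝ} (h : T ≤ T') :
    variationTo v T + ‖v T' - v T‖ₑ ^ (2 : ℝ) ≤ variationTo v T' := by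
  have key : ∀ p : {t : ℕ → ℝ // Monotone t} × ℕ,
      (∑ i ∈ Finset.range p.2, ‖v (min (p.1.1 (i + 1)) T) - v (min (p.1.1 i) T)‖ₑ ^ (2 : ℝ)) +
        ‖v T' - v T‖ₑ ^ (2 : ℝ) ≤ variationTo v T' := by
    rintro ⟨⟨t, ht⟩, K⟩
    set τ : ℕ → ℝ := fun i => if i ≤ K then min (t i) T else if i = K + 1 then T else T' with hτ
    have hτm : Monotone τ := monotone_nat_of_le_succ fun i => by
      simp only [hτ]
      have h1 := ht i.le_succ
      split_ifs <;> first | omega | skip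
      · exact min_le_min_right T h1
      · exact min_le_right _ _
      · exact le_rfl
    have hτT : ∀ i, τ i ≤ T' := fun i => by
      simp only [hτ]
      split_ifs
      · exact (min_le_right _ _).trans h
      · exact h
      · exact le_rfl
    refine le_trans ?_ (sum_le_variationTo v hτm hτT (K + 2))
    rw [Finset.sum_range_succ, Finset.sum_range_succ, add_assoc]
    refine add_le_add (le_of_eq (Finset.sum_congr rfl fun i hi => ?_)) (le_add_left (le_of_eq ?_))
    · have hi' := Finset.mem_range.1 hi
      simp only [hτ, if_pos hi'.le, if_pos (Nat.succ_le_of_lt hi')]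
    · have h2 : ¬ K + 1 + 1 ≤ K := by omega
      have h3 : ¬ K + 1 ≤ K := by omega
      have h4 : K + 1 + 1 ≠ K + 1 := by omega
      simp only [hτ, if_neg h2, if_neg h3, if_neg h4, if_true]
  have hfin : ‖v T' - v T‖ₑ ^ (2 : ℝ) ≠ ⊤ :=
    ENNReal.rpow_ne_top_of_nonneg (by norm_num) enorm_ne_top
  have h1 : ‖v T' - v T‖ₑ ^ (2 : ℝ) ≤ variationTo v T' :=
    le_add_self.trans (key ⟨⟨fun _ => 0, monotone_const⟩, 0⟩)
  exact add_le_of_le_tsub_right_of_le h1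
    (iSup_le fun p => ENNReal.le_sub_of_add_le_right hfin (key p))

/-- Squared increments of `v` are dominated by increments of the monotone function `variationTo v`,
so `v` is continuous wherever that function is. -/
theorem countable_not_continuousAt_of_v2Norm {v : ℝ → E} (hv : v2Norm v < ⊤) :
    {t | ¬ContinuousAt v t}.Countable := by
  have hfin : ∀ T, variationTo v T ≠ ⊤ := fun T => ((variationTo_le v T).trans_lt
    (ENNReal.rpow_lt_top_of_nonneg (by norm_num) hv.ne)).ne
  have key : ∀ {T T'}, T ≤ T' →
      ‖v T' - v T‖ ^ 2 ≤ (variationTo v T').toReal - (variationTo v T).toReal := fun {T T'} h => by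
    have h1 := ENNReal.toReal_mono (hfin _) (variationTo_add_le v h)
    rw [ENNReal.toReal_add (hfin _) (ENNReal.rpow_ne_top_of_nonneg (by norm_num) enorm_ne_top),
      ← ENNReal.toReal_rpow, toReal_enorm, Real.rpow_two] at h1
    linarith
  have hmono : Monotone fun T => (variationTo v T).toReal := fun T T' h => by
    have := key h
    have := sq_nonneg ‖v T' - v T‖
    simp only
    linarith
  refine hmono.countable_not_continuousAt.mono fun t ht => ?_
  refine fun hc => ht ?_
  have hle : ∀ τ, ‖v τ - v t‖ ≤ √|(variationTo v τ).toReal - (variationTo v t).toReal| := fun τ => by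
    refine Real.le_sqrt_of_sq_le ?_
    rcases le_total t τ with h | h
    · exact (key h).trans (le_abs_self _)
    · rw [norm_sub_rev, abs_sub_comm]
      exact (key h).trans (le_abs_self _)
  have hlim : Filter.Tendsto
      (fun τ => √|(variationTo v τ).toReal - (variationTo v t).toReal|) (nhds t) (nhds 0) := by
    have h1 := ((hc.tendsto.sub_const (variationTo v t).toReal).abs).sqrt
    simpa using h1
  exact tendsto_iff_norm_sub_tendsto_zero.2
    (squeeze_zero (fun _ => norm_nonneg _) hle hlim)

/-- Off the countable union of the exceptional sets all `F r` are continuous, and near a point `θ`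
is uniformly close to `F r` for a nearby rational `r`. -/
theorem countable_not_continuousAt_of_lipschitz {θ : ℝ → E} {F : ℚ → ℝ → E} {L : ℝ}
    (hF : ∀ r, {t | ¬ContinuousAt (F r) t}.Countable)
    (hL : ∀ (r : ℚ) t, ‖θ t - F r t‖ ≤ L * |t - r|) : {t | ¬ContinuousAt θ t}.Countable := by
  refine (Set.countable_iUnion hF).mono fun t ht => ?_
  by_contra hcon
  simp only [mem_iUnion, mem_ofPred_eq, not_exists, not_not] at hcon
  refine ht (Metric.continuousAt_iff.2 fun ε hε => ?_)
  have hL0 : 0 ≤ L := by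
    have h1 := (norm_nonneg _).trans (hL 0 1)
    simpa using h1
  -- The three errors are at most `2Lδ ≤ ε/3`, less than `ε/3`, and `Lδ ≤ ε/6`; the `1` covers `L =
  -- 0`.
  set δ := ε / (6 * (L + 1)) with hδ
  have hδ0 : 0 < δ := by positivity
  have hLδ : L * δ ≤ ε / 6 := by
    rw [hδ, mul_div_assoc', div_le_div_iff₀ (by positivity) (by norm_num)]
    nlinarith
  obtain ⟨r, hr1, hr2⟩ := exists_rat_btwn (show t < t + δ by linarith)
  obtain ⟨η, hη, hc⟩ := Metric.continuousAt_iff.1 (hcon r) (ε / 3) (by positivity)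
  refine ⟨min η δ, lt_min hη hδ0, fun {τ} hτ => ?_⟩
  have h1 := hc (hτ.trans_le (min_le_left _ _))
  have h2 : |τ - t| < δ := (Real.dist_eq τ t ▸ hτ).trans_le (min_le_right _ _)
  have h3 : ‖θ τ - F r τ‖ ≤ L * (2 * δ) := (hL r τ).trans (mul_le_mul_of_nonneg_left (by
    rw [abs_le]
    rw [abs_lt] at h2
    constructor <;> linarith) hL0)
  have h4 : ‖θ t - F r t‖ ≤ L * δ := (hL r t).trans (mul_le_mul_of_nonneg_left (by
    rw [abs_le]
    constructor <;> linarith) hL0)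
  rw [dist_eq_norm] at h1 ⊢
  have h5 : θ τ - θ t = (θ τ - F r τ) + (F r τ - F r t) - (θ t - F r t) := by abel
  rw [h5]
  have h6 := norm_sub_le ((θ τ - F r τ) + (F r τ - F r t)) (θ t - F r t)
  have h7 := norm_add_le (θ τ - F r τ) (F r τ - F r t)
  linarith

theorem countable_not_continuousAt_of_eqOn {θ θ' : ℝ → E} {a b : ℝ}
    (hθ : {t | ¬ContinuousAt θ' t}.Countable) (h : ∀ t ∈ Icc a b, θ t = θ' t)
    (h0 : ∀ t, t ∉ Icc a b → θ t = 0) : {t | ¬ContinuousAt θ t}.Countable := by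
  refine (hθ.union (Set.countable_insert.2 (Set.countable_singleton b) : ({a, b} : Set ℝ).Countable)).mono
    fun t ht => ?_
  by_contra hcon
  simp only [mem_union, mem_ofPred_eq, mem_insert_iff, mem_singleton_iff, not_or, not_not] at hcon
  obtain ⟨hc, hta, htb⟩ := hcon
  refine ht ?_
  by_cases hmem : t ∈ Icc a b
  · refine hc.congr (Filter.eventuallyEq_of_mem
      (Ioo_mem_nhds (lt_of_le_of_ne hmem.1 (Ne.symm hta)) (lt_of_le_of_ne hmem.2 htb)) fun τ hτ => ?_)
    exact (h τ (Ioo_subset_Icc_self hτ)).symm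
  · refine continuousAt_const.congr (f := fun _ => (0 : E)) (Filter.eventuallyEq_of_mem
      (isClosed_Icc.isOpen_compl.mem_nhds hmem) fun τ hτ => ?_)
    exact (h0 τ hτ).symm

end Countable

/-! ### Functionals evaluated along the flow and on truncations -/

theorem sum_norm_sq_le_of_functional {Y : Type*} [SeminormedAddCommGroup Y] [NormedSpace ℂ Y]
    (ℓ : Y →L⋆[ℂ] ℂ) (y : ℕ → Y) (K : ℕ) {M : ℝ}
    (hM : 0 ≤ M) (hb : ∀ c : ℕ → ℂ, ‖∑ m ∈ Finset.range K, c m • y m‖ ≤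
      M * √(∑ m ∈ Finset.range K, ‖c m‖ ^ 2)) :
    √(∑ m ∈ Finset.range K, ‖ℓ (y m)‖ ^ 2) ≤ ‖ℓ‖ * M := by
  set S := ∑ m ∈ Finset.range K, ‖ℓ (y m)‖ ^ 2 with hS
  have hS0 : 0 ≤ S := Finset.sum_nonneg fun _ _ => by positivity
  -- The coefficients `ℓ (y m)` are extremal; conjugate linearity turns them into the squares `‖ℓ (y
  -- m)‖ ^ 2`.
  have h1 : ℓ (∑ m ∈ Finset.range K, ℓ (y m) • y m) = (S : ℂ) := by
    rw [map_sum, hS, Complex.ofReal_sum]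
    refine Finset.sum_congr rfl fun m _ => ?_
    rw [ContinuousLinearMap.map_smulₛₗ, smul_eq_mul, mul_comm, Complex.mul_conj,
      Complex.normSq_eq_norm_sq]
  have h2 : S ≤ ‖ℓ‖ * M * √S := by
    have h3 := (ℓ.le_opNorm _).trans (mul_le_mul_of_nonneg_left (hb fun m => ℓ (y m))
      (norm_nonneg ℓ))
    rw [h1, Complex.norm_real, Real.norm_of_nonneg hS0, ← mul_assoc] at h3
    exact h3
  by_contra! hcon
  have hpos : 0 < √S := (mul_nonneg (norm_nonneg ℓ) hM).trans_lt hcon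
  nlinarith [Real.mul_self_sqrt hS0]

theorem stepDist_neg (t : ℕ → ℝ) (a : ℕ → 𝓢(Space n, ℂ)) (K : ℕ) :
    stepDist t (fun m => -a m) K = (∑ m ∈ Finset.range K,
      (instant (t (m + 1)) (a m) - instant (t m) (a m))) - instant (t K) (a K) := by
  have hsub : ∀ t (h h' : 𝓢(Space n, ℂ)), instant t (h - h') = instant t h - instant t h' :=
    fun t => map_sub (instantL t)
  have hneg : ∀ t (h : 𝓢(Space n, ℂ)), instant t (-h) = -instant t h :=
    fun t => map_neg (instantL t)
  induction K with
  | zero => rw [stepDist, hneg, Finset.sum_range_zero, zero_sub]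
  | succ K ih =>
    rw [stepDist, ih, hsub, hneg, hneg, Finset.sum_range_succ]
    abel

section Functional

variable {φ χ : Space n → ℝ} (hφ : IsBump φ) (hχ : IsBump χ) (s : ℝ)

theorem schrodingerST_sum_instY {t : ℕ → ℝ} (hmem : ∀ m, t m ∈ Icc (0 : ℝ) 1) (c : ℕ → ℂ)
    (h : 𝓢(Space n, ℂ)) (K : ℕ) :
    schrodingerST (∑ m ∈ Finset.range K, c m • (instY hφ hχ s (t (m + 1)) (expT (-t (m + 1)) h) -
      instY hφ hχ s (t m) (expT (-t m) h))).val =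
      stepDist t (fun m => -(if m < K then c m • h else 0)) K := by
  rw [stepDist_neg, if_neg (lt_irrefl K), ← valY_apply, map_sum, map_sum]
  have h0 : instant (t K) (0 : 𝓢(Space n, ℂ)) = 0 := map_zero (instantL (t K))
  rw [h0, sub_zero]
  refine Finset.sum_congr rfl fun m hm => ?_
  have hsmul : ∀ t, instant t (c m • h) = c m • instant t h := fun t => map_smul (instantL t) (c m) h
  rw [if_pos (Finset.mem_range.1 hm), map_smul, map_sub, valY_apply, valY_apply, val_instY,
    val_instY, if_pos (hmem _), if_pos (hmem _), map_smul, map_sub, schrodingerST_instant,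
    schrodingerST_instant, expT_neg_expT, expT_neg_expT, hsmul, hsmul, smul_sub]

theorem l2Sum_enorm_eq {H : Type*} [NormedAddCommGroup H] [NormedSpace ℂ H] (c : ℕ → ℂ) (x : H)
    (y : ℕ → H) (K : ℕ) (hy : ∀ m, ‖y m‖ = if m < K then ‖c m‖ * ‖x‖ else 0) :
    (l2Sum fun m : Fin (K + 1) => ‖y m‖ₑ) =
      ENNReal.ofReal (‖x‖ * √(∑ m ∈ Finset.range K, ‖c m‖ ^ 2)) := by
  rw [← ofReal_sqrt_sum, Finset.sum_range_succ, hy K, if_neg (lt_irrefl K)]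
  congr 1
  have h1 : ∑ m ∈ Finset.range K, ‖y m‖ ^ 2 = ‖x‖ ^ 2 * ∑ m ∈ Finset.range K, ‖c m‖ ^ 2 := by
    rw [Finset.mul_sum]
    refine Finset.sum_congr rfl fun m hm => ?_
    rw [hy m, if_pos (Finset.mem_range.1 hm)]
    ring
  rw [h1, zero_pow two_ne_zero, add_zero, Real.sqrt_mul (by positivity),
    Real.sqrt_sq (norm_nonneg x)]

theorem exists_norm_sum_instY_le : ∃ C : ℝ, 0 ≤ C ∧ ∀ (t : ℕ → ℝ) (c : ℕ → ℂ)
    (h : 𝓢(Space n, ℂ)) (K : ℕ), Monotone t → (∀ m, t m ∈ Icc (0 : ℝ) 1) →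
      ‖∑ m ∈ Finset.range K, c m • (instY hφ hχ s (t (m + 1)) (expT (-t (m + 1)) h) -
        instY hφ hχ s (t m) (expT (-t m) h))‖ ≤
        C * ‖toL2 (sobolevT s h)‖ * √(∑ m ∈ Finset.range K, ‖c m‖ ^ 2) := by
  obtain ⟨C, hC, hb⟩ := exists_stepDist_bound s hφ hχ
  refine ⟨C.toReal, ENNReal.toReal_nonneg, fun t c h K ht hmem => ?_⟩
  have h1 := hb t _ K _ ht (schrodingerST_sum_instY hφ hχ s hmem c h K)
  have h2 := l2Sum_enorm_eq c (toL2 (sobolevT s h))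
    (fun m => toL2 (sobolevT s (-(if m < K then c m • h else 0)))) K fun m => by
      split_ifs
      · rw [map_neg, map_neg, map_smul, map_smul, norm_neg, norm_smul]
      · rw [neg_zero, map_zero, map_zero, norm_zero]
  have h3 := h1.trans_eq (congrArg (C * ·) h2)
  rw [FiniteSpace.norm_eq, mul_assoc]
  refine (ENNReal.toReal_mono (ENNReal.mul_ne_top hC ENNReal.ofReal_ne_top) h3).trans_eq ?_
  rw [ENNReal.toReal_mul, ENNReal.toReal_ofReal (by positivity)]

/-- The flow cancels the factor `e^{-itΔ}`, so combinations of increments become derivatives of step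
functions with multiples of the single profile `h`, bounded by the `ℓ²` norm of the coefficients.
The projection to `[0,1]` freezes time outside, keeping all instants within the range where `instY`
is nontrivial. -/
theorem v2Norm_functional_lt_top (ℓ : YSpace φ χ s →L⋆[ℂ] ℂ) (h : 𝓢(Space n, ℂ)) :
    v2Norm (fun t => ℓ (instY hφ hχ s (projIcc (0 : ℝ) 1 zero_le_one t)
      (expT (-(projIcc (0 : ℝ) 1 zero_le_one t : ℝ)) h))) < ⊤ := by
  obtain ⟨C, hC, hb⟩ := exists_norm_sum_instY_le hφ hχ s
  refine lt_of_le_of_lt (b := ENNReal.ofReal (‖ℓ‖ * (C * ‖toL2 (sobolevT s h)‖))) ?_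
    ENNReal.ofReal_lt_top
  refine iSup_le fun t => iSup₂_le fun ht K => ?_
  have h1 := sum_norm_sq_le_of_functional ℓ (fun m =>
    instY hφ hχ s (projIcc (0 : ℝ) 1 zero_le_one (t (m + 1)))
      (expT (-(projIcc (0 : ℝ) 1 zero_le_one (t (m + 1)) : ℝ)) h) -
    instY hφ hχ s (projIcc (0 : ℝ) 1 zero_le_one (t m))
      (expT (-(projIcc (0 : ℝ) 1 zero_le_one (t m) : ℝ)) h)) K
    (M := C * ‖toL2 (sobolevT s h)‖) (by positivity) fun c =>
      hb (fun m => projIcc (0 : ℝ) 1 zero_le_one (t m)) c h K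
        (fun _ _ hm => monotone_projIcc zero_le_one (ht.monotone hm))
        fun m => (projIcc (0 : ℝ) 1 zero_le_one (t m)).2
  simp only [map_sub] at h1
  exact (ofReal_sqrt_sum _ K).symm.trans_le (ENNReal.ofReal_le_ofReal h1)

theorem countable_not_continuousAt_functional (ℓ : YSpace φ χ s →L⋆[ℂ] ℂ) (h : 𝓢(Space n, ℂ)) :
    {t | ¬ContinuousAt (fun t => ℓ (instY hφ hχ s t (expT (-t) h))) t}.Countable := by
  refine countable_not_continuousAt_of_eqOn (a := 0) (b := 1)
    (countable_not_continuousAt_of_v2Norm (v2Norm_functional_lt_top hφ hχ s ℓ h))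
    (fun t ht => ?_) fun t ht => ?_
  · rw [projIcc_of_mem zero_le_one ht]
  · rw [instY_of_notMem hφ hχ s ht, map_zero]

theorem sobolevT_expT_slice (g : 𝓢(SpaceTime n, ℂ)) (t : ℝ) :
    toL2 (sobolevT s (slice t (schrodingerTest g))) = sliceL2 (multT
      (fun p : SpaceTime n => sobolevSymbol s p.snd) (schrodingerTest g)) t := by
  rw [toL2_apply, sliceL2, slice_multT (sobolevSymbol_temperate s), sobolevT]

theorem slice_eq_expT_neg (g : 𝓢(SpaceTime n, ℂ)) (t : ℝ) :
    slice t g = expT (-t) (slice t (schrodingerTest g)) := by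
  rw [slice_schrodingerTest, ← expT]
  have h := expT_neg_expT (-t) (slice t g)
  rw [neg_neg] at h
  exact h.symm

theorem exists_norm_functional_le (ℓ : YSpace φ χ s →L⋆[ℂ] ℂ) : ∃ C : ℝ, 0 ≤ C ∧ ∀ t h,
    ‖ℓ (instY hφ hχ s t (expT (-t) h))‖ ≤ C * ‖toL2 (sobolevT s h)‖ := by
  obtain ⟨C, hC, hb⟩ := exists_norm_instY_le hφ hχ s
  refine ⟨‖ℓ‖ * C, by positivity, fun t h => (ℓ.le_opNorm _).trans ?_⟩
  have h1 := hb t (expT (-t) h)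
  rw [expT_neg_expT] at h1
  rw [mul_assoc]
  exact mul_le_mul_of_nonneg_left h1 (norm_nonneg ℓ)

/-- `g(t)` is `e^{-itΔ}` applied to a profile that is Lipschitz in time for the Sobolev norm.
Freezing the profile at a rational time reduces to a fixed vector, with an error linear in the time
difference. -/
theorem countable_not_continuousAt_slice (ℓ : YSpace φ χ s →L⋆[ℂ] ℂ) (g : 𝓢(SpaceTime n, ℂ)) :
    {t | ¬ContinuousAt (fun t => ℓ (instY hφ hχ s t (slice t g))) t}.Countable := by
  obtain ⟨C, hC, hb⟩ := exists_norm_functional_le hφ hχ s ℓ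
  obtain ⟨L, hL, hlip⟩ := exists_sliceL2_lipschitz (multT
    (fun p : SpaceTime n => sobolevSymbol s p.snd) (schrodingerTest g))
  refine countable_not_continuousAt_of_lipschitz (L := C * L)
    (fun r : ℚ => countable_not_continuousAt_functional hφ hχ s ℓ (slice r (schrodingerTest g)))
    fun r t => ?_
  rw [slice_eq_expT_neg, ← map_sub, ← map_sub, ← map_sub]
  refine (hb t _).trans ?_
  rw [map_sub, map_sub, sobolevT_expT_slice, sobolevT_expT_slice, mul_assoc]
  exact mul_le_mul_of_nonneg_left (hlip t r) hC

theorem exists_norm_functional_slice_le (ℓ : YSpace φ χ s →L⋆[ℂ] ℂ) (g : 𝓢(SpaceTime n, ℂ)) :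
    ∃ B, ∀ t, ‖ℓ (instY hφ hχ s t (slice t g))‖ ≤ B := by
  obtain ⟨C, hC, hb⟩ := exists_norm_functional_le hφ hχ s ℓ
  obtain ⟨B, hB, hbd⟩ := exists_norm_sliceL2_bound (multT
    (fun p : SpaceTime n => sobolevSymbol s p.snd) (schrodingerTest g))
  refine ⟨C * B, fun t => ?_⟩
  rw [slice_eq_expT_neg]
  refine (hb t _).trans ?_
  rw [sobolevT_expT_slice]
  exact mul_le_mul_of_nonneg_left (hbd t) hC

/-- The Riemann distributions converge to `f` in `Y^s`, and `ℓ` maps them to Riemann sums of a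
bounded function with countably many discontinuities. -/
theorem functional_truncation (ℓ : YSpace φ χ s →L⋆[ℂ] ℂ) {g : 𝓢(SpaceTime n, ℂ)}
    {f : YSpace φ χ s} (hf : IsTruncation g f.val) :
    IntervalIntegrable (fun t => ℓ (instY hφ hχ s t (slice t g))) volume 0 1 ∧
      ℓ f = ∫ t in (0 : ℝ)..1, ℓ (instY hφ hχ s t (slice t g)) := by
  obtain ⟨B, hB⟩ := exists_norm_functional_slice_le hφ hχ s ℓ g
  obtain ⟨hint, hlim⟩ := tendsto_dyadic_sum hB (countable_not_continuousAt_slice hφ hχ s ℓ g)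
  refine ⟨hint, ?_⟩
  set R : ℕ → YSpace φ χ s := fun m => ∑ i ∈ Finset.range (2 ^ m),
    ((2 : ℂ) ^ m)⁻¹ • instY hφ hχ s ((i : ℝ) / 2 ^ m) (slice ((i : ℝ) / 2 ^ m) g) with hR
  have hRval : ∀ m, (f - R m).val = f.val - riemannDist g m := fun m => by
    rw [← valY_apply, map_sub, valY_apply, hR, map_sum, riemannDist]
    congr 1
    refine Finset.sum_congr rfl fun i hi => ?_
    have hi' : (i : ℝ) < 2 ^ m := by exact_mod_cast Finset.mem_range.1 hi
    rw [map_smul, valY_apply, val_instY, if_pos]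
    exact ⟨by positivity, (div_le_one (by positivity)).2 hi'.le⟩
  have hRlim : Filter.Tendsto R Filter.atTop (nhds f) := by
    rw [tendsto_iff_norm_sub_tendsto_zero]
    have h1 := (ENNReal.tendsto_toReal ENNReal.zero_ne_top).comp (hf.tendsto_riemannDist s hφ hχ)
    refine h1.congr fun m => ?_
    rw [norm_sub_rev, FiniteSpace.norm_eq, hRval]
    rfl
  refine tendsto_nhds_unique ((ℓ.continuous.tendsto f).comp hRlim) (hlim.congr fun m => ?_)
  rw [Function.comp_apply, hR, map_sum]
  refine Finset.sum_congr rfl fun i _ => ?_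
  rw [ContinuousLinearMap.map_smulₛₗ, smul_eq_mul]
  rw [map_inv₀, map_pow, Complex.conj_ofNat]

end Functional

end

end WavePacket

end

/-! ### The duality theorem -/

theorem mainTheorem9 (n : ℕ) (s : ℝ) (φ χ : WavePacket.Space n → ℝ)
    (hφ : WavePacket.IsUnitPartition φ) (hχ : WavePacket.IsUnitPartition χ) :
    -- Schwartz functions `g`, restricted to `[0,1] × ℝⁿ`, belong to `Y^s`;
    (∀ g : 𝓢(WavePacket.SpaceTime n, ℂ), ∃ f : WavePacket.YSpace φ χ s,
      WavePacket.IsTruncation g f.val) ∧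
    -- the distributions `δ(t - t₀) h(x)` belong to `Y^s`, and they span a dense subspace;
    (∀ t₀ ∈ Icc (0 : ℝ) 1, ∀ h : 𝓢(WavePacket.Space n, ℂ), ∃ f : WavePacket.YSpace φ χ s,
      f.val = WavePacket.instant t₀ h) ∧
    Dense (Submodule.span ℂ {f : WavePacket.YSpace φ χ s | ∃ t₀ ∈ Icc (0 : ℝ) 1,
      ∃ h : 𝓢(WavePacket.Space n, ℂ), f.val = WavePacket.instant t₀ h} :
        Set (WavePacket.YSpace φ χ s)) ∧
    -- the pairing `∫∫ u f̄ dx dt` identifies `X^{-s}` with the dual of `Y^s`.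
    ∃ Φ : WavePacket.XSpace φ χ (-s) ≃L[ℂ] (WavePacket.YSpace φ χ s →L⋆[ℂ] ℂ),
      (∀ (u : WavePacket.XSpace φ χ (-s)) (f : WavePacket.YSpace φ χ s),
        ∀ t₀ ∈ Icc (0 : ℝ) 1, ∀ h : 𝓢(WavePacket.Space n, ℂ), f.val = WavePacket.instant t₀ h →
          Φ u f = u.val t₀ (WavePacket.conjSchwartz h)) ∧
      (∀ (u : WavePacket.XSpace φ χ (-s)) (f : WavePacket.YSpace φ χ s)
        (g : 𝓢(WavePacket.SpaceTime n, ℂ)), WavePacket.IsTruncation g f.val →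
          IntervalIntegrable (fun t => u.val t (WavePacket.conjSchwartz (WavePacket.slice t g)))
            volume 0 1 ∧
          Φ u f = ∫ t in (0 : ℝ)..1, u.val t (WavePacket.conjSchwartz (WavePacket.slice t g))) := by
  obtain ⟨Φ, hΦ⟩ := WavePacket.exists_duality s hφ hχ
  have hinst : ∀ (f : WavePacket.YSpace φ χ s) t₀ (h : 𝓢(WavePacket.Space n, ℂ)),
      t₀ ∈ Icc (0 : ℝ) 1 → f.val = WavePacket.instant t₀ h →
        f = WavePacket.instY hφ.isBump hχ.isBump s t₀ h := fun f t₀ h ht hf => by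
    refine WavePacket.valY_injective s ?_
    rw [WavePacket.valY_apply, WavePacket.valY_apply, WavePacket.val_instY, if_pos ht, hf]
  refine ⟨fun g => ?_, fun t₀ ht h => ⟨WavePacket.instY hφ.isBump hχ.isBump s t₀ h, ?_⟩,
    WavePacket.dense_instantSpan s hφ hχ, Φ, fun u f t₀ ht h hf => ?_, fun u f g hf => ?_⟩
  · obtain ⟨f, hf⟩ := WavePacket.exists_isTruncation g
    exact ⟨⟨f, hf.mem_unitTimeDistributions, hf.ysNorm_lt_top s hφ.isBump hχ.isBump⟩, hf⟩
  · rw [WavePacket.val_instY, if_pos ht]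
  · rw [hinst f t₀ h ht hf, hΦ]
  · have h := WavePacket.functional_truncation hφ.isBump hχ.isBump s (Φ u) hf
    simp only [hΦ] at h
    exact h
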